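/- Let $d\in\{2,3\}$, $k>0$, $0<R_0<R$. For $\rho>0$ put $\Omega^{\rho}=\mathbb R^{d-1}\times(0,\rho)$, $\Omega_0^{\rho}=(-\pi,\pi)^{d-1}\times(0,\rho)$ and $\Gamma^\rho=\mathbb R^{d-1}\times\{\rho\}$, $\Gamma^0=\mathbb R^{d-1}\times\{0\}$. Let $n_p^2\in L^\infty(\mathbb R^d_+;\mathbb C)$, where $\mathbb R^d_+=\{x\in\mathbb R^d:x_d>0\}$, be $2\pi$-periodic in each of $x_1,\dots,x_{d-1}$, equal to $1$ for $x_d>R_0$, with $\operatorname{Im} n_p^2\ge 0$ almost everywhere and $\operatorname{Im} n_p^2>0$ almost everywhere on some non-empty open set. Let $\tilde H^1(\Omega^R)$ be the space of complex-valued $H^1(\Omega^R)$-functions with vanishing trace on $\Gamma^0$, and $\tilde H^1(\Omega^R)^*$ its antidual (the bounded antilinear functionals). Let $T:H^{1/2}(\Gamma^R)\to H^{-1/2}(\Gamma^R)$ be the Dirichlet-to-Neumann map $\widehat{T\phi}(\xi)=i\sqrt{k^2-|\xi|^2}\,\hat\phi(\xi)$, where $\hat{\ }$ is the Fourier transform on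 $\mathbb R^{d-1}$ and $\sqrt{-t}=i\sqrt t$ for $t>0$. For $q\in L^2(\Omega_0^R;\mathbb C)$, extended by zero, let $$a_q(u,v)=\int_{\Omega^R}\nabla u\cdot\nabla\overline v-k^2(n_p^2+q)u\overline v\,dx-\int_{\Gamma^R}T(u|_{\Gamma^R})\overline v\,dS\qquad(u,v\in\tilde H^1(\Omega^R)),$$ the boundary integral being the duality pairing of $H^{-1/2}(\Gamma^R)$ and $H^{1/2}(\Gamma^R)$. This form is bounded; let $B_q:\tilde H^1(\Omega^R)\to\tilde H^1(\Omega^R)^*$ be the operator $\langle B_qu,v\rangle=a_q(u,v)$. Call $B_q$ invertible if for every $\ell\in\tilde H^1(\Omega^R)^*$ there is exactly one $u$ with $B_qu=\ell$. Let $$Q=\bigcup_{q_0}\ \bigcup_{\delta}\ \{q\in L^2(\Omega_0^R):\|q-q_0\|_{L^2}<\delta\},$$ the union being over all $q_0\in L^\infty(\Omega_0^R)$ with $\operatorname{Im}q_0\ge0$ and all $\delta>0$ so small that $B_p$ is invertible for every $p$ with $\|p-q_0\|_{L^2}<\delta$. Then $Q$ is open and contains every $q_0\in L^\infty(\Omega_0^R)$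 with $\operatorname{Im}q_0\ge0$. For $q\in Q$ and $f\in L^2(\Omega_0^{R_0})$ there is a unique $u_f\in\tilde H^1(\Omega^R)$ with $a_q(u_f,v)=\int_{\Omega_0^{R_0}}f\overline v\,dx$ for all $v\in\tilde H^1(\Omega^R)$, and $\Lambda_q f:=u_f|_{\Omega_0^R}$ defines a bounded linear operator $\Lambda_q:L^2(\Omega_0^{R_0})\to L^2(\Omega_0^R)$. The map $$\Lambda:Q\subseteq L^2(\Omega_0^R)\to\mathcal L(L^2(\Omega_0^{R_0}),L^2(\Omega_0^R)),\qquad q\mapsto\Lambda_q,$$ is (complex) Fréchet differentiable at every $q\in Q$, with derivative $\Lambda'(q)h=W_h$ for $h\in L^2(\Omega_0^R)$, where $W_hf=w_{h,f}|_{\Omega_0^R}$ and $w_{h,f}\in\tilde H^1(\Omega^R)$ is the unique solution of $$a_q(w_{h,f},v)=\int_{\Omega_0^R}k^2\,h\,u_f\,\overline v\,dx\qquad\text{for all }v\in\tilde H^1(\Omega^R).$$ Moreover $q\mapsto B_q$ is Fréchet differentiable at every $q\in Q$, with $\langle (B_q'h)u,v\rangle=-\int_{\Omega_0^R}k^2hu\overline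 v\,dx$, the operator $B_q$ has a bounded inverse, and with the functional $F_f(v)=\int_{\Omega_0^{R_0}}f\overline v\,dx$ one has $\Lambda_qf=(B_q^{-1}F_f)|_{\Omega_0^R}$ and $\Lambda'(q)[h]f=-\big(B_q^{-1}(B_q'h)B_q^{-1}F_f\big)|_{\Omega_0^R}$. -/

import Mathlib

open MeasureTheory
open scoped ContDiff ComplexConjugate

namespace LayerScattering

/-- Points `(x̲, x_d)` of `ℝ^d`, `d = m + 1`: the horizontal part `x̲ ∈ ℝ^m` and the height `x_d`. -/
abbrev Pt (m : ℕ) : Type := EuclideanSpace ℝ (Fin m) × ℝ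

/-- The upper half space `ℝ^d_+`. -/
def halfSpace (m : ℕ) : Set (Pt m) := {x | 0 < x.2}

/-- The strip `Ω^R = ℝ^{d-1} × (0, R)`. -/
def strip (m : ℕ) (R : ℝ) : Set (Pt m) := {x | 0 < x.2 ∧ x.2 < R}

/-- One periodic cell `Ω_0^R = (-π, π)^{d-1} × (0, R)`. -/
def cell (m : ℕ) (R : ℝ) : Set (Pt m) :=
  {x | (∀ i, -Real.pi < x.1 i ∧ x.1 i < Real.pi) ∧ 0 < x.2 ∧ x.2 < R}

/-- Complex-valued `L²(s)`. -/
abbrev L2 {m : ℕ} (s : Set (Pt m)) : Type := Lp ℂ 2 (volume.restrict s)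

/-- The translate `(x̲ + 2πj, x_d)`. -/
noncomputable def shift {m : ℕ} (j : Fin m → ℤ) (x : Pt m) : Pt m :=
  (x.1 + WithLp.toLp 2 (fun i => 2 * Real.pi * (j i : ℝ)), x.2)

/-- The standing assumptions on the unperturbed refractive index `n_p²` : it is in `L^∞`,
`2π`-periodic in the horizontal variables, equal to `1` above height `R₀`, and absorbing
(`Im n_p² ≥ 0`, with `Im n_p² > 0` on some non-empty open set). -/
structure IsPeriodicIndex (m : ℕ) (R₀ : ℝ) (np : Pt m → ℂ) : Prop where
  bounded : MemLp np ⊤ (volume.restrict (halfSpace m))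
  periodic : ∀ j : Fin m → ℤ, ∀ᵐ x ∂(volume.restrict (halfSpace m)), np (shift j x) = np x
  eq_one : ∀ᵐ x ∂(volume.restrict (halfSpace m)), R₀ < x.2 → np x = 1
  im_nonneg : ∀ᵐ x ∂(volume.restrict (halfSpace m)), 0 ≤ (np x).im
  absorbing : ∃ U : Set (Pt m), IsOpen U ∧ U.Nonempty ∧ U ⊆ halfSpace m ∧
    ∀ᵐ x ∂(volume.restrict U), 0 < (np x).im

/-- The coordinate directions: `some j` is the `j`-th horizontal one, `none` the vertical one. -/
noncomputable def dir (m : ℕ) : Option (Fin m) → Pt m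
  | some j => (EuclideanSpace.single j 1, 0)
  | none => (0, 1)

/-- Pairs `(u, ∇u)` with `u` and the components of `∇u` in `L²(Ω^R)`, normed by
`(‖u‖² + ∑ᵢ ‖∂ᵢu‖²)^{1/2}`. -/
abbrev GradPair (m : ℕ) (R : ℝ) : Type :=
  WithLp 2 (L2 (strip m R) × PiLp 2 (fun _ : Option (Fin m) => L2 (strip m R)))

/-- Smooth, compactly supported functions on `ℝ^d`. -/
def IsTest {m : ℕ} (φ : Pt m → ℂ) : Prop := ContDiff ℝ ∞ φ ∧ HasCompactSupport φ

theorem integrable_mul_test {m : ℕ} {R : ℝ} (u : L2 (strip m R)) {φ : Pt m → ℂ}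
    (hc : Continuous φ) (hs : HasCompactSupport φ) :
    Integrable (fun x => u x * φ x) (volume.restrict (strip m R)) := by
  have h2 : MemLp φ 2 (volume.restrict (strip m R)) :=
    (hc.memLp_of_hasCompactSupport hs)
  exact (Lp.memLp u).integrable_mul h2

theorem integrable_mul_deriv_test {m : ℕ} {R : ℝ} (u : L2 (strip m R)) {φ : Pt m → ℂ}
    (hφ : IsTest φ) (e : Pt m) :
    Integrable (fun x => u x * fderiv ℝ φ x e) (volume.restrict (strip m R)) :=
  integrable_mul_test u ((hφ.1.continuous_fderiv (by simp)).clm_apply continuous_const)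
    (hφ.2.fderiv_apply ℝ e)

/-- The space `H̃¹(Ω^R)` of `H¹(Ω^R)`-functions with vanishing trace on `Γ^0`, a function being
given together with its weak gradient. The test functions need not vanish on `Γ^0 = {x_d = 0}`:
those supported inside `Ω^R` say that the second component is the weak gradient of the first one,
and the others that there is no boundary term on `Γ^0`, i.e. that the trace on `Γ^0` is zero. -/
noncomputable def HTilde (m : ℕ) (R : ℝ) : Submodule ℂ (GradPair m R) where
  carrier := {U | ∀ φ : Pt m → ℂ, IsTest φ → (∀ x ∈ tsupport φ, x.2 < R) →
    ∀ i : Option (Fin m),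
      ∫ x in strip m R, U.snd i x * φ x = -∫ x in strip m R, U.fst x * fderiv ℝ φ x (dir m i)}
  zero_mem' := by
    intro φ hφ _ i
    have h0 : ((0 : L2 (strip m R)) : Pt m → ℂ) =ᵐ[volume.restrict (strip m R)] 0 :=
      Lp.coeFn_zero _ _ _
    have e1 : ∫ x in strip m R, (0 : L2 (strip m R)) x * φ x = 0 := by
      rw [integral_congr_ae (g := fun _ => 0)]
      · simp
      · filter_upwards [h0] with x hx
        rw [hx, Pi.zero_apply, zero_mul]
    have e2 : ∫ x in strip m R, (0 : L2 (strip m R)) x * fderiv ℝ φ x (dir m i) = 0 := by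
      rw [integral_congr_ae (g := fun _ => 0)]
      · simp
      · filter_upwards [h0] with x hx
        rw [hx, Pi.zero_apply, zero_mul]
    change ∫ x in strip m R, (0 : L2 (strip m R)) x * φ x
      = -∫ x in strip m R, (0 : L2 (strip m R)) x * fderiv ℝ φ x (dir m i)
    rw [e1, e2, neg_zero]
  add_mem' := by
    intro U V hU hV φ hφ hR i
    have key : ∀ (a b : L2 (strip m R)) (ψ : Pt m → ℂ),
        Integrable (fun x => a x * ψ x) (volume.restrict (strip m R)) →
        Integrable (fun x => b x * ψ x) (volume.restrict (strip m R)) →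
        ∫ x in strip m R, (a + b : L2 (strip m R)) x * ψ x
          = (∫ x in strip m R, a x * ψ x) + ∫ x in strip m R, b x * ψ x := by
      intro a b ψ ha hb
      rw [← integral_add ha hb]
      refine integral_congr_ae ?_
      filter_upwards [Lp.coeFn_add a b] with x hx
      rw [hx, Pi.add_apply, add_mul]
    change ∫ x in strip m R, (U.snd i + V.snd i : L2 (strip m R)) x * φ x
      = -∫ x in strip m R, (U.fst + V.fst : L2 (strip m R)) x * fderiv ℝ φ x (dir m i)
    rw [key _ _ _ (integrable_mul_test _ hφ.1.continuous hφ.2)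
        (integrable_mul_test _ hφ.1.continuous hφ.2),
      key _ _ _ (integrable_mul_deriv_test _ hφ _) (integrable_mul_deriv_test _ hφ _),
      hU φ hφ hR i, hV φ hφ hR i]
    ring
  smul_mem' := by
    intro c U hU φ hφ hR i
    have key : ∀ (a : L2 (strip m R)) (ψ : Pt m → ℂ),
        ∫ x in strip m R, (c • a : L2 (strip m R)) x * ψ x
          = c * ∫ x in strip m R, a x * ψ x := by
      intro a ψ
      rw [← integral_const_mul]
      refine integral_congr_ae ?_
      filter_upwards [Lp.coeFn_smul c a] with x hx
      rw [hx, Pi.smul_apply, smul_eq_mul, mul_assoc]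
    change ∫ x in strip m R, (c • U.snd i : L2 (strip m R)) x * φ x
      = -∫ x in strip m R, (c • U.fst : L2 (strip m R)) x * fderiv ℝ φ x (dir m i)
    rw [key, key, hU φ hφ hR i]
    ring

/-- The function underlying an element of `H̃¹(Ω^R)`. -/
noncomputable def val {m : ℕ} {R : ℝ} (u : HTilde m R) : L2 (strip m R) :=
  (u : GradPair m R).fst

/-- The weak partial derivatives of an element of `H̃¹(Ω^R)`. -/
noncomputable def grad {m : ℕ} {R : ℝ} (u : HTilde m R) (i : Option (Fin m)) : L2 (strip m R) :=
  (u : GradPair m R).snd i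

/-- Functions in `L²(Γ^R)`, where `Γ^R = ℝ^{d-1} × {R}`. -/
abbrev L2Top (m : ℕ) : Type := Lp ℂ 2 (volume : Measure (EuclideanSpace ℝ (Fin m)))

/-- `g` is the trace of `u` on `Γ^R`: the integration by parts formula in the vertical direction
holds with the boundary term `∫_{Γ^R} g φ`. -/
def IsTrace {m : ℕ} {R : ℝ} (u : HTilde m R) (g : L2Top m) : Prop :=
  ∀ φ : Pt m → ℂ, IsTest φ →
    (∫ x in strip m R, grad u none x * φ x) +
        ∫ x in strip m R, val u x * fderiv ℝ φ x (dir m none)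
      = ∫ y : EuclideanSpace ℝ (Fin m), g y * φ (y, R)

open Classical in
/-- The trace of `u ∈ H̃¹(Ω^R)` on `Γ^R`. -/
noncomputable def trace {m : ℕ} {R : ℝ} (u : HTilde m R) : L2Top m :=
  if h : ∃ g, IsTrace u g then h.choose else 0

/-- The Fourier transform `ĝ(ξ) = (2π)^{-m/2} ∫ e^{-i y·ξ} g(y) dy` on `L²(ℝ^m)`, written through
Mathlib's unitary Fourier transform, whose kernel is `e^{-2πi y·ξ}`. -/
noncomputable def fourierHat {m : ℕ} (g : L2Top m) (ξ : EuclideanSpace ℝ (Fin m)) : ℂ :=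
  (((2 * Real.pi) ^ (-(m : ℝ) / 2) : ℝ) : ℂ) *
    (Lp.fourierTransformₗᵢ (EuclideanSpace ℝ (Fin m)) ℂ g) ((2 * Real.pi)⁻¹ • ξ)

/-- The square root of a real number `t`, for the branch cut along the negative imaginary axis:
`√t` for `t ≥ 0` and `i √(-t)` for `t < 0`. -/
noncomputable def branchSqrt (t : ℝ) : ℂ := (Real.sqrt t : ℂ) + Complex.I * (Real.sqrt (-t) : ℂ)

/-- The Fourier transform `i √(k² - |ξ|²) ĝ(ξ)` of `T g`, where `T` is the exterior
Dirichlet-to-Neumann map on `Γ^R`. -/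
noncomputable def dtnHat {m : ℕ} (k : ℝ) (g : L2Top m) (ξ : EuclideanSpace ℝ (Fin m)) : ℂ :=
  Complex.I * branchSqrt (k ^ 2 - ‖ξ‖ ^ 2) * fourierHat g ξ

/-- The boundary term `∫_{Γ^R} T(g) h̄ dS`, the duality pairing of `T g ∈ H^{-1/2}` with
`h ∈ H^{1/2}`, which is computed on the Fourier side. -/
noncomputable def dtnPairing {m : ℕ} (k : ℝ) (g h : L2Top m) : ℂ :=
  ∫ ξ : EuclideanSpace ℝ (Fin m), dtnHat k g ξ * conj (fourierHat h ξ)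

/-- The sesquilinear form `a_q` of the scattering problem, with `n² = n_p² + q` and `q ∈ L²(Ω_0^R)`
extended by zero. -/
noncomputable def form {m : ℕ} {R : ℝ} (k : ℝ) (np : Pt m → ℂ) (q : L2 (cell m R))
    (u v : HTilde m R) : ℂ :=
  (∫ x in strip m R, ((∑ i, grad u i x * conj (grad v i x))
      - (k : ℂ) ^ 2 * (np x + (cell m R).indicator q x) * val u x * conj (val v x)))
    - dtnPairing k (trace u) (trace v)

/-- `u ∈ H̃¹(Ω^R)` solves `a_q(u, v) = ℓ(v)` for all `v ∈ H̃¹(Ω^R)`. -/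
def IsSolution {m : ℕ} {R : ℝ} (k : ℝ) (np : Pt m → ℂ) (q : L2 (cell m R))
    (ℓ : HTilde m R → ℂ) (u : HTilde m R) : Prop :=
  ∀ v : HTilde m R, form k np q u v = ℓ v

/-- `u` is the one and only solution of the problem with right hand side `ℓ`. -/
def IsTheSolution {m : ℕ} {R : ℝ} (k : ℝ) (np : Pt m → ℂ) (q : L2 (cell m R))
    (ℓ : HTilde m R → ℂ) (u : HTilde m R) : Prop :=
  IsSolution k np q ℓ u ∧ ∀ u' : HTilde m R, IsSolution k np q ℓ u' → u' = u

/-- The functional `v ↦ ∫_{Ω^R} f v̄` for `f ∈ L²(Ω_0^{R₀})`, extended by zero. -/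
noncomputable def source {m : ℕ} (R : ℝ) {R₀ : ℝ} (f : L2 (cell m R₀)) (v : HTilde m R) : ℂ :=
  ∫ x in cell m R₀, f x * conj (val v x)

/-- The functional `v ↦ ∫_{Ω_0^R} k² h u v̄` for `h ∈ L²(Ω_0^R)` and `u ∈ H̃¹(Ω^R)`. -/
noncomputable def linSource {m : ℕ} {R : ℝ} (k : ℝ) (h : L2 (cell m R)) (u v : HTilde m R) : ℂ :=
  ∫ x in cell m R, (k : ℂ) ^ 2 * h x * val u x * conj (val v x)

/-- The differential operator of the problem is invertible: every bounded antilinear functional on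
`H̃¹(Ω^R)` is the right hand side of exactly one solution. -/
def IsInvertible {m : ℕ} {R : ℝ} (k : ℝ) (np : Pt m → ℂ) (q : L2 (cell m R)) : Prop :=
  ∀ ℓ : HTilde m R →L⋆[ℂ] ℂ, ∃! u : HTilde m R, IsSolution k np q ℓ u

/-- The centers: `q₀ ∈ L^∞(Ω_0^R)` with `Im q₀ ≥ 0`. -/
def IsCenter {m : ℕ} {R : ℝ} (q₀ : L2 (cell m R)) : Prop :=
  MemLp q₀ ⊤ (volume.restrict (cell m R)) ∧
    ∀ᵐ x ∂(volume.restrict (cell m R)), 0 ≤ (q₀ x).im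

/-- The domain of definition `Q`: the union of the open `L²(Ω_0^R)`-balls around the
centers `q₀`, with radii so small that the problem is invertible throughout the ball. -/
def domainQ {m : ℕ} {R : ℝ} (k : ℝ) (np : Pt m → ℂ) : Set (L2 (cell m R)) :=
  {q | ∃ q₀ : L2 (cell m R), IsCenter q₀ ∧ ∃ δ > 0,
    (∀ p ∈ Metric.ball q₀ δ, IsInvertible k np p) ∧ q ∈ Metric.ball q₀ δ}

theorem cell_subset_strip (m : ℕ) (R : ℝ) : cell m R ⊆ strip m R := fun _ hx => hx.2

/-- Restriction from `Ω^R` to `Ω_0^R`. -/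
noncomputable def restrictCell {m : ℕ} {R : ℝ} (u : L2 (strip m R)) : L2 (cell m R) :=
  ((Lp.memLp u).mono_measure (Measure.restrict_mono (cell_subset_strip m R) le_rfl)).toLp u

/-- `L` maps `f` to the restriction to `Ω_0^R` of the solution with right hand side `f`. -/
def IsMeasurement {m : ℕ} {R R₀ : ℝ} (k : ℝ) (np : Pt m → ℂ) (q : L2 (cell m R))
    (L : L2 (cell m R₀) →L[ℂ] L2 (cell m R)) : Prop :=
  ∀ f : L2 (cell m R₀), ∃ u : HTilde m R,
    IsTheSolution k np q (source R f) u ∧ L f = restrictCell (val u)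

open Classical in
/-- The measurement operator `Λ : q ↦ Λ_q` (with the value `0` where there is no `Λ_q`). -/
noncomputable def Lam {m : ℕ} {R : ℝ} (R₀ k : ℝ) (np : Pt m → ℂ) (q : L2 (cell m R)) :
    L2 (cell m R₀) →L[ℂ] L2 (cell m R) :=
  if h : ∃ L, IsMeasurement k np q L then h.choose else 0

/-- `W` is the operator `W_h`: it maps `f` to the restriction to `Ω_0^R` of the solution `w` with
right hand side `k² h u_f`, where `u_f` is the solution with right hand side `f`. -/
def IsLinearization {m : ℕ} {R R₀ : ℝ} (k : ℝ) (np : Pt m → ℂ) (q h : L2 (cell m R))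
    (W : L2 (cell m R₀) →L[ℂ] L2 (cell m R)) : Prop :=
  ∀ f : L2 (cell m R₀), ∃ u w : HTilde m R,
    IsTheSolution k np q (source R f) u ∧ IsTheSolution k np q (linSource k h u) w ∧
      W f = restrictCell (val w)

open Classical in
/-- The differential operator `B_q : H̃¹(Ω^R) → H̃¹(Ω^R)*` (antidual) with `⟨B_q u, v⟩ = a_q(u, v)`
(with the value `0` if `a_q` were not bounded). -/
noncomputable def diffOp {m : ℕ} {R : ℝ} (k : ℝ) (np : Pt m → ℂ) (q : L2 (cell m R)) :
    HTilde m R →L[ℂ] (HTilde m R →L⋆[ℂ] ℂ) :=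
  if h : ∃ B : HTilde m R →L[ℂ] (HTilde m R →L⋆[ℂ] ℂ), ∀ u v, B u v = form k np q u v
  then h.choose else 0

end LayerScattering

open LayerScattering

/-!
The theorem rests on one fact: for a center `q₀` the operator `B_{q₀}` is an isomorphism. The map
`q ↦ B_q` is affine, and it is bounded from `L²(Ω_0^R)` because `H̃¹ ⊆ L⁴` in dimensions two and
three (`exists_eLpNorm_four_le`). Hence `B_q` stays invertible near `q₀`, and the formulas for `Λ`
and its derivative are those for the inverse of an operator (`hasFDerivAt_Lam`,
`isLinearization_derivLam`).

By Riesz' theorem `B_{q₀}` becomes an operator `A` on the Hilbert space `H̃¹`, and it suffices that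
`A` and its adjoint are bounded below (`isUnit_of_bounded_below`, `exists_norm_le_center`). Let
`w = A u`. The real part of the form is coercive up to a multiple of `‖u‖²_{L²}`, since the
Dirichlet-to-Neumann form has non-positive real part. The imaginary part bounds the absorbed energy
`∫ k² Im n_p² |u|²` by `‖u‖ ‖w‖`, since the Dirichlet-to-Neumann form has non-negative imaginary
part. So everything reduces to bounding `‖u‖_{L²}` by the absorbed energy, by `w`, and by a small
multiple of `‖u‖`.

That bound is local. In a box of the strip, `z = u - w` satisfies `|Δz| ≤ M |z| + |f|`, and a
Carleman estimate with a Gaussian weight propagates smallness of `z` from balls to larger balls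
(`propagation`). It starts on the open set where the medium absorbs, spreads by connectedness over
compact parts of the box, and the remaining thin layer near the boundary carries little `L²` mass
by the `L⁴` bound (`local_estimate`). As `n_p²` is periodic, the local estimate holds with the same
constant on all lattice translates of the box, and summation gives the estimate in the whole strip
(`global_estimate`). The perturbation `q₀` lives in one cell; there `q₀ u` is regarded as a right
hand side, which is controlled by applying the local estimate to the full potential on one box first
(`exists_norm_le`). In particular no Floquet transform and no uniqueness theorem for the unperturbed
periodic problem is needed.

The trace on `Γ^R` and the boundedness of the Dirichlet-to-Neumann form on `H̃¹` are obtained from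
the Fourier transform in the horizontal variables, first for smooth functions, which are dense in
`H̃¹` (`mem_closure_ofTest`, `isTrace_trace`, `halfEnergy_trace_le`).
-/

namespace LayerScattering

open Filter Topology ENNReal

variable {m : ℕ}

instance : (volume : Measure (Pt m)).IsAddHaarMeasure :=
  inferInstanceAs ((volume : Measure (EuclideanSpace ℝ (Fin m))).prod
    (volume : Measure ℝ)).IsAddHaarMeasure

/-! ### Partial derivatives of smooth functions -/

/-- The partial derivative in the `i`-th coordinate direction. -/
noncomputable def pd {F : Type*} [NormedAddCommGroup F] [NormedSpace ℝ F] (i : Option (Fin m))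
    (f : Pt m → F) (x : Pt m) : F := fderiv ℝ f x (dir m i)

section pd
variable {F : Type*} [NormedAddCommGroup F] [NormedSpace ℝ F]

theorem contDiff_pd {f : Pt m → F} (hf : ContDiff ℝ ∞ f) (i : Option (Fin m)) :
    ContDiff ℝ ∞ (pd i f) :=
  (hf.fderiv_right (m := ∞) (by simp)).clm_apply contDiff_const

theorem hasCompactSupport_pd {f : Pt m → F} (hf : HasCompactSupport f) (i : Option (Fin m)) :
    HasCompactSupport (pd i f) := hf.fderiv_apply ℝ _

theorem tsupport_pd_subset (f : Pt m → F) (i : Option (Fin m)) :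
    tsupport (pd i f) ⊆ tsupport f :=
  tsupport_fderiv_apply_subset ℝ _

theorem pd_add {f g : Pt m → F} {x : Pt m} (hf : DifferentiableAt ℝ f x)
    (hg : DifferentiableAt ℝ g x) (i : Option (Fin m)) :
    pd i (fun x => f x + g x) x = pd i f x + pd i g x := by
  simp only [pd]; rw [fderiv_fun_add hf hg]; rfl

theorem pd_sub {f g : Pt m → F} {x : Pt m} (hf : DifferentiableAt ℝ f x)
    (hg : DifferentiableAt ℝ g x) (i : Option (Fin m)) :
    pd i (fun x => f x - g x) x = pd i f x - pd i g x := by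
  simp only [pd]; rw [fderiv_fun_sub hf hg]; rfl

theorem pd_sum {ι : Type*} (s : Finset ι) {f : ι → Pt m → F} {x : Pt m}
    (hf : ∀ j ∈ s, DifferentiableAt ℝ (f j) x) (i : Option (Fin m)) :
    pd i (fun x => ∑ j ∈ s, f j x) x = ∑ j ∈ s, pd i (f j) x := by
  simp only [pd]
  rw [fderiv_fun_sum hf]
  simp

theorem pd_smul {f : Pt m → ℝ} {g : Pt m → F} {x : Pt m} (hf : DifferentiableAt ℝ f x)
    (hg : DifferentiableAt ℝ g x) (i : Option (Fin m)) :
    pd i (fun x => f x • g x) x = f x • pd i g x + pd i f x • g x := by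
  simp only [pd]; rw [fderiv_fun_smul hf hg]; rfl

theorem pd_mul {𝔸 : Type*} [NormedCommRing 𝔸] [NormedAlgebra ℝ 𝔸] {f g : Pt m → 𝔸} {x : Pt m}
    (hf : DifferentiableAt ℝ f x)
    (hg : DifferentiableAt ℝ g x) (i : Option (Fin m)) :
    pd i (fun x => f x * g x) x = f x * pd i g x + g x * pd i f x := by
  simp only [pd]; rw [fderiv_fun_mul hf hg]; rfl

theorem pd_const (c : F) (i : Option (Fin m)) (x : Pt m) : pd i (fun _ : Pt m => c) x = 0 := by
  simp [pd]

theorem pd_clm_comp {G : Type*} [NormedAddCommGroup G] [NormedSpace ℝ G] (L : F →L[ℝ] G)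
    {f : Pt m → F} {x : Pt m} (hf : DifferentiableAt ℝ f x) (i : Option (Fin m)) :
    pd i (fun x => L (f x)) x = L (pd i f x) := by
  simp only [pd]
  rw [show (fun x => L (f x)) = L ∘ f from rfl, fderiv_comp x L.differentiableAt hf,
    ContinuousLinearMap.fderiv]
  rfl

theorem pd_conj {f : Pt m → ℂ} {x : Pt m} (hf : DifferentiableAt ℝ f x) (i : Option (Fin m)) :
    pd i (fun x => conj (f x)) x = conj (pd i f x) :=
  pd_clm_comp Complex.conjCLE.toContinuousLinearMap hf i

theorem pd_comp_real {f : ℝ → ℝ} {g : Pt m → ℝ} {x : Pt m} {f' : ℝ} (hf : HasDerivAt f f' (g x))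
    (hg : DifferentiableAt ℝ g x) (i : Option (Fin m)) :
    pd i (fun x => f (g x)) x = f' * pd i g x := by
  have := (hf.comp_hasFDerivAt x hg.hasFDerivAt).fderiv
  simp only [pd]
  rw [show (fun x => f (g x)) = f ∘ g from rfl, this]
  simp

theorem pd_comm {f : Pt m → F} (hf : ContDiff ℝ ∞ f) (i j : Option (Fin m)) (x : Pt m) :
    pd i (pd j f) x = pd j (pd i f) x := by
  have h1 : ContDiff ℝ ∞ (fderiv ℝ f) := hf.fderiv_right (m := ∞) (by simp)
  have hd : DifferentiableAt ℝ (fderiv ℝ f) x := (h1.differentiable (by simp)).differentiableAt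
  have key : ∀ a b : Option (Fin m), pd a (pd b f) x
      = fderiv ℝ (fderiv ℝ f) x (dir m a) (dir m b) := by
    intro a b
    change fderiv ℝ (fun y => (fderiv ℝ f y) (dir m b)) x (dir m a) = _
    rw [fderiv_clm_apply hd (differentiableAt_const _)]
    simp
  rw [key, key]
  have hs : IsSymmSndFDerivAt ℝ f x :=
    hf.contDiffAt.isSymmSndFDerivAt (by
      simp only [minSmoothness_of_isRCLikeNormedField]; exact ENat.LEInfty.out)
  exact hs _ _

/-- The integral of a partial derivative of a compactly supported function vanishes. -/
theorem integral_pd_eq_zero {f : Pt m → F} (hf : ContDiff ℝ 1 f) (hs : HasCompactSupport f)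
    (i : Option (Fin m)) : ∫ x, pd i f x = 0 := by
  have hc : Continuous (fun x => fderiv ℝ f x (dir m i)) :=
    (hf.continuous_fderiv (by simp)).clm_apply continuous_const
  have := integral_smul_fderiv_eq_neg_fderiv_smul_of_integrable (μ := (volume : Measure (Pt m)))
    (f := fun _ => (1 : ℝ)) (g := f) (v := dir m i) (by simp)
    (by simpa using hc.integrable_of_hasCompactSupport (hs.fderiv_apply ℝ _))
    (by simpa using hf.continuous.integrable_of_hasCompactSupport hs) (by simp)
    (fun x _ => (hf.differentiable (by simp)).differentiableAt)
  simpa [pd] using this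

end pd

/-! ### Mollification in `L²` -/

/-- The convolution `κ ⋆ g`. -/
noncomputable def moll (κ : Pt m → ℝ) (g : Pt m → ℂ) : Pt m → ℂ :=
  convolution κ g (ContinuousLinearMap.lsmul ℝ ℝ) volume

theorem moll_apply (κ : Pt m → ℝ) (g : Pt m → ℂ) (x : Pt m) :
    moll κ g x = ∫ z, κ z • g (x - z) := rfl

theorem moll_apply' (κ : Pt m → ℝ) (g : Pt m → ℂ) (x : Pt m) :
    moll κ g x = ∫ z, κ (x - z) • g z := by
  rw [moll, convolution_eq_swap]; rfl

theorem contDiff_moll {κ : Pt m → ℝ} {g : Pt m → ℂ} (hκ : ContDiff ℝ ∞ κ)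
    (hκs : HasCompactSupport κ) (hg : LocallyIntegrable g volume) : ContDiff ℝ ∞ (moll κ g) :=
  hκs.contDiff_convolution_left _ hκ hg

theorem pd_moll {κ : Pt m → ℝ} {g : Pt m → ℂ} (hκ : ContDiff ℝ ∞ κ)
    (hκs : HasCompactSupport κ) (hg : LocallyIntegrable g volume) (i : Option (Fin m)) (x : Pt m) :
    pd i (moll κ g) x = moll (pd i κ) g x := by
  have h := hκs.hasFDerivAt_convolution_left (ContinuousLinearMap.lsmul ℝ ℝ) (μ := volume)
    (hκ.of_le (by simp)) hg x
  have hi : Integrable (fun t => (((ContinuousLinearMap.lsmul ℝ ℝ : ℝ →L[ℝ] ℂ →L[ℝ] ℂ).precompL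
      (Pt m)) (fderiv ℝ κ t)) (g (x - t))) volume :=
    (HasCompactSupport.convolutionExists_left _ (hκs.fderiv ℝ)
      (hκ.continuous_fderiv (by simp)) hg x)
  simp only [pd, moll]
  rw [h.fderiv, convolution, ContinuousLinearMap.integral_apply hi]
  rfl

theorem locallyIntegrable_of_memLp {g : Pt m → ℂ} (hg : MemLp g 2 volume) :
    LocallyIntegrable g volume := hg.locallyIntegrable (by norm_num)

theorem eLpNorm_two_sq {α E : Type*} [MeasurableSpace α] [NormedAddCommGroup E] (μ : Measure α)
    (f : α → E) : eLpNorm f 2 μ ^ 2 = ∫⁻ x, ‖f x‖ₑ ^ 2 ∂μ := by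
  have := eLpNorm_nnreal_pow_eq_lintegral (f := f) (μ := μ) (p := 2) (by norm_num)
  simpa using this

theorem eLpNorm_two_le_iff {α E : Type*} [MeasurableSpace α] [NormedAddCommGroup E] {μ : Measure α}
    {f : α → E} {ε : ℝ≥0∞} : eLpNorm f 2 μ ≤ ε ↔ ∫⁻ x, ‖f x‖ₑ ^ 2 ∂μ ≤ ε ^ 2 := by
  rw [← eLpNorm_two_sq]
  exact (ENNReal.pow_le_pow_left_iff (by norm_num)).symm

theorem moll_congr {κ : Pt m → ℝ} {g g' : Pt m → ℂ} (h : g =ᵐ[volume] g') (x : Pt m) :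
    moll κ g x = moll κ g' x := by
  rw [moll_apply', moll_apply']
  exact integral_congr_ae (h.mono fun z hz => by simp only [hz])

theorem quasiMeasurePreserving_sub_const (x : Pt m) :
    Measure.QuasiMeasurePreserving (fun z => z - x) (volume : Measure (Pt m)) volume :=
  (measurePreserving_sub_right volume x).quasiMeasurePreserving

/-- Minkowski's inequality for the average against a bump function. -/
theorem eLpNorm_moll_sub_le {c : Pt m} (b : ContDiffBump c) {g : Pt m → ℂ} (hg : MemLp g 2 volume)
    {ε : ℝ≥0∞} (hε : ∀ z ∈ Metric.ball c b.rOut, eLpNorm (fun x => g (x - z) - g x) 2 volume ≤ ε) :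
    eLpNorm (fun x => moll (b.normed volume) g x - g x) 2 volume ≤ ε := by
  wlog hm : StronglyMeasurable g generalizing g
  · have hgg := hg.1.ae_eq_mk
    have h1 := this (g := hg.1.mk g) ((memLp_congr_ae hgg).1 hg) (fun z hz => by
      refine le_trans (le_of_eq (eLpNorm_congr_ae ?_)) (hε z hz)
      filter_upwards [hgg, (quasiMeasurePreserving_sub_const z).ae hgg] with x h1 h2
      rw [← h1, ← h2]) hg.1.stronglyMeasurable_mk
    refine le_trans (le_of_eq (eLpNorm_congr_ae ?_)) h1
    filter_upwards [hgg] with x hx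
    rw [hx, moll_congr hgg]
  set κ := b.normed volume with hκ
  have hκc : Continuous κ := b.continuous_normed
  have hκs : HasCompactSupport κ := b.hasCompactSupport_normed
  set ν : Measure (Pt m) := volume.withDensity (fun z => ENNReal.ofReal (κ z)) with hν
  have hκm : Measurable fun z => ENNReal.ofReal (κ z) := hκc.measurable.ennreal_ofReal
  have hprob : IsProbabilityMeasure ν := by
    constructor
    rw [hν, withDensity_apply _ MeasurableSet.univ, Measure.restrict_univ,
      ← ofReal_integral_eq_lintegral_ofReal b.integrable_normed
        (Eventually.of_forall fun z => b.nonneg_normed z), b.integral_normed, ENNReal.ofReal_one]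
  have hint : ∀ f : Pt m → ℂ, ∫ z, f z ∂ν = ∫ z, κ z • f z := by
    intro f
    rw [hν, integral_withDensity_eq_integral_toReal_smul hκm (by simp)]
    refine integral_congr_ae (Eventually.of_forall fun z => ?_)
    change (ENNReal.ofReal (κ z)).toReal • f z = κ z • f z
    rw [ENNReal.toReal_ofReal (b.nonneg_normed z)]
  have hpt : ∀ x, ‖moll κ g x - g x‖ₑ ^ 2 ≤ ∫⁻ z, ‖g (x - z) - g x‖ₑ ^ 2 ∂ν := by
    intro x
    have hmeas : StronglyMeasurable fun z => g (x - z) - g x :=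
      (hm.comp_measurable (measurable_const.sub measurable_id)).sub stronglyMeasurable_const
    have e1 : moll κ g x - g x = ∫ z, (g (x - z) - g x) ∂ν := by
      rw [hint]
      simp only [smul_sub]
      rw [integral_sub]
      · rw [b.integral_normed_smul, moll_apply]
      · exact hκs.convolutionExists_left (ContinuousLinearMap.lsmul ℝ ℝ) hκc
          (locallyIntegrable_of_memLp hg) x
      · exact b.integrable_normed.smul_const _
    rw [e1, ← eLpNorm_two_sq]
    gcongr
    calc _ ≤ ∫⁻ z, ‖g (x - z) - g x‖ₑ ∂ν := enorm_integral_le_lintegral_enorm _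
      _ = eLpNorm (fun z => g (x - z) - g x) 1 ν := eLpNorm_one_eq_lintegral_enorm.symm
      _ ≤ _ := eLpNorm_le_eLpNorm_of_exponent_le (by norm_num) hmeas.aestronglyMeasurable
  rw [eLpNorm_two_le_iff]
  calc _ ≤ ∫⁻ x, ∫⁻ z, ‖g (x - z) - g x‖ₑ ^ 2 ∂ν := lintegral_mono hpt
    _ = ∫⁻ z, (∫⁻ x, ‖g (x - z) - g x‖ₑ ^ 2) ∂ν := by
      refine lintegral_lintegral_swap ?_
      have : StronglyMeasurable (fun p : Pt m × Pt m => g (p.1 - p.2) - g p.1) :=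
        (hm.comp_measurable (measurable_fst.sub measurable_snd)).sub
          (hm.comp_measurable measurable_fst)
      exact (this.enorm.pow_const 2).aemeasurable
    _ ≤ ∫⁻ z, ε ^ 2 ∂ν := by
      refine lintegral_mono_ae ?_
      have h0 : ∀ᵐ z ∂ν, z ∈ Metric.ball c b.rOut := by
        rw [hν, ae_withDensity_iff hκm]
        refine Eventually.of_forall fun z hz => ?_
        rw [← b.support_normed_eq (μ := volume)]
        intro h
        exact hz (by rw [hκ, h, ENNReal.ofReal_zero])
      filter_upwards [h0] with z hz
      exact eLpNorm_two_le_iff.1 (hε z hz)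
    _ = ε ^ 2 := by simp

/-- Translation is continuous in `L²`. -/
theorem tendsto_eLpNorm_translate {g : Pt m → ℂ} (hg : MemLp g 2 volume) :
    Tendsto (fun z : Pt m => eLpNorm (fun x => g (x - z) - g x) 2 volume) (𝓝 0) (𝓝 0) := by
  let T : Pt m → C(Pt m, Pt m) := fun z => ⟨fun x => x - z, by fun_prop⟩
  have hT : Continuous T := by
    apply ContinuousMap.continuous_of_continuous_uncurry
    exact continuous_snd.sub continuous_fst
  have hmp : ∀ z, MeasurePreserving (T z) (volume : Measure (Pt m)) volume :=
    fun z => measurePreserving_sub_right volume z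
  have h := (Filter.Tendsto.compMeasurePreservingLp (p := 2)
    (tendsto_const_nhds (x := hg.toLp g) (f := 𝓝 (0 : Pt m)))
    (hT.tendsto 0) hmp (hmp 0) (by norm_num))
  rw [Lp.tendsto_Lp_iff_tendsto_eLpNorm'] at h
  refine h.congr fun z => eLpNorm_congr_ae ?_
  have h1 := Lp.coeFn_compMeasurePreserving (hg.toLp g) (hmp z)
  have h2 := Lp.coeFn_compMeasurePreserving (hg.toLp g) (hmp 0)
  filter_upwards [h1, h2, hg.coeFn_toLp,
    (quasiMeasurePreserving_sub_const z).ae hg.coeFn_toLp] with x e1 e2 e3 e4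
  simp only [Pi.sub_apply, e1, e2, Function.comp]
  simp only [T, ContinuousMap.coe_mk, sub_zero]
  rw [e3, e4]

/-- `b n ⋆ g → g` in `L²` for bump functions shrinking to the origin. -/
theorem tendsto_eLpNorm_moll {c : ℕ → Pt m} (b : ∀ n, ContDiffBump (c n))
    (hc : Tendsto c atTop (𝓝 0)) (hb : Tendsto (fun n => (b n).rOut) atTop (𝓝 0))
    {g : Pt m → ℂ} (hg : MemLp g 2 volume) :
    Tendsto (fun n => eLpNorm (fun x => moll ((b n).normed volume) g x - g x) 2 volume) atTop
      (𝓝 0) := by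
  rw [ENNReal.tendsto_nhds_zero]
  intro ε hε
  have h := (ENNReal.tendsto_nhds_zero.1 (tendsto_eLpNorm_translate hg)) ε hε
  obtain ⟨δ, hδ, hball⟩ := Metric.eventually_nhds_iff_ball.1 h
  have e1 := Metric.tendsto_nhds.1 hc (δ / 2) (half_pos hδ)
  have e2 := Metric.tendsto_nhds.1 hb (δ / 2) (half_pos hδ)
  filter_upwards [e1, e2] with n h1 h2
  refine eLpNorm_moll_sub_le (b n) hg fun z hz => hball z ?_
  rw [Real.dist_0_eq_abs, abs_of_pos (b n).rOut_pos] at h2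
  rw [Metric.mem_ball] at hz ⊢
  linarith [dist_triangle z (c n) 0]

/-! ### Weak derivatives -/

/-- `g` is the weak gradient of `u` in `Ω`. Functions are defined on all of `ℝ^d`, being extended by
zero where necessary. -/
def HasWeakGrad (Ω : Set (Pt m)) (u : Pt m → ℂ) (g : Option (Fin m) → Pt m → ℂ) : Prop :=
  ∀ φ : Pt m → ℂ, IsTest φ → tsupport φ ⊆ Ω → ∀ i,
    ∫ x, g i x * φ x = -∫ x, u x * pd i φ x

/-- `u ∈ L²(ℝ^d)` has the weak gradient `g ∈ L²(ℝ^d)` in `Ω`. -/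
structure IsH1 (Ω : Set (Pt m)) (u : Pt m → ℂ) (g : Option (Fin m) → Pt m → ℂ) : Prop where
  memLp : MemLp u 2 volume
  memLp_grad : ∀ i, MemLp (g i) 2 volume
  weak : HasWeakGrad Ω u g

/-- `F` is the weak divergence of the vector field `g` in `Ω`. -/
def HasWeakDiv (Ω : Set (Pt m)) (g : Option (Fin m) → Pt m → ℂ) (F : Pt m → ℂ) : Prop :=
  ∀ φ : Pt m → ℂ, IsTest φ → tsupport φ ⊆ Ω → ∑ i, ∫ x, g i x * pd i φ x = -∫ x, F x * φ x

theorem IsTest.differentiable {φ : Pt m → ℂ} (hφ : IsTest φ) : Differentiable ℝ φ :=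
  hφ.1.differentiable (by simp)

theorem IsTest.pd {φ : Pt m → ℂ} (hφ : IsTest φ) (i : Option (Fin m)) : IsTest (pd i φ) :=
  ⟨contDiff_pd hφ.1 i, hasCompactSupport_pd hφ.2 i⟩

theorem IsTest.memLp {φ : Pt m → ℂ} (hφ : IsTest φ) (p : ℝ≥0∞) : MemLp φ p volume :=
  hφ.1.continuous.memLp_of_hasCompactSupport hφ.2

theorem IsTest.smul {φ : Pt m → ℂ} (hφ : IsTest φ) {χ : Pt m → ℝ} (hχ : ContDiff ℝ ∞ χ) :
    IsTest (fun x => χ x • φ x) :=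
  ⟨hχ.smul hφ.1, HasCompactSupport.smul_left (f := χ) (f' := φ) hφ.2⟩

theorem IsTest.conj {φ : Pt m → ℂ} (hφ : IsTest φ) : IsTest (fun x => conj (φ x)) :=
  ⟨Complex.conjCLE.contDiff.comp hφ.1, hφ.2.comp_left (g := conj) (by simp)⟩

theorem IsTest.sub {φ ψ : Pt m → ℂ} (hφ : IsTest φ) (hψ : IsTest ψ) :
    IsTest (fun x => φ x - ψ x) := ⟨hφ.1.sub hψ.1, hφ.2.sub hψ.2⟩

theorem IsTest.mul {φ ψ : Pt m → ℂ} (hφ : ContDiff ℝ ∞ φ) (hψ : IsTest ψ) :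
    IsTest (fun x => φ x * ψ x) := ⟨hφ.mul hψ.1, hψ.2.mul_left⟩

theorem IsTest.integrable_mul {φ : Pt m → ℂ} (hφ : IsTest φ) {u : Pt m → ℂ}
    (hu : MemLp u 2 volume) : Integrable (fun x => u x * φ x) volume :=
  hu.integrable_mul (hφ.memLp 2)

/-- The functions `w ↦ κ (x - w)` are test functions. -/
theorem isTest_kernel {κ : Pt m → ℝ} (hκ : ContDiff ℝ ∞ κ) (hκs : HasCompactSupport κ)
    (x : Pt m) : IsTest (fun w => ((κ (x - w) : ℝ) : ℂ)) := by
  refine ⟨Complex.ofRealCLM.contDiff.comp (hκ.comp (contDiff_const.sub contDiff_id)), ?_⟩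
  have : HasCompactSupport (fun w => κ (x - w)) :=
    hκs.comp_homeomorph (Homeomorph.subLeft x)
  exact this.comp_left (g := ((↑) : ℝ → ℂ)) (by simp)

theorem pd_kernel {κ : Pt m → ℝ} (hκ : ContDiff ℝ ∞ κ) (x w : Pt m) (i : Option (Fin m)) :
    pd i (fun w => ((κ (x - w) : ℝ) : ℂ)) w = -((pd i κ (x - w) : ℝ) : ℂ) := by
  have hd : Differentiable ℝ κ := hκ.differentiable (by simp)
  have h1 : pd i (fun w => κ (x - w)) w = - pd i κ (x - w) := by
    have := (hd (x - w)).hasFDerivAt.comp w ((hasFDerivAt_const x w).sub (hasFDerivAt_id w))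
    simp only [pd]
    rw [show (fun w => κ (x - w)) = κ ∘ (fun w => x - w) from rfl]
    erw [this.fderiv]
    simp
  have := pd_clm_comp Complex.ofRealCLM (f := fun w => κ (x - w)) (x := w)
    ((hd (x - w)).comp w (by fun_prop)) i
  simp only [Complex.ofRealCLM_apply] at this
  rw [this, h1]; simp

theorem moll_eq_integral_mul (κ : Pt m → ℝ) (g : Pt m → ℂ) (x : Pt m) :
    moll κ g x = ∫ w, g w * ((κ (x - w) : ℝ) : ℂ) := by
  rw [moll_apply']
  refine integral_congr_ae (Eventually.of_forall fun w => ?_)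
  simp only [Complex.real_smul, mul_comm]

/-- Mollification turns weak derivatives into classical ones. -/
theorem pd_moll_of_weak {Ω : Set (Pt m)} {u : Pt m → ℂ} {g : Option (Fin m) → Pt m → ℂ}
    (hu : IsH1 Ω u g) {κ : Pt m → ℝ} (hκ : ContDiff ℝ ∞ κ) (hκs : HasCompactSupport κ) {x : Pt m}
    (hx : tsupport (fun w => ((κ (x - w) : ℝ) : ℂ)) ⊆ Ω) (i : Option (Fin m)) :
    pd i (moll κ u) x = moll κ (g i) x := by
  rw [pd_moll hκ hκs (locallyIntegrable_of_memLp hu.memLp), moll_eq_integral_mul,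
    moll_eq_integral_mul, hu.weak _ (isTest_kernel hκ hκs x) hx i, ← integral_neg]
  refine integral_congr_ae (Eventually.of_forall fun w => ?_)
  simp only [pd_kernel hκ]
  ring

theorem div_moll_of_weak {Ω : Set (Pt m)} {F : Pt m → ℂ} {g : Option (Fin m) → Pt m → ℂ}
    (hg : ∀ i, MemLp (g i) 2 volume) (hF : HasWeakDiv Ω g F) {κ : Pt m → ℝ} (hκ : ContDiff ℝ ∞ κ)
    (hκs : HasCompactSupport κ) {x : Pt m}
    (hx : tsupport (fun w => ((κ (x - w) : ℝ) : ℂ)) ⊆ Ω) :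
    ∑ i, pd i (moll κ (g i)) x = moll κ F x := by
  have h := hF _ (isTest_kernel hκ hκs x) hx
  rw [moll_eq_integral_mul κ F, ← neg_eq_iff_eq_neg.2 h, ← Finset.sum_neg_distrib]
  refine Finset.sum_congr rfl fun i _ => ?_
  rw [pd_moll hκ hκs (locallyIntegrable_of_memLp (hg i)), moll_eq_integral_mul, ← integral_neg]
  refine integral_congr_ae (Eventually.of_forall fun w => ?_)
  simp only [pd_kernel hκ]
  ring

theorem memLp_smul_of_bound {χ : Pt m → ℝ} (hχ : Continuous χ) {C : ℝ} (hC : ∀ x, |χ x| ≤ C)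
    {u : Pt m → ℂ} (hu : MemLp u 2 volume) : MemLp (fun x => χ x • u x) 2 volume := by
  refine MemLp.of_le_mul (c := C) hu (hχ.aestronglyMeasurable.smul hu.1)
    (Eventually.of_forall fun x => ?_)
  rw [norm_smul, Real.norm_eq_abs]
  gcongr
  exact hC x

theorem tsupport_smul_subset_inter (χ : Pt m → ℝ) (φ : Pt m → ℂ) :
    tsupport (fun x => χ x • φ x) ⊆ tsupport φ ∩ tsupport χ :=
  Set.subset_inter (tsupport_smul_subset_right χ φ) (tsupport_smul_subset_left χ φ)

/-- Multiplication by a smooth function that is bounded together with its gradient. -/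
theorem IsH1.cutoff {Ω Ω' : Set (Pt m)} {u : Pt m → ℂ} {g : Option (Fin m) → Pt m → ℂ}
    (hu : IsH1 Ω u g) {χ : Pt m → ℝ} (hχ : ContDiff ℝ ∞ χ) {C : ℝ} (hC : ∀ x, |χ x| ≤ C)
    (hC' : ∀ i x, |pd i χ x| ≤ C) (hΩ : Ω' ∩ tsupport χ ⊆ Ω) :
    IsH1 Ω' (fun x => χ x • u x) (fun i x => χ x • g i x + pd i χ x • u x) where
  memLp := memLp_smul_of_bound hχ.continuous hC hu.memLp
  memLp_grad i := (memLp_smul_of_bound hχ.continuous hC (hu.memLp_grad i)).add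
    (memLp_smul_of_bound (contDiff_pd hχ i).continuous (hC' i) hu.memLp)
  weak := by
    intro φ hφ hs i
    have h := hu.weak _ (hφ.smul hχ) (((tsupport_smul_subset_inter χ φ).trans
      (Set.inter_subset_inter_left _ hs)).trans hΩ) i
    have i1 : Integrable (fun x => g i x * (χ x • φ x)) volume :=
      (hφ.smul hχ).integrable_mul (hu.memLp_grad i)
    have i2 : Integrable (fun x => u x * (pd i χ x • φ x)) volume :=
      (hφ.smul (contDiff_pd hχ i)).integrable_mul hu.memLp
    have i3 : Integrable (fun x => u x * (χ x • pd i φ x)) volume :=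
      ((hφ.pd i).smul hχ).integrable_mul hu.memLp
    have e1 : ∀ x, (χ x • g i x + pd i χ x • u x) * φ x
        = g i x * (χ x • φ x) + u x * (pd i χ x • φ x) := by
      intro x; simp only [Complex.real_smul]; ring
    have e2 : ∀ x, u x * pd i (fun x => χ x • φ x) x
        = u x * (χ x • pd i φ x) + u x * (pd i χ x • φ x) := by
      intro x
      rw [pd_smul (hχ.differentiable (by simp)).differentiableAt
        hφ.differentiable.differentiableAt]
      ring
    have e3 : ∀ x, χ x • u x * pd i φ x = u x * (χ x • pd i φ x) := by
      intro x; simp only [Complex.real_smul]; ring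
    simp only [e1, e3]
    simp only [e2] at h
    rw [integral_add i1 i2, h, integral_add i3 i2]
    ring

/-- The divergence of the gradient of `χ u`. -/
theorem HasWeakDiv.cutoff {Ω Ω' : Set (Pt m)} {u F : Pt m → ℂ} {g : Option (Fin m) → Pt m → ℂ}
    (hu : IsH1 Ω u g) (hF : HasWeakDiv Ω g F) (hFm : MemLp F 2 volume) {χ : Pt m → ℝ}
    (hχ : ContDiff ℝ ∞ χ) (hΩ : Ω' ∩ tsupport χ ⊆ Ω) :
    HasWeakDiv Ω' (fun i x => χ x • g i x + pd i χ x • u x)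
      (fun x => χ x • F x + (2 * ∑ i, pd i χ x • g i x + (∑ i, pd i (pd i χ) x) • u x)) := by
  intro φ hφ hs
  have hsub : ∀ {ψ : Pt m → ℝ}, tsupport ψ ⊆ tsupport χ →
      tsupport (fun x => ψ x • φ x) ⊆ Ω := fun {ψ} hψ =>
    ((tsupport_smul_subset_inter ψ φ).trans (Set.inter_subset_inter hs hψ)).trans hΩ
  have h1 := hF _ (hφ.smul hχ) (hsub subset_rfl)
  have h2 := fun i => hu.weak _ (hφ.smul (contDiff_pd hχ i)) (hsub (tsupport_pd_subset χ i)) i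
  have hdχ : Differentiable ℝ χ := hχ.differentiable (by simp)
  have hdp : ∀ i, Differentiable ℝ (pd i χ) := fun i => (contDiff_pd hχ i).differentiable (by simp)
  -- the integrals that occur
  have j1 : ∀ i, Integrable (fun x => g i x * (χ x • pd i φ x)) volume := fun i =>
    ((hφ.pd i).smul hχ).integrable_mul (hu.memLp_grad i)
  have j2 : ∀ i, Integrable (fun x => g i x * (pd i χ x • φ x)) volume := fun i =>
    (hφ.smul (contDiff_pd hχ i)).integrable_mul (hu.memLp_grad i)
  have j3 : ∀ i, Integrable (fun x => u x * (pd i χ x • pd i φ x)) volume := fun i =>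
    ((hφ.pd i).smul (contDiff_pd hχ i)).integrable_mul hu.memLp
  have j4 : ∀ i, Integrable (fun x => u x * (pd i (pd i χ) x • φ x)) volume := fun i =>
    (hφ.smul (contDiff_pd (contDiff_pd hχ i) i)).integrable_mul hu.memLp
  have j5 : Integrable (fun x => F x * (χ x • φ x)) volume := (hφ.smul hχ).integrable_mul hFm
  have h1' : ∑ i, ((∫ x, g i x * (χ x • pd i φ x)) + ∫ x, g i x * (pd i χ x • φ x))
      = -∫ x, F x * (χ x • φ x) := by
    rw [← h1]
    refine Finset.sum_congr rfl fun i _ => ?_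
    rw [← integral_add (j1 i) (j2 i)]
    refine integral_congr_ae (Eventually.of_forall fun x => ?_)
    simp only [pd_smul hdχ.differentiableAt hφ.differentiable.differentiableAt]
    ring
  have h2' : ∀ i, ∫ x, g i x * (pd i χ x • φ x)
      = -((∫ x, u x * (pd i χ x • pd i φ x)) + ∫ x, u x * (pd i (pd i χ) x • φ x)) := by
    intro i
    rw [h2 i, ← integral_add (j3 i) (j4 i)]
    congr 1
    refine integral_congr_ae (Eventually.of_forall fun x => ?_)
    simp only [pd_smul (hdp i).differentiableAt hφ.differentiable.differentiableAt]
    ring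
  have hL : ∀ i, ∫ x, (χ x • g i x + pd i χ x • u x) * pd i φ x
      = (∫ x, g i x * (χ x • pd i φ x)) + ∫ x, u x * (pd i χ x • pd i φ x) := by
    intro i
    rw [← integral_add (j1 i) (j3 i)]
    refine integral_congr_ae (Eventually.of_forall fun x => ?_)
    simp only [Complex.real_smul]; ring
  have hRt : ∫ x, (χ x • F x + (2 * ∑ i, pd i χ x • g i x + (∑ i, pd i (pd i χ) x) • u x)) * φ x
      = (∫ x, F x * (χ x • φ x)) + ∑ i, (2 * (∫ x, g i x * (pd i χ x • φ x))
        + ∫ x, u x * (pd i (pd i χ) x • φ x)) := by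
    have : ∀ i, 2 * (∫ x, g i x * (pd i χ x • φ x)) + ∫ x, u x * (pd i (pd i χ) x • φ x)
        = ∫ x, (2 * (g i x * (pd i χ x • φ x)) + u x * (pd i (pd i χ) x • φ x)) := by
      intro i
      rw [integral_add ((j2 i).const_mul 2) (j4 i), integral_const_mul]
    simp only [this]
    have j6 : ∀ i ∈ Finset.univ, Integrable (fun x => 2 * (g i x * (pd i χ x • φ x))
        + u x * (pd i (pd i χ) x • φ x)) volume := fun i _ => ((j2 i).const_mul 2).add (j4 i)
    rw [← integral_finsetSum _ j6, ← integral_add j5 (integrable_finsetSum _ j6)]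
    refine integral_congr_ae (Eventually.of_forall fun x => ?_)
    simp only [Complex.real_smul, Finset.sum_add_distrib, ← Finset.mul_sum, add_mul,
      Finset.sum_mul, Complex.ofReal_sum]
    simp only [Finset.mul_sum, ← Finset.sum_add_distrib]
    rw [Finset.sum_mul, ← Finset.sum_add_distrib]
    congr 1
    · ring
    · refine Finset.sum_congr rfl fun i _ => ?_
      ring
  rw [hRt]
  simp only [hL]
  simp only [Finset.sum_add_distrib, ← Finset.mul_sum] at h1' ⊢
  have h2s := Finset.sum_congr (rfl : (Finset.univ : Finset (Option (Fin m))) = _)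
    (fun i _ => h2' i)
  simp only [Finset.sum_neg_distrib, Finset.sum_add_distrib] at h2s
  linear_combination h1' + h2s

/-! ### A Carleman estimate with a Gaussian weight -/

/-- The coordinate functions of `x - c`. -/
def co (c : Pt m) : Option (Fin m) → Pt m → ℝ
  | some j, x => x.1 j - c.1 j
  | none, x => x.2 - c.2

/-- The squared Euclidean distance to `c` (the norm of `Pt m` being a maximum norm). -/
noncomputable def sqDist (c : Pt m) (x : Pt m) : ℝ := ∑ i, co c i x ^ 2

@[fun_prop]
theorem contDiff_co (c : Pt m) (i : Option (Fin m)) : ContDiff ℝ ∞ (co c i) := by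
  cases i with
  | none => exact contDiff_snd.sub contDiff_const
  | some j =>
    have : ContDiff ℝ ∞ (fun x : Pt m => x.1 j) := by fun_prop
    exact this.sub contDiff_const

@[fun_prop]
theorem differentiable_co (c : Pt m) (i : Option (Fin m)) : Differentiable ℝ (co c i) :=
  (contDiff_co c i).differentiable (by simp)

@[fun_prop]
theorem contDiff_sqDist (c : Pt m) : ContDiff ℝ ∞ (sqDist c) :=
  ContDiff.sum fun i _ => (contDiff_co c i).pow 2

@[fun_prop]
theorem differentiable_sqDist (c : Pt m) : Differentiable ℝ (sqDist c) :=
  (contDiff_sqDist c).differentiable (by simp)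

theorem pd_co (c : Pt m) (i j : Option (Fin m)) (x : Pt m) :
    pd i (co c j) x = if i = j then 1 else 0 := by
  classical
  have key : ∀ L : Pt m →L[ℝ] ℝ, ∀ a : ℝ, (∀ x, co c j x = L x - a) →
      pd i (co c j) x = L (dir m i) := by
    intro L a h
    have : co c j = fun x => L x - a := funext h
    rw [this, pd, fderiv_sub_const, ContinuousLinearMap.fderiv]
  cases j with
  | none =>
    rw [key (ContinuousLinearMap.snd ℝ _ _) c.2 (fun x => rfl)]
    cases i <;> simp [dir]
  | some j =>
    rw [key ((EuclideanSpace.proj j).comp (ContinuousLinearMap.fst ℝ _ _)) (c.1 j) (fun x => rfl)]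
    cases i with
    | none => simp [dir]
    | some i => simp [dir, eq_comm]

theorem pd_sq {f : Pt m → ℝ} {x : Pt m} (hf : DifferentiableAt ℝ f x) (i : Option (Fin m)) :
    pd i (fun x => f x ^ 2) x = 2 * f x * pd i f x := by
  simp only [pow_two]
  rw [pd_mul hf hf]; ring

theorem pd_sqDist (c : Pt m) (i : Option (Fin m)) (x : Pt m) :
    pd i (sqDist c) x = 2 * co c i x := by
  change pd i (fun x => ∑ j, co c j x ^ 2) x = _
  rw [pd_sum _ (fun j _ => by fun_prop)]
  have : ∀ j, pd i (fun x => co c j x ^ 2) x = if i = j then 2 * co c j x else 0 := by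
    intro j
    rw [pd_sq (by fun_prop), pd_co]
    split <;> simp
  simp only [this]
  simp

/-- The weight function `exp (-l |x - c|² / 2)`. -/
noncomputable def gauss (c : Pt m) (l : ℝ) (x : Pt m) : ℝ := Real.exp (-(l / 2) * sqDist c x)

@[fun_prop]
theorem contDiff_gauss (c : Pt m) (l : ℝ) : ContDiff ℝ ∞ (gauss c l) :=
  Real.contDiff_exp.comp (contDiff_const.mul (contDiff_sqDist c))

@[fun_prop]
theorem differentiable_gauss (c : Pt m) (l : ℝ) : Differentiable ℝ (gauss c l) :=
  (contDiff_gauss c l).differentiable (by simp)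

theorem gauss_pos (c : Pt m) (l : ℝ) (x : Pt m) : 0 < gauss c l x := Real.exp_pos _

theorem pd_gauss (c : Pt m) (l : ℝ) (i : Option (Fin m)) (x : Pt m) :
    pd i (gauss c l) x = -l * co c i x * gauss c l x := by
  have h : DifferentiableAt ℝ (fun x => -(l / 2) * sqDist c x) x := by fun_prop
  change pd i (fun x => Real.exp (-(l / 2) * sqDist c x)) x = _
  rw [pd_comp_real (Real.hasDerivAt_exp _) h, pd_mul (by fun_prop) (by fun_prop), pd_const,
    pd_sqDist, gauss]
  ring

theorem differentiable_pd {f : Pt m → ℝ} (hf : ContDiff ℝ ∞ f) (i : Option (Fin m)) :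
    Differentiable ℝ (pd i f) := (contDiff_pd hf i).differentiable (by simp)

/-- The Laplacian. -/
noncomputable def lap {F : Type*} [NormedAddCommGroup F] [NormedSpace ℝ F] (f : Pt m → F)
    (x : Pt m) : F := ∑ i, pd i (pd i f) x

/-- The Euler field `(x - c) · ∇w`. -/
noncomputable def euler (c : Pt m) (w : Pt m → ℝ) (x : Pt m) : ℝ := ∑ j, co c j x * pd j w x

theorem contDiff_euler (c : Pt m) {w : Pt m → ℝ} (hw : ContDiff ℝ ∞ w) :
    ContDiff ℝ ∞ (euler c w) :=
  ContDiff.sum fun i _ => (contDiff_co c i).mul (contDiff_pd hw i)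

theorem pd_euler (c : Pt m) {w : Pt m → ℝ} (hw : ContDiff ℝ ∞ w) (i : Option (Fin m)) (x : Pt m) :
    pd i (euler c w) x = pd i w x + ∑ j, co c j x * pd i (pd j w) x := by
  change pd i (fun x => ∑ j, co c j x * pd j w x) x = _
  have hd := differentiable_pd hw
  rw [pd_sum _ (fun j _ => by have := hd j; fun_prop)]
  have : ∀ j, pd i (fun x => co c j x * pd j w x) x
      = (if i = j then pd j w x else 0) + co c j x * pd i (pd j w) x := by
    intro j
    rw [pd_mul (by fun_prop) (hd j).differentiableAt, pd_co]
    split <;> simp [add_comm]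
  simp only [this, Finset.sum_add_distrib]
  simp

/-- `|∇w|²`. -/
noncomputable def gradSq (w : Pt m → ℝ) (x : Pt m) : ℝ := ∑ j, pd j w x ^ 2

theorem contDiff_gradSq {w : Pt m → ℝ} (hw : ContDiff ℝ ∞ w) :
    ContDiff ℝ ∞ (gradSq w) := ContDiff.sum fun i _ => (contDiff_pd hw i).pow 2

theorem pd_gradSq {w : Pt m → ℝ} (hw : ContDiff ℝ ∞ w) (i : Option (Fin m)) (x : Pt m) :
    pd i (gradSq w) x = 2 * ∑ j, pd j w x * pd i (pd j w) x := by
  change pd i (fun x => ∑ j, pd j w x ^ 2) x = _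
  have hd := differentiable_pd hw
  rw [pd_sum _ (fun j _ => by have := hd j; fun_prop), Finset.mul_sum]
  refine Finset.sum_congr rfl fun j _ => ?_
  rw [pd_sq (hd j).differentiableAt, mul_assoc]

/-- The vector field whose divergence is the difference between the two sides of the
Carleman identity. -/
noncomputable def carlemanField (c : Pt m) (l τ : ℝ) (h w : Pt m → ℝ) (i : Option (Fin m))
    (x : Pt m) : ℝ :=
  τ * (4 * l * (gauss c l x * (euler c w x * pd i w x))
    - 2 * l * (gauss c l x * (co c i x * gradSq w x))
    - 2 * (h x * (w x * pd i w x)) + w x ^ 2 * pd i h x)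
  + 2 * τ ^ 3 * l ^ 3 * (gauss c l x * (gauss c l x * (gauss c l x *
      (sqDist c x * (co c i x * w x ^ 2)))))

theorem contDiff_carlemanField (c : Pt m) (l τ : ℝ) {h w : Pt m → ℝ} (hh : ContDiff ℝ ∞ h)
    (hw : ContDiff ℝ ∞ w) (i : Option (Fin m)) : ContDiff ℝ ∞ (carlemanField c l τ h w i) := by
  have h1 := contDiff_pd hw i
  have h2 := contDiff_pd hh i
  have h3 := contDiff_euler c hw
  have h4 := contDiff_gradSq hw
  unfold carlemanField
  fun_prop

theorem pd_const_mul {f : Pt m → ℝ} {x : Pt m} (hf : DifferentiableAt ℝ f x) (a : ℝ)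
    (i : Option (Fin m)) : pd i (fun x => a * f x) x = a * pd i f x := by
  rw [pd_mul (by fun_prop) hf, pd_const]; ring

/-- The divergence of the field. By symmetry of the Hessian of `w` its entries cancel
after summation, except for those in `lap w`. -/
theorem sum_pd_carlemanField (c : Pt m) (l τ : ℝ) {h w : Pt m → ℝ} (hh : ContDiff ℝ ∞ h)
    (hw : ContDiff ℝ ∞ w) (x : Pt m) :
    ∑ i, pd i (carlemanField c l τ h w i) x =
      τ * (4 * l * gauss c l x * euler c w x * lap w x - 4 * l ^ 2 * gauss c l x * euler c w x ^ 2
        + 4 * l * gauss c l x * gradSq w x + 2 * l ^ 2 * gauss c l x * sqDist c x * gradSq w x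
        - 2 * l * (m + 1) * gauss c l x * gradSq w x
        - 2 * h x * w x * lap w x - 2 * h x * gradSq w x + w x ^ 2 * lap h x)
      + 2 * τ ^ 3 * l ^ 3 * gauss c l x ^ 3 * (2 * sqDist c x * w x * euler c w x
        + ((m + 3) * sqDist c x - 3 * l * sqDist c x ^ 2) * w x ^ 2) := by
  have d1 := differentiable_pd hw
  have d2 := differentiable_pd hh
  have d3 : Differentiable ℝ (euler c w) := (contDiff_euler c hw).differentiable (by simp)
  have d4 : Differentiable ℝ (gradSq w) := (contDiff_gradSq hw).differentiable (by simp)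
  have d5 : Differentiable ℝ w := hw.differentiable (by simp)
  have d6 : Differentiable ℝ h := hh.differentiable (by simp)
  have key : ∀ i, pd i (carlemanField c l τ h w i) x =
      (4 * τ * l * gauss c l x * euler c w x) * pd i (pd i w) x
      - (4 * τ * l ^ 2 * gauss c l x * euler c w x) * (co c i x * pd i w x)
      + (4 * τ * l * gauss c l x) * (pd i w x ^ 2)
      + (4 * τ * l * gauss c l x) * (∑ j, co c j x * pd i (pd j w) x * pd i w x)
      + (2 * τ * l ^ 2 * gauss c l x * gradSq w x) * co c i x ^ 2
      - (2 * τ * l * gauss c l x * gradSq w x) * 1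
      - (4 * τ * l * gauss c l x) * (∑ j, co c i x * pd i (pd j w) x * pd j w x)
      - (2 * τ * h x) * (pd i w x ^ 2) - (2 * τ * h x * w x) * pd i (pd i w) x
      + (τ * w x ^ 2) * pd i (pd i h) x
      + (4 * τ ^ 3 * l ^ 3 * gauss c l x ^ 3 * sqDist c x * w x) * (co c i x * pd i w x)
      + (2 * τ ^ 3 * l ^ 3 * gauss c l x ^ 3 * sqDist c x * w x ^ 2) * 1
      + (4 * τ ^ 3 * l ^ 3 * gauss c l x ^ 3 * w x ^ 2) * co c i x ^ 2
      - (6 * τ ^ 3 * l ^ 4 * gauss c l x ^ 3 * sqDist c x * w x ^ 2) * co c i x ^ 2 := by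
    intro i
    have d1i := d1 i
    have d2i := d2 i
    change pd i (fun x => τ * (4 * l * (gauss c l x * (euler c w x * pd i w x))
      - 2 * l * (gauss c l x * (co c i x * gradSq w x))
      - 2 * (h x * (w x * pd i w x)) + w x ^ 2 * pd i h x)
      + 2 * τ ^ 3 * l ^ 3 * (gauss c l x * (gauss c l x * (gauss c l x *
      (sqDist c x * (co c i x * w x ^ 2)))))) x = _
    rw [pd_add (by fun_prop) (by fun_prop), pd_const_mul (by fun_prop), pd_const_mul (by fun_prop),
      pd_add (by fun_prop) (by fun_prop), pd_sub (by fun_prop) (by fun_prop),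
      pd_sub (by fun_prop) (by fun_prop), pd_const_mul (by fun_prop), pd_const_mul (by fun_prop),
      pd_const_mul (by fun_prop)]
    have e1 : ∑ j, co c j x * pd i (pd j w) x * pd i w x
        = (∑ j, co c j x * pd i (pd j w) x) * pd i w x := (Finset.sum_mul ..).symm
    have e2 : ∑ j, co c i x * pd i (pd j w) x * pd j w x
        = co c i x * ∑ j, pd j w x * pd i (pd j w) x := by
      rw [Finset.mul_sum]; exact Finset.sum_congr rfl fun j _ => by ring
    rw [e1, e2]
    simp (disch := fun_prop) only [pd_mul, pd_gauss, pd_euler c hw, pd_gradSq hw, pd_sq, pd_co,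
      pd_sqDist, if_true]
    ring
  simp only [key, Finset.sum_add_distrib, Finset.sum_sub_distrib, ← Finset.mul_sum]
  have eT : ∑ i, ∑ j, co c j x * pd i (pd j w) x * pd i w x
      = ∑ i, ∑ j, co c i x * pd i (pd j w) x * pd j w x := by
    rw [Finset.sum_comm]
    refine Finset.sum_congr rfl fun i _ => Finset.sum_congr rfl fun j _ => ?_
    rw [pd_comm hw i j]
  have e1 : ∑ i, pd i (pd i w) x = lap w x := rfl
  have e2 : ∑ i, pd i (pd i h) x = lap h x := rfl
  have e3 : ∑ i, co c i x * pd i w x = euler c w x := rfl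
  have e4 : ∑ i, pd i w x ^ 2 = gradSq w x := rfl
  have e5 : ∑ i, co c i x ^ 2 = sqDist c x := rfl
  have e6 : ∑ _i : Option (Fin m), (1 : ℝ) = m + 1 := by simp
  rw [eT, e1, e2, e3, e4, e5, e6]
  ring

theorem sqDist_eq (c x : Pt m) : sqDist c x = ‖x.1 - c.1‖ ^ 2 + (x.2 - c.2) ^ 2 := by
  simp only [sqDist, Fintype.sum_option, co, EuclideanSpace.norm_sq_eq, PiLp.sub_apply,
    Real.norm_eq_abs, sq_abs]
  ring

theorem dist_sq_le_sqDist (c x : Pt m) : dist x c ^ 2 ≤ sqDist c x := by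
  rw [sqDist_eq, dist_eq_norm, Prod.norm_def]
  have h1 : ‖(x - c).2‖ ^ 2 = (x.2 - c.2) ^ 2 := by
    rw [Real.norm_eq_abs, sq_abs]; rfl
  have h2 : ‖(x - c).1‖ ^ 2 = ‖x.1 - c.1‖ ^ 2 := rfl
  rcases max_choice ‖(x - c).1‖ ‖(x - c).2‖ with h | h <;> rw [h]
  · rw [h2]; nlinarith [sq_nonneg (x.2 - c.2)]
  · rw [h1]; nlinarith [sq_nonneg ‖x.1 - c.1‖]

theorem sqDist_le_dist_sq (c x : Pt m) : sqDist c x ≤ 2 * dist x c ^ 2 := by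
  rw [sqDist_eq, dist_eq_norm, Prod.norm_def]
  have h1 : ‖(x - c).2‖ ^ 2 = (x.2 - c.2) ^ 2 := by
    rw [Real.norm_eq_abs, sq_abs]; rfl
  have h2 : ‖(x - c).1‖ ^ 2 = ‖x.1 - c.1‖ ^ 2 := rfl
  have h3 := pow_le_pow_left₀ (norm_nonneg _) (le_max_left ‖(x - c).1‖ ‖(x - c).2‖) 2
  have h4 := pow_le_pow_left₀ (norm_nonneg _) (le_max_right ‖(x - c).1‖ ‖(x - c).2‖) 2
  rw [← h1, ← h2]; linarith

theorem isCompact_sqDist_le (c : Pt m) (a : ℝ) : IsCompact {x | sqDist c x ≤ a} := by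
  refine Metric.isCompact_of_isClosed_isBounded
    (isClosed_le (contDiff_sqDist c).continuous continuous_const) ?_
  refine (Metric.isBounded_closedBall (x := c) (r := Real.sqrt a)).subset fun x hx => ?_
  exact Real.le_sqrt_of_sq_le ((dist_sq_le_sqDist c x).trans hx)

theorem sqDist_nonneg (c x : Pt m) : 0 ≤ sqDist c x := Finset.sum_nonneg fun _ _ => sq_nonneg _

theorem gauss_le_one (c : Pt m) {l : ℝ} (hl : 0 < l) (x : Pt m) : gauss c l x ≤ 1 := by
  rw [gauss, Real.exp_le_one_iff]
  nlinarith [mul_nonneg hl.le (sqDist_nonneg c x)]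

/-- The auxiliary function `Δφ - g` in the Carleman estimate, where `φ` is the weight and
`g = -2 l φ`; with this choice of `g` no gradient terms are left over but a nonnegative one. -/
noncomputable def carlemanAux (c : Pt m) (l : ℝ) (x : Pt m) : ℝ :=
  (l ^ 2 * sqDist c x - l * (m + 1) + 2 * l) * gauss c l x

theorem contDiff_carlemanAux (c : Pt m) (l : ℝ) : ContDiff ℝ ∞ (carlemanAux c l) := by
  unfold carlemanAux; fun_prop

theorem contDiff_lap {F : Type*} [NormedAddCommGroup F] [NormedSpace ℝ F] {f : Pt m → F}
    (hf : ContDiff ℝ ∞ f) : ContDiff ℝ ∞ (lap f) :=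
  ContDiff.sum fun i _ => contDiff_pd (contDiff_pd hf i) i

/-- The Laplacian conjugated with the weight `exp (τ gauss)`. -/
theorem conjugate_lap (c : Pt m) (l τ : ℝ) {v : Pt m → ℝ} (hv : ContDiff ℝ ∞ v) (x : Pt m) :
    let w := fun x => Real.exp (τ * gauss c l x) * v x
    Real.exp (τ * gauss c l x) * lap v x = (lap w x + τ ^ 2 * l ^ 2 * gauss c l x ^ 2 * sqDist c x
        * w x) + τ * (2 * l * gauss c l x * euler c w x - carlemanAux c l x * w x)
        + 2 * τ * l * gauss c l x * w x := by
  intro w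
  set E : Pt m → ℝ := fun x => Real.exp (τ * gauss c l x) with hE
  have dE : Differentiable ℝ E := by fun_prop
  have dv : Differentiable ℝ v := hv.differentiable (by simp)
  have dv' := differentiable_pd hv
  have hEi : ∀ i x, pd i E x = -(τ * l) * (gauss c l x * (co c i x * E x)) := by
    intro i x
    rw [hE, pd_comp_real (Real.hasDerivAt_exp _) (by fun_prop), pd_const_mul (by fun_prop), pd_gauss]
    ring
  have hwi : ∀ i, pd i w = fun x => E x * pd i v x
      + (-(τ * l)) * (gauss c l x * (co c i x * (E x * v x))) := by
    intro i; funext x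
    change pd i (fun x => E x * v x) x = _
    rw [pd_mul dE.differentiableAt dv.differentiableAt, hEi]; ring
  have hwii : ∀ i, pd i (pd i w) x = E x * pd i (pd i v) x
      - (2 * τ * l * gauss c l x * E x) * (co c i x * pd i v x)
      + (τ ^ 2 * l ^ 2 * gauss c l x ^ 2 + τ * l ^ 2 * gauss c l x) * (E x * v x) * co c i x ^ 2
      - (τ * l * gauss c l x * (E x * v x)) * 1 := by
    intro i
    have := dv' i
    rw [hwi, pd_add (by fun_prop) (by fun_prop), pd_const_mul (by fun_prop)]
    simp (disch := fun_prop) only [pd_mul, pd_gauss, hEi, pd_co, if_true]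
    ring
  have hl : lap w x = E x * lap v x - (2 * τ * l * gauss c l x * E x) * euler c v x
      + (τ ^ 2 * l ^ 2 * gauss c l x ^ 2 + τ * l ^ 2 * gauss c l x) * (E x * v x) * sqDist c x
      - (τ * l * gauss c l x * (E x * v x)) * (m + 1) := by
    have e6 : ∑ _i : Option (Fin m), (1 : ℝ) = m + 1 := by simp
    simp only [lap, hwii, Finset.sum_add_distrib, Finset.sum_sub_distrib, ← Finset.mul_sum, e6]
    rfl
  have he : euler c w x = E x * euler c v x - τ * l * gauss c l x * (E x * v x) * sqDist c x := by
    simp only [euler, hwi, sqDist, Finset.mul_sum]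
    rw [← Finset.sum_sub_distrib]
    exact Finset.sum_congr rfl fun i _ => by ring
  have hw : w x = E x * v x := rfl
  rw [hl, he, hw, carlemanAux]
  change E x * lap v x = _
  ring

theorem carleman_pointwise (c : Pt m) (l τ : ℝ) {w : Pt m → ℝ} (hw : ContDiff ℝ ∞ w) (x : Pt m) :
    ∑ i, pd i (carlemanField c l τ (carlemanAux c l) w i) x
      + 4 * τ * l ^ 2 * gauss c l x * euler c w x ^ 2
      + (4 * τ ^ 3 * l ^ 3 * gauss c l x ^ 3 * sqDist c x * (l * sqDist c x - 2)
        - τ * lap (carlemanAux c l) x - 4 * τ ^ 2 * l ^ 2 * gauss c l x ^ 2) * w x ^ 2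
    ≤ ((lap w x + τ ^ 2 * l ^ 2 * gauss c l x ^ 2 * sqDist c x
        * w x) + τ * (2 * l * gauss c l x * euler c w x - carlemanAux c l x * w x)
        + 2 * τ * l * gauss c l x * w x) ^ 2 := by
  rw [sum_pd_carlemanField c l τ (contDiff_carlemanAux c l) hw]
  have key : ∀ S M N : ℝ, 2 * S * M - N ^ 2 ≤ (S + M + N) ^ 2 := fun S M N => by
    nlinarith [sq_nonneg (S + N), sq_nonneg (M + N)]
  refine le_trans (le_of_eq ?_) (key _ _ _)
  simp only [carlemanAux]
  ring

/-- Carleman estimate for smooth functions supported in a spherical shell. The weight grows towards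
the center of the shell. -/
theorem carleman_smooth (c : Pt m) {l r ρ : ℝ} (hl : 0 < l) (hr : 0 < r) (hlr : 4 ≤ l * r ^ 2) :
    ∃ A > 0, ∃ τ₀ ≥ 1, ∀ τ ≥ τ₀, ∀ v : Pt m → ℝ, ContDiff ℝ ∞ v → HasCompactSupport v →
      (∀ x ∈ tsupport v, r ^ 2 ≤ sqDist c x ∧ sqDist c x ≤ ρ ^ 2) →
      τ ^ 3 * ∫ x, (Real.exp (τ * gauss c l x) * v x) ^ 2
        ≤ A * ∫ x, (Real.exp (τ * gauss c l x) * lap v x) ^ 2 := by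
  obtain ⟨H, hH⟩ := (isCompact_sqDist_le c (ρ ^ 2)).exists_bound_of_continuousOn
    (contDiff_lap (contDiff_carlemanAux c l)).continuous.continuousOn
  set e := Real.exp (-(l / 2) * ρ ^ 2) with he
  have he0 : 0 < e := Real.exp_pos _
  set κ := 4 * l ^ 3 * e ^ 3 * r ^ 2 with hκ
  have hκ0 : 0 < κ := by positivity
  refine ⟨κ⁻¹, inv_pos.2 hκ0, max 1 ((|H| + 4 * l ^ 2) / κ), le_max_left _ _, ?_⟩
  intro τ hτ v hv hvs hsupp
  have hτ1 : 1 ≤ τ := (le_max_left _ _).trans hτ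
  have hτ2 : |H| + 4 * l ^ 2 ≤ τ * κ := (div_le_iff₀ hκ0).1 ((le_max_right _ _).trans hτ)
  set w : Pt m → ℝ := fun x => Real.exp (τ * gauss c l x) * v x with hwdef
  have hw : ContDiff ℝ ∞ w := by fun_prop
  have hws : HasCompactSupport w := hvs.mono fun x hx h0 => hx (by
    have h0' : v x = 0 := h0
    simp [hwdef, h0'])
  have hpt : ∀ x, ∑ i, pd i (carlemanField c l τ (carlemanAux c l) w i) x + κ * τ ^ 3 * w x ^ 2
      ≤ (Real.exp (τ * gauss c l x) * lap v x) ^ 2 := by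
    intro x
    rw [conjugate_lap c l τ hv x]
    refine le_trans ?_ (carleman_pointwise c l τ hw x)
    have h1 : 0 ≤ 4 * τ * l ^ 2 * gauss c l x * euler c w x ^ 2 := by
      have := gauss_pos c l x; positivity
    have h2 : κ * τ ^ 3 * w x ^ 2 ≤ (4 * τ ^ 3 * l ^ 3 * gauss c l x ^ 3 * sqDist c x
        * (l * sqDist c x - 2) - τ * lap (carlemanAux c l) x
        - 4 * τ ^ 2 * l ^ 2 * gauss c l x ^ 2) * w x ^ 2 := by
      by_cases hx : x ∈ tsupport v
      · refine mul_le_mul_of_nonneg_right ?_ (sq_nonneg _)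
        obtain ⟨hx1, hx2⟩ := hsupp x hx
        have g1 := gauss_le_one c hl x
        have g0 := gauss_pos c l x
        have g2 : e ≤ gauss c l x := by
          rw [he, gauss]; apply Real.exp_le_exp.2; nlinarith
        have b1 : 2 * κ * τ ^ 3 ≤ 4 * τ ^ 3 * l ^ 3 * gauss c l x ^ 3 * sqDist c x
            * (l * sqDist c x - 2) := by
          have : l * r ^ 2 ≤ l * sqDist c x := by gcongr
          calc 2 * κ * τ ^ 3 = 4 * τ ^ 3 * l ^ 3 * e ^ 3 * r ^ 2 * 2 := by rw [hκ]; ring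
            _ ≤ 4 * τ ^ 3 * l ^ 3 * gauss c l x ^ 3 * sqDist c x * (l * sqDist c x - 2) := by
              gcongr
              · exact mul_nonneg (by positivity) (sqDist_nonneg c x)
              · linarith
        have b2 : τ * lap (carlemanAux c l) x ≤ τ ^ 2 * |H| := by
          have := (Real.le_norm_self _).trans ((hH x hx2).trans (le_abs_self H))
          calc τ * lap (carlemanAux c l) x ≤ τ * |H| := by gcongr
            _ ≤ τ ^ 2 * |H| := by
              have := abs_nonneg H
              gcongr; nlinarith
        have b3 : 4 * τ ^ 2 * l ^ 2 * gauss c l x ^ 2 ≤ 4 * τ ^ 2 * l ^ 2 * 1 := by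
          gcongr; nlinarith
        have b4 : τ ^ 2 * (|H| + 4 * l ^ 2) ≤ τ ^ 2 * (τ * κ) := by gcongr
        nlinarith
      · have : w x = 0 := by simp [hwdef, image_eq_zero_of_notMem_tsupport hx]
        simp [this]
    linarith
  have hfield : ∀ i, HasCompactSupport (carlemanField c l τ (carlemanAux c l) w i) := by
    intro i
    refine HasCompactSupport.of_support_subset_isCompact hws fun x hx => ?_
    by_contra h
    apply hx
    have h0 : w x = 0 := image_eq_zero_of_notMem_tsupport h
    have h1 : ∀ i, pd i w x = 0 := fun i =>
      image_eq_zero_of_notMem_tsupport fun h' => h (tsupport_pd_subset w i h')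
    simp [carlemanField, gradSq, h0, h1]
  have hfc := contDiff_carlemanField c l τ (contDiff_carlemanAux c l) hw
  have i1 : ∀ i, Integrable (pd i (carlemanField c l τ (carlemanAux c l) w i)) volume := fun i =>
    (contDiff_pd (hfc i) i).continuous.integrable_of_hasCompactSupport
      (hasCompactSupport_pd (hfield i) i)
  have i2 : Integrable (fun x => w x ^ 2) volume := by
    exact (hw.continuous.pow 2).integrable_of_hasCompactSupport
      (hws.mono fun x hx h0 => hx (by
        have h0' : w x = 0 := h0
        simp [h0']))
  have hls : HasCompactSupport (lap v) := by
    refine HasCompactSupport.of_support_subset_isCompact hvs fun x hx => ?_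
    by_contra h
    refine hx (Finset.sum_eq_zero fun i _ => image_eq_zero_of_notMem_tsupport fun h' => h ?_)
    exact tsupport_pd_subset v i (tsupport_pd_subset _ i h')
  have i3 : Integrable (fun x => (Real.exp (τ * gauss c l x) * lap v x) ^ 2) volume := by
    have hc : Continuous fun x => Real.exp (τ * gauss c l x) * lap v x :=
      (Real.continuous_exp.comp (continuous_const.mul (contDiff_gauss c l).continuous)).mul
        (contDiff_lap hv).continuous
    exact (hc.pow 2).integrable_of_hasCompactSupport
      (hls.mono fun x hx h0 => hx (by
        have h0' : lap v x = 0 := h0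
        simp [h0']))
  have hint := integral_mono ((integrable_finsetSum _ fun i _ => i1 i).add (i2.const_mul _)) i3 hpt
  simp only [Pi.add_apply] at hint
  rw [integral_add (integrable_finsetSum _ fun i _ => i1 i) (i2.const_mul _),
    integral_finsetSum _ fun i _ => i1 i, integral_const_mul] at hint
  simp only [integral_pd_eq_zero ((hfc _).of_le (by simp)) (hfield _),
    Finset.sum_const_zero, zero_add] at hint
  rw [inv_mul_eq_div, le_div_iff₀ hκ0]
  linarith

/-! ### Passing to the limit in `L²` -/

section L2lim
variable {α E : Type*} [MeasurableSpace α] {μ : Measure α} [NormedAddCommGroup E]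

theorem integral_norm_sq_eq {f : α → E} (hf : MemLp f 2 μ) :
    ∫ x, ‖f x‖ ^ 2 ∂μ = (eLpNorm f 2 μ).toReal ^ 2 := by
  rw [← ENNReal.toReal_pow, eLpNorm_two_sq, integral_eq_lintegral_of_nonneg_ae
    (Eventually.of_forall fun x => by positivity) (f := fun x => ‖f x‖ ^ 2) (hf.1.norm.pow 2)]
  congr 1
  refine lintegral_congr fun x => ?_
  rw [← ofReal_norm, ENNReal.ofReal_pow (norm_nonneg _)]

theorem integrable_norm_sq {f : α → E} (hf : MemLp f 2 μ) :
    Integrable (fun x => ‖f x‖ ^ 2) μ := by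
  have := hf.integrable_norm_pow (by norm_num)
  simpa using this

theorem tendsto_integral_norm_sq {f : ℕ → α → E} {g : α → E} (hf : ∀ n, MemLp (f n) 2 μ)
    (hg : MemLp g 2 μ) (h : Tendsto (fun n => eLpNorm (fun x => f n x - g x) 2 μ) atTop (𝓝 0)) :
    Tendsto (fun n => ∫ x, ‖f n x‖ ^ 2 ∂μ) atTop (𝓝 (∫ x, ‖g x‖ ^ 2 ∂μ)) := by
  have h1 := ((Lp.tendsto_Lp_iff_tendsto_eLpNorm'' f hf g hg).2 h).norm.pow 2
  simp only [Lp.norm_toLp] at h1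
  rw [integral_norm_sq_eq hg]
  simpa only [integral_norm_sq_eq (hf _)] using h1

theorem tendsto_integral_mul_conj {f : ℕ → α → ℂ} {g k : α → ℂ} (hf : ∀ n, MemLp (f n) 2 μ)
    (hg : MemLp g 2 μ) (hk : MemLp k 2 μ)
    (h : Tendsto (fun n => eLpNorm (fun x => f n x - g x) 2 μ) atTop (𝓝 0)) :
    Tendsto (fun n => ∫ x, k x * conj (f n x) ∂μ) atTop (𝓝 (∫ x, k x * conj (g x) ∂μ)) := by
  have h1 := (Lp.tendsto_Lp_iff_tendsto_eLpNorm'' f hf g hg).2 h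
  have h2 := h1.inner (tendsto_const_nhds (x := hk.toLp k)) (𝕜 := ℂ)
  have key : ∀ (a : α → ℂ) (ha : MemLp a 2 μ), inner ℂ (ha.toLp a) (hk.toLp k)
      = ∫ x, k x * conj (a x) ∂μ := by
    intro a ha
    rw [L2.inner_def]
    refine integral_congr_ae ?_
    filter_upwards [ha.coeFn_toLp, hk.coeFn_toLp] with x e1 e2
    rw [e1, e2]; rfl
  simpa only [key] using h2

end L2lim

theorem tendsto_eLpNorm_smul {f : ℕ → Pt m → ℂ} {g : Pt m → ℂ} {χ : Pt m → ℝ}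
    {C : ℝ} (hC : ∀ x, |χ x| ≤ C)
    (h : Tendsto (fun n => eLpNorm (fun x => f n x - g x) 2 volume) atTop (𝓝 0)) :
    Tendsto (fun n => eLpNorm (fun x => χ x • f n x - χ x • g x) 2 volume) atTop (𝓝 0) := by
  have h1 : Tendsto (fun n => ENNReal.ofReal C * eLpNorm (fun x => f n x - g x) 2 volume) atTop
      (𝓝 0) := by
    have := ENNReal.Tendsto.const_mul (a := ENNReal.ofReal C) h (Or.inr ENNReal.ofReal_ne_top)
    simpa using this
  refine tendsto_of_tendsto_of_tendsto_of_le_of_le tendsto_const_nhds h1 (fun _ => zero_le)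
    fun n => ?_
  refine eLpNorm_le_mul_eLpNorm_of_ae_le_mul (Eventually.of_forall fun x => ?_) 2
  rw [← smul_sub, norm_smul, Real.norm_eq_abs]
  gcongr
  exact hC x

/-! ### Approximation of compactly supported functions with `L²` Laplacian -/

/-- A bump function of radius `ε / (n + 1)`. -/
noncomputable def shrinkingBump (c : Pt m) {ε : ℝ} (hε : 0 < ε) (n : ℕ) : ContDiffBump c where
  rIn := ε / (n + 1) / 2
  rOut := ε / (n + 1)
  rIn_pos := by positivity
  rIn_lt_rOut := half_lt_self (by positivity)

theorem tendsto_div_succ (ε : ℝ) : Tendsto (fun n : ℕ => ε / ((n : ℝ) + 1)) atTop (𝓝 0) :=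
  tendsto_const_div_atTop_nhds_zero_nat ε |>.comp (tendsto_add_atTop_nat 1) |>.congr
    fun n => by simp

open scoped Pointwise in
/-- Mollification approximates a compactly supported function in `L²` together with its gradient and
its weak Laplacian. -/
theorem exists_smooth_approx {y F : Pt m → ℂ} {Y : Option (Fin m) → Pt m → ℂ}
    (hy : IsH1 Set.univ y Y) (hF : HasWeakDiv Set.univ Y F) (hFm : MemLp F 2 volume)
    {K U : Set (Pt m)} (hK : IsCompact K) (hU : IsOpen U) (hKU : K ⊆ U)
    (hyK : ∀ x ∉ K, y x = 0) :
    ∃ v : ℕ → Pt m → ℂ, (∀ n, IsTest (v n)) ∧ (∀ n, tsupport (v n) ⊆ U) ∧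
      Tendsto (fun n => eLpNorm (fun x => v n x - y x) 2 volume) atTop (𝓝 0) ∧
      (∀ i, Tendsto (fun n => eLpNorm (fun x => pd i (v n) x - Y i x) 2 volume) atTop (𝓝 0)) ∧
      Tendsto (fun n => eLpNorm (fun x => lap (v n) x - F x) 2 volume) atTop (𝓝 0) := by
  obtain ⟨δ, hδ, hδU⟩ := hK.exists_cthickening_subset_open hU hKU
  let b := fun n => shrinkingBump (0 : Pt m) hδ n
  have hlim := fun {g : Pt m → ℂ} (hg : MemLp g 2 volume) =>
    tendsto_eLpNorm_moll b tendsto_const_nhds (tendsto_div_succ δ) hg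
  have hsub : ∀ n, tsupport (moll ((b n).normed volume) y) ⊆ Metric.closedBall (0 : Pt m) δ + K := by
    intro n
    refine closure_minimal ((support_convolution_subset _).trans ?_)
      ((isCompact_closedBall 0 δ).add hK).isClosed
    refine Set.add_subset_add ?_ fun x hx => by_contra fun h => (Function.mem_support.1 hx) (hyK x h)
    rw [(b n).support_normed_eq]
    refine Metric.ball_subset_closedBall.trans (Metric.closedBall_subset_closedBall ?_)
    exact div_le_self hδ.le (by linarith [n.cast_nonneg (α := ℝ)])
  have hpd : ∀ n i, pd i (moll ((b n).normed volume) y) = moll ((b n).normed volume) (Y i) :=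
    fun n i => funext fun x => pd_moll_of_weak hy (b n).contDiff_normed
      (b n).hasCompactSupport_normed (Set.subset_univ _) i
  refine ⟨fun n => moll ((b n).normed volume) y, fun n => ⟨?_, ?_⟩, fun n => ?_, hlim hy.memLp,
    fun i => ?_, ?_⟩
  · exact contDiff_moll (b n).contDiff_normed (b n).hasCompactSupport_normed
      (locallyIntegrable_of_memLp hy.memLp)
  · exact ((isCompact_closedBall 0 δ).add hK).of_isClosed_subset (isClosed_tsupport _) (hsub n)
  · refine (hsub n).trans (subset_trans ?_ hδU)
    rintro _ ⟨a, ha, k, hk, rfl⟩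
    refine Metric.mem_cthickening_of_dist_le _ k δ K hk ?_
    simpa [dist_eq_norm] using ha
  · simpa only [hpd] using hlim (hy.memLp_grad i)
  · have : ∀ n, lap (moll ((b n).normed volume) y) = moll ((b n).normed volume) F := by
      intro n; funext x
      simp only [lap, hpd]
      exact div_moll_of_weak hy.memLp_grad hF (b n).contDiff_normed
        (b n).hasCompactSupport_normed (Set.subset_univ _)
    simpa only [this] using hlim hFm

theorem IsTest.memLp_lap {φ : Pt m → ℂ} (hφ : IsTest φ) : MemLp (lap φ) 2 volume :=
  memLp_finsetSum _ fun i _ => ((hφ.pd i).pd i).memLp 2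

theorem lap_clm_comp {F G : Type*} [NormedAddCommGroup F] [NormedSpace ℝ F] [NormedAddCommGroup G]
    [NormedSpace ℝ G] (L : F →L[ℝ] G) {f : Pt m → F} (hf : ContDiff ℝ ∞ f) (x : Pt m) :
    lap (fun x => L (f x)) x = L (lap f x) := by
  have h1 : ∀ i, pd i (fun x => L (f x)) = fun x => L (pd i f x) := fun i => funext fun x =>
    pd_clm_comp L (hf.differentiable (by simp)).differentiableAt i
  simp only [lap, h1, map_sum]
  refine Finset.sum_congr rfl fun i _ => ?_
  exact pd_clm_comp L ((contDiff_pd hf i).differentiable (by simp)).differentiableAt i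

theorem abs_exp_gauss_le (c : Pt m) {l τ : ℝ} (hl : 0 < l) (hτ : 0 ≤ τ) (x : Pt m) :
    |Real.exp (τ * gauss c l x)| ≤ Real.exp τ := by
  rw [abs_of_pos (Real.exp_pos _)]
  exact Real.exp_le_exp.2 (by nlinarith [gauss_le_one c hl x])

/-- The Carleman estimate for functions with weak Laplacian `F`. -/
theorem carleman_weak (c : Pt m) {l r ρ₁ ρ : ℝ} (hl : 0 < l) (hr : 0 < r) (hlr : 4 ≤ l * r ^ 2)
    {r₁ : ℝ} (hr₁ : r ^ 2 < r₁) (hρ : ρ₁ < ρ ^ 2) :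
    ∃ A > 0, ∃ τ₀ ≥ 1, ∀ τ ≥ τ₀, ∀ (y F : Pt m → ℂ) (Y : Option (Fin m) → Pt m → ℂ),
      IsH1 Set.univ y Y → HasWeakDiv Set.univ Y F → MemLp F 2 volume →
      (∀ x, y x ≠ 0 → r₁ ≤ sqDist c x ∧ sqDist c x ≤ ρ₁) →
      τ ^ 3 * ∫ x, ‖Real.exp (τ * gauss c l x) • y x‖ ^ 2
        ≤ A * ∫ x, ‖Real.exp (τ * gauss c l x) • F x‖ ^ 2 := by
  obtain ⟨A, hA, τ₀, hτ₀, H⟩ := carleman_smooth c (ρ := ρ) hl hr hlr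
  refine ⟨A, hA, τ₀, hτ₀, fun τ hτ y F Y hy hF hFm hsupp => ?_⟩
  have hs := (contDiff_sqDist c).continuous
  have hK : IsCompact {x | r₁ ≤ sqDist c x ∧ sqDist c x ≤ ρ₁} :=
    (isCompact_sqDist_le c ρ₁).of_isClosed_subset
      ((isClosed_le continuous_const hs).inter (isClosed_le hs continuous_const)) fun x hx => hx.2
  have hU : IsOpen {x | r ^ 2 < sqDist c x ∧ sqDist c x < ρ ^ 2} :=
    (isOpen_lt continuous_const hs).inter (isOpen_lt hs continuous_const)
  obtain ⟨v, hv, hvU, hv0, -, hv2⟩ := exists_smooth_approx hy hF hFm hK hU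
    (fun x hx => ⟨hr₁.trans_le hx.1, hx.2.trans_lt hρ⟩)
    (fun x hx => by_contra fun h => hx (hsupp x h))
  have hE : Continuous fun x => Real.exp (τ * gauss c l x) :=
    Real.continuous_exp.comp (continuous_const.mul (contDiff_gauss c l).continuous)
  have hEb := abs_exp_gauss_le c hl (by linarith : 0 ≤ τ)
  have t1 := tendsto_integral_norm_sq (fun n => memLp_smul_of_bound hE hEb ((hv n).memLp 2))
    (memLp_smul_of_bound hE hEb hy.memLp) (tendsto_eLpNorm_smul hEb hv0)
  have t2 := tendsto_integral_norm_sq (fun n => memLp_smul_of_bound hE hEb (hv n).memLp_lap)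
    (memLp_smul_of_bound hE hEb hFm) (tendsto_eLpNorm_smul hEb hv2)
  refine le_of_tendsto_of_tendsto' (t1.const_mul _) (t2.const_mul _) fun n => ?_
  -- the estimate holds for the real and for the imaginary part
  have hparts : ∀ L : ℂ →L[ℝ] ℝ, τ ^ 3 * ∫ x, (Real.exp (τ * gauss c l x) * L (v n x)) ^ 2
      ≤ A * ∫ x, (Real.exp (τ * gauss c l x) * L (lap (v n) x)) ^ 2 := by
    intro L
    have := H τ hτ (fun x => L (v n x)) (L.contDiff.comp (hv n).1)
      ((hv n).2.comp_left (map_zero L)) (fun x hx => by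
        have := hvU n (tsupport_comp_subset (map_zero L) (v n) hx)
        exact ⟨this.1.le, this.2.le⟩)
    simpa only [lap_clm_comp L (hv n).1] using this
  have hsplit : ∀ f : Pt m → ℂ, MemLp f 2 volume →
      ∫ x, ‖Real.exp (τ * gauss c l x) • f x‖ ^ 2
        = (∫ x, (Real.exp (τ * gauss c l x) * (f x).re) ^ 2)
          + ∫ x, (Real.exp (τ * gauss c l x) * (f x).im) ^ 2 := by
    intro f hf
    have hm := memLp_smul_of_bound hE hEb hf
    have h1 : Integrable (fun x => (Real.exp (τ * gauss c l x) * (f x).re) ^ 2) volume := by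
      refine (integrable_norm_sq hm.re).congr (Eventually.of_forall fun x => ?_)
      simp only [RCLike.re_to_complex, Complex.smul_re, Real.norm_eq_abs, sq_abs, smul_eq_mul]
    have h2 : Integrable (fun x => (Real.exp (τ * gauss c l x) * (f x).im) ^ 2) volume := by
      refine (integrable_norm_sq hm.im).congr (Eventually.of_forall fun x => ?_)
      simp only [RCLike.im_to_complex, Complex.smul_im, Real.norm_eq_abs, sq_abs, smul_eq_mul]
    rw [← integral_add h1 h2]
    refine integral_congr_ae (Eventually.of_forall fun x => ?_)
    simp only [norm_smul, mul_pow, ← Complex.normSq_eq_norm_sq, Complex.normSq_apply,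
      Real.norm_eq_abs, sq_abs]
    ring
  rw [hsplit _ ((hv n).memLp 2), hsplit _ (hv n).memLp_lap]
  have e1 := hparts Complex.reCLM
  have e2 := hparts Complex.imCLM
  simp only [Complex.reCLM_apply, Complex.imCLM_apply] at e1 e2
  linarith

/-! ### Propagation of smallness -/

/-- The energy density `|z|² + |G|²`. -/
noncomputable def energy (z : Pt m → ℂ) (G : Option (Fin m) → Pt m → ℂ) (x : Pt m) : ℝ :=
  ‖z x‖ ^ 2 + ∑ i, ‖G i x‖ ^ 2

theorem energy_nonneg (z : Pt m → ℂ) (G : Option (Fin m) → Pt m → ℂ) (x : Pt m) :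
    0 ≤ energy z G x := by unfold energy; positivity

theorem norm_sq_le_energy (z : Pt m → ℂ) (G : Option (Fin m) → Pt m → ℂ) (x : Pt m) :
    ‖z x‖ ^ 2 ≤ energy z G x := le_add_of_nonneg_right (by positivity)

theorem IsH1.integrable_energy {Ω : Set (Pt m)} {z : Pt m → ℂ} {G : Option (Fin m) → Pt m → ℂ}
    (h : IsH1 Ω z G) : Integrable (energy z G) volume :=
  (integrable_norm_sq h.memLp).add
    (integrable_finsetSum _ fun i _ => integrable_norm_sq (h.memLp_grad i))

theorem exists_bound_cutoff {χ : Pt m → ℝ} (hχ : ContDiff ℝ ∞ χ) (hs : HasCompactSupport χ) :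
    ∃ C, 0 ≤ C ∧ (∀ x, |χ x| ≤ C) ∧ (∀ i x, |pd i χ x| ≤ C) ∧ ∀ x, |lap χ x| ≤ C := by
  obtain ⟨C₁, h1⟩ := hs.exists_bound_of_continuous hχ.continuous
  choose C₂ h2 using fun i => (hasCompactSupport_pd hs i).exists_bound_of_continuous
    (contDiff_pd hχ i).continuous
  choose C₃ h3 using fun i => (hasCompactSupport_pd (hasCompactSupport_pd hs i)
    i).exists_bound_of_continuous (contDiff_pd (contDiff_pd hχ i) i).continuous
  have n2 : ∀ i, 0 ≤ C₂ i := fun i => (norm_nonneg _).trans (h2 i 0)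
  have n3 : ∀ i, 0 ≤ C₃ i := fun i => (norm_nonneg _).trans (h3 i 0)
  have n1 : 0 ≤ C₁ := (norm_nonneg _).trans (h1 0)
  have s2 : 0 ≤ ∑ i, C₂ i := Finset.sum_nonneg fun i _ => n2 i
  have s3 : 0 ≤ ∑ i, C₃ i := Finset.sum_nonneg fun i _ => n3 i
  refine ⟨C₁ + ∑ i, C₂ i + ∑ i, C₃ i, by positivity, fun x => ?_, fun i x => ?_, fun x => ?_⟩
  · have := h1 x; rw [Real.norm_eq_abs] at this; linarith
  · have := h2 i x; rw [Real.norm_eq_abs] at this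
    have := Finset.single_le_sum (fun i _ => n2 i) (Finset.mem_univ i)
    linarith
  · have : |lap χ x| ≤ ∑ i, C₃ i :=
      (Finset.abs_sum_le_sum_abs _ _).trans (Finset.sum_le_sum fun i _ => h3 i x)
    linarith

theorem lap_eq_zero_of_notMem {χ : Pt m → ℝ} {x : Pt m} (hx : x ∉ tsupport χ) : lap χ x = 0 :=
  Finset.sum_eq_zero fun i _ => image_eq_zero_of_notMem_tsupport fun h' =>
    hx (tsupport_pd_subset χ i (tsupport_pd_subset _ i h'))

theorem pd_eq_zero_of_notMem {χ : Pt m → ℝ} {x : Pt m} (hx : x ∉ tsupport χ)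
    (i : Option (Fin m)) : pd i χ x = 0 :=
  image_eq_zero_of_notMem_tsupport fun h' => hx (tsupport_pd_subset χ i h')

theorem memLp_cutoff_div {z F : Pt m → ℂ} {G : Option (Fin m) → Pt m → ℂ} {Ω : Set (Pt m)}
    (hz : IsH1 Ω z G) (hF : MemLp F 2 volume) {χ : Pt m → ℝ} (hχ : ContDiff ℝ ∞ χ)
    (hs : HasCompactSupport χ) :
    MemLp (fun x => χ x • F x + (2 * ∑ i, pd i χ x • G i x + (∑ i, pd i (pd i χ) x) • z x)) 2
      volume := by
  obtain ⟨C, -, h1, h2, h3⟩ := exists_bound_cutoff hχ hs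
  refine (memLp_smul_of_bound hχ.continuous h1 hF).add (MemLp.add ?_ ?_)
  · exact (memLp_finsetSum Finset.univ fun i _ => memLp_smul_of_bound (contDiff_pd hχ i).continuous
      (h2 i) (hz.memLp_grad i)).const_mul 2
  · exact memLp_smul_of_bound (contDiff_lap hχ).continuous h3 hz.memLp

/-- Interior estimate for the gradient (Caccioppoli). -/
theorem caccioppoli {Ω : Set (Pt m)} {χ : Pt m → ℝ} (hχ : ContDiff ℝ ∞ χ)
    (hs : HasCompactSupport χ) (hΩ : tsupport χ ⊆ Ω) :
    ∃ C ≥ 0, ∀ (z F : Pt m → ℂ) (G : Option (Fin m) → Pt m → ℂ), IsH1 Ω z G →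
      HasWeakDiv Ω G F → MemLp F 2 volume →
      ∑ i, ∫ x, ‖χ x • G i x‖ ^ 2 ≤ C * ∫ x in tsupport χ, (‖z x‖ ^ 2 + ‖F x‖ ^ 2) := by
  obtain ⟨C, hC, hb, hb1, hb2⟩ := exists_bound_cutoff hχ hs
  set C₁ := 2 * C ^ 2 + 4 * C ^ 2 * (m + 1) with hC₁
  refine ⟨4 * C₁ + 2 * (m + 1) * C ^ 2, by positivity, fun z F G hz hF hFm => ?_⟩
  have hΩ' : Set.univ ∩ tsupport χ ⊆ Ω := by simpa using hΩ
  have hy := hz.cutoff hχ hb hb1 hΩ'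
  have hdiv := hF.cutoff hz hFm hχ hΩ'
  have hFy := memLp_cutoff_div hz hFm hχ hs
  set y := fun x => χ x • z x with hydef
  set Y := fun i x => χ x • G i x + pd i χ x • z x with hYdef
  set Fy := fun x => χ x • F x + (2 * ∑ i, pd i χ x • G i x + (∑ i, pd i (pd i χ) x) • z x)
    with hFydef
  -- testing the equation with the function itself
  have hid : ∑ i, ∫ x, ‖Y i x‖ ^ 2 ≤ ∫ x, ‖Fy x‖ * ‖y x‖ := by
    obtain ⟨v, hv, -, hv0, hv1, -⟩ := exists_smooth_approx hy hdiv hFy hs isOpen_univ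
      (Set.subset_univ _) (fun x hx => by simp [hydef, image_eq_zero_of_notMem_tsupport hx])
    have hn : ∀ n, ∑ i, ∫ x, Y i x * conj (pd i (v n) x) = -∫ x, Fy x * conj (v n x) := by
      intro n
      have := hdiv _ (hv n).conj (Set.subset_univ _)
      simpa only [pd_conj (hv n).differentiable.differentiableAt] using this
    have t1 := tendsto_finsetSum Finset.univ fun i (_ : i ∈ Finset.univ) =>
      tendsto_integral_mul_conj (fun n => ((hv n).pd i).memLp 2) (hy.memLp_grad i)
        (hy.memLp_grad i) (hv1 i)
    have t2 := (tendsto_integral_mul_conj (fun n => (hv n).memLp 2) hy.memLp hFy hv0).neg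
    have heq := tendsto_nhds_unique t1 (t2.congr fun n => (hn n).symm)
    have hsq : ∀ i, ∫ x, Y i x * conj (Y i x) = ((∫ x, ‖Y i x‖ ^ 2 : ℝ) : ℂ) := by
      intro i
      rw [← integral_complex_ofReal]
      refine integral_congr_ae (Eventually.of_forall fun x => ?_)
      simp only [Complex.mul_conj, Complex.normSq_eq_norm_sq]
    have hre := congrArg norm heq
    change ‖∑ i, ∫ x, Y i x * conj (Y i x)‖ = ‖-∫ x, Fy x * conj (y x)‖ at hre
    simp only [hsq] at hre
    rw [← Complex.ofReal_sum, Complex.norm_real, Real.norm_eq_abs, norm_neg] at hre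
    calc _ ≤ |∑ i, ∫ x, ‖Y i x‖ ^ 2| := le_abs_self _
      _ = _ := hre
      _ ≤ ∫ x, ‖Fy x * conj (y x)‖ := norm_integral_le_integral_norm _
      _ = _ := by simp only [norm_mul, RCLike.norm_conj]
  have hpt : ∀ x, ‖Fy x‖ * ‖y x‖ ≤ 1 / 2 * ∑ i, ‖Y i x‖ ^ 2
      + C₁ * (tsupport χ).indicator (fun x => ‖z x‖ ^ 2 + ‖F x‖ ^ 2) x := by
    intro x
    by_cases hx : x ∈ tsupport χ
    · rw [Set.indicator_of_mem hx]
      have hyx : ‖y x‖ = |χ x| * ‖z x‖ := by rw [hydef, norm_smul, Real.norm_eq_abs]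
      have a1 : ‖Fy x‖ ≤ |χ x| * ‖F x‖ + (2 * ∑ i, |pd i χ x| * ‖G i x‖ + |lap χ x| * ‖z x‖) := by
        refine (norm_add_le _ _).trans (add_le_add (by rw [norm_smul, Real.norm_eq_abs])
          ((norm_add_le _ _).trans (add_le_add ?_ (by rw [norm_smul, Real.norm_eq_abs]; rfl))))
        rw [norm_mul, RCLike.norm_ofNat]
        gcongr
        refine (norm_sum_le _ _).trans (Finset.sum_le_sum fun i _ => ?_)
        rw [norm_smul, Real.norm_eq_abs]
      have hterm : ∀ i, 2 * (|pd i χ x| * ‖G i x‖) * ‖y x‖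
          ≤ 1 / 2 * ‖Y i x‖ ^ 2 + 4 * C ^ 2 * ‖z x‖ ^ 2 := by
        intro i
        have b1 : |χ x| * ‖G i x‖ ≤ ‖Y i x‖ + |pd i χ x| * ‖z x‖ := by
          have : χ x • G i x = Y i x - pd i χ x • z x := by simp [hYdef]
          calc |χ x| * ‖G i x‖ = ‖χ x • G i x‖ := by rw [norm_smul, Real.norm_eq_abs]
            _ ≤ _ := by rw [this]; refine (norm_sub_le _ _).trans (by
                          rw [norm_smul, Real.norm_eq_abs])
        have b2 : |pd i χ x| ^ 2 ≤ C ^ 2 := pow_le_pow_left₀ (abs_nonneg _) (hb1 i x) 2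
        have b3 : 0 ≤ |pd i χ x| * ‖z x‖ := by positivity
        calc 2 * (|pd i χ x| * ‖G i x‖) * ‖y x‖
            = 2 * (|pd i χ x| * ‖z x‖) * (|χ x| * ‖G i x‖) := by rw [hyx]; ring
          _ ≤ 2 * (|pd i χ x| * ‖z x‖) * (‖Y i x‖ + |pd i χ x| * ‖z x‖) := by gcongr
          _ ≤ 1 / 2 * ‖Y i x‖ ^ 2 + 4 * (|pd i χ x| * ‖z x‖) ^ 2 := by
            nlinarith [sq_nonneg (‖Y i x‖ - 2 * (|pd i χ x| * ‖z x‖))]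
          _ ≤ _ := by rw [mul_pow, ← mul_assoc]; gcongr
      have c1 : |χ x| * ‖F x‖ * ‖y x‖ ≤ C ^ 2 * (‖z x‖ ^ 2 + ‖F x‖ ^ 2) := by
        rw [hyx]
        have b2 : |χ x| ^ 2 ≤ C ^ 2 := pow_le_pow_left₀ (abs_nonneg _) (hb x) 2
        calc |χ x| * ‖F x‖ * (|χ x| * ‖z x‖) = |χ x| ^ 2 * (‖F x‖ * ‖z x‖) := by ring
          _ ≤ C ^ 2 * (‖F x‖ * ‖z x‖) := by gcongr
          _ ≤ _ := by
            gcongr; nlinarith [sq_nonneg (‖F x‖ - ‖z x‖), sq_nonneg (‖F x‖), sq_nonneg (‖z x‖)]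
      have c2 : |lap χ x| * ‖z x‖ * ‖y x‖ ≤ C ^ 2 * ‖z x‖ ^ 2 := by
        rw [hyx]
        calc |lap χ x| * ‖z x‖ * (|χ x| * ‖z x‖) = |lap χ x| * |χ x| * ‖z x‖ ^ 2 := by ring
          _ ≤ C * C * ‖z x‖ ^ 2 := by gcongr; exacts [hb2 x, hb x]
          _ = _ := by ring
      have c3 := Finset.sum_le_sum fun i (_ : i ∈ Finset.univ) => hterm i
      rw [← Finset.sum_mul, ← Finset.mul_sum, Finset.sum_add_distrib, ← Finset.mul_sum,
        Finset.sum_const, Finset.card_univ, Fintype.card_option, Fintype.card_fin,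
        nsmul_eq_mul] at c3
      push_cast at c3
      have hn := norm_nonneg (y x)
      calc ‖Fy x‖ * ‖y x‖ ≤ (|χ x| * ‖F x‖ + (2 * ∑ i, |pd i χ x| * ‖G i x‖
            + |lap χ x| * ‖z x‖)) * ‖y x‖ := by gcongr
        _ = |χ x| * ‖F x‖ * ‖y x‖ + (2 * ∑ i, |pd i χ x| * ‖G i x‖) * ‖y x‖
            + |lap χ x| * ‖z x‖ * ‖y x‖ := by ring
        _ ≤ C ^ 2 * (‖z x‖ ^ 2 + ‖F x‖ ^ 2) + (1 / 2 * ∑ i, ‖Y i x‖ ^ 2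
            + (m + 1) * (4 * C ^ 2 * ‖z x‖ ^ 2)) + C ^ 2 * ‖z x‖ ^ 2 := by gcongr
        _ ≤ _ := by
          rw [hC₁]
          have : 0 ≤ (C ^ 2 + 4 * C ^ 2 * (m + 1)) * ‖F x‖ ^ 2 := by positivity
          nlinarith
    · rw [Set.indicator_of_notMem hx, mul_zero, add_zero]
      have : y x = 0 := by simp [hydef, image_eq_zero_of_notMem_tsupport hx]
      rw [this, norm_zero, mul_zero]
      positivity
  have hJi : Integrable (fun x => ‖z x‖ ^ 2 + ‖F x‖ ^ 2) volume :=
    (integrable_norm_sq hz.memLp).add (integrable_norm_sq hFm)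
  have hmeas : MeasurableSet (tsupport χ) := (isClosed_tsupport χ).measurableSet
  have hJ' : Integrable ((tsupport χ).indicator (fun x => ‖z x‖ ^ 2 + ‖F x‖ ^ 2)) volume :=
    hJi.indicator hmeas
  have hYi : ∀ i ∈ Finset.univ, Integrable (fun x => ‖Y i x‖ ^ 2) volume := fun i _ =>
    integrable_norm_sq (hy.memLp_grad i)
  set J := ∫ x in tsupport χ, (‖z x‖ ^ 2 + ‖F x‖ ^ 2) with hJ
  have hJeq : ∫ x, (tsupport χ).indicator (fun x => ‖z x‖ ^ 2 + ‖F x‖ ^ 2) x = J :=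
    integral_indicator hmeas
  have hbound : ∑ i, ∫ x, ‖Y i x‖ ^ 2 ≤ 1 / 2 * ∑ i, (∫ x, ‖Y i x‖ ^ 2) + C₁ * J := by
    refine hid.trans ?_
    have i1 : Integrable (fun x => ‖Fy x‖ * ‖y x‖) volume := hFy.norm.integrable_mul hy.memLp.norm
    have := integral_mono i1 (((integrable_finsetSum _ hYi).const_mul (1 / 2)).add
      (hJ'.const_mul C₁)) hpt
    simp only [Pi.add_apply] at this
    rw [integral_add ((integrable_finsetSum _ hYi).const_mul (1 / 2)) (hJ'.const_mul C₁),
      integral_const_mul, integral_const_mul, hJeq, integral_finsetSum _ hYi] at this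
    exact this
  have hlast : ∀ i, ∫ x, ‖χ x • G i x‖ ^ 2 ≤ 2 * (∫ x, ‖Y i x‖ ^ 2) + 2 * C ^ 2 * J := by
    intro i
    rw [← hJeq, ← integral_const_mul, ← integral_const_mul,
      ← integral_add ((hYi i (Finset.mem_univ i)).const_mul 2) (hJ'.const_mul _)]
    refine integral_mono (integrable_norm_sq (memLp_smul_of_bound hχ.continuous hb
      (hz.memLp_grad i))) (((hYi i (Finset.mem_univ i)).const_mul 2).add (hJ'.const_mul _)) ?_
    intro x
    change ‖χ x • G i x‖ ^ 2 ≤ 2 * ‖Y i x‖ ^ 2 + 2 * C ^ 2 * _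
    have e : χ x • G i x = Y i x - pd i χ x • z x := by simp [hYdef]
    by_cases hx : x ∈ tsupport χ
    · rw [Set.indicator_of_mem hx, e]
      have b1 : ‖pd i χ x • z x‖ ^ 2 ≤ C ^ 2 * ‖z x‖ ^ 2 := by
        rw [norm_smul, Real.norm_eq_abs, mul_pow]
        gcongr
        exact hb1 i x
      have b2 : ‖Y i x - pd i χ x • z x‖ ^ 2 ≤ (‖Y i x‖ + ‖pd i χ x • z x‖) ^ 2 := by
        gcongr; exact norm_sub_le _ _
      have b3 : 0 ≤ C ^ 2 * ‖F x‖ ^ 2 := by positivity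
      nlinarith [sq_nonneg (‖Y i x‖ - ‖pd i χ x • z x‖)]
    · rw [Set.indicator_of_notMem hx, image_eq_zero_of_notMem_tsupport hx]
      rw [zero_smul, norm_zero, zero_pow two_ne_zero]
      positivity
  have hsum := Finset.sum_le_sum fun i (_ : i ∈ Finset.univ) => hlast i
  rw [Finset.sum_add_distrib, ← Finset.mul_sum, Finset.sum_const, Finset.card_univ,
    Fintype.card_option, Fintype.card_fin, nsmul_eq_mul] at hsum
  push_cast at hsum
  nlinarith

/-- `z` has the gradient `G` and the Laplacian `F` in `Ω`, in the weak sense, and satisfies the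
differential inequality `|Δz| ≤ M |z| + |f|`. -/
structure LaplaceIneq (Ω : Set (Pt m)) (M : ℝ) (z : Pt m → ℂ) (G : Option (Fin m) → Pt m → ℂ)
    (F : Pt m → ℂ) (f : Pt m → ℝ) : Prop where
  isH1 : IsH1 Ω z G
  div : HasWeakDiv Ω G F
  memLp_lap : MemLp F 2 volume
  memLp_rhs : MemLp f 2 volume
  bound : ∀ᵐ x, x ∈ Ω → ‖F x‖ ≤ M * ‖z x‖ + |f x|

/-- A smooth function of the distance to `c` that cuts off to a spherical shell. -/
theorem exists_shell_cutoff (c : Pt m) {a b δ : ℝ} (hab : a < b) (hδ : 0 < δ) :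
    ∃ χ : Pt m → ℝ, ContDiff ℝ ∞ χ ∧ HasCompactSupport χ ∧ (∀ x, |χ x| ≤ 1) ∧
      (∀ x, a ≤ sqDist c x → sqDist c x ≤ b → χ x = 1) ∧
      tsupport χ ⊆ {x | a - δ ≤ sqDist c x ∧ sqDist c x ≤ b + δ} := by
  let η : ContDiffBump ((a + b) / 2) := ⟨(b - a) / 2, (b - a) / 2 + δ, by linarith, by linarith⟩
  have hc : IsClosed {x | a - δ ≤ sqDist c x ∧ sqDist c x ≤ b + δ} :=
    (isClosed_le continuous_const (contDiff_sqDist c).continuous).inter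
      (isClosed_le (contDiff_sqDist c).continuous continuous_const)
  have hts : tsupport (fun x => η (sqDist c x)) ⊆
      {x | a - δ ≤ sqDist c x ∧ sqDist c x ≤ b + δ} := by
    refine closure_minimal (fun x hx => ?_) hc
    have : sqDist c x ∈ Function.support η := hx
    rw [η.support_eq, Metric.mem_ball, Real.dist_eq, abs_lt] at this
    constructor
    · have := this.1; simp only [η] at this; linarith
    · have := this.2; simp only [η] at this; linarith
  refine ⟨fun x => η (sqDist c x), η.contDiff.comp (contDiff_sqDist c), ?_, fun x => ?_, ?_, hts⟩
  · exact (isCompact_sqDist_le c (b + δ)).of_isClosed_subset (isClosed_tsupport _)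
      (hts.trans fun x hx => hx.2)
  · rw [abs_of_nonneg η.nonneg]; exact η.le_one
  · intro x h1 h2
    refine η.one_of_mem_closedBall ?_
    rw [Metric.mem_closedBall, Real.dist_eq, abs_le]
    simp only [η]
    constructor <;> linarith

/-- The commutator of the Laplacian with a cutoff is of first order, hence bounded by the energy. -/
theorem norm_cutoff_commutator_sq_le {χ : Pt m → ℝ} {C : ℝ} {x : Pt m}
    (h1 : ∀ i, |pd i χ x| ≤ C) (h2 : |lap χ x| ≤ C) (z : Pt m → ℂ)
    (G : Option (Fin m) → Pt m → ℂ) :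
    ‖2 * ∑ i, pd i χ x • G i x + (∑ i, pd i (pd i χ) x) • z x‖ ^ 2
      ≤ 8 * C ^ 2 * (m + 1) * energy z G x := by
  have t1 : ‖2 * ∑ i, pd i χ x • G i x + (∑ i, pd i (pd i χ) x) • z x‖
      ≤ 2 * (C * ∑ i, ‖G i x‖) + C * ‖z x‖ := by
    refine (norm_add_le _ _).trans (add_le_add ?_ ?_)
    · rw [norm_mul, RCLike.norm_ofNat, Finset.mul_sum]
      gcongr
      refine (norm_sum_le _ _).trans (Finset.sum_le_sum fun i _ => ?_)
      rw [norm_smul, Real.norm_eq_abs]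
      gcongr; exact h1 i
    · rw [norm_smul, Real.norm_eq_abs]
      gcongr; exact h2
  have t2 : (∑ i, ‖G i x‖) ^ 2 ≤ (m + 1) * ∑ i, ‖G i x‖ ^ 2 := by
    have := sq_sum_le_card_mul_sum_sq (s := Finset.univ) (f := fun i => ‖G i x‖)
    simpa using this
  have t3 := pow_le_pow_left₀ (norm_nonneg _) t1 2
  have t4 : 0 ≤ C ^ 2 * m * ‖z x‖ ^ 2 := by positivity
  have t5 : C ^ 2 * (∑ i, ‖G i x‖) ^ 2 ≤ C ^ 2 * ((m + 1) * ∑ i, ‖G i x‖ ^ 2) := by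
    gcongr
  have t6 : 0 ≤ C ^ 2 * ‖z x‖ ^ 2 := by positivity
  rw [energy]
  nlinarith [sq_nonneg (2 * (C * ∑ i, ‖G i x‖) - C * ‖z x‖)]

theorem integral_add_four {α : Type*} [MeasurableSpace α] {μ : Measure α} {a b c d : α → ℝ}
    (ha : Integrable a μ) (hb : Integrable b μ) (hc : Integrable c μ) (hd : Integrable d μ) :
    ∫ x, (a x + b x + c x + d x) ∂μ
      = (∫ x, a x ∂μ) + (∫ x, b x ∂μ) + (∫ x, c x ∂μ) + ∫ x, d x ∂μ := by
  have h1 : Integrable (fun x => a x + b x) μ := ha.add hb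
  have h2 : Integrable (fun x => a x + b x + c x) μ := h1.add hc
  rw [integral_add h2 hd, integral_add h1 hc, integral_add ha hb]

/-- The energy in a ball is controlled by the function in a bigger ball. -/
theorem energy_ball_le {Ω : Set (Pt m)} (hΩm : MeasurableSet Ω) {M : ℝ} (c : Pt m)
    {a b : ℝ} (ha : 0 < a) (hab : a < b) (hballΩ : {x | sqDist c x < b} ⊆ Ω) :
    ∃ C ≥ 0, ∀ (z F : Pt m → ℂ) (G : Option (Fin m) → Pt m → ℂ) (f : Pt m → ℝ),
      LaplaceIneq Ω M z G F f → ∫ x in {x | sqDist c x ≤ a}, energy z G x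
        ≤ C * ((∫ x in {x | sqDist c x < b}, ‖z x‖ ^ 2) + ∫ x in Ω, f x ^ 2) := by
  have hs := (contDiff_sqDist c).continuous
  obtain ⟨χ', hχ', hχs', -, hχ2', hχ3'⟩ := exists_shell_cutoff c (a := -1) (b := a)
    (δ := (b - a) / 2) (by linarith) (by linarith)
  have hχΩ' : tsupport χ' ⊆ {x | sqDist c x < b} := hχ3'.trans fun x hx => by
    have := hx.2; simp only [Set.mem_ofPred_eq]; linarith
  obtain ⟨C₂, hC₂, hcacc⟩ := caccioppoli hχ' hχs' (hχΩ'.trans hballΩ)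
  refine ⟨1 + C₂ * (1 + 2 * M ^ 2) + 2 * C₂, by positivity, fun z F G f h => ?_⟩
  have hsa : MeasurableSet {x : Pt m | sqDist c x ≤ a} :=
    (isClosed_le hs continuous_const).measurableSet
  have hsr : MeasurableSet {x : Pt m | sqDist c x < b} :=
    (isOpen_lt hs continuous_const).measurableSet
  have hen := h.isH1.integrable_energy
  have hf2 : Integrable (fun x => f x ^ 2) volume := by
    simpa [sq_abs] using integrable_norm_sq h.memLp_rhs
  have hz2 := integrable_norm_sq h.isH1.memLp
  have hF2 := integrable_norm_sq h.memLp_lap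
  set Z := ∫ x in {x | sqDist c x < b}, ‖z x‖ ^ 2 with hZ
  set N := ∫ x in Ω, f x ^ 2 with hN
  have hZ0 : 0 ≤ Z := integral_nonneg fun x => by positivity
  have hN0 : 0 ≤ N := integral_nonneg fun x => by positivity
  have hpos : ∀ (s : Set (Pt m)) (g : Pt m → ℝ) (x : Pt m), (∀ x, 0 ≤ g x) → 0 ≤ s.indicator g x :=
    fun s g x hg => Set.indicator_nonneg (fun x _ => hg x) x
  have h1 := hcacc z F G h.isH1 h.div h.memLp_lap
  have h2 : ∫ x in tsupport χ', (‖z x‖ ^ 2 + ‖F x‖ ^ 2) ≤ (1 + 2 * M ^ 2) * Z + 2 * N := by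
    have hm' : MeasurableSet (tsupport χ') := (isClosed_tsupport χ').measurableSet
    rw [hZ, hN, ← integral_const_mul, ← integral_const_mul, ← integral_indicator hm',
      ← integral_indicator hsr, ← integral_indicator hΩm, ← integral_add
        ((hz2.const_mul _).indicator hsr) ((hf2.const_mul _).indicator hΩm)]
    refine integral_mono_ae ((hz2.add hF2).indicator hm')
      (((hz2.const_mul _).indicator hsr).add ((hf2.const_mul _).indicator hΩm)) ?_
    filter_upwards [h.bound] with x hx
    by_cases hxt : x ∈ tsupport χ'
    · have hx1 := hχΩ' hxt
      have hx2 := hballΩ hx1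
      rw [Set.indicator_of_mem hxt, Set.indicator_of_mem hx1, Set.indicator_of_mem hx2]
      have := pow_le_pow_left₀ (norm_nonneg _) (hx hx2) 2
      have h3 : (M * ‖z x‖ + |f x|) ^ 2 ≤ 2 * M ^ 2 * ‖z x‖ ^ 2 + 2 * f x ^ 2 := by
        rw [← sq_abs (f x)]; nlinarith [sq_nonneg (M * ‖z x‖ - |f x|)]
      linarith
    · rw [Set.indicator_of_notMem hxt]
      exact add_nonneg (hpos _ _ x fun x => by positivity) (hpos _ _ x fun x => by positivity)
  have h3 : ∫ x in {x | sqDist c x ≤ a}, energy z G x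
      ≤ Z + ∑ i, ∫ x, ‖χ' x • G i x‖ ^ 2 := by
    have i1 : ∀ i ∈ Finset.univ, Integrable (fun x => ‖χ' x • G i x‖ ^ 2) volume := by
      intro i _
      obtain ⟨C, -, hC, -, -⟩ := exists_bound_cutoff hχ' hχs'
      exact integrable_norm_sq (memLp_smul_of_bound hχ'.continuous hC (h.isH1.memLp_grad i))
    rw [hZ, ← integral_indicator hsa, ← integral_indicator hsr, ← integral_finsetSum _ i1,
      ← integral_add (hz2.indicator hsr) (integrable_finsetSum _ i1)]
    refine integral_mono (hen.indicator hsa)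
      ((hz2.indicator hsr).add (integrable_finsetSum _ i1)) fun x => ?_
    change _ ≤ Set.indicator _ (fun x => ‖z x‖ ^ 2) x + ∑ i, ‖χ' x • G i x‖ ^ 2
    by_cases hxa : x ∈ {x : Pt m | sqDist c x ≤ a}
    · have hxr : x ∈ {x : Pt m | sqDist c x < b} := lt_of_le_of_lt hxa hab
      rw [Set.indicator_of_mem hxa, Set.indicator_of_mem hxr,
        hχ2' x (by linarith [sqDist_nonneg c x]) hxa]
      simp only [one_smul, energy, le_refl]
    · rw [Set.indicator_of_notMem hxa]
      exact add_nonneg (hpos _ _ x fun x => by positivity) (by positivity)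
  have h4 : C₂ * ∫ x in tsupport χ', (‖z x‖ ^ 2 + ‖F x‖ ^ 2)
      ≤ C₂ * ((1 + 2 * M ^ 2) * Z + 2 * N) := mul_le_mul_of_nonneg_left h2 hC₂
  have e1 : 0 ≤ C₂ * (1 + 2 * M ^ 2) * N := by positivity
  have e2 : 0 ≤ C₂ * Z := by positivity
  nlinarith

/-- The final computation in the propagation of smallness: `I` is the weighted norm on the left of
the Carleman estimate. -/
theorem propagation_algebra {A B C C' M τ e ε I D En J : ℝ} (hA : 0 < A) (hB : 0 ≤ B) (hC : 0 ≤ C)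
    (hC' : 0 ≤ C') (hτ1 : 1 ≤ τ) (hτ2 : 6 * A * M ^ 2 ≤ τ) (hτ3 : 6 * A * C ≤ τ * ε) (he : 1 ≤ e)
    (hI : 0 ≤ I) (hD : 0 ≤ D) (hEn : 0 ≤ En) (hcarl : τ ^ 3 * I ≤ A * J)
    (hJ : J ≤ 3 * M ^ 2 * I + 3 * B * D + 3 * C * B * (C' * D) + 3 * C * e ^ 2 * En) :
    I / e ^ 2 ≤ ε * En + 2 * A * (3 * B + 3 * C * B * C') * D := by
  have hττ : τ ≤ τ ^ 3 := by
    calc τ = τ ^ 1 := (pow_one _).symm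
      _ ≤ τ ^ 3 := pow_le_pow_right₀ hτ1 (by norm_num)
  have hfin : τ ^ 3 * I ≤ 2 * A * ((3 * B + 3 * C * B * C') * D + 3 * C * e ^ 2 * En) := by
    have h6 := hcarl.trans (mul_le_mul_of_nonneg_left hJ hA.le)
    have h7 : 6 * A * M ^ 2 * I ≤ τ ^ 3 * I := by gcongr; exact hτ2.trans hττ
    linarith
  rw [div_le_iff₀ (by positivity)]
  have hk : 0 ≤ 2 * A * (3 * B + 3 * C * B * C') * D := by positivity
  have k1 : τ * I ≤ τ ^ 3 * I := by gcongr
  have k2 : 6 * A * C * (e ^ 2 * En) ≤ τ * ε * (e ^ 2 * En) := by gcongr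
  have k3 : 2 * A * (3 * B + 3 * C * B * C') * D
      ≤ τ * (2 * A * (3 * B + 3 * C * B * C') * D * e ^ 2) := by
    calc _ = 1 * (2 * A * (3 * B + 3 * C * B * C') * D * 1) := by ring
      _ ≤ _ := by gcongr; exact one_le_pow₀ he
  have k4 : τ * I ≤ τ * ((ε * En + 2 * A * (3 * B + 3 * C * B * C') * D) * e ^ 2) := by
    linarith
  exact le_of_mul_le_mul_left k4 (by linarith)

set_option maxHeartbeats 2000000 in
/-- A function that is small in a ball is small in every concentric ball in the domain, relative to
its energy and to the right hand side. -/
theorem propagation {Ω : Set (Pt m)} (hΩm : MeasurableSet Ω) {M : ℝ} (c : Pt m)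
    {r ρ ρ₁ : ℝ} (hr : 0 < r) (hρ : r < ρ) (hρ₁ : ρ < ρ₁) (hsub : {x | sqDist c x ≤ ρ₁ ^ 2} ⊆ Ω)
    {ε : ℝ} (hε : 0 < ε) :
    ∃ K ≥ 0, ∀ (z F : Pt m → ℂ) (G : Option (Fin m) → Pt m → ℂ) (f : Pt m → ℝ),
      LaplaceIneq Ω M z G F f →
      ∫ x in {x | sqDist c x < ρ ^ 2}, ‖z x‖ ^ 2 ≤ ε * (∫ x in Ω, energy z G x)
        + K * ((∫ x in {x | sqDist c x < r ^ 2}, ‖z x‖ ^ 2) + ∫ x in Ω, f x ^ 2) := by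
  have hs := (contDiff_sqDist c).continuous
  set a := r ^ 2 / 2 with ha
  set b := ρ ^ 2 with hb
  have hr2 : 0 < r ^ 2 := by positivity
  have hrb : r ^ 2 < b := by rw [hb]; gcongr
  have hbρ₁ : b < ρ₁ ^ 2 := by rw [hb]; have := hr.trans hρ; gcongr
  set δ := min (r ^ 2 / 8) ((ρ₁ ^ 2 - b) / 2) with hδdef
  have hδ : 0 < δ := lt_min (by positivity) (by linarith)
  have hδ1 : δ ≤ r ^ 2 / 8 := min_le_left _ _
  have hδ2 : δ ≤ (ρ₁ ^ 2 - b) / 2 := min_le_right _ _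
  obtain ⟨χ, hχ, hχs, hχ1, hχ2, hχ3⟩ := exists_shell_cutoff c (a := a) (b := b) (by linarith) hδ
  obtain ⟨C₀, hC₀, hb0, hb1, hb2⟩ := exists_bound_cutoff hχ hχs
  have hχΩ : tsupport χ ⊆ Ω := hχ3.trans fun x hx => hsub (by
    have := hx.2; simp only [Set.mem_ofPred_eq]; linarith)
  have hballΩ : {x | sqDist c x < r ^ 2} ⊆ Ω := fun x hx => hsub (by
    have : sqDist c x < r ^ 2 := hx
    simp only [Set.mem_ofPred_eq]; linarith)
  obtain ⟨C₃, hC₃, hcacc⟩ := energy_ball_le hΩm (M := M) c (a := a) (by positivity) (by linarith)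
    hballΩ
  -- With `l = 16 / r ^ 2` the product of `l` and the squared inner radius `r / 2` is `4`.
  obtain ⟨A, hA, τ₀, hτ₀, hcarl⟩ := carleman_weak c (l := 16 / r ^ 2) (r := r / 2) (r₁ := a - δ)
    (ρ₁ := b + δ) (ρ := ρ₁) (by positivity) (by positivity) (by field_simp; norm_num)
    (by nlinarith) (by linarith)
  set l := 16 / r ^ 2 with hl
  have hl0 : 0 < l := by positivity
  set C₁ := 8 * C₀ ^ 2 * (m + 1) with hC₁
  -- `τ` is so large that the potential term is absorbed by the left hand side, and that the
  -- commutator on the outer shell costs at most `ε` times the energy.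
  set τ := max τ₀ (max (6 * A * M ^ 2) (6 * A * C₁ / ε)) with hτ
  have hτ0 : τ₀ ≤ τ := le_max_left _ _
  have hτ1 : 1 ≤ τ := le_trans hτ₀ hτ0
  have hτ2 : 6 * A * M ^ 2 ≤ τ := (le_max_left _ _).trans (le_max_right _ _)
  have hτ3 : 6 * A * C₁ ≤ τ * ε :=
    (div_le_iff₀ hε).1 ((le_max_right _ _).trans (le_max_right _ _))
  set B := Real.exp τ ^ 2 with hB
  have hB0 : 0 < B := by positivity
  refine ⟨1 + 2 * A * (3 * B + 3 * C₁ * B * C₃), by positivity, fun z F G f h => ?_⟩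
  set E : Pt m → ℝ := fun x => Real.exp (τ * gauss c l x) with hE
  set e := Real.exp (τ * Real.exp (-(l / 2) * b)) with he
  have he1 : 1 ≤ e := Real.one_le_exp (by positivity)
  have hEpos : ∀ x, 0 < E x := fun x => Real.exp_pos _
  have hEB : ∀ x, E x ^ 2 ≤ B := fun x => by
    rw [hB]; exact pow_le_pow_left₀ (hEpos x).le
      ((le_abs_self _).trans (abs_exp_gauss_le c hl0 (by linarith) x)) 2
  have hEe : ∀ x, b ≤ sqDist c x → E x ≤ e := fun x hx => Real.exp_le_exp.2 (by
    gcongr; exact Real.exp_le_exp.2 (by nlinarith))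
  have heE : ∀ x, sqDist c x ≤ b → e ≤ E x := fun x hx => Real.exp_le_exp.2 (by
    gcongr; exact Real.exp_le_exp.2 (by nlinarith))
  have hχuniv : Set.univ ∩ tsupport χ ⊆ Ω := by simpa using hχΩ
  have hy := h.isH1.cutoff hχ hb0 hb1 hχuniv
  have hdiv := h.div.cutoff h.isH1 h.memLp_lap hχ hχuniv
  have hFy := memLp_cutoff_div h.isH1 h.memLp_lap hχ hχs
  have hC := hcarl τ hτ0 _ _ _ hy hdiv hFy (fun x hx => hχ3 (subset_tsupport _ fun h0 =>
    hx (by simp [h0])))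
  set y := fun x => χ x • z x with hydef
  set Fy := fun x => χ x • F x + (2 * ∑ i, pd i χ x • G i x + (∑ i, pd i (pd i χ) x) • z x)
    with hFydef
  have hsa : MeasurableSet {x : Pt m | sqDist c x ≤ a} :=
    (isClosed_le hs continuous_const).measurableSet
  have hsr : MeasurableSet {x : Pt m | sqDist c x < r ^ 2} :=
    (isOpen_lt hs continuous_const).measurableSet
  have hsb : MeasurableSet {x : Pt m | sqDist c x < b} :=
    (isOpen_lt hs continuous_const).measurableSet
  have hen := h.isH1.integrable_energy
  have hf2 : Integrable (fun x => f x ^ 2) volume := by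
    simpa [sq_abs] using integrable_norm_sq h.memLp_rhs
  have hz2 := integrable_norm_sq h.isH1.memLp
  have hF2 := integrable_norm_sq h.memLp_lap
  set Z := ∫ x in {x | sqDist c x < r ^ 2}, ‖z x‖ ^ 2 with hZ
  set N := ∫ x in Ω, f x ^ 2 with hN
  set En := ∫ x in Ω, energy z G x with hEn
  have hZ0 : 0 ≤ Z := integral_nonneg fun x => by positivity
  have hN0 : 0 ≤ N := integral_nonneg fun x => by positivity
  have hEn0 : 0 ≤ En := integral_nonneg fun x => energy_nonneg _ _ _
  have hEa := hcacc z F G f h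
  -- the right hand side of the Carleman estimate
  have hyE : MemLp (fun x => E x • y x) 2 volume := memLp_smul_of_bound (by fun_prop)
    (abs_exp_gauss_le c hl0 (by linarith)) hy.memLp
  have hFyE : MemLp (fun x => E x • Fy x) 2 volume := memLp_smul_of_bound (by fun_prop)
    (abs_exp_gauss_le c hl0 (by linarith)) hFy
  have hI2 := integrable_norm_sq hyE
  set I := ∫ x, ‖E x • y x‖ ^ 2 with hI
  have hI0 : 0 ≤ I := integral_nonneg fun x => by positivity
  have hRHS : ∫ x, ‖E x • Fy x‖ ^ 2 ≤ 3 * M ^ 2 * I + 3 * B * N + 3 * C₁ * B * (C₃ * (Z + N))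
      + 3 * C₁ * e ^ 2 * En := by
    have hpt : ∀ᵐ x, ‖E x • Fy x‖ ^ 2 ≤ 3 * M ^ 2 * ‖E x • y x‖ ^ 2
        + Ω.indicator (fun x => 3 * B * f x ^ 2) x
        + {x | sqDist c x ≤ a}.indicator (fun x => 3 * C₁ * B * energy z G x) x
        + Ω.indicator (fun x => 3 * C₁ * e ^ 2 * energy z G x) x := by
      filter_upwards [h.bound] with x hx
      have p1 : 0 ≤ {x | sqDist c x ≤ a}.indicator (fun x => 3 * C₁ * B * energy z G x) x :=
        Set.indicator_nonneg (fun x _ => by have := energy_nonneg z G x; positivity) x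
      by_cases hxt : x ∈ tsupport χ
      · have hxΩ := hχΩ hxt
        rw [Set.indicator_of_mem hxΩ, Set.indicator_of_mem hxΩ]
        set T := 2 * ∑ i, pd i χ x • G i x + (∑ i, pd i (pd i χ) x) • z x with hT
        have hT2 : ‖T‖ ^ 2 ≤ C₁ * energy z G x :=
          norm_cutoff_commutator_sq_le (fun i => hb1 i x) (hb2 x) z G
        have hF1 : ‖χ x • F x‖ ≤ M * ‖y x‖ + |f x| := by
          have e1 : ‖y x‖ = |χ x| * ‖z x‖ := by rw [hydef, norm_smul, Real.norm_eq_abs]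
          rw [norm_smul, Real.norm_eq_abs, e1]
          calc |χ x| * ‖F x‖ ≤ |χ x| * (M * ‖z x‖ + |f x|) := by gcongr; exact hx hxΩ
            _ = M * (|χ x| * ‖z x‖) + |χ x| * |f x| := by ring
            _ ≤ M * (|χ x| * ‖z x‖) + 1 * |f x| := by gcongr; exact hχ1 x
            _ = _ := by ring
        have hF3 : ‖Fy x‖ ^ 2 ≤ 3 * M ^ 2 * ‖y x‖ ^ 2 + 3 * f x ^ 2 + 3 * ‖T‖ ^ 2 := by
          have : ‖Fy x‖ ≤ M * ‖y x‖ + |f x| + ‖T‖ := (norm_add_le _ _).trans (by gcongr)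
          have := pow_le_pow_left₀ (norm_nonneg _) this 2
          rw [← sq_abs (f x)]
          nlinarith [sq_nonneg (M * ‖y x‖ - |f x|), sq_nonneg (M * ‖y x‖ - ‖T‖),
            sq_nonneg (|f x| - ‖T‖)]
        have hET : E x ^ 2 * ‖T‖ ^ 2 ≤
            {x | sqDist c x ≤ a}.indicator (fun x => C₁ * B * energy z G x) x
            + C₁ * e ^ 2 * energy z G x := by
          have pe := energy_nonneg z G x
          by_cases hxa : x ∈ {x : Pt m | sqDist c x ≤ a}
          · rw [Set.indicator_of_mem hxa]
            calc E x ^ 2 * ‖T‖ ^ 2 ≤ B * (C₁ * energy z G x) := by gcongr; exact hEB x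
              _ = C₁ * B * energy z G x := by ring
              _ ≤ _ := le_add_of_nonneg_right (by positivity)
          · rw [Set.indicator_of_notMem hxa, zero_add]
            by_cases hxb : sqDist c x < b
            · -- the cutoff is constant near `x`
              have hloc : χ =ᶠ[𝓝 x] fun _ => 1 := by
                have ho : IsOpen {x : Pt m | a < sqDist c x ∧ sqDist c x < b} :=
                  (isOpen_lt continuous_const hs).inter (isOpen_lt hs continuous_const)
                filter_upwards [ho.mem_nhds ⟨not_le.1 hxa, hxb⟩] with w hw
                exact hχ2 w hw.1.le hw.2.le
              have hd1 : ∀ i, pd i χ =ᶠ[𝓝 x] fun _ => 0 := fun i => by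
                filter_upwards [hloc.fderiv (𝕜 := ℝ)] with w hw
                rw [pd, hw]; simp
              have hd2 : ∀ i, pd i (pd i χ) x = 0 := fun i => by
                rw [pd, (hd1 i).fderiv_eq]; simp
              have hT0 : T = 0 := by
                rw [hT]; simp [(hd1 _).eq_of_nhds, hd2]
              rw [hT0, norm_zero]
              simp only [ne_eq, OfNat.ofNat_ne_zero, not_false_eq_true, zero_pow, mul_zero]
              positivity
            · calc E x ^ 2 * ‖T‖ ^ 2 ≤ e ^ 2 * (C₁ * energy z G x) := by
                    have := (hEpos x).le
                    gcongr; exact hEe x (not_lt.1 hxb)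
                _ = _ := by ring
        have hI3 : {x | sqDist c x ≤ a}.indicator (fun x => 3 * C₁ * B * energy z G x) x
            = 3 * {x | sqDist c x ≤ a}.indicator (fun x => C₁ * B * energy z G x) x := by
          simp only [Set.indicator_apply]; split_ifs <;> ring
        have hEf : E x ^ 2 * f x ^ 2 ≤ B * f x ^ 2 := by gcongr; exact hEB x
        have hnE : ∀ w : ℂ, ‖E x • w‖ ^ 2 = E x ^ 2 * ‖w‖ ^ 2 := fun w => by
          rw [norm_smul, mul_pow, Real.norm_eq_abs, sq_abs]
        rw [hnE, hnE, hI3]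
        calc E x ^ 2 * ‖Fy x‖ ^ 2
            ≤ E x ^ 2 * (3 * M ^ 2 * ‖y x‖ ^ 2 + 3 * f x ^ 2 + 3 * ‖T‖ ^ 2) := by gcongr
          _ ≤ _ := by linarith
      · have e1 : Fy x = 0 := by
          have : ∑ i, pd i (pd i χ) x = 0 := lap_eq_zero_of_notMem hxt
          simp only [hFydef, this, pd_eq_zero_of_notMem hxt, image_eq_zero_of_notMem_tsupport hxt]
          simp
        rw [e1, smul_zero, norm_zero, zero_pow two_ne_zero]
        have p2 : 0 ≤ Ω.indicator (fun x => 3 * B * f x ^ 2) x :=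
          Set.indicator_nonneg (fun x _ => by positivity) x
        have p3 : 0 ≤ Ω.indicator (fun x => 3 * C₁ * e ^ 2 * energy z G x) x :=
          Set.indicator_nonneg (fun x _ => by have := energy_nonneg z G x; positivity) x
        positivity
    have j1 := hI2.const_mul (3 * M ^ 2)
    have j2 := (hf2.const_mul (3 * B)).indicator hΩm
    have j3 := (hen.const_mul (3 * C₁ * B)).indicator hsa
    have j4 := (hen.const_mul (3 * C₁ * e ^ 2)).indicator hΩm
    have := integral_mono_ae (integrable_norm_sq hFyE) (((j1.add j2).add j3).add j4) hpt
    refine this.trans ?_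
    have := integral_add_four j1 j2 j3 j4
    rw [integral_indicator hΩm, integral_indicator hΩm, integral_indicator hsa, integral_const_mul,
      integral_const_mul, integral_const_mul, integral_const_mul] at this
    refine (le_of_eq this).trans ?_
    have h5 : 3 * C₁ * B * (∫ x in {x | sqDist c x ≤ a}, energy z G x)
        ≤ 3 * C₁ * B * (C₃ * (Z + N)) := by gcongr
    linarith
  -- the left hand side of the Carleman estimate
  have hLHS : ∫ x in {x | sqDist c x < b}, ‖z x‖ ^ 2 ≤ Z + I / e ^ 2 := by
    rw [hZ, hI, ← integral_div, ← integral_indicator hsb, ← integral_indicator hsr,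
      ← integral_add (hz2.indicator hsr) (hI2.div_const _)]
    refine integral_mono (hz2.indicator hsb) ((hz2.indicator hsr).add (hI2.div_const _))
      fun x => ?_
    change _ ≤ Set.indicator _ (fun x => ‖z x‖ ^ 2) x + ‖E x • y x‖ ^ 2 / e ^ 2
    by_cases hxb : x ∈ {x : Pt m | sqDist c x < b}
    · rw [Set.indicator_of_mem hxb]
      by_cases hxr : x ∈ {x : Pt m | sqDist c x < r ^ 2}
      · rw [Set.indicator_of_mem hxr]
        exact le_add_of_nonneg_right (by positivity)
      · rw [Set.indicator_of_notMem hxr, zero_add, le_div_iff₀ (by positivity)]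
        have hx1 : r ^ 2 ≤ sqDist c x := not_lt.1 hxr
        have hx2 : sqDist c x < b := hxb
        have : y x = z x := by simp only [hydef, hχ2 x (by linarith) hx2.le, one_smul]
        rw [this, norm_smul, mul_pow, Real.norm_eq_abs, sq_abs, mul_comm]
        have := heE x hx2.le
        gcongr
    · rw [Set.indicator_of_notMem hxb]
      exact add_nonneg (Set.indicator_nonneg (fun x _ => by positivity) x) (by positivity)
  have hI1 := propagation_algebra (D := Z + N) hA hB0.le (by positivity) hC₃ hτ1 hτ2 hτ3 he1 hI0
    (by positivity) hEn0 hC (by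
      refine hRHS.trans ?_
      have : 3 * B * N ≤ 3 * B * (Z + N) := by gcongr; linarith
      linarith)
  linarith

variable {R : ℝ}

/-! ### The space `H̃¹` and density of smooth functions -/

theorem isOpen_strip : IsOpen (strip m R) :=
  (isOpen_lt continuous_const continuous_snd).inter (isOpen_lt continuous_snd continuous_const)

theorem measurableSet_strip : MeasurableSet (strip m R) := isOpen_strip.measurableSet

/-- The extension by zero of an element of `H̃¹`. -/
noncomputable def extVal (u : HTilde m R) : Pt m → ℂ := (strip m R).indicator (val u)

/-- The extension by zero of the gradient of an element of `H̃¹`. -/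
noncomputable def extGrad (u : HTilde m R) (i : Option (Fin m)) : Pt m → ℂ :=
  (strip m R).indicator (grad u i)

theorem memLp_ext (f : L2 (strip m R)) : MemLp ((strip m R).indicator f) 2 volume :=
  (memLp_indicator_iff_restrict measurableSet_strip).2 (Lp.memLp f)

theorem integral_indicator_mul (s : Set (Pt m)) (hs : MeasurableSet s) (f φ : Pt m → ℂ) :
    ∫ x, s.indicator f x * φ x = ∫ x in s, f x * φ x := by
  rw [← integral_indicator hs]
  refine integral_congr_ae (Eventually.of_forall fun x => ?_)
  by_cases hx : x ∈ s <;> simp [hx]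

theorem isH1_ext (u : HTilde m R) : IsH1 {x | x.2 < R} (extVal u) (extGrad u) where
  memLp := memLp_ext _
  memLp_grad i := memLp_ext _
  weak φ hφ hs i := by
    simp only [extVal, extGrad, integral_indicator_mul _ measurableSet_strip]
    exact u.2 φ hφ hs i

theorem extVal_of_nonpos (u : HTilde m R) {x : Pt m} (hx : x.2 ≤ 0) : extVal u x = 0 :=
  Set.indicator_of_notMem (fun h => not_lt.2 hx h.1) _

theorem extGrad_of_nonpos (u : HTilde m R) (i : Option (Fin m)) {x : Pt m} (hx : x.2 ≤ 0) :
    extGrad u i x = 0 :=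
  Set.indicator_of_notMem (fun h => not_lt.2 hx h.1) _

/-- The element of `H̃¹(Ω^R)` given by an `H¹` function on `{x_d < R}` that vanishes for
`x_d ≤ 0`. -/
noncomputable def mkHTilde {u : Pt m → ℂ} {g : Option (Fin m) → Pt m → ℂ}
    (h : IsH1 {x | x.2 < R} u g) (h0 : ∀ x, x.2 ≤ 0 → u x = 0)
    (h1 : ∀ i x, x.2 ≤ 0 → g i x = 0) : HTilde m R :=
  ⟨WithLp.toLp 2 (h.memLp.restrict (strip m R) |>.toLp u,
      WithLp.toLp 2 fun i => (h.memLp_grad i).restrict (strip m R) |>.toLp (g i)), by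
    intro φ hφ hs i
    have key : ∀ (f : Pt m → ℂ) (hf : MemLp f 2 volume) (ψ : Pt m → ℂ), (∀ x, x.2 ≤ 0 → f x = 0) →
        (∀ x, ψ x ≠ 0 → x.2 < R) →
        ∫ x in strip m R, (hf.restrict (strip m R)).toLp f x * ψ x = ∫ x, f x * ψ x := by
      intro f hf ψ hf0 hψ
      have hz : ∀ x, x ∉ strip m R → f x * ψ x = 0 := by
        intro x hx
        by_cases hx0 : x.2 ≤ 0
        · rw [hf0 x hx0, zero_mul]
        · have : ψ x = 0 := by_contra fun h => hx ⟨not_le.1 hx0, hψ x h⟩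
          rw [this, mul_zero]
      rw [← setIntegral_eq_integral_of_forall_compl_eq_zero hz]
      refine integral_congr_ae ?_
      filter_upwards [(hf.restrict (strip m R)).coeFn_toLp] with x hx
      rw [hx]
    change ∫ x in strip m R, ((h.memLp_grad i).restrict (strip m R)).toLp (g i) x * φ x
      = -∫ x in strip m R, (h.memLp.restrict (strip m R)).toLp u x * pd i φ x
    rw [key _ (h.memLp_grad i) _ (h1 i) fun x hx => hs x (subset_tsupport _ hx),
      key _ h.memLp _ h0 fun x hx => hs x (tsupport_pd_subset φ i (subset_tsupport _ hx))]
    exact h.weak φ hφ hs i⟩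

theorem indicator_toLp {f : Pt m → ℂ} {s : Set (Pt m)} (hs : MeasurableSet s)
    (hf : MemLp f 2 (volume.restrict s)) :
    s.indicator (hf.toLp f) =ᵐ[volume] s.indicator f := by
  have := hf.coeFn_toLp
  rw [Filter.EventuallyEq, ae_restrict_iff' hs] at this
  filter_upwards [this] with x hx
  by_cases h : x ∈ s
  · rw [Set.indicator_of_mem h, Set.indicator_of_mem h, hx h]
  · rw [Set.indicator_of_notMem h, Set.indicator_of_notMem h]

theorem extVal_mk {u : Pt m → ℂ} {g : Option (Fin m) → Pt m → ℂ}
    (h : IsH1 {x | x.2 < R} u g) (h0 : ∀ x, x.2 ≤ 0 → u x = 0)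
    (h1 : ∀ i x, x.2 ≤ 0 → g i x = 0) :
    extVal (mkHTilde h h0 h1) =ᵐ[volume] (strip m R).indicator u :=
  indicator_toLp measurableSet_strip (h.memLp.restrict (strip m R))

theorem extGrad_mk {u : Pt m → ℂ} {g : Option (Fin m) → Pt m → ℂ}
    (h : IsH1 {x | x.2 < R} u g) (h0 : ∀ x, x.2 ≤ 0 → u x = 0)
    (h1 : ∀ i x, x.2 ≤ 0 → g i x = 0) (i : Option (Fin m)) :
    extGrad (mkHTilde h h0 h1) i =ᵐ[volume] (strip m R).indicator (g i) :=
  indicator_toLp measurableSet_strip ((h.memLp_grad i).restrict (strip m R))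

theorem eLpNorm_ext (f : L2 (strip m R)) :
    eLpNorm ((strip m R).indicator f) 2 volume = eLpNorm f 2 (volume.restrict (strip m R)) :=
  eLpNorm_indicator_eq_eLpNorm_restrict measurableSet_strip

theorem norm_sq_eq_add (u : HTilde m R) :
    ‖u‖ ^ 2 = ‖val u‖ ^ 2 + ∑ i, ‖grad u i‖ ^ 2 := by
  change ‖(u : GradPair m R)‖ ^ 2 = _
  rw [WithLp.prod_norm_sq_eq_of_L2, PiLp.norm_sq_eq_of_L2]
  rfl

theorem norm_sq_ext (f : L2 (strip m R)) : ‖f‖ ^ 2 = ∫ x, ‖(strip m R).indicator f x‖ ^ 2 := by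
  rw [integral_norm_sq_eq (memLp_ext f), eLpNorm_ext, Lp.norm_def]

theorem norm_sq_eq_integral_energy (u : HTilde m R) :
    ‖u‖ ^ 2 = ∫ x, energy (extVal u) (extGrad u) x := by
  have h := isH1_ext u
  simp only [energy]
  rw [integral_add (integrable_norm_sq h.memLp)
    (integrable_finsetSum _ fun i _ => integrable_norm_sq (h.memLp_grad i)),
    integral_finsetSum _ fun i _ => integrable_norm_sq (h.memLp_grad i), norm_sq_eq_add, norm_sq_ext]
  simp only [norm_sq_ext]
  rfl

theorem extVal_sub (u v : HTilde m R) :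
    extVal (u - v) =ᵐ[volume] fun x => extVal u x - extVal v x := by
  have h := Lp.coeFn_sub (val u) (val v)
  rw [Filter.EventuallyEq, ae_restrict_iff' measurableSet_strip] at h
  filter_upwards [h] with x hx
  by_cases hs : x ∈ strip m R
  · simp only [extVal, Set.indicator_of_mem hs]; exact hx hs
  · simp only [extVal, Set.indicator_of_notMem hs, sub_zero]

theorem extGrad_sub (u v : HTilde m R) (i : Option (Fin m)) :
    extGrad (u - v) i =ᵐ[volume] fun x => extGrad u i x - extGrad v i x := by
  have h := Lp.coeFn_sub (grad u i) (grad v i)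
  rw [Filter.EventuallyEq, ae_restrict_iff' measurableSet_strip] at h
  filter_upwards [h] with x hx
  by_cases hs : x ∈ strip m R
  · simp only [extGrad, Set.indicator_of_mem hs]; exact hx hs
  · simp only [extGrad, Set.indicator_of_notMem hs, sub_zero]

theorem tendsto_HTilde {w : ℕ → HTilde m R} {u : HTilde m R}
    (h0 : Tendsto (fun n => eLpNorm (fun x => extVal (w n) x - extVal u x) 2 volume) atTop (𝓝 0))
    (h1 : ∀ i, Tendsto (fun n => eLpNorm (fun x => extGrad (w n) i x - extGrad u i x) 2 volume)
      atTop (𝓝 0)) : Tendsto w atTop (𝓝 u) := by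
  rw [tendsto_iff_norm_sub_tendsto_zero]
  have key : Tendsto (fun n => ‖w n - u‖ ^ 2) atTop (𝓝 0) := by
    have e : ∀ n, ‖w n - u‖ ^ 2
        = (eLpNorm (fun x => extVal (w n) x - extVal u x) 2 volume).toReal ^ 2
          + ∑ i, (eLpNorm (fun x => extGrad (w n) i x - extGrad u i x) 2 volume).toReal ^ 2 := by
      intro n
      rw [norm_sq_eq_add, ← eLpNorm_congr_ae (extVal_sub (w n) u), extVal, eLpNorm_ext,
        ← Lp.norm_def]
      congr 1
      refine Finset.sum_congr rfl fun i _ => ?_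
      rw [← eLpNorm_congr_ae (extGrad_sub (w n) u i), extGrad, eLpNorm_ext, ← Lp.norm_def]
    simp only [e]
    have z : ∀ {a : ℕ → ℝ≥0∞}, Tendsto a atTop (𝓝 0) →
        Tendsto (fun n => (a n).toReal ^ 2) atTop (𝓝 0) := fun {a} ha => by
      have := ((ENNReal.tendsto_toReal ENNReal.zero_ne_top).comp ha).pow 2
      simpa using this
    have := (z h0).add (tendsto_finsetSum Finset.univ fun i (_ : i ∈ Finset.univ) => z (h1 i))
    simpa using this
  have := (Real.continuous_sqrt.tendsto 0).comp key
  simpa [Function.comp_def, Real.sqrt_sq (norm_nonneg _)] using this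

/-- Test functions supported above `Γ^0`. Their restrictions to the strip are dense in `H̃¹`. -/
def IsUpperTest (φ : Pt m → ℂ) : Prop := IsTest φ ∧ tsupport φ ⊆ {x | 0 < x.2}

theorem IsTest.hasWeakGrad {φ : Pt m → ℂ} (hφ : IsTest φ) (Ω : Set (Pt m)) :
    IsH1 Ω φ (fun i => LayerScattering.pd i φ) where
  memLp := hφ.memLp 2
  memLp_grad i := (hφ.pd i).memLp 2
  weak ψ hψ _ i := by
    have h := integral_pd_eq_zero (f := fun x => φ x * ψ x) ((IsTest.mul hφ.1 hψ).1.of_le (by simp))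
      (IsTest.mul hφ.1 hψ).2 i
    have e : ∀ x, LayerScattering.pd i (fun x => φ x * ψ x) x = φ x * LayerScattering.pd i ψ x
        + LayerScattering.pd i φ x * ψ x := fun x => by
      rw [pd_mul hφ.differentiable.differentiableAt hψ.differentiable.differentiableAt]; ring
    simp only [e] at h
    rw [integral_add ((hψ.pd i).integrable_mul (hφ.memLp 2))
      (hψ.integrable_mul ((hφ.pd i).memLp 2))] at h
    linear_combination h

theorem IsUpperTest.eq_zero {φ : Pt m → ℂ} (hφ : IsUpperTest φ) {x : Pt m} (hx : x.2 ≤ 0) :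
    φ x = 0 := image_eq_zero_of_notMem_tsupport fun h => not_lt.2 hx (hφ.2 h)

theorem IsUpperTest.pd {φ : Pt m → ℂ} (hφ : IsUpperTest φ) (i : Option (Fin m)) :
    IsUpperTest (pd i φ) := ⟨hφ.1.pd i, (tsupport_pd_subset φ i).trans hφ.2⟩

theorem IsUpperTest.sub {φ ψ : Pt m → ℂ} (hφ : IsUpperTest φ) (hψ : IsUpperTest ψ) :
    IsUpperTest (fun x => φ x - ψ x) := by
  refine ⟨hφ.1.sub hψ.1, fun x hx => ?_⟩
  by_contra h
  rcases (tsupport_sub φ ψ) hx with h' | h'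
  exacts [h (hφ.2 h'), h (hψ.2 h')]

/-- The restriction of a test function to the strip, as an element of `H̃¹`. -/
noncomputable def ofTest (R : ℝ) {φ : Pt m → ℂ} (hφ : IsUpperTest φ) : HTilde m R :=
  mkHTilde (hφ.1.hasWeakGrad _) (fun _ hx => hφ.eq_zero hx) fun i _ hx => (hφ.pd i).eq_zero hx

theorem extVal_ofTest {φ : Pt m → ℂ} (hφ : IsUpperTest φ) :
    extVal (ofTest R hφ) =ᵐ[volume] (strip m R).indicator φ := extVal_mk _ _ _

theorem extGrad_ofTest {φ : Pt m → ℂ} (hφ : IsUpperTest φ) (i : Option (Fin m)) :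
    extGrad (ofTest R hφ) i =ᵐ[volume] (strip m R).indicator (pd i φ) := extGrad_mk _ _ _ i

theorem norm_sq_ofTest {φ : Pt m → ℂ} (hφ : IsUpperTest φ) :
    ‖ofTest R hφ‖ ^ 2 = ∫ x in strip m R, energy φ (fun i => pd i φ) x := by
  rw [norm_sq_eq_integral_energy, ← integral_indicator measurableSet_strip]
  refine integral_congr_ae ?_
  filter_upwards [extVal_ofTest (R := R) hφ, ae_all_iff.2 fun i => extGrad_ofTest (R := R) hφ i]
    with x h0 h1
  simp only [energy, h0, h1]
  by_cases hx : x ∈ strip m R <;> simp [hx, energy]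

theorem norm_dir_fst_le (i : Option (Fin m)) : ‖(dir m i).1‖ ≤ 1 := by
  cases i <;> simp [dir]

theorem abs_pd_horizontal_le {ψ : EuclideanSpace ℝ (Fin m) → ℝ} (hψ : ContDiff ℝ ∞ ψ)
    (i : Option (Fin m)) (x : Pt m) : |pd i (fun x : Pt m => ψ x.1) x| ≤ ‖fderiv ℝ ψ x.1‖ := by
  have h : HasFDerivAt (fun x : Pt m => ψ x.1)
      ((fderiv ℝ ψ x.1).comp (ContinuousLinearMap.fst ℝ (EuclideanSpace ℝ (Fin m)) ℝ)) x :=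
    HasFDerivAt.comp (g := ψ) (f := Prod.fst) x
      (hψ.differentiable (by simp) x.1).hasFDerivAt hasFDerivAt_fst
  rw [pd, h.fderiv, ← Real.norm_eq_abs]
  exact ((fderiv ℝ ψ x.1).le_opNorm (dir m i).1).trans
    (mul_le_of_le_one_right (norm_nonneg _) (norm_dir_fst_le i))

theorem exists_bound_horizontal {ψ : EuclideanSpace ℝ (Fin m) → ℝ} (hψ : ContDiff ℝ ∞ ψ)
    (hs : HasCompactSupport ψ) : ∃ C ≥ 0, (∀ y, |ψ y| ≤ C) ∧ ∀ y, ‖fderiv ℝ ψ y‖ ≤ C := by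
  obtain ⟨C₁, h1⟩ := hs.exists_bound_of_continuous hψ.continuous
  obtain ⟨C₂, h2⟩ := (hs.fderiv ℝ).exists_bound_of_continuous (hψ.continuous_fderiv (by simp))
  refine ⟨max C₁ C₂, ((norm_nonneg _).trans (h1 0)).trans (le_max_left _ _), fun y => ?_,
    fun y => (h2 y).trans (le_max_right _ _)⟩
  exact (h1 y).trans (le_max_left _ _)

/-- Multiplication by a smooth function of the horizontal variables maps `H̃¹` to itself. -/
noncomputable def horizontalCutoff {ψ : EuclideanSpace ℝ (Fin m) → ℝ} (hψ : ContDiff ℝ ∞ ψ) {C : ℝ}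
    (h0 : ∀ y, |ψ y| ≤ C) (h1 : ∀ y, ‖fderiv ℝ ψ y‖ ≤ C) (u : HTilde m R) : HTilde m R :=
  mkHTilde ((isH1_ext u).cutoff (Ω' := {x | x.2 < R}) (χ := fun x => ψ x.1) (hψ.comp contDiff_fst)
    (fun x => h0 x.1) (fun i x => (abs_pd_horizontal_le hψ i x).trans (h1 x.1))
    Set.inter_subset_left) (fun x hx => by simp [extVal_of_nonpos u hx])
    (fun i x hx => by simp [extVal_of_nonpos u hx, extGrad_of_nonpos u i hx])

theorem extVal_horizontalCutoff {ψ : EuclideanSpace ℝ (Fin m) → ℝ} (hψ : ContDiff ℝ ∞ ψ) {C : ℝ}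
    (h0 : ∀ y, |ψ y| ≤ C) (h1 : ∀ y, ‖fderiv ℝ ψ y‖ ≤ C) (u : HTilde m R) :
    extVal (horizontalCutoff hψ h0 h1 u) =ᵐ[volume] fun x => ψ x.1 • extVal u x := by
  refine (extVal_mk _ _ _).trans (Eventually.of_forall fun x => ?_)
  by_cases hx : x ∈ strip m R <;> simp [hx, extVal]

theorem extGrad_horizontalCutoff {ψ : EuclideanSpace ℝ (Fin m) → ℝ} (hψ : ContDiff ℝ ∞ ψ) {C : ℝ}
    (h0 : ∀ y, |ψ y| ≤ C) (h1 : ∀ y, ‖fderiv ℝ ψ y‖ ≤ C) (u : HTilde m R) (i : Option (Fin m)) :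
    extGrad (horizontalCutoff hψ h0 h1 u) i =ᵐ[volume]
      fun x => ψ x.1 • extGrad u i x + pd i (fun x : Pt m => ψ x.1) x • extVal u x := by
  refine (extGrad_mk _ _ _ i).trans (Eventually.of_forall fun x => ?_)
  by_cases hx : x ∈ strip m R <;> simp [hx, extVal, extGrad]

theorem tendsto_eLpNorm_smul_zero {a : ℕ → Pt m → ℝ} (ha : ∀ n, Continuous (a n)) {C : ℝ}
    (hC : ∀ n x, |a n x| ≤ C) (hlim : ∀ x, Tendsto (fun n => a n x) atTop (𝓝 0)) {u : Pt m → ℂ}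
    (hu : MemLp u 2 volume) : Tendsto (fun n => eLpNorm (fun x => a n x • u x) 2 volume) atTop
      (𝓝 0) := by
  have h2 : Tendsto (fun n => ∫⁻ x, ‖a n x • u x‖ₑ ^ 2) atTop (𝓝 (∫⁻ _ : Pt m, 0)) := by
    refine tendsto_lintegral_of_dominated_convergence' (fun x => ‖C • u x‖ₑ ^ 2) (fun n => ?_)
      (fun n => Eventually.of_forall fun x => ?_) ?_ (Eventually.of_forall fun x => ?_)
    · exact (((ha n).aestronglyMeasurable.smul hu.1).enorm.pow_const 2)
    · simp only [enorm_smul]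
      gcongr
      rw [enorm_le_iff_norm_le, Real.norm_eq_abs, Real.norm_eq_abs]
      exact (hC n x).trans (le_abs_self _)
    · rw [← eLpNorm_two_sq]
      exact (ENNReal.pow_lt_top (hu.const_smul C).2).ne
    · have : Tendsto (fun n => a n x • u x) atTop (𝓝 (0 : ℂ)) := by
        simpa using (hlim x).smul_const (u x)
      have h := ((ENNReal.continuous_pow 2).tendsto _).comp this.enorm
      rw [enorm_zero, zero_pow two_ne_zero] at h
      exact h
  simp only [lintegral_zero, ← eLpNorm_two_sq] at h2
  have h3 := (ENNReal.continuous_rpow_const (y := 1 / 2)).tendsto 0 |>.comp h2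
  simp only [Function.comp_def] at h3
  rw [ENNReal.zero_rpow_of_pos (by norm_num)] at h3
  refine h3.congr fun n => ?_
  rw [← ENNReal.rpow_natCast, ← ENNReal.rpow_mul]
  norm_num

open scoped Pointwise in
/-- A horizontally compactly supported element of `H̃¹` is a limit of test functions: it is
mollified with a kernel that is displaced upwards, so that the trace on `Γ^0` stays zero and only
values in the strip are used. -/
theorem mem_closure_ofTest_of_bounded (u : HTilde m R) {L : ℝ}
    (hL : ∀ᵐ x : Pt m, L < ‖x.1‖ → extVal u x = 0) :
    u ∈ closure {v : HTilde m R | ∃ φ, ∃ hφ : IsUpperTest φ, v = ofTest R hφ} := by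
  let c : ℕ → Pt m := fun n => (0, 2 * (1 / ((n : ℝ) + 1)))
  let b := fun n => shrinkingBump (c n) one_pos n
  have hrout : ∀ n, (b n).rOut = 1 / ((n : ℝ) + 1) := fun n => rfl
  have hc : Tendsto c atTop (𝓝 0) := by
    have := (tendsto_div_succ 1).const_mul 2
    rw [mul_zero] at this
    exact (tendsto_const_nhds (x := (0 : EuclideanSpace ℝ (Fin m)))).prodMk_nhds this
  have hlim := fun {g : Pt m → ℂ} (hg : MemLp g 2 volume) =>
    tendsto_eLpNorm_moll b hc (tendsto_div_succ 1) hg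
  have hu := isH1_ext u
  have hball : ∀ n, ∀ z ∈ Metric.ball (c n) (b n).rOut, 1 / ((n : ℝ) + 1) < z.2 := by
    intro n z hz
    rw [hrout, Metric.mem_ball, Prod.dist_eq, max_lt_iff, Real.dist_eq, abs_lt] at hz
    have := hz.2.1
    simp only [c] at this
    linarith
  -- the supports of the mollified functions
  have hK : IsCompact (Metric.closedBall (0 : EuclideanSpace ℝ (Fin m)) L ×ˢ Set.Icc (0 : ℝ) R) :=
    (isCompact_closedBall _ _).prod isCompact_Icc
  -- a representative that vanishes far out
  let f' : Pt m → ℂ := {x : Pt m | ‖x.1‖ ≤ L}.indicator (extVal u)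
  have hff : extVal u =ᵐ[volume] f' := by
    filter_upwards [hL] with x hx
    by_cases h : ‖x.1‖ ≤ L
    · exact (Set.indicator_of_mem (s := {x : Pt m | ‖x.1‖ ≤ L}) h _).symm
    · rw [hx (not_le.1 h)]
      exact (Set.indicator_of_notMem (s := {x : Pt m | ‖x.1‖ ≤ L}) h _).symm
  have hsuppu : Function.support f'
      ⊆ Metric.closedBall (0 : EuclideanSpace ℝ (Fin m)) L ×ˢ Set.Icc (0 : ℝ) R := by
    intro x hx
    obtain ⟨h1, h2⟩ := Set.indicator_apply_ne_zero.1 hx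
    have hxs : x ∈ strip m R := by
      by_contra h; exact h2 (Set.indicator_of_notMem h _)
    exact ⟨mem_closedBall_zero_iff.2 h1, hxs.1.le, hxs.2.le⟩
  have hsupp : ∀ n, Function.support (moll ((b n).normed volume) f')
      ⊆ Metric.ball (c n) (b n).rOut + Function.support f' := by
    intro n
    refine (support_convolution_subset _).trans ?_
    rw [(b n).support_normed_eq]
  have htest : ∀ n, IsUpperTest (moll ((b n).normed volume) (extVal u)) := by
    intro n
    rw [show moll ((b n).normed volume) (extVal u) = moll ((b n).normed volume) f' from
      funext fun x => moll_congr hff x]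
    refine ⟨⟨contDiff_moll (b n).contDiff_normed (b n).hasCompactSupport_normed
      (locallyIntegrable_of_memLp (hu.memLp.ae_eq hff)), ?_⟩, ?_⟩
    · refine HasCompactSupport.intro ((isCompact_closedBall (c n) (b n).rOut).add hK)
        fun x hx => by_contra fun h => hx ?_
      exact Set.add_subset_add Metric.ball_subset_closedBall hsuppu (hsupp n h)
    · have hpos : (0 : ℝ) < 1 / ((n : ℝ) + 1) := by positivity
      have : tsupport (moll ((b n).normed volume) f')
          ⊆ {x : Pt m | 1 / ((n : ℝ) + 1) ≤ x.2} := by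
        refine closure_minimal ((hsupp n).trans ?_) (isClosed_le continuous_const continuous_snd)
        rintro _ ⟨a, ha, k, hk, rfl⟩
        have h1 := hball n a ha
        have h2 := (hsuppu hk).2.1
        simp only [Set.mem_ofPred_eq, Prod.snd_add]
        linarith
      exact this.trans fun x hx => lt_of_lt_of_le hpos hx
  have hpd : ∀ n i, ∀ x ∈ strip m R, pd i (moll ((b n).normed volume) (extVal u)) x
      = moll ((b n).normed volume) (extGrad u i) x := by
    intro n i x hx
    refine pd_moll_of_weak hu (b n).contDiff_normed (b n).hasCompactSupport_normed ?_ i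
    have hpos : (0 : ℝ) < 1 / ((n : ℝ) + 1) := by positivity
    have : tsupport (fun w => (((b n).normed volume (x - w) : ℝ) : ℂ))
        ⊆ {w : Pt m | w.2 ≤ x.2 - 1 / ((n : ℝ) + 1)} := by
      refine closure_minimal (fun w hw => ?_) (isClosed_le continuous_snd continuous_const)
      have h1 : x - w ∈ Function.support ((b n).normed volume) := fun h => hw (by simp [h])
      rw [(b n).support_normed_eq] at h1
      have h2 := hball n _ h1
      simp only [Set.mem_ofPred_eq, Prod.snd_sub] at h2 ⊢
      linarith
    refine this.trans fun w hw => ?_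
    have h1 := hx.2
    simp only [Set.mem_ofPred_eq] at hw ⊢
    linarith
  refine mem_closure_of_tendsto (f := fun n => ofTest R (htest n)) (b := atTop) ?_
    (Eventually.of_forall fun n => ⟨_, htest n, rfl⟩)
  refine tendsto_HTilde ?_ fun i => ?_
  · refine tendsto_of_tendsto_of_tendsto_of_le_of_le tendsto_const_nhds (hlim hu.memLp)
      (fun _ => zero_le) fun n => ?_
    refine eLpNorm_mono_ae ?_
    filter_upwards [extVal_ofTest (R := R) (htest n)] with x hx
    rw [hx]
    by_cases hs : x ∈ strip m R
    · rw [Set.indicator_of_mem hs]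
    · rw [Set.indicator_of_notMem hs, extVal, Set.indicator_of_notMem hs, sub_zero, norm_zero]
      exact norm_nonneg _
  · refine tendsto_of_tendsto_of_tendsto_of_le_of_le tendsto_const_nhds (hlim (hu.memLp_grad i))
      (fun _ => zero_le) fun n => ?_
    refine eLpNorm_mono_ae ?_
    filter_upwards [extGrad_ofTest (R := R) (htest n) i] with x hx
    rw [hx]
    by_cases hs : x ∈ strip m R
    · rw [Set.indicator_of_mem hs, hpd n i x hs]
    · rw [Set.indicator_of_notMem hs, extGrad, Set.indicator_of_notMem hs, sub_zero, norm_zero]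
      exact norm_nonneg _

/-- Test functions on the half space are dense in `H̃¹`: horizontal cutoffs on growing balls reduce to
functions of bounded horizontal support. -/
theorem mem_closure_ofTest (u : HTilde m R) :
    u ∈ closure {v : HTilde m R | ∃ φ, ∃ hφ : IsUpperTest φ, v = ofTest R hφ} := by
  let η : ContDiffBump (0 : EuclideanSpace ℝ (Fin m)) := ⟨1, 2, one_pos, one_lt_two⟩
  obtain ⟨C, hC, hC0, hC1⟩ := exists_bound_horizontal η.contDiff η.hasCompactSupport
  let ψ : ℕ → EuclideanSpace ℝ (Fin m) → ℝ := fun n y => η ((1 / ((n : ℝ) + 1)) • y)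
  have hψ : ∀ n, ContDiff ℝ ∞ (ψ n) := fun n => η.contDiff.comp (contDiff_const_smul _)
  have hψ0 : ∀ n y, |ψ n y| ≤ C := fun n y => hC0 _
  have hψ1' : ∀ n y, ‖fderiv ℝ (ψ n) y‖ ≤ C * (1 / ((n : ℝ) + 1)) := by
    intro n y
    have hd : DifferentiableAt ℝ η ((1 / ((n : ℝ) + 1)) • y) :=
      (η.contDiff (n := 1)).differentiable (by simp) |>.differentiableAt
    have h := hd.hasFDerivAt.comp y ((hasFDerivAt_id y).const_smul (1 / ((n : ℝ) + 1)))
    change ‖fderiv ℝ (η ∘ fun y => (1 / ((n : ℝ) + 1)) • y) y‖ ≤ _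
    erw [h.fderiv]
    refine (ContinuousLinearMap.opNorm_comp_le _ _).trans ?_
    gcongr
    · exact hC1 _
    · refine (norm_smul_le _ _).trans ?_
      rw [Real.norm_of_nonneg (by positivity)]
      exact mul_le_of_le_one_right (by positivity) ContinuousLinearMap.norm_id_le
  have hle : ∀ n : ℕ, 1 / ((n : ℝ) + 1) ≤ 1 := fun n => by
    rw [div_le_one (by positivity)]; linarith [n.cast_nonneg (α := ℝ)]
  have hψ1 : ∀ n y, ‖fderiv ℝ (ψ n) y‖ ≤ C := fun n y =>
    (hψ1' n y).trans (mul_le_of_le_one_right hC (hle n))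
  have hu := isH1_ext u
  refine closure_closure.subset (mem_closure_of_tendsto
    (f := fun n => horizontalCutoff (hψ n) (hψ0 n) (hψ1 n) u) (b := atTop) ?_
    (Eventually.of_forall fun n => ?_))
  · have hpt : ∀ x : Pt m, Tendsto (fun n => ψ n x.1 - 1) atTop (𝓝 0) := by
      intro x
      have h1 : Tendsto (fun n : ℕ => (1 / ((n : ℝ) + 1)) • x.1) atTop (𝓝 0) := by
        simpa using (tendsto_div_succ 1).smul_const x.1
      have h2 := (η.continuous.tendsto 0).comp h1
      rw [η.one_of_mem_closedBall (by simp [η])] at h2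
      have h3 := h2.sub_const 1
      rw [sub_self] at h3
      exact h3
    have hb : ∀ n (x : Pt m), |ψ n x.1 - 1| ≤ C + 1 := fun n x =>
      (abs_sub _ _).trans (by rw [abs_one]; gcongr; exact hψ0 n _)
    have hcont : ∀ n, Continuous fun x : Pt m => ψ n x.1 - 1 := fun n =>
      ((hψ n).continuous.comp continuous_fst).sub continuous_const
    refine tendsto_HTilde ?_ fun i => ?_
    · refine (tendsto_eLpNorm_smul_zero hcont hb hpt hu.memLp).congr fun n => eLpNorm_congr_ae ?_
      filter_upwards [extVal_horizontalCutoff (hψ n) (hψ0 n) (hψ1 n) u] with x hx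
      rw [hx, sub_smul, one_smul]
    · have t1 := tendsto_eLpNorm_smul_zero hcont hb hpt (hu.memLp_grad i)
      have t2 : Tendsto (fun n => eLpNorm (fun x => pd i (fun x : Pt m => ψ n x.1) x • extVal u x) 2
          volume) atTop (𝓝 0) := by
        refine tendsto_eLpNorm_smul_zero (fun n =>
          (contDiff_pd ((hψ n).comp contDiff_fst) i).continuous) (C := C)
          (fun n x => (abs_pd_horizontal_le (hψ n) i x).trans (hψ1 n _)) (fun x => ?_) hu.memLp
        refine squeeze_zero_norm (fun n => (abs_pd_horizontal_le (hψ n) i x).trans (hψ1' n x.1)) ?_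
        simpa using (tendsto_div_succ 1).const_mul C
      have t3 := t1.add t2
      rw [add_zero] at t3
      refine tendsto_of_tendsto_of_tendsto_of_le_of_le tendsto_const_nhds t3 (fun _ => zero_le)
        fun n => ?_
      have m1 : AEStronglyMeasurable (fun x : Pt m => (ψ n x.1 - 1) • extGrad u i x) volume :=
        (hcont n).aestronglyMeasurable.smul (hu.memLp_grad i).1
      have m2 : AEStronglyMeasurable
          (fun x : Pt m => pd i (fun x : Pt m => ψ n x.1) x • extVal u x) volume :=
        (contDiff_pd ((hψ n).comp contDiff_fst) i).continuous.aestronglyMeasurable.smul hu.memLp.1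
      refine le_trans (le_of_eq (eLpNorm_congr_ae ?_)) (eLpNorm_add_le m1 m2 (by norm_num))
      filter_upwards [extGrad_horizontalCutoff (hψ n) (hψ0 n) (hψ1 n) u i] with x hx
      rw [hx, Pi.add_apply, sub_smul, one_smul]
      abel
  · have hzero : ∀ x : Pt m, 2 * ((n : ℝ) + 1) < ‖x.1‖ → ψ n x.1 = 0 := by
      intro x hx
      refine η.zero_of_le_dist ?_
      rw [dist_zero_right, norm_smul, Real.norm_of_nonneg (by positivity), one_div,
        le_inv_mul_iff₀ (by positivity)]
      change ((n : ℝ) + 1) * 2 ≤ _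
      linarith
    refine mem_closure_ofTest_of_bounded _ (L := 2 * ((n : ℝ) + 1)) ?_
    filter_upwards [extVal_horizontalCutoff (hψ n) (hψ0 n) (hψ1 n) u] with x hx h
    rw [hx, hzero x h, zero_smul]

/-! ### The embedding into `L⁴` -/

/-- The fundamental theorem of calculus for `f ^ 2`. -/
theorem enorm_sq_le_of_eq_zero {f f' : ℝ → ℂ} (hf : ∀ t, HasDerivAt f (f' t) t)
    (hf' : Continuous f') {a t : ℝ} (hat : a ≤ t) (ha : f a = 0) :
    ‖f t‖ₑ ^ 2 ≤ 2 * ∫⁻ s in Set.Ioc a t, ‖f s‖ₑ * ‖f' s‖ₑ := by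
  have hc : Continuous f := continuous_iff_continuousAt.2 fun t => (hf t).continuousAt
  have hd : ∀ s ∈ Set.uIcc a t, HasDerivAt (fun s => f s ^ 2) (2 * (f s * f' s)) s := by
    intro s _
    have := (hf s).pow 2
    convert! this using 1
    ring
  have h := intervalIntegral.integral_eq_sub_of_hasDerivAt hd
    ((continuous_const.mul (hc.mul hf')).intervalIntegrable _ _)
  rw [ha, zero_pow two_ne_zero, sub_zero, intervalIntegral.integral_of_le hat] at h
  rw [← enorm_pow, ← h]
  refine (enorm_integral_le_lintegral_enorm _).trans ?_
  rw [← lintegral_const_mul' _ _ (by simp)]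
  refine lintegral_mono fun s => ?_
  rw [enorm_mul, enorm_mul]
  gcongr
  rw [← ofReal_norm]
  simp

theorem two_mul_le_sq_add_sq (a b : ℝ≥0∞) : 2 * (a * b) ≤ a ^ 2 + b ^ 2 := by
  induction a with
  | top => simp
  | coe a =>
    induction b with
    | top => simp
    | coe b =>
      norm_cast
      rw [← NNReal.coe_le_coe]
      push_cast
      nlinarith [sq_nonneg ((a : ℝ) - b)]

/-- The Cauchy-Schwarz inequality without square roots. -/
theorem lintegral_mul_sq_le {α : Type*} [MeasurableSpace α] {μ : Measure α} {f g : α → ℝ≥0∞}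
    (hf : AEMeasurable f μ) (hg : AEMeasurable g μ) :
    (∫⁻ x, f x * g x ∂μ) ^ 2 ≤ (∫⁻ x, f x ^ 2 ∂μ) * ∫⁻ x, g x ^ 2 ∂μ := by
  have h := ENNReal.lintegral_mul_le_Lp_mul_Lq μ Real.HolderConjugate.two_two hf hg
  simp only [Pi.mul_apply, ENNReal.rpow_two] at h
  refine (pow_le_pow_left' h 2).trans (le_of_eq ?_)
  rw [mul_pow, ← ENNReal.rpow_natCast, ← ENNReal.rpow_natCast, ← ENNReal.rpow_mul,
    ← ENNReal.rpow_mul]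
  norm_num

/-- On the line, `‖g‖_∞² ≤ ‖g‖² + ‖g'‖²`. -/
theorem enorm_sq_le_lintegral_fin_one {g : EuclideanSpace ℝ (Fin 1) → ℂ} (hg : ContDiff ℝ ∞ g)
    (hs : HasCompactSupport g) (y : EuclideanSpace ℝ (Fin 1)) :
    ‖g y‖ₑ ^ 2 ≤ ∫⁻ z, (‖g z‖ₑ ^ 2 + ‖fderiv ℝ g z‖ₑ ^ 2) := by
  let b := OrthonormalBasis.singleton (Fin 1) ℝ
  let f : ℝ → ℂ := fun s => g (b.repr s)
  have hd : ∀ s, HasDerivAt f (fderiv ℝ g (b.repr s) (b.repr 1)) s := by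
    intro s
    have h1 : HasDerivAt (fun s : ℝ => b.repr s) (b.repr 1) s := by
      simpa using (b.repr.toContinuousLinearEquiv.toContinuousLinearMap.hasDerivAt (x := s))
    exact ((hg.differentiable (by simp) _).hasFDerivAt.comp_hasDerivAt s h1)
  have hcs : HasCompactSupport f := hs.comp_homeomorph b.repr.toHomeomorph
  obtain ⟨t, rfl⟩ := b.repr.surjective y
  obtain ⟨a, hat, ha⟩ : ∃ a ≤ t, f a = 0 := by
    obtain ⟨r, hr⟩ := hcs.isCompact.isBounded.subset_closedBall 0
    refine ⟨min t (-|r| - 1), min_le_left _ _, image_eq_zero_of_notMem_tsupport fun h => ?_⟩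
    have h1 := hr h
    rw [mem_closedBall_zero_iff, Real.norm_eq_abs, abs_le] at h1
    have := h1.1.trans (min_le_right _ _)
    have := le_abs_self r
    linarith
  have hcont : Continuous fun s => fderiv ℝ g (b.repr s) (b.repr 1) :=
    ((hg.continuous_fderiv (by simp)).comp b.repr.continuous).clm_apply continuous_const
  refine (enorm_sq_le_of_eq_zero hd hcont hat ha).trans ?_
  rw [← lintegral_const_mul' _ _ (by simp)]
  refine (setLIntegral_le_lintegral _ _).trans ?_
  refine le_trans ?_ (b.measurePreserving_repr.lintegral_comp_emb
    b.repr.toHomeomorph.measurableEmbedding fun z => ‖g z‖ₑ ^ 2 + ‖fderiv ℝ g z‖ₑ ^ 2).le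
  refine lintegral_mono fun s => (two_mul_le_sq_add_sq _ _).trans ?_
  gcongr
  rw [enorm_le_iff_norm_le]
  have h1 : ‖b.repr (1 : ℝ)‖ = 1 := (b.repr.norm_map 1).trans norm_one
  refine (ContinuousLinearMap.le_opNorm _ _).trans (le_of_eq ?_)
  exact (congrArg (_ * ·) h1).trans (mul_one _)

/-- The inequality of Gagliardo, Nirenberg and Ladyzhenskaya on a horizontal slice. -/
theorem exists_ladyzhenskaya (hm : m = 1 ∨ m = 2) :
    ∃ C : ℝ≥0∞, C ≠ ⊤ ∧ ∀ g : EuclideanSpace ℝ (Fin m) → ℂ, ContDiff ℝ ∞ g → HasCompactSupport g →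
      ∫⁻ y, ‖g y‖ₑ ^ 4 ≤ C * (∫⁻ y, ‖g y‖ₑ ^ 2) * ∫⁻ y, (‖g y‖ₑ ^ 2 + ‖fderiv ℝ g y‖ₑ ^ 2) := by
  rcases hm with rfl | rfl
  · refine ⟨1, by simp, fun g hg hs => ?_⟩
    rw [one_mul, mul_comm, ← lintegral_const_mul _ (hg.continuous.enorm.measurable.pow_const 2)]
    refine lintegral_mono fun y => ?_
    rw [show (4 : ℕ) = 2 + 2 from rfl, pow_add]
    gcongr
    exact enorm_sq_le_lintegral_fin_one hg hs y
  · have hp : Real.HolderConjugate (Module.finrank ℝ (EuclideanSpace ℝ (Fin 2))) 2 := by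
      rw [finrank_euclideanSpace_fin]; exact_mod_cast Real.HolderConjugate.two_two
    refine ⟨4 * lintegralPowLePowLIntegralFDerivConst
      (volume : Measure (EuclideanSpace ℝ (Fin 2))) 2, by finiteness, fun g hg hs => ?_⟩
    have h := lintegral_pow_le_pow_lintegral_fderiv
      (volume : Measure (EuclideanSpace ℝ (Fin 2))) (u := fun y => g y * g y)
      ((hg.mul hg).of_le (by simp)) hs.mul_left hp
    have hfd : ∀ y, ‖fderiv ℝ (fun y => g y * g y) y‖ₑ ≤ 2 * (‖g y‖ₑ * ‖fderiv ℝ g y‖ₑ) := by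
      intro y
      have hd := (hg.differentiable (by simp) y)
      rw [fderiv_fun_mul hd hd, two_mul]
      rw [← two_smul ℝ, enorm_smul, enorm_smul, ← ofReal_norm (2 : ℝ)]
      simp [two_mul]
    have hI := lintegral_mul_sq_le (μ := (volume : Measure (EuclideanSpace ℝ (Fin 2))))
      hg.continuous.enorm.measurable.aemeasurable
      (hg.continuous_fderiv (by simp)).enorm.measurable.aemeasurable
    simp only [ENNReal.rpow_two] at h
    calc ∫⁻ y, ‖g y‖ₑ ^ 4 = ∫⁻ y, ‖g y * g y‖ₑ ^ 2 := by
          refine lintegral_congr fun y => ?_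
          rw [enorm_mul]; ring
      _ ≤ _ := h
      _ ≤ lintegralPowLePowLIntegralFDerivConst (volume : Measure (EuclideanSpace ℝ (Fin 2))) 2
            * (2 * ∫⁻ y, ‖g y‖ₑ * ‖fderiv ℝ g y‖ₑ) ^ 2 := by
          gcongr
          rw [← lintegral_const_mul' _ _ (by simp)]
          exact lintegral_mono hfd
      _ ≤ lintegralPowLePowLIntegralFDerivConst (volume : Measure (EuclideanSpace ℝ (Fin 2))) 2
            * (4 * ((∫⁻ y, ‖g y‖ₑ ^ 2) * ∫⁻ y, (‖g y‖ₑ ^ 2 + ‖fderiv ℝ g y‖ₑ ^ 2))) := by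
          rw [mul_pow]
          norm_num
          gcongr
          refine hI.trans ?_
          gcongr
          exact le_add_self
      _ = _ := by ring

/-- The square of the `H¹` norm on the strip, as an extended real. -/
noncomputable def eenergy (R : ℝ) (φ : Pt m → ℂ) : ℝ≥0∞ :=
  ∫⁻ x in strip m R, (‖φ x‖ₑ ^ 2 + ∑ i, ‖pd i φ x‖ₑ ^ 2)

theorem lintegral_strip (f : Pt m → ℝ≥0∞) (hf : Measurable f) :
    ∫⁻ x in strip m R, f x = ∫⁻ t in Set.Ioo 0 R, ∫⁻ y, f (y, t) := by
  have : strip m R = Set.univ ×ˢ Set.Ioo 0 R := by ext x; simp [strip]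
  rw [this, Measure.volume_eq_prod, ← Measure.prod_restrict, Measure.restrict_univ,
    lintegral_prod_symm' _ hf]

theorem hasDerivAt_vertical {φ : Pt m → ℂ} (hφ : IsTest φ) (y : EuclideanSpace ℝ (Fin m)) (t : ℝ) :
    HasDerivAt (fun s => φ (y, s)) (pd none φ (y, t)) t := by
  have h1 : HasDerivAt (fun s : ℝ => ((y, s) : Pt m)) (0, 1) t :=
    (hasDerivAt_const t y).prodMk (hasDerivAt_id t)
  exact (hφ.differentiable (y, t)).hasFDerivAt.comp_hasDerivAt t h1

theorem enorm_sq_le_vertical {φ : Pt m → ℂ} (hφ : IsUpperTest φ) {t : ℝ} (h0 : 0 ≤ t) (hR : t ≤ R)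
    (y : EuclideanSpace ℝ (Fin m)) :
    ‖φ (y, t)‖ₑ ^ 2 ≤ ∫⁻ s in Set.Ioo 0 R, (‖φ (y, s)‖ₑ ^ 2 + ‖pd none φ (y, s)‖ₑ ^ 2) := by
  refine (enorm_sq_le_of_eq_zero (hasDerivAt_vertical hφ.1 y)
    ((hφ.1.pd none).1.continuous.comp (by fun_prop)) h0 (hφ.eq_zero le_rfl)).trans ?_
  rw [← lintegral_const_mul' _ _ (by simp), Measure.restrict_congr_set Ioo_ae_eq_Ioc]
  exact (lintegral_mono_set (Set.Ioc_subset_Ioc_right hR)).trans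
    (lintegral_mono fun s => two_mul_le_sq_add_sq _ _)

/-- Every horizontal slice of a test function vanishing near `Γ^0` is bounded in `L²` by the
`H¹` norm. -/
theorem lintegral_slice_le {φ : Pt m → ℂ} (hφ : IsUpperTest φ) {t : ℝ} (h0 : 0 ≤ t) (hR : t ≤ R) :
    ∫⁻ y, ‖φ (y, t)‖ₑ ^ 2 ≤ eenergy R φ := by
  have hm1 : Measurable fun x : Pt m => ‖φ x‖ₑ ^ 2 + ‖pd none φ x‖ₑ ^ 2 :=
    (hφ.1.1.continuous.enorm.measurable.pow_const 2).add
      ((hφ.1.pd none).1.continuous.enorm.measurable.pow_const 2)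
  calc ∫⁻ y, ‖φ (y, t)‖ₑ ^ 2
      ≤ ∫⁻ y, ∫⁻ s in Set.Ioo 0 R, (‖φ (y, s)‖ₑ ^ 2 + ‖pd none φ (y, s)‖ₑ ^ 2) :=
        lintegral_mono fun y => enorm_sq_le_vertical hφ h0 hR y
    _ = ∫⁻ x in strip m R, (‖φ x‖ₑ ^ 2 + ‖pd none φ x‖ₑ ^ 2) := by
        rw [lintegral_strip _ hm1]
        exact lintegral_lintegral_swap hm1.aemeasurable
    _ ≤ _ := lintegral_mono fun x => by
        gcongr
        exact Finset.single_le_sum (f := fun i => ‖pd i φ x‖ₑ ^ 2) (fun _ _ => zero_le)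
          (Finset.mem_univ none)

theorem hasFDerivAt_slice {φ : Pt m → ℂ} (hφ : IsTest φ) (y : EuclideanSpace ℝ (Fin m)) (t : ℝ) :
    HasFDerivAt (fun y => φ (y, t))
      ((fderiv ℝ φ (y, t)).comp (ContinuousLinearMap.inl ℝ (EuclideanSpace ℝ (Fin m)) ℝ)) y :=
  HasFDerivAt.comp (g := φ) (f := fun y => (y, t)) y (hφ.differentiable (y, t)).hasFDerivAt
    (hasFDerivAt_prodMk_left y t)

theorem fderiv_slice_single {φ : Pt m → ℂ} (hφ : IsTest φ) (y : EuclideanSpace ℝ (Fin m)) (t : ℝ)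
    (j : Fin m) : fderiv ℝ (fun y => φ (y, t)) y (EuclideanSpace.single j 1)
      = pd (some j) φ (y, t) := by
  rw [(hasFDerivAt_slice hφ y t).fderiv]
  rfl

theorem norm_sq_le_sum_single (L : EuclideanSpace ℝ (Fin m) →L[ℝ] ℂ) :
    ‖L‖ ^ 2 ≤ ∑ j, ‖L (EuclideanSpace.single j 1)‖ ^ 2 := by
  have h : ‖L‖ ≤ √(∑ j, ‖L (EuclideanSpace.single j 1)‖ ^ 2) := by
    refine L.opNorm_le_bound (Real.sqrt_nonneg _) fun v => ?_
    have hv : L v = ∑ j, v j • L (EuclideanSpace.single j 1) := by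
      conv_lhs => rw [← (EuclideanSpace.basisFun (Fin m) ℝ).sum_repr v]
      simp
    rw [hv, EuclideanSpace.norm_eq]
    refine (norm_sum_le _ _).trans ?_
    simp only [norm_smul]
    rw [mul_comm]
    exact Real.sum_mul_le_sqrt_mul_sqrt _ _ _
  calc ‖L‖ ^ 2 ≤ (√(∑ j, ‖L (EuclideanSpace.single j 1)‖ ^ 2)) ^ 2 := by gcongr
    _ = _ := Real.sq_sqrt (by positivity)

theorem enorm_fderiv_slice_le {φ : Pt m → ℂ} (hφ : IsTest φ) (y : EuclideanSpace ℝ (Fin m))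
    (t : ℝ) :
    ‖fderiv ℝ (fun y => φ (y, t)) y‖ₑ ^ 2 ≤ ∑ i, ‖pd i φ (y, t)‖ₑ ^ 2 := by
  have h := norm_sq_le_sum_single (fderiv ℝ (fun y => φ (y, t)) y)
  simp only [fderiv_slice_single hφ] at h
  rw [Fintype.sum_option]
  refine le_trans ?_ le_add_self
  simp only [← ofReal_norm, ← ENNReal.ofReal_pow (norm_nonneg _)]
  rw [← ENNReal.ofReal_sum_of_nonneg fun _ _ => by positivity]
  exact ENNReal.ofReal_le_ofReal h

theorem hasCompactSupport_slice {φ : Pt m → ℂ} (hφ : HasCompactSupport φ) (t : ℝ) :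
    HasCompactSupport fun y : EuclideanSpace ℝ (Fin m) => φ (y, t) :=
  HasCompactSupport.intro (hφ.isCompact.image continuous_fst) fun _ hy =>
    image_eq_zero_of_notMem_tsupport fun h => hy ⟨_, h, rfl⟩

/-- The Ladyzhenskaya inequality is applied on each horizontal slice; the `L²` norm of a slice is
bounded by the energy on the strip, since the function vanishes at the bottom. -/
theorem exists_lintegral_pow_four_le (hm : m = 1 ∨ m = 2) (R : ℝ) :
    ∃ C : ℝ≥0∞, C ≠ ⊤ ∧ ∀ φ : Pt m → ℂ, IsUpperTest φ →
      ∫⁻ x in strip m R, ‖φ x‖ₑ ^ 4 ≤ C * eenergy R φ ^ 2 := by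
  obtain ⟨C, hC, h⟩ := exists_ladyzhenskaya hm
  refine ⟨C, hC, fun φ hφ => ?_⟩
  have hm2 : Measurable fun x : Pt m => ‖φ x‖ₑ ^ 2 + ∑ i, ‖pd i φ x‖ₑ ^ 2 :=
    (hφ.1.1.continuous.enorm.measurable.pow_const 2).add (Finset.measurable_sum _ fun i _ =>
      (hφ.1.pd i).1.continuous.enorm.measurable.pow_const 2)
  rw [lintegral_strip _ (hφ.1.1.continuous.enorm.measurable.pow_const 4)]
  calc ∫⁻ t in Set.Ioo 0 R, ∫⁻ y, ‖φ (y, t)‖ₑ ^ 4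
      ≤ ∫⁻ t in Set.Ioo 0 R, C * eenergy R φ *
          ∫⁻ y, (‖φ (y, t)‖ₑ ^ 2 + ∑ i, ‖pd i φ (y, t)‖ₑ ^ 2) := by
        refine setLIntegral_mono' measurableSet_Ioo fun t ht => ?_
        refine (h (fun y => φ (y, t)) (hφ.1.1.comp (contDiff_prodMk_left t))
          (hasCompactSupport_slice hφ.1.2 t)).trans ?_
        gcongr
        · exact lintegral_slice_le hφ ht.1.le ht.2.le
        · exact enorm_fderiv_slice_le hφ.1 _ t
    _ = C * eenergy R φ * eenergy R φ := by
        rw [lintegral_const_mul, eenergy, lintegral_strip _ hm2]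
        exact hm2.lintegral_prod_left'
    _ = C * eenergy R φ ^ 2 := by ring

theorem eenergy_eq {φ : Pt m → ℂ} (hφ : IsUpperTest φ) :
    eenergy R φ = ENNReal.ofReal (‖ofTest R hφ‖ ^ 2) := by
  have hi := (hφ.1.hasWeakGrad Set.univ).integrable_energy.restrict (s := strip m R)
  rw [norm_sq_ofTest, ofReal_integral_eq_lintegral_ofReal hi
    (Eventually.of_forall fun x => energy_nonneg _ _ _), eenergy]
  refine lintegral_congr fun x => ?_
  rw [energy, ENNReal.ofReal_add (by positivity) (by positivity),
    ENNReal.ofReal_sum_of_nonneg fun _ _ => by positivity]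
  simp only [← ofReal_norm, ← ENNReal.ofReal_pow (norm_nonneg _)]

/-- A sequence of test functions converging in `H̃¹`, and almost everywhere. -/
theorem exists_seq_ofTest (u : HTilde m R) :
    ∃ (φ : ℕ → Pt m → ℂ) (hφ : ∀ n, IsUpperTest (φ n)),
      Tendsto (fun n => ofTest R (hφ n)) atTop (𝓝 u) ∧
      ∀ᵐ x, Tendsto (fun n => (strip m R).indicator (φ n) x) atTop (𝓝 (extVal u x)) := by
  obtain ⟨v, hv, hlim⟩ := mem_closure_iff_seq_limit.1 (mem_closure_ofTest u)
  choose φ hφ hvφ using hv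
  obtain rfl : v = fun n => ofTest R (hφ n) := funext hvφ
  have h2 : Tendsto (fun n => eLpNorm (extVal (ofTest R (hφ n)) - extVal u) 2 volume) atTop
      (𝓝 0) := by
    have h3 : Tendsto (fun n => ENNReal.ofReal ‖ofTest R (hφ n) - u‖) atTop (𝓝 0) := by
      have := (ENNReal.continuous_ofReal.tendsto 0).comp (tendsto_iff_norm_sub_tendsto_zero.1 hlim)
      rwa [ENNReal.ofReal_zero] at this
    refine tendsto_of_tendsto_of_tendsto_of_le_of_le tendsto_const_nhds h3 (fun _ => zero_le)
      fun n => ?_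
    have e : eLpNorm (extVal (ofTest R (hφ n)) - extVal u) 2 volume
        = ENNReal.ofReal ‖val (ofTest R (hφ n) - u)‖ := by
      rw [show extVal (ofTest R (hφ n)) - extVal u = fun x => extVal (ofTest R (hφ n)) x - extVal u x
        from rfl, ← eLpNorm_congr_ae (extVal_sub (ofTest R (hφ n)) u), extVal, eLpNorm_ext, Lp.norm_def,
        ENNReal.ofReal_toReal (Lp.eLpNorm_ne_top _)]
    refine e.le.trans (ENNReal.ofReal_le_ofReal (abs_le_of_sq_le_sq' ?_ (norm_nonneg _)).2)
    rw [norm_sq_eq_add]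
    exact le_add_of_nonneg_right (by positivity)
  obtain ⟨ns, hns, hae⟩ := (tendstoInMeasure_of_tendsto_eLpNorm_of_ne_top two_ne_zero (by simp)
    (fun n => (isH1_ext _).memLp.1) (isH1_ext u).memLp.1 h2).exists_seq_tendsto_ae
  refine ⟨fun n => φ (ns n), fun n => hφ (ns n), hlim.comp hns.tendsto_atTop, ?_⟩
  filter_upwards [hae, ae_all_iff.2 fun n => extVal_ofTest (R := R) (hφ (ns n))] with x hx h
  exact hx.congr h

/-- The Sobolev embedding of `H̃¹(Ω^R)` into `L⁴`. -/
theorem exists_eLpNorm_four_le (hm : m = 1 ∨ m = 2) (R : ℝ) :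
    ∃ C : ℝ, 0 ≤ C ∧ ∀ u : HTilde m R, eLpNorm (extVal u) 4 volume ≤ ENNReal.ofReal (C * ‖u‖) := by
  obtain ⟨C, hC, h⟩ := exists_lintegral_pow_four_le hm R
  let K := (C.toReal) ^ (1 / 4 : ℝ)
  have hK : 0 ≤ K := by positivity
  have hb : ∀ φ (hφ : IsUpperTest φ), eLpNorm ((strip m R).indicator φ) 4 volume
      ≤ ENNReal.ofReal (K * ‖ofTest R hφ‖) := by
    intro φ hφ
    have h1 := h φ hφ
    have e4 := eLpNorm_nnreal_pow_eq_lintegral (f := φ) (μ := volume.restrict (strip m R)) (p := 4)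
      (by norm_num)
    rw [eLpNorm_indicator_eq_eLpNorm_restrict measurableSet_strip]
    have e4' : eLpNorm φ 4 (volume.restrict (strip m R)) ^ 4
        = ∫⁻ x in strip m R, ‖φ x‖ₑ ^ 4 := by simpa using e4
    rw [← e4', eenergy_eq hφ] at h1
    refine (ENNReal.pow_le_pow_left_iff (n := 4) (by norm_num)).1 (h1.trans (le_of_eq ?_))
    rw [← ENNReal.ofReal_pow (by positivity), ← ENNReal.ofReal_pow (by positivity),
      ← ENNReal.ofReal_toReal hC, ← ENNReal.ofReal_mul (by positivity), mul_pow,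
      ← Real.rpow_natCast K, ← Real.rpow_mul (by positivity)]
    norm_num
    ring_nf
  refine ⟨K, hK, fun u => ?_⟩
  obtain ⟨φ, hφ, hlim, hae⟩ := exists_seq_ofTest u
  refine (Lp.eLpNorm_lim_le_liminf_eLpNorm (fun n => (((hφ n).1.memLp 2).indicator
    measurableSet_strip).1) _ hae).trans ?_
  have h1 : Tendsto (fun n => ENNReal.ofReal (K * ‖ofTest R (hφ n)‖)) atTop
      (𝓝 (ENNReal.ofReal (K * ‖u‖))) :=
    (ENNReal.continuous_ofReal.tendsto _).comp (hlim.norm.const_mul K)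
  rw [← h1.liminf_eq]
  exact liminf_le_liminf (Eventually.of_forall fun n => hb _ (hφ n))

open scoped FourierTransform

/-! ### The trace on `Γ^R` and its Fourier transform -/

/-- The Fourier transform of the horizontal slice of `φ` at height `t`. -/
noncomputable def sliceFT (φ : Pt m → ℂ) (t : ℝ) (η : EuclideanSpace ℝ (Fin m)) : ℂ :=
  𝓕 (fun y : EuclideanSpace ℝ (Fin m) => φ (y, t)) η

theorem IsTest.slice {φ : Pt m → ℂ} (hφ : IsTest φ) (t : ℝ) :
    ContDiff ℝ ∞ (fun y : EuclideanSpace ℝ (Fin m) => φ (y, t)) :=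
  hφ.1.comp (contDiff_prodMk_left t)

theorem IsTest.integrable_slice {φ : Pt m → ℂ} (hφ : IsTest φ) (t : ℝ) :
    Integrable (fun y : EuclideanSpace ℝ (Fin m) => φ (y, t)) volume :=
  (hφ.slice t).continuous.integrable_of_hasCompactSupport (hasCompactSupport_slice hφ.2 t)

theorem sliceFT_eq (φ : Pt m → ℂ) (t : ℝ) (η : EuclideanSpace ℝ (Fin m)) :
    sliceFT φ t η = ∫ y, Real.fourierChar (-inner ℝ y η) • φ (y, t) := Real.fourier_eq _ _

theorem hasDerivAt_sliceFT {φ : Pt m → ℂ} (hφ : IsTest φ) (t : ℝ)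
    (η : EuclideanSpace ℝ (Fin m)) :
    HasDerivAt (fun s => sliceFT φ s η) (sliceFT (pd none φ) t η) t := by
  simp only [sliceFT_eq]
  obtain ⟨C, hC⟩ := (hφ.pd none).2.exists_bound_of_continuous (hφ.pd none).1.continuous
  have hK : IsCompact (Prod.fst '' tsupport φ) := hφ.2.isCompact.image continuous_fst
  have hchar : Continuous fun y : EuclideanSpace ℝ (Fin m) =>
      Real.fourierChar (-inner ℝ y η) := by fun_prop
  refine (hasDerivAt_integral_of_dominated_loc_of_deriv_le (s := Set.univ)
    (F := fun s y => Real.fourierChar (-inner ℝ y η) • φ (y, s))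
    (F' := fun s y => Real.fourierChar (-inner ℝ y η) • pd none φ (y, s))
    (bound := (Prod.fst '' tsupport φ).indicator fun _ => C) univ_mem
    (Eventually.of_forall fun s => ?_) ?_ ?_ (Eventually.of_forall fun y s _ => ?_) ?_
    (Eventually.of_forall fun y s _ => ?_)).2
  · exact (hchar.smul (hφ.slice s).continuous).aestronglyMeasurable
  · exact (Real.fourierIntegral_convergent_iff η).2 (hφ.integrable_slice t)
  · exact (hchar.smul ((hφ.pd none).slice t).continuous).aestronglyMeasurable
  · rw [Circle.norm_smul]
    by_cases hy : y ∈ Prod.fst '' tsupport φ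
    · rw [Set.indicator_of_mem hy]; exact hC _
    · rw [Set.indicator_of_notMem hy, image_eq_zero_of_notMem_tsupport fun h =>
        hy ⟨_, tsupport_pd_subset φ none h, rfl⟩, norm_zero]
  · exact (integrable_indicator_iff hK.measurableSet).2 (integrableOn_const hK.measure_lt_top.ne)
  · exact (hasDerivAt_vertical hφ y s).const_smul (Real.fourierChar (-inner ℝ y η))

theorem continuous_sliceFT {φ : Pt m → ℂ} (hφ : IsTest φ) (η : EuclideanSpace ℝ (Fin m)) :
    Continuous fun t => sliceFT φ t η :=
  continuous_iff_continuousAt.2 fun t => (hasDerivAt_sliceFT hφ t η).continuousAt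

/-- The horizontal slice of a test function as a Schwartz function. -/
noncomputable def sliceSchwartz {φ : Pt m → ℂ} (hφ : IsTest φ) (t : ℝ) :
    SchwartzMap (EuclideanSpace ℝ (Fin m)) ℂ :=
  (hasCompactSupport_slice hφ.2 t).toSchwartzMap (hφ.slice t)

theorem sliceFT_eq_fourier {φ : Pt m → ℂ} (hφ : IsTest φ) (t : ℝ) :
    sliceFT φ t = 𝓕 (sliceSchwartz hφ t) := rfl

theorem lintegral_sliceFT {φ : Pt m → ℂ} (hφ : IsTest φ) (t : ℝ) :
    ∫⁻ η, ‖sliceFT φ t η‖ₑ ^ 2 = ∫⁻ y, ‖φ (y, t)‖ₑ ^ 2 := by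
  have h := SchwartzMap.norm_fourier_toL2_eq (sliceSchwartz hφ t)
  rw [SchwartzMap.norm_toLp, SchwartzMap.norm_toLp, ENNReal.toReal_eq_toReal_iff'
    ((SchwartzMap.memLp _ 2 volume).2.ne) ((SchwartzMap.memLp _ 2 volume).2.ne)] at h
  rw [← eLpNorm_two_sq, ← eLpNorm_two_sq]
  exact congrArg (· ^ 2) h

theorem sliceFT_pd_some {φ : Pt m → ℂ} (hφ : IsTest φ) (t : ℝ) (η : EuclideanSpace ℝ (Fin m))
    (j : Fin m) : sliceFT (pd (some j) φ) t η = (2 * Real.pi * Complex.I * η j) * sliceFT φ t η := by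
  have h1 : Integrable (fderiv ℝ fun y : EuclideanSpace ℝ (Fin m) => φ (y, t)) volume :=
    ((hφ.slice t).continuous_fderiv (by simp)).integrable_of_hasCompactSupport
      ((hasCompactSupport_slice hφ.2 t).fderiv ℝ)
  have h := Real.fourier_fderiv (hφ.integrable_slice t) ((hφ.slice t).differentiable (by simp)) h1
  have h2 := congrArg (fun L => L (EuclideanSpace.single j 1)) (congrFun h η)
  simp only [Real.fourier_eq] at h2
  rw [ContinuousLinearMap.integral_apply ((Real.fourierIntegral_convergent_iff η).2 h1)] at h2
  rw [sliceFT_eq]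
  refine (integral_congr_ae (Eventually.of_forall fun y => ?_)).trans (h2.trans ?_)
  · simp only [← fderiv_slice_single hφ y t j]
    rfl
  · rw [sliceFT_eq, VectorFourier.fourierSMulRight_apply, Real.fourier_eq]
    have e : (innerSL ℝ η) (EuclideanSpace.single j (1 : ℝ)) = η j := by
      change inner ℝ η (EuclideanSpace.single j (1 : ℝ)) = η j
      simp [EuclideanSpace.inner_single_right]
    simp [e]
    ring

theorem measurable_sliceFT {φ : Pt m → ℂ} (hφ : IsTest φ) :
    Measurable fun x : Pt m => sliceFT φ x.2 x.1 := by
  simp only [sliceFT_eq]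
  have hc : Continuous (fun z : Pt m × EuclideanSpace ℝ (Fin m) =>
      Real.fourierChar (-inner ℝ z.2 z.1.1) • φ (z.2, z.1.2)) := by
    have := hφ.1.continuous
    fun_prop
  exact (hc.stronglyMeasurable.integral_prod_right').measurable

/-- The key estimate of the trace theorem, in each Fourier mode. -/
theorem weighted_sliceFT_le {φ : Pt m → ℂ} (hφ : IsUpperTest φ) (hR : 0 ≤ R)
    (η : EuclideanSpace ℝ (Fin m)) :
    (1 + ‖η‖ₑ) * ‖sliceFT φ R η‖ₑ ^ 2 ≤
      2 * ∫⁻ t in Set.Ioo 0 R, (‖sliceFT φ t η‖ₑ ^ 2 + ∑ i, ‖sliceFT (pd i φ) t η‖ₑ ^ 2) := by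
  have h0 : sliceFT φ 0 η = 0 := by
    rw [sliceFT_eq]
    simp [hφ.eq_zero (x := (_, 0)) le_rfl]
  have h1 := enorm_sq_le_of_eq_zero (fun t => hasDerivAt_sliceFT hφ.1 t η)
    (continuous_sliceFT (hφ.1.pd none) η) hR h0
  calc _ ≤ (1 + ‖η‖ₑ) * (2 * ∫⁻ t in Set.Ioc 0 R, ‖sliceFT φ t η‖ₑ * ‖sliceFT (pd none φ) t η‖ₑ) := by
        gcongr
    _ = ∫⁻ t in Set.Ioo 0 R, 2 * (((1 + ‖η‖ₑ) * ‖sliceFT φ t η‖ₑ) * ‖sliceFT (pd none φ) t η‖ₑ) := by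
        rw [Measure.restrict_congr_set Ioo_ae_eq_Ioc, ← lintegral_const_mul' _ _ (by simp),
          ← lintegral_const_mul' _ _ (by simp)]
        refine lintegral_congr fun t => ?_
        ring
    _ ≤ ∫⁻ t in Set.Ioo 0 R,
          2 * (‖sliceFT φ t η‖ₑ ^ 2 + ∑ i, ‖sliceFT (pd i φ) t η‖ₑ ^ 2) := by
        refine lintegral_mono fun t => (two_mul_le_sq_add_sq _ _).trans ?_
        have e1 : ∑ j : Fin m, ‖sliceFT (pd (some j) φ) t η‖ₑ ^ 2
            = ENNReal.ofReal ((2 * Real.pi) ^ 2 * ‖η‖ ^ 2 * ‖sliceFT φ t η‖ ^ 2) := by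
          simp only [sliceFT_pd_some hφ.1, ← ofReal_norm, ← ENNReal.ofReal_pow (norm_nonneg _)]
          rw [← ENNReal.ofReal_sum_of_nonneg fun _ _ => by positivity, EuclideanSpace.norm_sq_eq,
            Finset.mul_sum, Finset.sum_mul]
          congr 1
          refine Finset.sum_congr rfl fun j _ => ?_
          simp only [norm_mul, Complex.norm_I, Complex.norm_real, Complex.norm_ofNat, mul_pow]
          rw [Real.norm_of_nonneg Real.pi_pos.le]
          ring
        rw [Fintype.sum_option, e1]
        simp only [← ofReal_norm, ← ENNReal.ofReal_pow (norm_nonneg _)]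
        rw [← ENNReal.ofReal_one, ← ENNReal.ofReal_add (by positivity) (by positivity),
          ← ENNReal.ofReal_mul (by positivity), ← ENNReal.ofReal_pow (by positivity),
          ← ENNReal.ofReal_add (by positivity) (by positivity),
          ← ENNReal.ofReal_add (by positivity) (by positivity),
          ← ENNReal.ofReal_add (by positivity) (by positivity),
          two_mul (ENNReal.ofReal _), ← ENNReal.ofReal_add (by positivity) (by positivity)]
        refine ENNReal.ofReal_le_ofReal ?_
        have hpi : 1 ≤ (2 * Real.pi) ^ 2 := by nlinarith [Real.pi_gt_three]
        have hF := sq_nonneg ‖sliceFT φ t η‖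
        have h2 : ‖η‖ ^ 2 * ‖sliceFT φ t η‖ ^ 2
            ≤ (2 * Real.pi) ^ 2 * (‖η‖ ^ 2 * ‖sliceFT φ t η‖ ^ 2) :=
          le_mul_of_one_le_left (by positivity) hpi
        have h3 : (1 + ‖η‖) ^ 2 ≤ 2 * (1 + ‖η‖ ^ 2) := by nlinarith [sq_nonneg (1 - ‖η‖)]
        nlinarith [mul_le_mul_of_nonneg_right h3 hF, sq_nonneg ‖sliceFT (pd none φ) t η‖]
    _ = _ := lintegral_const_mul' _ _ (by simp)

theorem measurable_enorm_sliceFT {φ : Pt m → ℂ} (hφ : IsTest φ) :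
    Measurable fun x : Pt m => ‖sliceFT φ x.2 x.1‖ₑ ^ 2 :=
  (measurable_sliceFT hφ).enorm.pow_const 2

theorem measurable_enorm_sliceFT' {φ : Pt m → ℂ} (hφ : IsTest φ) (t : ℝ) :
    Measurable fun η => ‖sliceFT φ t η‖ₑ ^ 2 :=
  Measurable.comp (g := fun x : Pt m => ‖sliceFT φ x.2 x.1‖ₑ ^ 2) (f := fun η => (η, t))
    (measurable_enorm_sliceFT hφ) measurable_prodMk_right

/-- Plancherel's identity for the energy of a horizontal slice. -/
theorem lintegral_energy_sliceFT {φ : Pt m → ℂ} (hφ : IsTest φ) (t : ℝ) :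
    ∫⁻ η, (‖sliceFT φ t η‖ₑ ^ 2 + ∑ i, ‖sliceFT (pd i φ) t η‖ₑ ^ 2)
      = ∫⁻ y, (‖φ (y, t)‖ₑ ^ 2 + ∑ i, ‖pd i φ (y, t)‖ₑ ^ 2) := by
  have hs : ∀ ψ : Pt m → ℂ, IsTest ψ →
      Measurable fun y : EuclideanSpace ℝ (Fin m) => ‖ψ (y, t)‖ₑ ^ 2 :=
    fun ψ hψ => (hψ.slice t).continuous.enorm.measurable.pow_const 2
  rw [lintegral_add_left (measurable_enorm_sliceFT' hφ t), lintegral_add_left (hs φ hφ),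
    lintegral_finsetSum _ fun i _ => measurable_enorm_sliceFT' (hφ.pd i) t,
    lintegral_finsetSum _ fun i _ => hs _ (hφ.pd i), lintegral_sliceFT hφ]
  congr 1
  exact Finset.sum_congr rfl fun i _ => lintegral_sliceFT (hφ.pd i) t

theorem lintegral_energy_sliceFT_swap {φ : Pt m → ℂ} (hφ : IsTest φ) :
    ∫⁻ η, ∫⁻ t in Set.Ioo 0 R, (‖sliceFT φ t η‖ₑ ^ 2 + ∑ i, ‖sliceFT (pd i φ) t η‖ₑ ^ 2)
      = eenergy R φ := by
  have hm3 : Measurable fun x : Pt m => ‖sliceFT φ x.2 x.1‖ₑ ^ 2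
      + ∑ i, ‖sliceFT (pd i φ) x.2 x.1‖ₑ ^ 2 :=
    (measurable_enorm_sliceFT hφ).add
      (Finset.measurable_sum _ fun i _ => measurable_enorm_sliceFT (hφ.pd i))
  have hm4 : Measurable fun x : Pt m => ‖φ x‖ₑ ^ 2 + ∑ i, ‖pd i φ x‖ₑ ^ 2 :=
    (hφ.1.continuous.enorm.measurable.pow_const 2).add
      (Finset.measurable_sum _ fun i _ => (hφ.pd i).1.continuous.enorm.measurable.pow_const 2)
  have h := lintegral_lintegral_swap (μ := (volume : Measure (EuclideanSpace ℝ (Fin m))))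
    (ν := (volume : Measure ℝ).restrict (Set.Ioo 0 R))
    (f := fun η t => ‖sliceFT φ t η‖ₑ ^ 2 + ∑ i, ‖sliceFT (pd i φ) t η‖ₑ ^ 2) hm3.aemeasurable
  rw [h, eenergy, lintegral_strip _ hm4]
  exact lintegral_congr fun t => lintegral_energy_sliceFT hφ t

theorem lintegral_weighted_sliceFT_le {φ : Pt m → ℂ} (hφ : IsUpperTest φ) (hR : 0 ≤ R) :
    ∫⁻ η, (1 + ‖η‖ₑ) * ‖sliceFT φ R η‖ₑ ^ 2 ≤ 2 * eenergy R φ := by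
  rw [← lintegral_energy_sliceFT_swap hφ.1, ← lintegral_const_mul' _ _ (by simp)]
  exact lintegral_mono fun η => weighted_sliceFT_le hφ hR η

theorem norm_val_le (u : HTilde m R) : ‖val u‖ ≤ ‖u‖ := by
  refine (abs_le_of_sq_le_sq' ?_ (norm_nonneg _)).2
  rw [norm_sq_eq_add]
  exact le_add_of_nonneg_right (by positivity)

theorem norm_grad_le (u : HTilde m R) (i : Option (Fin m)) : ‖grad u i‖ ≤ ‖u‖ := by
  refine (abs_le_of_sq_le_sq' ?_ (norm_nonneg _)).2
  rw [norm_sq_eq_add]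
  have := Finset.single_le_sum (f := fun i => ‖grad u i‖ ^ 2) (fun _ _ => by positivity)
    (Finset.mem_univ i)
  have h2 := sq_nonneg ‖val u‖
  linarith

/-- `val` as a continuous linear map. -/
noncomputable def valL (m : ℕ) (R : ℝ) : HTilde m R →L[ℂ] L2 (strip m R) :=
  LinearMap.mkContinuous
    { toFun := val
      map_add' := fun _ _ => rfl
      map_smul' := fun _ _ => rfl } 1 fun u => by rw [one_mul]; exact norm_val_le u

/-- A component of `grad` as a continuous linear map. -/
noncomputable def gradL (m : ℕ) (R : ℝ) (i : Option (Fin m)) : HTilde m R →L[ℂ] L2 (strip m R) :=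
  LinearMap.mkContinuous
    { toFun := fun u => grad u i
      map_add' := fun _ _ => rfl
      map_smul' := fun _ _ => rfl } 1 fun u => by rw [one_mul]; exact norm_grad_le u i

@[simp] theorem valL_apply (u : HTilde m R) : valL m R u = val u := rfl

@[simp] theorem gradL_apply (u : HTilde m R) (i : Option (Fin m)) : gradL m R i u = grad u i := rfl

/-- Integration of an `L²` function against a fixed `L²` function. -/
noncomputable def pairL {α : Type*} [MeasurableSpace α] {μ : Measure α} {ψ : α → ℂ}
    (hψ : MemLp ψ 2 μ) : Lp ℂ 2 μ →L[ℂ] ℂ := innerSL ℂ (hψ.star.toLp (star ψ))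

theorem pairL_apply {α : Type*} [MeasurableSpace α] {μ : Measure α} {ψ : α → ℂ}
    (hψ : MemLp ψ 2 μ) (f : Lp ℂ 2 μ) : pairL hψ f = ∫ x, f x * ψ x ∂μ := by
  rw [pairL, innerSL_apply_apply, L2.inner_def]
  refine integral_congr_ae ?_
  filter_upwards [hψ.star.coeFn_toLp] with x hx
  simp [hx]

/-- The two sides of the integration by parts formula that defines the trace are continuous. -/
theorem isTrace_of_tendsto {w : ℕ → HTilde m R} {g : ℕ → L2Top m} {u : HTilde m R} {g₀ : L2Top m}
    (hw : Tendsto w atTop (𝓝 u)) (hg : Tendsto g atTop (𝓝 g₀)) (h : ∀ n, IsTrace (w n) (g n)) :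
    IsTrace u g₀ := by
  intro φ hφ
  have m1 : MemLp φ 2 (volume.restrict (strip m R)) := (hφ.memLp 2).restrict _
  have m2 : MemLp (pd none φ) 2 (volume.restrict (strip m R)) := ((hφ.pd none).memLp 2).restrict _
  have m3 : MemLp (fun y : EuclideanSpace ℝ (Fin m) => φ (y, R)) 2 volume :=
    (hφ.slice R).continuous.memLp_of_hasCompactSupport (hasCompactSupport_slice hφ.2 R)
  have h1 : ∀ n, pairL m1 (gradL m R none (w n)) + pairL m2 (valL m R (w n)) = pairL m3 (g n) := by
    intro n
    rw [pairL_apply, pairL_apply, pairL_apply]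
    exact h n φ hφ
  have t1 := ((((pairL m1).continuous.comp (gradL m R none).continuous).tendsto u).comp hw).add
    ((((pairL m2).continuous.comp (valL m R).continuous).tendsto u).comp hw)
  have t2 := ((pairL m3).continuous.tendsto g₀).comp hg
  have h2 := tendsto_nhds_unique (t1.congr fun n => h1 n) t2
  simp only [Function.comp_apply, pairL_apply] at h2
  exact h2

theorem isTrace_unique {u : HTilde m R} {g g' : L2Top m} (h : IsTrace u g) (h' : IsTrace u g') :
    g = g' := by
  refine Lp.ext (ae_eq_of_integral_contDiff_smul_eq ((Lp.memLp g).locallyIntegrable (by norm_num))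
    ((Lp.memLp g').locallyIntegrable (by norm_num)) fun ψ hψ hs => ?_)
  let χ : ContDiffBump R := ⟨1, 2, one_pos, one_lt_two⟩
  have hχ : χ R = 1 := χ.one_of_mem_closedBall (by simp [χ])
  have hφ : IsTest fun x : Pt m => ((ψ x.1 * χ x.2 : ℝ) : ℂ) := by
    refine ⟨Complex.ofRealCLM.contDiff.comp
      ((hψ.comp contDiff_fst).mul (χ.contDiff.comp contDiff_snd)), ?_⟩
    refine HasCompactSupport.intro (hs.isCompact.prod χ.hasCompactSupport.isCompact) fun x hx => ?_
    by_cases h1 : x.1 ∈ tsupport ψ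
    · have : χ x.2 = 0 := image_eq_zero_of_notMem_tsupport fun h2 => hx ⟨h1, h2⟩
      simp [this]
    · simp [image_eq_zero_of_notMem_tsupport h1]
  have e := (h _ hφ).symm.trans (h' _ hφ)
  simp only [hχ, mul_one] at e
  simp only [Complex.real_smul]
  convert e using 2 <;> · ext y; ring

/-- The trace of a test function is its slice at height `R`. -/
theorem isTrace_ofTest {φ : Pt m → ℂ} (hφ : IsUpperTest φ) (hR : 0 ≤ R) :
    IsTrace (ofTest R hφ) ((sliceSchwartz hφ.1 R).toLp 2) := by
  intro ψ hψ
  have hmul : IsTest fun x => φ x * ψ x := IsTest.mul hφ.1.1 hψ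
  have hφψ := hψ.integrable_mul (hφ.1.memLp 2)
  have e1 : (∫ x in strip m R, grad (ofTest R hφ) none x * ψ x)
      = ∫ x in strip m R, pd none φ x * ψ x := by
    rw [← integral_indicator_mul _ measurableSet_strip, ← integral_indicator_mul _ measurableSet_strip]
    refine integral_congr_ae ?_
    filter_upwards [extGrad_ofTest (R := R) hφ none] with x hx
    rw [← hx]; rfl
  have e2 : (∫ x in strip m R, val (ofTest R hφ) x * pd none ψ x)
      = ∫ x in strip m R, φ x * pd none ψ x := by
    rw [← integral_indicator_mul _ measurableSet_strip, ← integral_indicator_mul _ measurableSet_strip]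
    refine integral_congr_ae ?_
    filter_upwards [extVal_ofTest (R := R) hφ] with x hx
    rw [← hx]; rfl
  change (∫ x in strip m R, grad (ofTest R hφ) none x * ψ x)
    + (∫ x in strip m R, val (ofTest R hφ) x * pd none ψ x) = _
  have hi := memLp_one_iff_integrable.1 ((hmul.pd none).memLp 1)
  have hset : strip m R = Set.univ ×ˢ Set.Ioo 0 R := by ext x; simp [strip]
  rw [e1, e2, ← integral_add (hψ.integrable_mul ((hφ.1.pd none).memLp 2)).restrict
    ((hψ.pd none).integrable_mul (hφ.1.memLp 2)).restrict]
  calc _ = ∫ x in strip m R, pd none (fun x => φ x * ψ x) x := by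
        refine integral_congr_ae (Eventually.of_forall fun x => ?_)
        simp only
        rw [pd_mul hφ.1.differentiable.differentiableAt hψ.differentiable.differentiableAt]
        ring
    _ = ∫ y, ∫ t in Set.Ioo 0 R, pd none (fun x => φ x * ψ x) (y, t) := by
        have h := setIntegral_prod (μ := (volume : Measure (EuclideanSpace ℝ (Fin m))))
          (ν := (volume : Measure ℝ)) (s := Set.univ) (t := Set.Ioo 0 R) _ hi.integrableOn
        rw [Measure.restrict_univ, ← hset] at h
        exact h
    _ = ∫ y, φ (y, R) * ψ (y, R) := by
        refine integral_congr_ae (Eventually.of_forall fun y => ?_)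
        simp only
        rw [← integral_Ioc_eq_integral_Ioo, ← intervalIntegral.integral_of_le hR,
          intervalIntegral.integral_eq_sub_of_hasDerivAt (fun t _ => hasDerivAt_vertical hmul y t)
          (((hmul.pd none).1.continuous.comp (by fun_prop)).intervalIntegrable _ _),
          hφ.eq_zero (x := (y, 0)) le_rfl]
        ring
    _ = _ := by
        refine integral_congr_ae ?_
        filter_upwards [(sliceSchwartz hφ.1 R).coeFn_toLp 2 volume] with y hy
        rw [hy]; rfl

/-- Mathlib's Fourier transform of an `L²` function on `ℝ^m`, as a function. -/
noncomputable def ft (g : L2Top m) : EuclideanSpace ℝ (Fin m) → ℂ :=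
  Lp.fourierTransformₗᵢ (EuclideanSpace ℝ (Fin m)) ℂ g

theorem memLp_ft (g : L2Top m) : MemLp (ft g) 2 volume := Lp.memLp _

theorem ft_toLp {φ : Pt m → ℂ} (hφ : IsTest φ) (t : ℝ) :
    ft ((sliceSchwartz hφ t).toLp 2) =ᵐ[volume] sliceFT φ t := by
  have h : Lp.fourierTransformₗᵢ (EuclideanSpace ℝ (Fin m)) ℂ ((sliceSchwartz hφ t).toLp 2)
      = (𝓕 (sliceSchwartz hφ t)).toLp 2 := SchwartzMap.toLp_fourier_eq _
  rw [ft, h, sliceFT_eq_fourier]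
  exact SchwartzMap.coeFn_toLp _ 2 volume

/-- The square of the `H^{1/2}` norm, up to constants. -/
noncomputable def halfEnergy (g : L2Top m) : ℝ≥0∞ := ∫⁻ η, (1 + ‖η‖ₑ) * ‖ft g η‖ₑ ^ 2

theorem halfEnergy_ofTest_le {φ : Pt m → ℂ} (hφ : IsUpperTest φ) (hR : 0 ≤ R) :
    halfEnergy ((sliceSchwartz hφ.1 R).toLp 2) ≤ 2 * ENNReal.ofReal (‖ofTest R hφ‖ ^ 2) := by
  rw [← eenergy_eq hφ]
  refine le_of_eq_of_le (lintegral_congr_ae ?_) (lintegral_weighted_sliceFT_le hφ hR)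
  filter_upwards [ft_toLp hφ.1 R] with η h
  rw [h]

theorem ofTest_sub {φ ψ : Pt m → ℂ} (hφ : IsUpperTest φ) (hψ : IsUpperTest ψ) :
    ‖ofTest R (hφ.sub hψ)‖ = ‖ofTest R hφ - ofTest R hψ‖ := by
  rw [← sq_eq_sq₀ (norm_nonneg _) (norm_nonneg _), norm_sq_eq_integral_energy,
    norm_sq_eq_integral_energy]
  refine integral_congr_ae ?_
  filter_upwards [extVal_ofTest (R := R) hφ, extVal_ofTest (R := R) hψ,
    extVal_ofTest (R := R) (hφ.sub hψ), extVal_sub (ofTest R hφ) (ofTest R hψ),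
    ae_all_iff.2 fun i => extGrad_ofTest (R := R) hφ i,
    ae_all_iff.2 fun i => extGrad_ofTest (R := R) hψ i,
    ae_all_iff.2 fun i => extGrad_ofTest (R := R) (hφ.sub hψ) i,
    ae_all_iff.2 fun i => extGrad_sub (ofTest R hφ) (ofTest R hψ) i] with x a1 a2 a3 a4 b1 b2 b3 b4
  simp only [energy, a1, a2, a3, a4, b1, b2, b3, b4]
  by_cases hx : x ∈ strip m R
  · simp only [Set.indicator_of_mem hx,
      pd_sub hφ.1.differentiable.differentiableAt hψ.1.differentiable.differentiableAt]
  · simp [Set.indicator_of_notMem hx]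

theorem norm_toLp_slice_sub_le {φ ψ : Pt m → ℂ} (hφ : IsUpperTest φ) (hψ : IsUpperTest ψ)
    (hR : 0 ≤ R) : ‖(sliceSchwartz hφ.1 R).toLp 2 volume - (sliceSchwartz hψ.1 R).toLp 2 volume‖
      ≤ ‖ofTest R hφ - ofTest R hψ‖ := by
  rw [← ofTest_sub]
  have h := lintegral_slice_le (hφ.sub hψ) hR le_rfl
  rw [eenergy_eq (hφ.sub hψ), ENNReal.ofReal_pow (norm_nonneg _), ← eLpNorm_two_le_iff] at h
  rw [Lp.norm_def]
  refine ENNReal.toReal_le_of_le_ofReal (norm_nonneg _) (le_of_eq_of_le (eLpNorm_congr_ae ?_) h)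
  filter_upwards [Lp.coeFn_sub ((sliceSchwartz hφ.1 R).toLp 2 volume)
    ((sliceSchwartz hψ.1 R).toLp 2 volume),
    (sliceSchwartz hφ.1 R).coeFn_toLp 2 volume, (sliceSchwartz hψ.1 R).coeFn_toLp 2 volume]
    with y h1 h2 h3
  rw [h1, Pi.sub_apply, h2, h3]
  rfl

/-- The trace theorem. -/
theorem exists_isTrace (hR : 0 ≤ R) (u : HTilde m R) :
    ∃ g, IsTrace u g ∧ halfEnergy g ≤ 2 * ENNReal.ofReal (‖u‖ ^ 2) := by
  obtain ⟨φ, hφ, hlim, -⟩ := exists_seq_ofTest u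
  let g : ℕ → L2Top m := fun n => (sliceSchwartz (hφ n).1 R).toLp 2
  have hcauchy : CauchySeq g := by
    have h := hlim.cauchySeq
    rw [Metric.cauchySeq_iff] at h ⊢
    intro ε hε
    obtain ⟨N, hN⟩ := h ε hε
    refine ⟨N, fun a ha b hb => lt_of_le_of_lt ?_ (hN a ha b hb)⟩
    rw [dist_eq_norm, dist_eq_norm]
    exact norm_toLp_slice_sub_le (hφ a) (hφ b) hR
  obtain ⟨g₀, hg₀⟩ := cauchySeq_tendsto_of_complete hcauchy
  refine ⟨g₀, isTrace_of_tendsto hlim hg₀ fun n => isTrace_ofTest (hφ n) hR, ?_⟩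
  have hF : Tendsto (fun n => eLpNorm (ft (g n) - ft g₀) 2 volume) atTop (𝓝 0) := by
    have h1 := ((Lp.fourierTransformₗᵢ (EuclideanSpace ℝ (Fin m)) ℂ).continuous.tendsto g₀).comp hg₀
    exact (Lp.tendsto_Lp_iff_tendsto_eLpNorm' _ _).1 h1
  obtain ⟨ns, hns, hae⟩ := (tendstoInMeasure_of_tendsto_eLpNorm_of_ne_top two_ne_zero (by simp)
    (fun n => (memLp_ft (g n)).1) (memLp_ft g₀).1 hF).exists_seq_tendsto_ae
  have hm : ∀ n, AEMeasurable (fun η => (1 + ‖η‖ₑ) * ‖ft (g (ns n)) η‖ₑ ^ 2) volume := fun n =>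
    (measurable_const.add measurable_id.enorm).aemeasurable.mul
      ((memLp_ft (g (ns n))).1.enorm.pow_const 2)
  have h1 : Tendsto (fun n => 2 * ENNReal.ofReal (‖ofTest R (hφ (ns n))‖ ^ 2)) atTop
      (𝓝 (2 * ENNReal.ofReal (‖u‖ ^ 2))) :=
    ENNReal.Tendsto.const_mul ((ENNReal.continuous_ofReal.tendsto _).comp
      (((hlim.comp hns.tendsto_atTop).norm).pow 2)) (Or.inr (by simp))
  calc halfEnergy g₀ = ∫⁻ η, liminf (fun n => (1 + ‖η‖ₑ) * ‖ft (g (ns n)) η‖ₑ ^ 2) atTop := by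
        refine lintegral_congr_ae ?_
        filter_upwards [hae] with η h
        exact (Tendsto.liminf_eq (ENNReal.Tendsto.const_mul
          (((ENNReal.continuous_pow 2).tendsto _).comp h.enorm) (Or.inr (by simp)))).symm
    _ ≤ liminf (fun n => ∫⁻ η, (1 + ‖η‖ₑ) * ‖ft (g (ns n)) η‖ₑ ^ 2) atTop :=
        lintegral_liminf_le' hm
    _ ≤ liminf (fun n => 2 * ENNReal.ofReal (‖ofTest R (hφ (ns n))‖ ^ 2)) atTop :=
        liminf_le_liminf (Eventually.of_forall fun n => halfEnergy_ofTest_le (hφ (ns n)) hR)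
    _ = _ := h1.liminf_eq

theorem isTrace_trace (hR : 0 ≤ R) (u : HTilde m R) : IsTrace u (trace u) := by
  have h : ∃ g, IsTrace u g := (exists_isTrace hR u).imp fun _ h => h.1
  rw [trace, dif_pos h]
  exact h.choose_spec

theorem trace_eq {u : HTilde m R} {g : L2Top m} (h : IsTrace u g) : trace u = g := by
  have h' : ∃ g, IsTrace u g := ⟨g, h⟩
  rw [trace, dif_pos h']
  exact isTrace_unique h'.choose_spec h

theorem halfEnergy_trace_le (hR : 0 ≤ R) (u : HTilde m R) :
    halfEnergy (trace u) ≤ ENNReal.ofReal (2 * ‖u‖ ^ 2) := by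
  obtain ⟨g, h1, h2⟩ := exists_isTrace hR u
  rwa [trace_eq h1, ENNReal.ofReal_mul zero_le_two, ENNReal.ofReal_ofNat]

/-! ### The Dirichlet-to-Neumann form -/

theorem IsTrace.add {u v : HTilde m R} {g h : L2Top m} (hu : IsTrace u g) (hv : IsTrace v h) :
    IsTrace (u + v) (g + h) := by
  intro φ hφ
  have m1 : MemLp φ 2 (volume.restrict (strip m R)) := (hφ.memLp 2).restrict _
  have m2 : MemLp (pd none φ) 2 (volume.restrict (strip m R)) := ((hφ.pd none).memLp 2).restrict _
  have m3 : MemLp (fun y : EuclideanSpace ℝ (Fin m) => φ (y, R)) 2 volume :=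
    (hφ.slice R).continuous.memLp_of_hasCompactSupport (hasCompactSupport_slice hφ.2 R)
  have h1 : pairL m1 (gradL m R none u) + pairL m2 (valL m R u) = pairL m3 g := by
    rw [pairL_apply, pairL_apply, pairL_apply]; exact hu φ hφ
  have h2 : pairL m1 (gradL m R none v) + pairL m2 (valL m R v) = pairL m3 h := by
    rw [pairL_apply, pairL_apply, pairL_apply]; exact hv φ hφ
  have h3 : pairL m1 (gradL m R none (u + v)) + pairL m2 (valL m R (u + v)) = pairL m3 (g + h) := by
    simp only [map_add]
    rw [← h1, ← h2]
    abel
  rw [pairL_apply, pairL_apply, pairL_apply] at h3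
  exact h3

theorem IsTrace.smul {u : HTilde m R} {g : L2Top m} (hu : IsTrace u g) (c : ℂ) :
    IsTrace (c • u) (c • g) := by
  intro φ hφ
  have m1 : MemLp φ 2 (volume.restrict (strip m R)) := (hφ.memLp 2).restrict _
  have m2 : MemLp (pd none φ) 2 (volume.restrict (strip m R)) := ((hφ.pd none).memLp 2).restrict _
  have m3 : MemLp (fun y : EuclideanSpace ℝ (Fin m) => φ (y, R)) 2 volume :=
    (hφ.slice R).continuous.memLp_of_hasCompactSupport (hasCompactSupport_slice hφ.2 R)
  have h1 : pairL m1 (gradL m R none u) + pairL m2 (valL m R u) = pairL m3 g := by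
    rw [pairL_apply, pairL_apply, pairL_apply]; exact hu φ hφ
  have h3 : pairL m1 (gradL m R none (c • u)) + pairL m2 (valL m R (c • u)) = pairL m3 (c • g) := by
    simp only [map_smul]
    rw [← h1, smul_add]
  rw [pairL_apply, pairL_apply, pairL_apply] at h3
  exact h3

theorem trace_add (hR : 0 ≤ R) (u v : HTilde m R) : trace (u + v) = trace u + trace v :=
  trace_eq ((isTrace_trace hR u).add (isTrace_trace hR v))

theorem trace_smul (hR : 0 ≤ R) (c : ℂ) (u : HTilde m R) : trace (c • u) = c • trace u :=
  trace_eq ((isTrace_trace hR u).smul c)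

/-- The symbol of the Dirichlet-to-Neumann map in the variable of Mathlib's Fourier transform. -/
noncomputable def symbol (k : ℝ) (η : EuclideanSpace ℝ (Fin m)) : ℂ :=
  Complex.I * branchSqrt (k ^ 2 - ‖(2 * Real.pi) • η‖ ^ 2)

theorem symbol_re_nonpos (k : ℝ) (η : EuclideanSpace ℝ (Fin m)) : (symbol k η).re ≤ 0 := by
  simp [symbol, branchSqrt, Real.sqrt_nonneg]

theorem symbol_im_nonneg (k : ℝ) (η : EuclideanSpace ℝ (Fin m)) : 0 ≤ (symbol k η).im := by
  simp [symbol, branchSqrt, Real.sqrt_nonneg]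

theorem norm_symbol_le {k : ℝ} (hk : 0 < k) (η : EuclideanSpace ℝ (Fin m)) :
    ‖symbol k η‖ ≤ (k + 2 * Real.pi) * (1 + ‖η‖) := by
  have hpi := Real.pi_pos
  have h1 : √(k ^ 2 - ‖(2 * Real.pi) • η‖ ^ 2) ≤ k := by
    rw [Real.sqrt_le_left hk.le]
    nlinarith [sq_nonneg ‖(2 * Real.pi) • η‖]
  have h2 : √(-(k ^ 2 - ‖(2 * Real.pi) • η‖ ^ 2)) ≤ 2 * Real.pi * ‖η‖ := by
    rw [Real.sqrt_le_left (by positivity), norm_smul, Real.norm_of_nonneg (by positivity)]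
    nlinarith [sq_nonneg k]
  rw [symbol, norm_mul, Complex.norm_I, one_mul, branchSqrt]
  refine (norm_add_le _ _).trans ?_
  rw [norm_mul, Complex.norm_I, one_mul, Complex.norm_real, Complex.norm_real,
    Real.norm_of_nonneg (Real.sqrt_nonneg _), Real.norm_of_nonneg (Real.sqrt_nonneg _)]
  have := norm_nonneg η
  nlinarith [mul_nonneg hk.le this]

theorem continuous_symbol (k : ℝ) : Continuous (symbol (m := m) k) := by
  unfold symbol branchSqrt
  fun_prop

theorem dtnPairing_eq (k : ℝ) (g h : L2Top m) :
    dtnPairing k g h = ∫ η, symbol k η * ft g η * conj (ft h η) := by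
  have hpi : (0 : ℝ) < 2 * Real.pi := by positivity
  let c : ℝ := (2 * Real.pi) ^ (-(m : ℝ) / 2)
  have hc : c * c * (2 * Real.pi) ^ m = 1 := by
    rw [← Real.rpow_natCast, ← Real.rpow_add hpi, ← Real.rpow_add hpi]
    rw [show -(m : ℝ) / 2 + -(m : ℝ) / 2 + m = 0 by ring, Real.rpow_zero]
  have h1 := Measure.integral_comp_inv_smul_of_nonneg (volume : Measure (EuclideanSpace ℝ (Fin m)))
    (fun η => ((c * c : ℝ) : ℂ) * (symbol k η * ft g η * conj (ft h η))) hpi.le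
  rw [finrank_euclideanSpace_fin, integral_const_mul (((c * c : ℝ) : ℂ)) (fun η =>
    symbol k η * ft g η * conj (ft h η)), Complex.real_smul, ← mul_assoc,
    ← Complex.ofReal_mul, mul_comm _ (c * c), hc, Complex.ofReal_one, one_mul] at h1
  rw [← h1, dtnPairing]
  refine integral_congr_ae (Eventually.of_forall fun ξ => ?_)
  simp only [dtnHat, fourierHat, symbol, smul_smul, mul_inv_cancel₀ hpi.ne', one_smul, map_mul,
    Complex.conj_ofReal, ft, c]
  push_cast
  ring

/-- The Cauchy-Schwarz inequality with the weight `1 + |η|`. -/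
theorem lintegral_weighted_mul_sq_le (g h : L2Top m) :
    (∫⁻ η, (1 + ‖η‖ₑ) * (‖ft g η‖ₑ * ‖ft h η‖ₑ)) ^ 2 ≤ halfEnergy g * halfEnergy h := by
  have hm : ∀ g : L2Top m, AEMeasurable (fun η => (1 + ‖η‖ₑ) ^ (1 / 2 : ℝ) * ‖ft g η‖ₑ) volume :=
    fun g => ((measurable_const.add measurable_id.enorm).pow_const _).aemeasurable.mul
      (memLp_ft g).1.enorm
  have hw : ∀ a : ℝ≥0∞, a ^ (1 / 2 : ℝ) * a ^ (1 / 2 : ℝ) = a := fun a => by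
    rw [← ENNReal.rpow_add_of_nonneg _ _ (by norm_num) (by norm_num)]; norm_num
  refine le_of_eq_of_le ?_ ((lintegral_mul_sq_le (hm g) (hm h)).trans (le_of_eq ?_))
  · congr 1
    refine lintegral_congr fun η => ?_
    conv_lhs => rw [← hw (1 + ‖η‖ₑ)]
    ring
  · congr 1 <;>
    · refine lintegral_congr fun η => ?_
      rw [mul_pow, sq ((1 + ‖η‖ₑ) ^ (1 / 2 : ℝ)), hw]

theorem enorm_symbol_mul_le {k : ℝ} (hk : 0 < k) (g h : L2Top m) (η : EuclideanSpace ℝ (Fin m)) :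
    ‖symbol k η * ft g η * conj (ft h η)‖ₑ
      ≤ ENNReal.ofReal (k + 2 * Real.pi) * ((1 + ‖η‖ₑ) * (‖ft g η‖ₑ * ‖ft h η‖ₑ)) := by
  rw [enorm_mul, enorm_mul, RCLike.enorm_conj, mul_assoc, ← mul_assoc (ENNReal.ofReal _)]
  gcongr
  rw [← ofReal_norm, ← ofReal_norm, ← ENNReal.ofReal_one,
    ← ENNReal.ofReal_add zero_le_one (norm_nonneg _),
    ← ENNReal.ofReal_mul (by have := Real.pi_pos; positivity)]
  exact ENNReal.ofReal_le_ofReal (norm_symbol_le hk η)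

theorem integrable_symbol_mul {k : ℝ} (hk : 0 < k) {g h : L2Top m} (hg : halfEnergy g ≠ ⊤)
    (hh : halfEnergy h ≠ ⊤) :
    Integrable (fun η => symbol k η * ft g η * conj (ft h η)) volume := by
  refine ⟨((continuous_symbol k).aestronglyMeasurable.mul (memLp_ft g).1).mul
    (Complex.continuous_conj.comp_aestronglyMeasurable (memLp_ft h).1), ?_⟩
  refine lt_of_le_of_lt (lintegral_mono fun η => enorm_symbol_mul_le hk g h η) ?_
  rw [lintegral_const_mul' _ _ (by simp)]
  refine ENNReal.mul_lt_top (by simp) (ENNReal.pow_lt_top_iff.1 (lt_of_le_of_lt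
    (lintegral_weighted_mul_sq_le g h) (ENNReal.mul_lt_top hg.lt_top hh.lt_top)) |>.resolve_right
      two_ne_zero)

theorem halfEnergy_trace_ne_top (hR : 0 ≤ R) (u : HTilde m R) : halfEnergy (trace u) ≠ ⊤ :=
  ne_top_of_le_ne_top (by finiteness) (halfEnergy_trace_le hR u)

/-- The Dirichlet-to-Neumann pairing is bounded: its symbol grows linearly, and the `H^{1/2}` energy
of a trace is bounded by the `H¹` norm. -/
theorem norm_dtnPairing_trace_le {k : ℝ} (hk : 0 < k) (hR : 0 ≤ R) (u v : HTilde m R) :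
    ‖dtnPairing k (trace u) (trace v)‖ ≤ 2 * (k + 2 * Real.pi) * ‖u‖ * ‖v‖ := by
  have hpi := Real.pi_pos
  rw [dtnPairing_eq]
  have h1 := (enorm_integral_le_lintegral_enorm (μ := volume) _).trans (lintegral_mono fun η =>
    enorm_symbol_mul_le hk (trace u) (trace v) η)
  rw [lintegral_const_mul' _ _ (by simp)] at h1
  have h2 := pow_le_pow_left' h1 2
  have h3 := (lintegral_weighted_mul_sq_le (trace u) (trace v)).trans
    (mul_le_mul' (halfEnergy_trace_le hR u) (halfEnergy_trace_le hR v))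
  rw [mul_pow] at h2
  have h4 := h2.trans (mul_le_mul' le_rfl h3)
  rw [← ofReal_norm, ← ENNReal.ofReal_pow (norm_nonneg _), ← ENNReal.ofReal_pow (by positivity),
    ← ENNReal.ofReal_mul (by positivity), ← ENNReal.ofReal_mul (by positivity), ENNReal.ofReal_le_ofReal_iff (by positivity)] at h4
  refine (abs_le_of_sq_le_sq' (h4.trans (le_of_eq ?_)) (by positivity)).2
  ring

theorem ft_add (g h : L2Top m) : ft (g + h) =ᵐ[volume] ft g + ft h := by
  rw [ft, map_add]; exact Lp.coeFn_add _ _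

theorem ft_smul (c : ℂ) (g : L2Top m) : ft (c • g) =ᵐ[volume] c • ft g := by
  rw [ft, map_smul]; exact Lp.coeFn_smul _ _

/-- The boundary term of the sesquilinear form as a bounded sesquilinear map. -/
noncomputable def dtnL {k : ℝ} (hk : 0 < k) (hR : 0 ≤ R) :
    HTilde m R →L[ℂ] (HTilde m R →L⋆[ℂ] ℂ) :=
  LinearMap.mkContinuous₂ (LinearMap.mk₂'ₛₗ (RingHom.id ℂ) (starRingEnd ℂ)
    (fun u v => dtnPairing k (trace u) (trace v))
    (fun u u' v => by
      simp only [dtnPairing_eq, trace_add hR]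
      rw [← integral_add (integrable_symbol_mul hk (halfEnergy_trace_ne_top hR _)
        (halfEnergy_trace_ne_top hR _)) (integrable_symbol_mul hk (halfEnergy_trace_ne_top hR _)
        (halfEnergy_trace_ne_top hR _))]
      refine integral_congr_ae ?_
      filter_upwards [ft_add (trace u) (trace u')] with η h
      rw [h, Pi.add_apply]; ring)
    (fun c u v => by
      simp only [dtnPairing_eq, trace_smul hR]
      rw [smul_eq_mul, ← integral_const_mul]
      refine integral_congr_ae ?_
      filter_upwards [ft_smul c (trace u)] with η h
      rw [h, Pi.smul_apply, smul_eq_mul, RingHom.id_apply]; ring)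
    (fun u v v' => by
      simp only [dtnPairing_eq, trace_add hR]
      rw [← integral_add (integrable_symbol_mul hk (halfEnergy_trace_ne_top hR _)
        (halfEnergy_trace_ne_top hR _)) (integrable_symbol_mul hk (halfEnergy_trace_ne_top hR _)
        (halfEnergy_trace_ne_top hR _))]
      refine integral_congr_ae ?_
      filter_upwards [ft_add (trace v) (trace v')] with η h
      rw [h, Pi.add_apply, map_add]; ring)
    (fun c u v => by
      simp only [dtnPairing_eq, trace_smul hR]
      rw [smul_eq_mul, ← integral_const_mul]
      refine integral_congr_ae ?_
      filter_upwards [ft_smul c (trace v)] with η h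
      rw [h, Pi.smul_apply, smul_eq_mul, map_mul]; ring))
    (2 * (k + 2 * Real.pi)) fun u v => norm_dtnPairing_trace_le hk hR u v

theorem dtnL_apply {k : ℝ} (hk : 0 < k) (hR : 0 ≤ R) (u v : HTilde m R) :
    dtnL hk hR u v = dtnPairing k (trace u) (trace v) := rfl

theorem dtnPairing_self_re {k : ℝ} (hk : 0 < k) (hR : 0 ≤ R) (u : HTilde m R) :
    (dtnPairing k (trace u) (trace u)).re ≤ 0 := by
  rw [dtnPairing_eq]
  have h := integral_re (𝕜 := ℂ) (integrable_symbol_mul hk (halfEnergy_trace_ne_top hR u)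
    (halfEnergy_trace_ne_top hR u))
  simp only [RCLike.re_to_complex] at h
  rw [← h]
  refine integral_nonpos fun η => ?_
  simp only [mul_assoc, Complex.mul_conj, Complex.re_mul_ofReal, Pi.zero_apply]
  exact mul_nonpos_of_nonpos_of_nonneg (symbol_re_nonpos k η) (Complex.normSq_nonneg _)

theorem dtnPairing_self_im {k : ℝ} (hk : 0 < k) (hR : 0 ≤ R) (u : HTilde m R) :
    0 ≤ (dtnPairing k (trace u) (trace u)).im := by
  rw [dtnPairing_eq]
  have h := integral_im (𝕜 := ℂ) (integrable_symbol_mul hk (halfEnergy_trace_ne_top hR u)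
    (halfEnergy_trace_ne_top hR u))
  simp only [RCLike.im_to_complex] at h
  rw [← h]
  refine integral_nonneg fun η => ?_
  simp only [mul_assoc, Complex.mul_conj, Complex.im_mul_ofReal, Pi.zero_apply]
  exact mul_nonneg (symbol_im_nonneg k η) (Complex.normSq_nonneg _)

/-- Functions supported away from `Γ^R` have trace zero. -/
theorem trace_ofTest_eq_zero {φ : Pt m → ℂ} (hφ : IsUpperTest φ) (hR : 0 ≤ R)
    (hs : tsupport φ ⊆ {x | x.2 < R}) : trace (ofTest R hφ) = 0 := by
  rw [trace_eq (isTrace_ofTest hφ hR)]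
  have : sliceSchwartz hφ.1 R = 0 := by
    ext y
    have h0 : φ (y, R) = 0 :=
      image_eq_zero_of_notMem_tsupport fun h => lt_irrefl R (by simpa using hs h)
    exact h0
  rw [this]
  exact map_zero (SchwartzMap.toLpCLM ℂ ℂ 2 (volume : Measure (EuclideanSpace ℝ (Fin m))))

/-! ### The local estimate on a box -/

/-- The box of horizontal half-width `N` in the strip. -/
def box (m : ℕ) (N R : ℝ) : Set (Pt m) := {x | (∀ i, |x.1 i| < N) ∧ 0 < x.2 ∧ x.2 < R}

theorem box_subset_strip (N : ℝ) : box m N R ⊆ strip m R := fun _ hx => hx.2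

theorem box_mono {N N' : ℝ} (h : N ≤ N') : box m N R ⊆ box m N' R :=
  fun _ hx => ⟨fun i => (hx.1 i).trans_le h, hx.2⟩

theorem isOpen_box (N : ℝ) : IsOpen (box m N R) := by
  have h : box m N R = (⋂ i : Fin m, {x : Pt m | |x.1 i| < N}) ∩ strip m R := by
    ext x; simp [box, strip]
  rw [h]
  exact (isOpen_iInter_of_finite fun i => isOpen_lt (by fun_prop) continuous_const).inter isOpen_strip

theorem measurableSet_box (N : ℝ) : MeasurableSet (box m N R) := (isOpen_box N).measurableSet

theorem convex_box (N : ℝ) : Convex ℝ (box m N R) := by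
  have h : box m N R = (⋂ i : Fin m, {x : Pt m | x.1 i ∈ Set.Ioo (-N) N})
      ∩ {x : Pt m | x.2 ∈ Set.Ioo 0 R} := by
    ext x; simp [box, abs_lt]
  rw [h]
  refine (convex_iInter fun i => ?_).inter ?_
  · exact (convex_Ioo (-N) N).is_linear_preimage (f := fun x : Pt m => x.1 i)
      ⟨fun _ _ => rfl, fun _ _ => rfl⟩
  · exact (convex_Ioo 0 R).is_linear_preimage (f := fun x : Pt m => x.2)
      ⟨fun _ _ => rfl, fun _ _ => rfl⟩

theorem isBounded_box (N : ℝ) : Bornology.IsBounded (box m N R) := by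
  rw [isBounded_iff_forall_norm_le]
  refine ⟨√(∑ _i : Fin m, N ^ 2) + |R|, fun x hx => ?_⟩
  rw [Prod.norm_def]
  refine max_le ?_ ?_
  · refine le_trans ?_ (le_add_of_nonneg_right (abs_nonneg R))
    rw [EuclideanSpace.norm_eq]
    refine Real.sqrt_le_sqrt (Finset.sum_le_sum fun i _ => ?_)
    rw [Real.norm_eq_abs]
    exact pow_le_pow_left₀ (abs_nonneg _) (hx.1 i).le 2
  · refine le_trans ?_ (le_add_of_nonneg_left (Real.sqrt_nonneg _))
    rw [Real.norm_of_nonneg hx.2.1.le]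
    exact hx.2.2.le.trans (le_abs_self R)

theorem volume_box_lt_top (N : ℝ) : volume (box m N R) < ⊤ := (isBounded_box N).measure_lt_top

/-- `u` is an `H¹` function on the strip with vanishing trace on `Γ^0` and with gradient `g`, both
extended by zero. -/
structure IsLayer (R : ℝ) (u : Pt m → ℂ) (g : Option (Fin m) → Pt m → ℂ) : Prop where
  isH1 : IsH1 {x | x.2 < R} u g
  val_zero : ∀ x ∉ strip m R, u x = 0
  grad_zero : ∀ i, ∀ x ∉ strip m R, g i x = 0

theorem isLayer_ext (u : HTilde m R) : IsLayer R (extVal u) (extGrad u) where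
  isH1 := isH1_ext u
  val_zero _ hx := Set.indicator_of_notMem hx _
  grad_zero _ _ hx := Set.indicator_of_notMem hx _

/-- The functions that enter the equation `(-Δ - V) u = (-Δ + 1) w + p`. -/
structure LayerData (m : ℕ) where
  /-- The solution. -/
  u : Pt m → ℂ
  /-- The gradient of the solution. -/
  du : Option (Fin m) → Pt m → ℂ
  /-- The Riesz representative of the right hand side. -/
  w : Pt m → ℂ
  /-- The gradient of `w`. -/
  dw : Option (Fin m) → Pt m → ℂ
  /-- The part of the right hand side that is in `L²`. -/
  p : Pt m → ℂ

/-- The equation `(-Δ - V) u = (-Δ + 1) w + p` holds in the box of half-width `N + 1`. -/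
structure LocalEq (N R : ℝ) (V : Pt m → ℂ) (d : LayerData m) : Prop where
  isLayer_u : IsLayer R d.u d.du
  isLayer_w : IsLayer R d.w d.dw
  memLp_p : MemLp d.p 2 volume
  eq : ∀ φ : Pt m → ℂ, IsTest φ → tsupport φ ⊆ box m (N + 1) R →
    (∑ i, ∫ x, d.du i x * pd i φ x) - ∫ x, V x * d.u x * φ x
      = (∑ i, ∫ x, d.dw i x * pd i φ x) + ∫ x, (d.w x + d.p x) * φ x

/-- The energy of the solution in the larger box. -/
noncomputable def LayerData.size (d : LayerData m) (N R : ℝ) : ℝ :=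
  ∫ x in box m (N + 1) R, energy d.u d.du x

/-- What controls the solution: the right hand sides and the absorbed energy. -/
noncomputable def LayerData.defect (d : LayerData m) (N R : ℝ) (σ : Pt m → ℝ) : ℝ :=
  ∫ x in box m (N + 1) R, (energy d.w d.dw x + ‖d.p x‖ ^ 2 + σ x * ‖d.u x‖ ^ 2)

/-- A non-negative bounded absorption coefficient. -/
structure IsAbsorption (σ : Pt m → ℝ) : Prop where
  aesm : AEStronglyMeasurable σ volume
  nonneg : ∀ᵐ x, 0 ≤ σ x
  bdd : ∃ M, ∀ᵐ x, σ x ≤ M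

/-- A bounded potential. -/
structure IsPotential (M : ℝ) (V : Pt m → ℂ) : Prop where
  aesm : AEStronglyMeasurable V volume
  bdd : ∀ᵐ x, ‖V x‖ ≤ M

theorem IsPotential.memLp_mul {M : ℝ} {V : Pt m → ℂ} (hV : IsPotential M V) {u : Pt m → ℂ}
    (hu : MemLp u 2 volume) : MemLp (fun x => V x * u x) 2 volume := by
  refine MemLp.of_le_mul (c := M) hu (hV.aesm.mul hu.1) ?_
  filter_upwards [hV.bdd] with x hx
  rw [norm_mul]
  gcongr

theorem IsAbsorption.integrable_mul {σ : Pt m → ℝ} (hσ : IsAbsorption σ) {u : Pt m → ℂ}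
    (hu : MemLp u 2 volume) : Integrable (fun x => σ x * ‖u x‖ ^ 2) volume := by
  obtain ⟨M, hM⟩ := hσ.bdd
  refine ((integrable_norm_sq hu).const_mul M).mono' (hσ.aesm.mul (hu.1.norm.pow 2)) ?_
  filter_upwards [hM, hσ.nonneg] with x h1 h2
  rw [norm_mul, Real.norm_of_nonneg h2, Real.norm_of_nonneg (by positivity)]
  gcongr

theorem LocalEq.integrable_defect {N : ℝ} {V : Pt m → ℂ} {d : LayerData m} (h : LocalEq N R V d)
    {σ : Pt m → ℝ} (hσ : IsAbsorption σ) :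
    Integrable (fun x => energy d.w d.dw x + ‖d.p x‖ ^ 2 + σ x * ‖d.u x‖ ^ 2) volume :=
  (h.isLayer_w.isH1.integrable_energy.add (integrable_norm_sq h.memLp_p)).add
    (hσ.integrable_mul h.isLayer_u.isH1.memLp)

theorem setIntegral_le_of_ae {f g : Pt m → ℝ} {s t : Set (Pt m)}
    (hst : s ⊆ t) (hg : Integrable g volume) (hf0 : ∀ x, 0 ≤ f x) (hfg : ∀ᵐ x, f x ≤ g x) :
    ∫ x in s, f x ≤ ∫ x in t, g x := by
  have hg0 : 0 ≤ᵐ[volume.restrict t] g :=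
    ae_restrict_of_ae (hfg.mono fun x h => (hf0 x).trans h)
  refine (integral_mono_of_nonneg (Eventually.of_forall hf0) hg.integrableOn
    (ae_restrict_of_ae hfg)).trans (setIntegral_mono_set hg.integrableOn hg0
      (Eventually.of_forall hst))

theorem LocalEq.setIntegral_le_defect {N : ℝ} {V : Pt m → ℂ} {d : LayerData m}
    (h : LocalEq N R V d) {σ : Pt m → ℝ} (hσ : IsAbsorption σ) {f : Pt m → ℝ} {s : Set (Pt m)}
    (hs : s ⊆ box m (N + 1) R) {c : ℝ} (hf0 : ∀ x, 0 ≤ f x)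
    (hf : ∀ᵐ x, f x ≤ c * (energy d.w d.dw x + ‖d.p x‖ ^ 2 + σ x * ‖d.u x‖ ^ 2)) :
    ∫ x in s, f x ≤ c * d.defect N R σ := by
  rw [LayerData.defect, ← integral_const_mul]
  exact setIntegral_le_of_ae hs ((h.integrable_defect hσ).const_mul c) hf0 hf

theorem LayerData.size_nonneg (d : LayerData m) (N R : ℝ) : 0 ≤ d.size N R :=
  integral_nonneg fun x => energy_nonneg _ _ x

theorem LayerData.defect_nonneg (d : LayerData m) (N R : ℝ) {σ : Pt m → ℝ} (hσ : IsAbsorption σ) :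
    0 ≤ d.defect N R σ := by
  refine integral_nonneg_of_ae (ae_restrict_of_ae ?_)
  filter_upwards [hσ.nonneg] with x hx
  have := energy_nonneg d.w d.dw x
  simp only [Pi.zero_apply]
  positivity

/-- The `L²` norm on `s` of a solution is controlled by the defect, up to a small multiple of the
energy. -/
def Controlled (N R : ℝ) (V : Pt m → ℂ) (σ : Pt m → ℝ) (s : Set (Pt m)) : Prop :=
  ∀ η > 0, ∃ K ≥ 0, ∀ d : LayerData m, LocalEq N R V d →
    ∫ x in s, ‖d.u x‖ ^ 2 ≤ η * d.size N R + K * d.defect N R σ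

section Controlled

variable {N : ℝ} {V : Pt m → ℂ} {σ : Pt m → ℝ}

theorem setIntegral_norm_sq_mono {u : Pt m → ℂ} (hu : MemLp u 2 volume) {s t : Set (Pt m)}
    (hst : s ⊆ t) : ∫ x in s, ‖u x‖ ^ 2 ≤ ∫ x in t, ‖u x‖ ^ 2 :=
  setIntegral_mono_set (integrable_norm_sq hu).integrableOn
    (Eventually.of_forall fun _ => by positivity) (Eventually.of_forall hst)

theorem Controlled.mono {s t : Set (Pt m)} (ht : Controlled N R V σ t) (hst : s ⊆ t) :
    Controlled N R V σ s := by
  intro η hη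
  obtain ⟨K, hK, h⟩ := ht η hη
  exact ⟨K, hK, fun d hd => (setIntegral_norm_sq_mono hd.isLayer_u.isH1.memLp hst).trans (h d hd)⟩

theorem setIntegral_norm_sq_union_le {u : Pt m → ℂ} (hu : MemLp u 2 volume) (s t : Set (Pt m)) :
    ∫ x in s ∪ t, ‖u x‖ ^ 2 ≤ (∫ x in s, ‖u x‖ ^ 2) + ∫ x in t, ‖u x‖ ^ 2 := by
  have hi := integrable_norm_sq hu
  rw [← integral_add_measure hi.integrableOn hi.integrableOn]
  exact integral_mono_measure (Measure.restrict_union_le s t)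
    (Eventually.of_forall fun _ => by positivity) (Integrable.add_measure hi.integrableOn hi.integrableOn)

theorem Controlled.union {s t : Set (Pt m)} (hs : Controlled N R V σ s)
    (ht : Controlled N R V σ t) : Controlled N R V σ (s ∪ t) := by
  intro η hη
  obtain ⟨K, hK, h⟩ := hs (η / 2) (by positivity)
  obtain ⟨K', hK', h'⟩ := ht (η / 2) (by positivity)
  refine ⟨K + K', by positivity, fun d hd => ?_⟩
  have := setIntegral_norm_sq_union_le hd.isLayer_u.isH1.memLp s t
  linarith [h d hd, h' d hd]

theorem controlled_empty : Controlled N R V σ ∅ := fun η hη =>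
  ⟨0, le_rfl, fun d _ => by
    rw [Measure.restrict_empty, integral_zero_measure, zero_mul, add_zero]
    exact mul_nonneg hη.le (d.size_nonneg N R)⟩

theorem controlled_biUnion {ι : Type*} (t : Finset ι) {s : ι → Set (Pt m)}
    (h : ∀ i ∈ t, Controlled N R V σ (s i)) : Controlled N R V σ (⋃ i ∈ t, s i) := by
  classical
  induction t using Finset.induction_on with
  | empty => simpa using controlled_empty
  | insert a t _ ih =>
    rw [Finset.set_biUnion_insert]
    exact (h a (Finset.mem_insert_self _ _)).union
      (ih fun i hi => h i (Finset.mem_insert_of_mem hi))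

theorem norm_add_sq_le_two (a b : ℂ) : ‖a + b‖ ^ 2 ≤ 2 * ‖a‖ ^ 2 + 2 * ‖b‖ ^ 2 := by
  have h := norm_add_le a b
  nlinarith [sq_nonneg (‖a‖ - ‖b‖), norm_nonneg (a + b), norm_nonneg a, norm_nonneg b]

theorem norm_sub_sq_le_two (a b : ℂ) : ‖a - b‖ ^ 2 ≤ 2 * ‖a‖ ^ 2 + 2 * ‖b‖ ^ 2 := by
  simpa [sub_eq_add_neg] using norm_add_sq_le_two a (-b)

theorem energy_sub_le (u w : Pt m → ℂ) (g h : Option (Fin m) → Pt m → ℂ) (x : Pt m) :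
    energy (fun x => u x - w x) (fun i x => g i x - h i x) x
      ≤ 2 * energy u g x + 2 * energy w h x := by
  have h1 := norm_sub_sq_le_two (u x) (w x)
  have h2 := Finset.sum_le_sum fun i (_ : i ∈ Finset.univ) => norm_sub_sq_le_two (g i x) (h i x)
  rw [Finset.sum_add_distrib, ← Finset.mul_sum, ← Finset.mul_sum] at h2
  simp only [energy]
  linarith

theorem IsH1.sub {Ω : Set (Pt m)} {u w : Pt m → ℂ} {g h : Option (Fin m) → Pt m → ℂ}
    (hu : IsH1 Ω u g) (hw : IsH1 Ω w h) :
    IsH1 Ω (fun x => u x - w x) (fun i x => g i x - h i x) where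
  memLp := hu.memLp.sub hw.memLp
  memLp_grad i := (hu.memLp_grad i).sub (hw.memLp_grad i)
  weak φ hφ hs i := by
    simp only [sub_mul]
    rw [integral_sub (hφ.integrable_mul (hu.memLp_grad i)) (hφ.integrable_mul (hw.memLp_grad i)),
      integral_sub ((hφ.pd i).integrable_mul hu.memLp) ((hφ.pd i).integrable_mul hw.memLp),
      hu.weak φ hφ hs i, hw.weak φ hφ hs i]
    ring

theorem IsH1.mono {Ω Ω' : Set (Pt m)} {u : Pt m → ℂ} {g : Option (Fin m) → Pt m → ℂ}
    (hu : IsH1 Ω u g) (h : Ω' ⊆ Ω) : IsH1 Ω' u g :=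
  ⟨hu.memLp, hu.memLp_grad, fun φ hφ hs => hu.weak φ hφ (hs.trans h)⟩

/-- The difference `z = u - w` satisfies `-Δz = V u + w + p`, to which the propagation of smallness
applies. -/
theorem LocalEq.laplaceIneq {M : ℝ} (hM : 0 ≤ M) (hV : IsPotential M V) {d : LayerData m}
    (h : LocalEq N R V d) :
    LaplaceIneq (box m (N + 1) R) M (fun x => d.u x - d.w x) (fun i x => d.du i x - d.dw i x)
      (fun x => -(V x * d.u x + (d.w x + d.p x))) (fun x => (M + 1) * ‖d.w x‖ + ‖d.p x‖) where
  isH1 := (h.isLayer_u.isH1.sub h.isLayer_w.isH1).mono fun x hx => hx.2.2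
  div φ hφ hs := by
    have h1 := h.eq φ hφ hs
    have hm := hV.memLp_mul h.isLayer_u.isH1.memLp
    have hwp : MemLp (fun x => d.w x + d.p x) 2 volume := h.isLayer_w.isH1.memLp.add h.memLp_p
    have e1 : ∀ i, ∫ x, (d.du i x - d.dw i x) * pd i φ x
        = (∫ x, d.du i x * pd i φ x) - ∫ x, d.dw i x * pd i φ x := fun i => by
      simp only [sub_mul]
      exact integral_sub ((hφ.pd i).integrable_mul (h.isLayer_u.isH1.memLp_grad i))
        ((hφ.pd i).integrable_mul (h.isLayer_w.isH1.memLp_grad i))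
    have e2 : ∫ x, -(V x * d.u x + (d.w x + d.p x)) * φ x
        = -((∫ x, V x * d.u x * φ x) + ∫ x, (d.w x + d.p x) * φ x) := by
      rw [← integral_add (hφ.integrable_mul hm) (hφ.integrable_mul hwp), ← integral_neg]
      exact integral_congr_ae (Eventually.of_forall fun x => by ring)
    simp only [e1, e2, Finset.sum_sub_distrib]
    linear_combination h1
  memLp_lap := ((hV.memLp_mul h.isLayer_u.isH1.memLp).add
    (h.isLayer_w.isH1.memLp.add h.memLp_p)).neg
  memLp_rhs := (h.isLayer_w.isH1.memLp.norm.const_mul (M + 1)).add h.memLp_p.norm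
  bound := by
    filter_upwards [hV.bdd] with x hx _
    rw [norm_neg, abs_of_nonneg (by positivity)]
    have h1 : ‖d.u x‖ ≤ ‖d.u x - d.w x‖ + ‖d.w x‖ := by
      simpa using norm_add_le (d.u x - d.w x) (d.w x)
    have h2 : ‖V x * d.u x‖ ≤ M * (‖d.u x - d.w x‖ + ‖d.w x‖) := by
      rw [norm_mul]; gcongr
    have h3 := norm_add_le (V x * d.u x) (d.w x + d.p x)
    have h4 := norm_add_le (d.w x) (d.p x)
    linarith

/-- Control spreads from a ball to a larger concentric one: propagation of smallness applies to
`z = u - w`, and `w` is itself bounded by the defect. -/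
theorem Controlled.propagate {M : ℝ} (hM : 0 ≤ M) (hV : IsPotential M V) (hσ : IsAbsorption σ)
    {c : Pt m} {r ρ ρ₁ : ℝ} (hr : 0 < r) (hρ : r < ρ) (hρ₁ : ρ < ρ₁)
    (hsub : {x | sqDist c x ≤ ρ₁ ^ 2} ⊆ box m (N + 1) R)
    (h : Controlled N R V σ {x | sqDist c x < r ^ 2}) :
    Controlled N R V σ {x | sqDist c x < ρ ^ 2} := by
  intro η hη
  obtain ⟨K₁, hK₁, h1⟩ := propagation (measurableSet_box (R := R) (N + 1)) (M := M) c hr hρ hρ₁ hsub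
    (ε := η / 8) (by positivity)
  obtain ⟨K, hK, h2⟩ := h (η / (8 * (K₁ + 1))) (by positivity)
  refine ⟨η / 2 + 4 * K₁ * (K + 1 + (M + 1) ^ 2) + 2, by positivity, fun d hd => ?_⟩
  have hmu := hd.isLayer_u.isH1
  have hmw := hd.isLayer_w.isH1
  have hS := d.size_nonneg N R
  have hD := d.defect_nonneg N R hσ
  have hlt : ∀ {a b : ℝ}, 0 < a → a < b → {x : Pt m | sqDist c x < a ^ 2} ⊆
      {x | sqDist c x ≤ b ^ 2} := fun ha hab x hx => by
    have : sqDist c x < _ := hx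
    exact this.le.trans (pow_le_pow_left₀ ha.le hab.le 2)
  have sρ := (hlt (hr.trans hρ) hρ₁).trans hsub
  have sr := (hlt hr (hρ.trans hρ₁)).trans hsub
  have hdw : ∀ᵐ x, ‖d.w x‖ ^ 2 ≤ 1 * (energy d.w d.dw x + ‖d.p x‖ ^ 2 + σ x * ‖d.u x‖ ^ 2) := by
    filter_upwards [hσ.nonneg] with x hx
    have := norm_sq_le_energy d.w d.dw x
    have h1 : 0 ≤ σ x * ‖d.u x‖ ^ 2 := by positivity
    have h2 := sq_nonneg ‖d.p x‖
    linarith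
  have wD : ∀ {s : Set (Pt m)}, s ⊆ box m (N + 1) R → ∫ x in s, ‖d.w x‖ ^ 2 ≤ d.defect N R σ :=
    fun hs => by
      have := hd.setIntegral_le_defect hσ hs (fun x => by positivity) hdw
      rwa [one_mul] at this
  have key : ∀ {s : Set (Pt m)}, s ⊆ box m (N + 1) R →
      ((∫ x in s, ‖d.u x‖ ^ 2) ≤ 2 * (∫ x in s, ‖d.u x - d.w x‖ ^ 2) + 2 * d.defect N R σ) ∧
      ((∫ x in s, ‖d.u x - d.w x‖ ^ 2) ≤ 2 * (∫ x in s, ‖d.u x‖ ^ 2) + 2 * d.defect N R σ) := by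
    intro s hs
    have iu := (integrable_norm_sq hmu.memLp).integrableOn (s := s)
    have iw := (integrable_norm_sq hmw.memLp).integrableOn (s := s)
    have iz : IntegrableOn (fun x => ‖d.u x - d.w x‖ ^ 2) s volume :=
      (integrable_norm_sq (hmu.memLp.sub hmw.memLp)).integrableOn
    constructor
    · have : ∫ x in s, ‖d.u x‖ ^ 2
          ≤ ∫ x in s, (2 * ‖d.u x - d.w x‖ ^ 2 + 2 * ‖d.w x‖ ^ 2) :=
        integral_mono iu ((iz.const_mul 2).add (iw.const_mul 2)) fun x => by
          simpa using norm_add_sq_le_two (d.u x - d.w x) (d.w x)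
      have e := integral_add (iz.const_mul 2) (iw.const_mul 2)
      rw [integral_const_mul, integral_const_mul] at e
      exact this.trans (e.le.trans (by have := wD hs; linarith))
    · have : ∫ x in s, ‖d.u x - d.w x‖ ^ 2
          ≤ ∫ x in s, (2 * ‖d.u x‖ ^ 2 + 2 * ‖d.w x‖ ^ 2) :=
        integral_mono iz ((iu.const_mul 2).add (iw.const_mul 2)) fun x =>
          norm_sub_sq_le_two (d.u x) (d.w x)
      have e := integral_add (iu.const_mul 2) (iw.const_mul 2)
      rw [integral_const_mul, integral_const_mul] at e
      exact this.trans (e.le.trans (by have := wD hs; linarith))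
  have hz := h1 _ _ _ _ (hd.laplaceIneq hM hV)
  have hen : ∫ x in box m (N + 1) R, energy (fun x => d.u x - d.w x)
      (fun i x => d.du i x - d.dw i x) x ≤ 2 * d.size N R + 2 * d.defect N R σ := by
    have i1 := hmu.integrable_energy.integrableOn (s := box m (N + 1) R)
    have i2 := hmw.integrable_energy.integrableOn (s := box m (N + 1) R)
    have e := integral_add (i1.const_mul 2) (i2.const_mul 2)
    rw [integral_const_mul, integral_const_mul] at e
    refine (integral_mono (hmu.sub hmw).integrable_energy.integrableOn
      ((i1.const_mul 2).add (i2.const_mul 2)) fun x => energy_sub_le _ _ _ _ x).trans (e.le.trans ?_)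
    have : ∫ x in box m (N + 1) R, energy d.w d.dw x ≤ 1 * d.defect N R σ := by
      refine hd.setIntegral_le_defect hσ le_rfl (fun x => energy_nonneg _ _ x) ?_
      filter_upwards [hσ.nonneg] with x hx
      have h1 : 0 ≤ σ x * ‖d.u x‖ ^ 2 := by positivity
      have h2 := sq_nonneg ‖d.p x‖
      linarith
    rw [one_mul] at this
    rw [LayerData.size]
    linarith
  have hf : ∫ x in box m (N + 1) R, ((M + 1) * ‖d.w x‖ + ‖d.p x‖) ^ 2
      ≤ 2 * (M + 1) ^ 2 * d.defect N R σ := by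
    refine hd.setIntegral_le_defect hσ le_rfl (fun x => by positivity) ?_
    filter_upwards [hσ.nonneg] with x hx
    have h1 : 0 ≤ σ x * ‖d.u x‖ ^ 2 := by positivity
    have h2 := norm_sq_le_energy d.w d.dw x
    have h3 : ‖d.p x‖ ^ 2 ≤ (M + 1) ^ 2 * ‖d.p x‖ ^ 2 :=
      le_mul_of_one_le_left (by positivity) (by nlinarith)
    have h4 : (M + 1) ^ 2 * ‖d.w x‖ ^ 2 ≤ (M + 1) ^ 2 * energy d.w d.dw x := by gcongr
    have h5 : 0 ≤ (M + 1) ^ 2 * (σ x * ‖d.u x‖ ^ 2) := by positivity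
    nlinarith [sq_nonneg ((M + 1) * ‖d.w x‖ - ‖d.p x‖)]
  have hr' := h2 d hd
  have k1 := (key sρ).1
  have k2 := (key sr).2
  have k3 : K₁ * ((∫ x in {x | sqDist c x < r ^ 2}, ‖d.u x - d.w x‖ ^ 2)
        + ∫ x in box m (N + 1) R, ((M + 1) * ‖d.w x‖ + ‖d.p x‖) ^ 2)
      ≤ K₁ * ((2 * (η / (8 * (K₁ + 1)) * d.size N R + K * d.defect N R σ) + 2 * d.defect N R σ)
        + 2 * (M + 1) ^ 2 * d.defect N R σ) := by gcongr; linarith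
  have k4 : K₁ * (η / (8 * (K₁ + 1))) ≤ η / 8 := by
    have : K₁ * (η / (8 * (K₁ + 1))) = η / 8 * (K₁ / (K₁ + 1)) := by field_simp
    rw [this]
    exact mul_le_of_le_one_right (by positivity) (by rw [div_le_one (by positivity)]; linarith)
  have k5 := mul_le_mul_of_nonneg_right k4 hS
  have k6 := mul_le_mul_of_nonneg_left hen (show 0 ≤ η / 8 by positivity)
  calc _ ≤ _ := k1
    _ ≤ 2 * (η / 8 * (2 * d.size N R + 2 * d.defect N R σ)
        + K₁ * ((2 * (η / (8 * (K₁ + 1)) * d.size N R + K * d.defect N R σ) + 2 * d.defect N R σ)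
        + 2 * (M + 1) ^ 2 * d.defect N R σ)) + 2 * d.defect N R σ := by linarith
    _ ≤ _ := by linear_combination 4 * k5

/-- Controlled balls spread over the whole box, which is connected. -/
theorem Controlled.exists_ball {M : ℝ} (hM : 0 ≤ M) (hV : IsPotential M V) (hσ : IsAbsorption σ)
    {c₀ : Pt m} (hc₀ : c₀ ∈ box m (N + 1) R) {r₀ : ℝ} (hr₀ : 0 < r₀)
    (h : Controlled N R V σ (Metric.ball c₀ r₀)) {x : Pt m} (hx : x ∈ box m (N + 1) R) :
    ∃ r > 0, Controlled N R V σ (Metric.ball x r) := by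
  let S : Set (Pt m) := {x | ∃ r > 0, Controlled N R V σ (Metric.ball x r)}
  suffices hS : box m (N + 1) R ⊆ S from hS hx
  refine (convex_box (m := m) (R := R) (N + 1)).isPreconnected.subset_of_closure_inter_subset ?_
    ⟨c₀, hc₀, r₀, hr₀, h⟩ ?_
  · rw [Metric.isOpen_iff]
    rintro y ⟨r, hr, hy⟩
    refine ⟨r / 2, by positivity, fun z hz => ⟨r / 2, by positivity, hy.mono ?_⟩⟩
    refine Metric.ball_subset_ball' ?_
    rw [Metric.mem_ball] at hz
    linarith
  · rintro y ⟨hyS, hy⟩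
    obtain ⟨ρ, hρ, hball⟩ := Metric.isOpen_iff.1 (isOpen_box (m := m) (R := R) (N + 1)) y hy
    obtain ⟨c, ⟨r, hr, hc⟩, hcy⟩ := Metric.mem_closure_iff.1 hyS (ρ / 8) (by positivity)
    refine ⟨ρ / 8, by positivity, ?_⟩
    have hball' : ∀ {a}, 0 < a → ∀ x : Pt m, sqDist c x ≤ a ^ 2 → dist x c ≤ a :=
      fun ha x hx => (abs_le_of_sq_le_sq' ((dist_sq_le_sqDist c x).trans hx) ha.le).2
    have hsmall : Controlled N R V σ {x | sqDist c x < (min r (ρ / 8)) ^ 2} := by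
      refine hc.mono fun x hx => ?_
      have h1 : dist x c ^ 2 < (min r (ρ / 8)) ^ 2 := (dist_sq_le_sqDist c x).trans_lt hx
      have h2 := (abs_lt_of_sq_lt_sq' h1 (by positivity)).2
      exact h2.trans_le (min_le_left _ _)
    have hbig := hsmall.propagate hM hV hσ (ρ := ρ / 2) (ρ₁ := 3 * ρ / 4) (by positivity)
      (lt_of_le_of_lt (min_le_right _ _) (by linarith)) (by linarith) fun x hx => by
        refine hball ?_
        have h1 := hball' (by positivity) x hx
        rw [Metric.mem_ball]
        have h2 := dist_triangle x c y
        rw [dist_comm c y] at h2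
        linarith
    refine hbig.mono fun x hx => ?_
    rw [Metric.mem_ball] at hx
    have h1 := dist_triangle x y c
    have h2 := sqDist_le_dist_sq c x
    have h3 : dist x c < ρ / 4 := by linarith
    have h4 : dist x c ^ 2 ≤ (ρ / 4) ^ 2 := pow_le_pow_left₀ dist_nonneg h3.le 2
    simp only [Set.mem_ofPred_eq]
    nlinarith

/-- Control on one ball spreads to every ball along chains, and then to compact sets by a finite
cover. -/
theorem Controlled.of_isCompact {M : ℝ} (hM : 0 ≤ M) (hV : IsPotential M V) (hσ : IsAbsorption σ)
    {c₀ : Pt m} (hc₀ : c₀ ∈ box m (N + 1) R) {r₀ : ℝ} (hr₀ : 0 < r₀)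
    (h : Controlled N R V σ (Metric.ball c₀ r₀)) {s : Set (Pt m)} (hs : IsCompact s)
    (hsub : s ⊆ box m (N + 1) R) : Controlled N R V σ s := by
  choose! r hr hc using fun x (hx : x ∈ s) => h.exists_ball hM hV hσ hc₀ hr₀ (hsub hx)
  obtain ⟨t, ht, hst⟩ := hs.elim_nhds_subcover (fun x => Metric.ball x (r x))
    fun x hx => Metric.ball_mem_nhds x (hr x hx)
  exact (controlled_biUnion t fun x hx => hc x (ht x hx)).mono hst

end Controlled

/-- A smooth function of the horizontal variables that cuts off to a box. -/
theorem exists_box_cutoff (m : ℕ) {N : ℝ} (hN : 0 < N) :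
    ∃ (ψ : EuclideanSpace ℝ (Fin m) → ℝ) (B : ℝ), ContDiff ℝ ∞ ψ ∧ (∀ y, |ψ y| ≤ B) ∧
      (∀ y, ‖fderiv ℝ ψ y‖ ≤ B) ∧ (∀ y, (∀ i, |y i| < N) → ψ y = 1) ∧
      tsupport ψ ⊆ {y | ∀ i, |y i| < N + 1} := by
  let χ : ContDiffBump (0 : ℝ) := ⟨N, N + 1 / 2, hN, by linarith⟩
  let ψ : EuclideanSpace ℝ (Fin m) → ℝ := fun y => ∏ i, χ (y i)
  have hψ : ContDiff ℝ ∞ ψ := contDiff_prod fun i _ => χ.contDiff.comp (by fun_prop)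
  have hts : tsupport ψ ⊆ {y | ∀ i, |y i| ≤ N + 1 / 2} := by
    refine closure_minimal (fun y hy i => ?_) ?_
    · by_contra h
      refine hy (Finset.prod_eq_zero (Finset.mem_univ i) (χ.zero_of_le_dist ?_))
      rw [Real.dist_eq, sub_zero]
      exact (not_le.1 h).le
    · rw [Set.ofPred_forall]
      exact isClosed_iInter fun i => isClosed_le (by fun_prop) continuous_const
  have hs : HasCompactSupport ψ := by
    refine (Metric.isCompact_of_isClosed_isBounded (isClosed_tsupport ψ) ?_)
    rw [isBounded_iff_forall_norm_le]
    refine ⟨√(∑ _i : Fin m, (N + 1 / 2) ^ 2), fun y hy => ?_⟩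
    rw [EuclideanSpace.norm_eq]
    refine Real.sqrt_le_sqrt (Finset.sum_le_sum fun i _ => ?_)
    rw [Real.norm_eq_abs]
    exact pow_le_pow_left₀ (abs_nonneg _) (hts hy i) 2
  obtain ⟨B, -, hB0, hB1⟩ := exists_bound_horizontal hψ hs
  refine ⟨ψ, B, hψ, hB0, hB1, fun y hy => Finset.prod_eq_one fun i _ => ?_,
    hts.trans fun y hy i => (hy i).trans_lt (by linarith)⟩
  refine χ.one_of_mem_closedBall ?_
  rw [mem_closedBall_zero_iff]
  exact (hy i).le

/-- The square integral over a small set is small compared to the energy: this is the only place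
where the dimension matters. -/
theorem exists_setIntegral_norm_sq_le (hm : m = 1 ∨ m = 2) (R : ℝ) {N : ℝ} (hN : 0 < N) :
    ∃ C ≥ 0, ∀ (u : Pt m → ℂ) (g : Option (Fin m) → Pt m → ℂ), IsLayer R u g →
      ∀ A ⊆ box m N R, ∫ x in A, ‖u x‖ ^ 2
        ≤ C * (volume A).toReal ^ (1 / 2 : ℝ) * ∫ x in box m (N + 1) R, energy u g x := by
  obtain ⟨ψ, B, hψ, hB0, hB1, hone, hts⟩ := exists_box_cutoff m hN
  obtain ⟨C, hC, hC4⟩ := exists_eLpNorm_four_le hm R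
  refine ⟨C ^ 2 * ((2 * m + 3) * B ^ 2), by positivity, fun u g hu A hA => ?_⟩
  have hpd : ∀ i x, |pd i (fun x : Pt m => ψ x.1) x| ≤ B := fun i x =>
    (abs_pd_horizontal_le hψ i x).trans (hB1 x.1)
  have hcut := hu.isH1.cutoff (Ω' := {x | x.2 < R}) (χ := fun x : Pt m => ψ x.1)
    (hψ.comp contDiff_fst) (fun x => hB0 x.1) hpd Set.inter_subset_left
  have hz : ∀ x : Pt m, x ∉ strip m R → ψ x.1 • u x = 0 := fun x hx => by
    rw [hu.val_zero x hx, smul_zero]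
  have hzg : ∀ i, ∀ x : Pt m, x ∉ strip m R →
      ψ x.1 • g i x + pd i (fun x : Pt m => ψ x.1) x • u x = 0 := fun i x hx => by
    rw [hu.val_zero x hx, hu.grad_zero i x hx, smul_zero, smul_zero, add_zero]
  have hnot : ∀ x : Pt m, x.2 ≤ 0 → x ∉ strip m R := fun x hx h => not_lt.2 hx h.1
  let v : HTilde m R := mkHTilde hcut (fun x hx => hz x (hnot x hx))
    fun i x hx => hzg i x (hnot x hx)
  have hv : extVal v =ᵐ[volume] fun x => ψ x.1 • u x := by
    refine (extVal_mk _ _ _).trans (Eventually.of_forall fun x => ?_)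
    by_cases hx : x ∈ strip m R
    · exact Set.indicator_of_mem hx _
    · rw [Set.indicator_of_notMem hx]
      exact (hz x hx).symm
  have hvg : ∀ i, extGrad v i =ᵐ[volume]
      fun x => ψ x.1 • g i x + pd i (fun x : Pt m => ψ x.1) x • u x := by
    intro i
    refine (extGrad_mk _ _ _ i).trans (Eventually.of_forall fun x => ?_)
    by_cases hx : x ∈ strip m R
    · exact Set.indicator_of_mem hx _
    · rw [Set.indicator_of_notMem hx]
      exact (hzg i x hx).symm
  have hnorm : ‖v‖ ^ 2 ≤ (2 * m + 3) * B ^ 2 * ∫ x in box m (N + 1) R, energy u g x := by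
    rw [norm_sq_eq_integral_energy, ← integral_const_mul, ← integral_indicator (measurableSet_box _)]
    refine integral_mono_ae (isH1_ext v).integrable_energy
      ((hu.isH1.integrable_energy.const_mul _).indicator (measurableSet_box _)) ?_
    filter_upwards [hv, ae_all_iff.2 hvg] with x h0 h1
    simp only [energy, h0, h1]
    by_cases hx : x ∈ box m (N + 1) R
    · rw [Set.indicator_of_mem hx]
      have a1 : ‖ψ x.1 • u x‖ ^ 2 ≤ B ^ 2 * ‖u x‖ ^ 2 := by
        rw [norm_smul, mul_pow, Real.norm_eq_abs]
        gcongr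
        exact hB0 x.1
      have a2 : ∀ i, ‖ψ x.1 • g i x + pd i (fun x : Pt m => ψ x.1) x • u x‖ ^ 2
          ≤ 2 * (B ^ 2 * ‖g i x‖ ^ 2) + 2 * (B ^ 2 * ‖u x‖ ^ 2) := by
        intro i
        refine (norm_add_sq_le_two _ _).trans ?_
        rw [norm_smul, norm_smul, mul_pow, mul_pow, Real.norm_eq_abs, Real.norm_eq_abs]
        gcongr
        · exact hB0 x.1
        · exact hpd i x
      have a3 := Finset.sum_le_sum fun i (_ : i ∈ Finset.univ) => a2 i
      rw [Finset.sum_add_distrib, Finset.sum_const, Finset.card_univ, Fintype.card_option,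
        Fintype.card_fin, ← Finset.mul_sum, ← Finset.mul_sum, nsmul_eq_mul] at a3
      push_cast at a3
      have a4 : 0 ≤ (m : ℝ) * (B ^ 2 * ∑ i, ‖g i x‖ ^ 2) := by positivity
      have a5 : 0 ≤ B ^ 2 * ∑ i, ‖g i x‖ ^ 2 := by positivity
      nlinarith
    · rw [Set.indicator_of_notMem hx]
      by_cases hs : x ∈ strip m R
      · have hns : x.1 ∉ tsupport ψ := fun h => hx ⟨fun i => hts h i, hs⟩
        have e1 : ψ x.1 = 0 := image_eq_zero_of_notMem_tsupport hns
        have e2 : ∀ i, pd i (fun x : Pt m => ψ x.1) x = 0 := fun i => by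
          have := abs_pd_horizontal_le hψ i x
          rw [image_eq_zero_of_notMem_tsupport (f := fderiv ℝ ψ)
            fun h => hns (tsupport_fderiv_subset ℝ h), norm_zero] at this
          exact abs_nonpos_iff.1 this
        simp [e1, e2]
      · simp only [hz x hs, hzg _ x hs]
        simp
  -- Hölder's inequality between `L²` and `L⁴` on `A`
  have hmem : MemLp (fun x => ψ x.1 • u x) 2 volume := hcut.memLp
  have h2 : eLpNorm (fun x => ψ x.1 • u x) 2 (volume.restrict A)
      ≤ ENNReal.ofReal (C * ‖v‖) * volume A ^ (1 / 4 : ℝ) := by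
    refine (eLpNorm_le_eLpNorm_mul_rpow_measure_univ (q := 4) (by norm_num)
      hmem.1.restrict).trans ?_
    rw [Measure.restrict_apply_univ]
    norm_num
    gcongr
    refine (eLpNorm_mono_measure _ Measure.restrict_le_self).trans ?_
    have h4 := hC4 v
    rw [eLpNorm_congr_ae hv] at h4
    simpa using h4
  have hAfin : volume A ≠ ⊤ := ((measure_mono hA).trans_lt (volume_box_lt_top N)).ne
  have e : ∫ x in A, ‖u x‖ ^ 2 = ∫ x in A, ‖ψ x.1 • u x‖ ^ 2 := by
    refine integral_congr_ae ?_
    have : ∀ᵐ x ∂(volume.restrict (box m N R)), ‖u x‖ ^ 2 = ‖ψ x.1 • u x‖ ^ 2 := by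
      refine ae_restrict_of_forall_mem (measurableSet_box N) fun x hx => ?_
      rw [hone x.1 hx.1, one_smul]
    exact ae_mono (Measure.restrict_mono hA le_rfl) this
  rw [e, integral_norm_sq_eq (hmem.restrict A)]
  have h3 := ENNReal.toReal_mono (by finiteness) h2
  rw [ENNReal.toReal_mul, ENNReal.toReal_ofReal (by positivity), ← ENNReal.toReal_rpow] at h3
  refine (pow_le_pow_left₀ ENNReal.toReal_nonneg h3 2).trans ?_
  have e4 : ((volume A).toReal ^ (1 / 4 : ℝ)) ^ 2 = (volume A).toReal ^ (1 / 2 : ℝ) := by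
    rw [← Real.rpow_natCast, ← Real.rpow_mul ENNReal.toReal_nonneg]
    norm_num
  rw [mul_pow, mul_pow, e4]
  calc C ^ 2 * ‖v‖ ^ 2 * (volume A).toReal ^ (1 / 2 : ℝ)
      ≤ C ^ 2 * ((2 * m + 3) * B ^ 2 * ∫ x in box m (N + 1) R, energy u g x)
        * (volume A).toReal ^ (1 / 2 : ℝ) := by gcongr
    _ = _ := by ring

section Covering

variable {N : ℝ} {V : Pt m → ℂ} {σ : Pt m → ℝ}

/-- A set is controlled if it is controlled up to sets of arbitrarily small measure. -/
theorem Controlled.of_small (hm : m = 1 ∨ m = 2) (hN : 0 < N) {s : Set (Pt m)}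
    {A : ℕ → Set (Pt m)} (hA : ∀ n, A n ⊆ box m N R)
    (hlim : Tendsto (fun n => volume (A n)) atTop (𝓝 0))
    (h : ∀ n, Controlled N R V σ (s \ A n)) : Controlled N R V σ s := by
  intro η hη
  obtain ⟨C, hC, hsmall⟩ := exists_setIntegral_norm_sq_le hm R hN
  have hl : Tendsto (fun n => C * (volume (A n)).toReal ^ (1 / 2 : ℝ)) atTop (𝓝 0) := by
    have h1 := (ENNReal.tendsto_toReal ENNReal.zero_ne_top).comp hlim
    have h2 := (h1.rpow_const (p := 1 / 2) (Or.inr (by norm_num))).const_mul C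
    simpa using h2
  obtain ⟨n, hn⟩ := (hl.eventually (gt_mem_nhds (show (0 : ℝ) < η / 2 by positivity))).exists
  obtain ⟨K, hK, h1⟩ := h n (η / 2) (by positivity)
  refine ⟨K, hK, fun d hd => ?_⟩
  have hu := hd.isLayer_u.isH1.memLp
  have h2 := setIntegral_norm_sq_mono hu (s := s) (t := s \ A n ∪ A n) (by simp)
  have h3 := setIntegral_norm_sq_union_le hu (s \ A n) (A n)
  have h4 := hsmall d.u d.du hd.isLayer_u (A n) (hA n)
  have h5 := mul_le_mul_of_nonneg_right hn.le (d.size_nonneg N R)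
  rw [LayerData.size] at h5
  have h6 := h1 d hd
  rw [LayerData.size] at h6 ⊢
  linarith

theorem tendsto_volume_zero {A : ℕ → Set (Pt m)} (hA : ∀ n, A n ⊆ box m N R)
    (hmeas : ∀ n, MeasurableSet (A n)) (hanti : Antitone A) (h0 : volume (⋂ n, A n) = 0) :
    Tendsto (fun n => volume (A n)) atTop (𝓝 0) := by
  have h := tendsto_measure_iInter_atTop (μ := (volume : Measure (Pt m)))
    (fun n => (hmeas n).nullMeasurableSet) hanti
    ⟨0, ((measure_mono (hA 0)).trans_lt (volume_box_lt_top N)).ne⟩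
  rwa [h0] at h

theorem antitone_one_div_succ : Antitone fun n : ℕ => 1 / ((n : ℝ) + 1) := fun a b hab =>
  one_div_le_one_div_of_le (by positivity) (by gcongr)

/-- Absorption controls the solution. -/
theorem controlled_of_absorption (hm : m = 1 ∨ m = 2) (hN : 0 < N) (hσ : IsAbsorption σ)
    {s : Set (Pt m)} (hsm : MeasurableSet s) (hs : s ⊆ box m N R)
    (hpos : ∀ᵐ x, x ∈ s → 0 < σ x) : Controlled N R V σ s := by
  let σ' := hσ.aesm.mk σ
  have hσ' : Measurable σ' := hσ.aesm.measurable_mk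
  have hσσ' : σ =ᵐ[volume] σ' := hσ.aesm.ae_eq_mk
  let A : ℕ → Set (Pt m) := fun n => s ∩ {x | σ' x ≤ 1 / ((n : ℝ) + 1)}
  have hAm : ∀ n, MeasurableSet (A n) := fun n =>
    hsm.inter (measurableSet_le hσ' measurable_const)
  have hlim : Tendsto (fun n => volume (A n)) atTop (𝓝 0) := by
    refine tendsto_volume_zero (fun n => Set.inter_subset_left.trans hs) hAm
      (fun a b hab x hx => ⟨hx.1, le_trans hx.2 (antitone_one_div_succ hab)⟩) ?_
    rw [measure_eq_zero_iff_ae_notMem]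
    filter_upwards [hpos, hσσ'] with x h1 h2 hx
    rw [Set.mem_iInter] at hx
    have h3 : σ' x ≤ 0 := ge_of_tendsto' (tendsto_div_succ 1) fun n => (hx n).2
    exact absurd (h1 (hx 0).1) (not_lt.2 (h2 ▸ h3))
  refine Controlled.of_small hm hN (fun n => Set.inter_subset_left.trans hs) hlim fun n η hη =>
    ⟨(n : ℝ) + 1, by positivity, fun d hd => ?_⟩
  have e : ∫ x in s \ A n, ‖d.u x‖ ^ 2
      = ∫ x in s \ A n, (s \ A n).indicator (fun x => ‖d.u x‖ ^ 2) x :=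
    setIntegral_congr_fun (hsm.diff (hAm n)) fun x hx =>
      (Set.indicator_of_mem hx (fun x => ‖d.u x‖ ^ 2)).symm
  have hle := hd.setIntegral_le_defect hσ (c := (n : ℝ) + 1) (s := s \ A n)
    (f := (s \ A n).indicator fun x => ‖d.u x‖ ^ 2)
    (Set.sdiff_subset.trans (hs.trans (box_mono (by linarith))))
    (Set.indicator_nonneg fun x _ => by positivity) (by
      filter_upwards [hσσ', hσ.nonneg] with x h1 h2
      have h3 := energy_nonneg d.w d.dw x
      by_cases hx : x ∈ s \ A n
      · rw [Set.indicator_of_mem hx]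
        have h4 : 1 / ((n : ℝ) + 1) < σ x := by
          rw [h1]
          exact not_le.1 fun h => hx.2 ⟨hx.1, h⟩
        rw [div_lt_iff₀ (by positivity)] at h4
        have h5 : ‖d.u x‖ ^ 2 ≤ (σ x * ((n : ℝ) + 1)) * ‖d.u x‖ ^ 2 :=
          le_mul_of_one_le_left (by positivity) h4.le
        have h6 : 0 ≤ ((n : ℝ) + 1) * (energy d.w d.dw x + ‖d.p x‖ ^ 2) := by positivity
        linarith
      · rw [Set.indicator_of_notMem hx]
        positivity)
  rw [e]
  have := mul_nonneg hη.le (d.size_nonneg N R)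
  linarith

/-- The local estimate: in a box, a solution is controlled by the right hand sides and by the
absorbed energy. -/
theorem local_estimate (hm : m = 1 ∨ m = 2) (hN : 0 < N) {M : ℝ} (hM : 0 ≤ M)
    (hV : IsPotential M V) (hσ : IsAbsorption σ) {s : Set (Pt m)} (hso : IsOpen s)
    (hsn : s.Nonempty) (hs : s ⊆ box m N R) (hpos : ∀ᵐ x, x ∈ s → 0 < σ x) :
    Controlled N R V σ (box m N R) := by
  obtain ⟨c₀, hc₀⟩ := hsn
  obtain ⟨r₀, hr₀, hball⟩ := Metric.isOpen_iff.1 hso c₀ hc₀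
  have hstart : Controlled N R V σ (Metric.ball c₀ r₀) :=
    controlled_of_absorption hm hN hσ measurableSet_ball (hball.trans hs)
      (hpos.mono fun x h hx => h (hball hx))
  -- a thin layer along the horizontal boundaries of the box, whose complement is compact
  let A : ℕ → Set (Pt m) := fun n =>
    box m N R ∩ {x | x.2 ≤ 1 / ((n : ℝ) + 1) ∨ R - 1 / ((n : ℝ) + 1) ≤ x.2}
  have hAm : ∀ n, MeasurableSet (A n) := fun n =>
    (measurableSet_box N).inter ((measurableSet_le measurable_snd measurable_const).union
      (measurableSet_le measurable_const measurable_snd))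
  have hlim : Tendsto (fun n => volume (A n)) atTop (𝓝 0) := by
    refine tendsto_volume_zero (fun n => Set.inter_subset_left) hAm (fun a b hab x hx =>
      ⟨hx.1, hx.2.imp (fun h => h.trans (antitone_one_div_succ hab)) fun h => ?_⟩) ?_
    · have := antitone_one_div_succ hab
      simp only at this
      linarith
    · convert measure_empty (μ := (volume : Measure (Pt m)))
      rw [Set.eq_empty_iff_forall_notMem]
      intro x hx
      rw [Set.mem_iInter] at hx
      have hpos' := (hx 0).1.2
      have h1 := (tendsto_div_succ 1).eventually
        (gt_mem_nhds (show (0 : ℝ) < min x.2 (R - x.2) from lt_min hpos'.1 (by linarith [hpos'.2])))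
      obtain ⟨n, hn⟩ := h1.exists
      rcases (hx n).2 with h | h
      · exact absurd (hn.trans_le (min_le_left _ _)) (not_lt.2 h)
      · have := hn.trans_le (min_le_right _ _)
        linarith
  refine Controlled.of_small hm hN (fun n => Set.inter_subset_left) hlim fun n => ?_
  have hpos' : (0 : ℝ) < 1 / ((n : ℝ) + 1) := by positivity
  let K : Set (Pt m) := {x | (∀ i, |x.1 i| ≤ N) ∧ 1 / ((n : ℝ) + 1) ≤ x.2
    ∧ x.2 ≤ R - 1 / ((n : ℝ) + 1)}
  have hKbox : K ⊆ box m (N + 1) R := fun x hx =>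
    ⟨fun i => (hx.1 i).trans_lt (by linarith), hpos'.trans_le hx.2.1, by linarith [hx.2.2]⟩
  have hKc : IsCompact K := by
    refine Metric.isCompact_of_isClosed_isBounded ?_ ((isBounded_box _).subset hKbox)
    have : K = (⋂ i : Fin m, {x : Pt m | |x.1 i| ≤ N}) ∩ ({x : Pt m | 1 / ((n : ℝ) + 1) ≤ x.2}
        ∩ {x : Pt m | x.2 ≤ R - 1 / ((n : ℝ) + 1)}) := by
      ext x; simp [K]
    rw [this]
    exact (isClosed_iInter fun i => isClosed_le (by fun_prop) continuous_const).inter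
      ((isClosed_le continuous_const continuous_snd).inter
        (isClosed_le continuous_snd continuous_const))
  refine (hstart.of_isCompact hM hV hσ (box_mono (by linarith) (hs hc₀)) hr₀ hKc hKbox).mono ?_
  intro x hx
  have h1 : x ∉ {x : Pt m | x.2 ≤ 1 / ((n : ℝ) + 1) ∨ R - 1 / ((n : ℝ) + 1) ≤ x.2} :=
    fun h => hx.2 ⟨hx.1, h⟩
  rw [Set.mem_ofPred_eq, not_or, not_le, not_le] at h1
  exact ⟨fun i => (hx.1.1 i).le, h1.1.le, h1.2.le⟩

end Covering

-- The operator norm on the iterated space of sesquilinear forms is found through nested instances.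
set_option maxSynthPendingDepth 10

/-! ### The sesquilinear form -/

/-- The Dirichlet form `∫ ∇u · ∇v̄`. -/
noncomputable def dirichletL (m : ℕ) (R : ℝ) : HTilde m R →L[ℂ] (HTilde m R →L⋆[ℂ] ℂ) :=
  LinearMap.mkContinuous₂ (LinearMap.mk₂'ₛₗ (RingHom.id ℂ) (starRingEnd ℂ)
    (fun u v => ∑ i, inner ℂ (gradL m R i v) (gradL m R i u))
    (fun u u' v => by simp only [map_add, inner_add_right, Finset.sum_add_distrib])
    (fun c u v => by
      simp only [map_smul, inner_smul_right, Finset.mul_sum, smul_eq_mul, RingHom.id_apply])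
    (fun u v v' => by simp only [map_add, inner_add_left, Finset.sum_add_distrib])
    (fun c u v => by simp only [map_smul, inner_smul_left, Finset.mul_sum, smul_eq_mul]))
    (m + 1) fun u v => by
      simp only [LinearMap.mk₂'ₛₗ_apply]
      refine (norm_sum_le _ _).trans ?_
      calc ∑ i, ‖inner ℂ (gradL m R i v) (gradL m R i u)‖
          ≤ ∑ _i : Option (Fin m), ‖u‖ * ‖v‖ := by
            refine Finset.sum_le_sum fun i _ => (norm_inner_le_norm _ _).trans ?_
            rw [mul_comm]
            exact mul_le_mul (norm_grad_le u i) (norm_grad_le v i) (norm_nonneg _) (norm_nonneg _)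
        _ = _ := by simp; ring

theorem dirichletL_apply (u v : HTilde m R) : dirichletL m R u v
    = ∑ i, ∫ x in strip m R, grad u i x * conj (grad v i x) := by
  change ∑ i, inner ℂ (gradL m R i v) (gradL m R i u) = _
  refine Finset.sum_congr rfl fun i _ => ?_
  rw [L2.inner_def]
  rfl

theorem integrable_potential_mul {M : ℝ} {V : Pt m → ℂ} (hV : IsPotential M V)
    (u v : L2 (strip m R)) :
    Integrable (fun x => V x * u x * conj (v x)) (volume.restrict (strip m R)) := by
  have h1 : MemLp (fun x => V x * u x) 2 (volume.restrict (strip m R)) := by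
    refine MemLp.of_le_mul (c := M) (Lp.memLp u) (hV.aesm.restrict.mul (Lp.memLp u).1) ?_
    filter_upwards [ae_restrict_of_ae hV.bdd] with x hx
    rw [norm_mul]
    gcongr
  exact h1.integrable_mul (Lp.memLp v).star

theorem norm_integral_potential_le {M : ℝ} {V : Pt m → ℂ} (hV : IsPotential M V)
    (u v : L2 (strip m R)) :
    ‖∫ x in strip m R, V x * u x * conj (v x)‖ ≤ M * ‖u‖ * ‖v‖ := by
  have h1 : MemLp (fun x => V x * u x) 2 (volume.restrict (strip m R)) := by
    refine MemLp.of_le_mul (c := M) (Lp.memLp u) (hV.aesm.restrict.mul (Lp.memLp u).1) ?_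
    filter_upwards [ae_restrict_of_ae hV.bdd] with x hx
    rw [norm_mul]
    gcongr
  have h2 : ‖h1.toLp _‖ ≤ M * ‖u‖ := by
    refine Lp.norm_le_mul_norm_of_ae_le_mul ?_
    filter_upwards [h1.coeFn_toLp, ae_restrict_of_ae hV.bdd] with x hx hb
    rw [hx, norm_mul]
    gcongr
  have e : ∫ x in strip m R, V x * u x * conj (v x) = inner ℂ v (h1.toLp _) := by
    rw [L2.inner_def]
    refine integral_congr_ae ?_
    filter_upwards [h1.coeFn_toLp] with x hx
    rw [hx]
    rfl
  rw [e]
  refine (norm_inner_le_norm _ _).trans ?_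
  rw [mul_comm]
  gcongr

/-- The form `∫ V u v̄` for a bounded potential `V`. -/
noncomputable def potentialL {M : ℝ} (hM : 0 ≤ M) {V : Pt m → ℂ} (hV : IsPotential M V) (R : ℝ) :
    HTilde m R →L[ℂ] (HTilde m R →L⋆[ℂ] ℂ) :=
  LinearMap.mkContinuous₂ (LinearMap.mk₂'ₛₗ (RingHom.id ℂ) (starRingEnd ℂ)
    (fun u v => ∫ x in strip m R, V x * val u x * conj (val v x))
    (fun u u' v => by
      rw [← integral_add (integrable_potential_mul hV _ _) (integrable_potential_mul hV _ _)]
      refine integral_congr_ae ?_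
      filter_upwards [Lp.coeFn_add (val u) (val u')] with x hx
      rw [show val (u + u') = val u + val u' from rfl, hx, Pi.add_apply]; ring)
    (fun c u v => by
      rw [smul_eq_mul, ← integral_const_mul]
      refine integral_congr_ae ?_
      filter_upwards [Lp.coeFn_smul c (val u)] with x hx
      rw [show val (c • u) = c • val u from rfl, hx, Pi.smul_apply, smul_eq_mul,
        RingHom.id_apply]; ring)
    (fun u v v' => by
      rw [← integral_add (integrable_potential_mul hV _ _) (integrable_potential_mul hV _ _)]
      refine integral_congr_ae ?_
      filter_upwards [Lp.coeFn_add (val v) (val v')] with x hx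
      rw [show val (v + v') = val v + val v' from rfl, hx, Pi.add_apply, map_add]; ring)
    (fun c u v => by
      rw [smul_eq_mul, ← integral_const_mul]
      refine integral_congr_ae ?_
      filter_upwards [Lp.coeFn_smul c (val v)] with x hx
      rw [show val (c • v) = c • val v from rfl, hx, Pi.smul_apply, smul_eq_mul, map_mul]; ring))
    M fun u v => by
      refine (norm_integral_potential_le hV (val u) (val v)).trans ?_
      have h1 := norm_val_le u
      have h2 := norm_val_le v
      gcongr

theorem potentialL_apply {M : ℝ} (hM : 0 ≤ M) {V : Pt m → ℂ} (hV : IsPotential M V)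
    (u v : HTilde m R) :
    potentialL hM hV R u v = ∫ x in strip m R, V x * val u x * conj (val v x) := rfl

theorem measurableSet_cell : MeasurableSet (cell m R) := by
  have : cell m R = (⋂ i : Fin m, {x : Pt m | -Real.pi < x.1 i ∧ x.1 i < Real.pi}) ∩ strip m R := by
    ext x; simp [cell, strip]
  rw [this]
  refine (MeasurableSet.iInter fun i => ?_).inter measurableSet_strip
  have hc : Continuous fun x : Pt m => x.1 i := by fun_prop
  exact ((isOpen_lt continuous_const hc).inter (isOpen_lt hc continuous_const)).measurableSet

theorem lintegral_cell_pow_four_le {C : ℝ} (hC : 0 ≤ C) (u : HTilde m R)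
    (h : eLpNorm (extVal u) 4 volume ≤ ENNReal.ofReal (C * ‖u‖)) :
    ∫⁻ x in cell m R, ‖val u x‖ₑ ^ 4 ≤ ENNReal.ofReal ((C * ‖u‖) ^ 4) := by
  have e4 := eLpNorm_nnreal_pow_eq_lintegral (f := extVal u) (μ := volume) (p := 4) (by norm_num)
  have e5 : eLpNorm (extVal u) 4 volume ^ 4 = ∫⁻ x, ‖extVal u x‖ₑ ^ 4 := by simpa using e4
  rw [ENNReal.ofReal_pow (by positivity)]
  refine le_trans ?_ (pow_le_pow_left' h 4)
  rw [e5]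
  refine le_trans (le_of_eq ?_) (setLIntegral_le_lintegral (cell m R) _)
  refine setLIntegral_congr_fun measurableSet_cell fun x hx => ?_
  simp only [extVal, Set.indicator_of_mem (cell_subset_strip m R hx)]

/-- Hölder's inequality for the product of an `L²` function with two functions in `H̃¹ ⊆ L⁴`. -/
theorem lintegral_cell_mul_le {C : ℝ} (hC : 0 ≤ C)
    (h : ∀ u : HTilde m R, eLpNorm (extVal u) 4 volume ≤ ENNReal.ofReal (C * ‖u‖))
    (q : L2 (cell m R)) (u v : HTilde m R) :
    ∫⁻ x in cell m R, ‖q x * val u x * conj (val v x)‖ₑ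
      ≤ ENNReal.ofReal (C ^ 2 * ‖q‖ * ‖u‖ * ‖v‖) := by
  have hle : volume.restrict (cell m R) ≤ volume.restrict (strip m R) :=
    Measure.restrict_mono (cell_subset_strip m R) le_rfl
  have hmu : ∀ u : HTilde m R, AEMeasurable (fun x => ‖val u x‖ₑ) (volume.restrict (cell m R)) :=
    fun u => ((Lp.memLp (val u)).1.mono_measure hle).enorm
  have hmq : AEMeasurable (fun x => ‖q x‖ₑ) (volume.restrict (cell m R)) := (Lp.memLp q).1.enorm
  have h1 := lintegral_mul_sq_le hmq ((hmu u).mul (hmu v))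
  have h2 := lintegral_mul_sq_le ((hmu u).pow_const 2) ((hmu v).pow_const 2)
  have hq : ∫⁻ x in cell m R, ‖q x‖ₑ ^ 2 = ENNReal.ofReal (‖q‖ ^ 2) := by
    rw [← eLpNorm_two_sq, Lp.norm_def, ENNReal.ofReal_pow ENNReal.toReal_nonneg,
      ENNReal.ofReal_toReal (Lp.eLpNorm_ne_top q)]
  simp only [← pow_mul, ← mul_pow] at h2
  norm_num at h2
  have h3 := h2.trans (mul_le_mul' (lintegral_cell_pow_four_le hC u (h u))
    (lintegral_cell_pow_four_le hC v (h v)))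
  rw [← ENNReal.ofReal_mul (by positivity), show (C * ‖u‖) ^ 4 * (C * ‖v‖) ^ 4
    = (C ^ 4 * ‖u‖ ^ 2 * ‖v‖ ^ 2) ^ 2 by ring, ENNReal.ofReal_pow (by positivity),
    ENNReal.pow_le_pow_left_iff two_ne_zero] at h3
  simp only [Pi.mul_apply] at h1
  have h4 := h1.trans (mul_le_mul' hq.le h3)
  rw [← ENNReal.ofReal_mul (by positivity), show ‖q‖ ^ 2 * (C ^ 4 * ‖u‖ ^ 2 * ‖v‖ ^ 2)
    = (C ^ 2 * ‖q‖ * ‖u‖ * ‖v‖) ^ 2 by ring, ENNReal.ofReal_pow (by positivity),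
    ENNReal.pow_le_pow_left_iff two_ne_zero] at h4
  refine le_of_eq_of_le (lintegral_congr fun x => ?_) h4
  rw [enorm_mul, enorm_mul, RCLike.enorm_conj, mul_assoc]

theorem aestronglyMeasurable_cell_mul (q : L2 (cell m R)) (u v : HTilde m R) :
    AEStronglyMeasurable (fun x => q x * val u x * conj (val v x))
      (volume.restrict (cell m R)) := by
  have hle : volume.restrict (cell m R) ≤ volume.restrict (strip m R) :=
    Measure.restrict_mono (cell_subset_strip m R) le_rfl
  exact ((Lp.memLp q).1.mul ((Lp.memLp (val u)).1.mono_measure hle)).mul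
    (Complex.continuous_conj.comp_aestronglyMeasurable ((Lp.memLp (val v)).1.mono_measure hle))

theorem integrable_cell_mul (hm : m = 1 ∨ m = 2) (q : L2 (cell m R)) (u v : HTilde m R) :
    Integrable (fun x => q x * val u x * conj (val v x)) (volume.restrict (cell m R)) := by
  obtain ⟨C, hC, h⟩ := exists_eLpNorm_four_le hm R
  exact ⟨aestronglyMeasurable_cell_mul q u v,
    (lintegral_cell_mul_le hC h q u v).trans_lt ENNReal.ofReal_lt_top⟩

theorem exists_norm_cell_mul_le (hm : m = 1 ∨ m = 2) (R : ℝ) :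
    ∃ C ≥ 0, ∀ (q : L2 (cell m R)) (u v : HTilde m R),
      ‖∫ x in cell m R, q x * val u x * conj (val v x)‖ ≤ C * ‖q‖ * ‖u‖ * ‖v‖ := by
  obtain ⟨C, hC, h⟩ := exists_eLpNorm_four_le hm R
  refine ⟨C ^ 2, by positivity, fun q u v => ?_⟩
  have h1 := (enorm_integral_le_lintegral_enorm _).trans (lintegral_cell_mul_le hC h q u v)
  rw [← ofReal_norm, ENNReal.ofReal_le_ofReal_iff (by positivity)] at h1
  exact h1

theorem ae_cell_of_strip {P : Pt m → Prop} (h : ∀ᵐ x ∂(volume.restrict (strip m R)), P x) :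
    ∀ᵐ x ∂(volume.restrict (cell m R)), P x :=
  ae_mono (Measure.restrict_mono (cell_subset_strip m R) le_rfl) h

/-- The form `∫ q u v̄` for `q ∈ L²(Ω_0^R)`, for fixed `q`. -/
noncomputable def perturbationAux (hm : m = 1 ∨ m = 2) (q : L2 (cell m R)) :
    HTilde m R →L[ℂ] (HTilde m R →L⋆[ℂ] ℂ) :=
  LinearMap.mkContinuous₂ (LinearMap.mk₂'ₛₗ (RingHom.id ℂ) (starRingEnd ℂ)
    (fun u v => ∫ x in cell m R, q x * val u x * conj (val v x))
    (fun u u' v => by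
      rw [← integral_add (integrable_cell_mul hm _ _ _) (integrable_cell_mul hm _ _ _)]
      refine integral_congr_ae ?_
      filter_upwards [ae_cell_of_strip (Lp.coeFn_add (val u) (val u'))] with x hx
      rw [show val (u + u') = val u + val u' from rfl, hx, Pi.add_apply]; ring)
    (fun c u v => by
      rw [smul_eq_mul, ← integral_const_mul]
      refine integral_congr_ae ?_
      filter_upwards [ae_cell_of_strip (Lp.coeFn_smul c (val u))] with x hx
      rw [show val (c • u) = c • val u from rfl, hx, Pi.smul_apply, smul_eq_mul,
        RingHom.id_apply]; ring)
    (fun u v v' => by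
      rw [← integral_add (integrable_cell_mul hm _ _ _) (integrable_cell_mul hm _ _ _)]
      refine integral_congr_ae ?_
      filter_upwards [ae_cell_of_strip (Lp.coeFn_add (val v) (val v'))] with x hx
      rw [show val (v + v') = val v + val v' from rfl, hx, Pi.add_apply, map_add]; ring)
    (fun c u v => by
      rw [smul_eq_mul, ← integral_const_mul]
      refine integral_congr_ae ?_
      filter_upwards [ae_cell_of_strip (Lp.coeFn_smul c (val v))] with x hx
      rw [show val (c • v) = c • val v from rfl, hx, Pi.smul_apply, smul_eq_mul, map_mul]; ring))
    ((exists_norm_cell_mul_le hm R).choose * ‖q‖)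
    fun u v => (exists_norm_cell_mul_le hm R).choose_spec.2 q u v

theorem perturbationAux_apply (hm : m = 1 ∨ m = 2) (q : L2 (cell m R)) (u v : HTilde m R) :
    perturbationAux hm q u v = ∫ x in cell m R, q x * val u x * conj (val v x) := rfl

/-- The form `∫ q u v̄`, as a bounded linear function of `q ∈ L²(Ω_0^R)`. -/
noncomputable def perturbationL (hm : m = 1 ∨ m = 2) (R : ℝ) :
    L2 (cell m R) →L[ℂ] (HTilde m R →L[ℂ] (HTilde m R →L⋆[ℂ] ℂ)) :=
  LinearMap.mkContinuous
    { toFun := fun q : L2 (cell m R) => perturbationAux hm q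
      map_add' := fun q q' => by
        ext u v
        simp only [add_apply, perturbationAux_apply]
        rw [← integral_add (integrable_cell_mul hm _ _ _) (integrable_cell_mul hm _ _ _)]
        refine integral_congr_ae ?_
        filter_upwards [Lp.coeFn_add q q'] with x hx
        rw [hx, Pi.add_apply]; ring
      map_smul' := fun c q => by
        ext u v
        simp only [smul_apply, perturbationAux_apply, RingHom.id_apply]
        rw [smul_eq_mul, ← integral_const_mul]
        refine integral_congr_ae ?_
        filter_upwards [Lp.coeFn_smul c q] with x hx
        rw [hx, Pi.smul_apply, smul_eq_mul]; ring }
    (exists_norm_cell_mul_le hm R).choose fun q =>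
      LinearMap.mkContinuous₂_norm_le _
        (mul_nonneg (exists_norm_cell_mul_le hm R).choose_spec.1 (norm_nonneg q))
        fun u v => (exists_norm_cell_mul_le hm R).choose_spec.2 q u v

theorem perturbationL_apply (hm : m = 1 ∨ m = 2) (q : L2 (cell m R)) (u v : HTilde m R) :
    perturbationL hm R q u v = ∫ x in cell m R, q x * val u x * conj (val v x) := rfl

theorem linSource_eq (hm : m = 1 ∨ m = 2) (k : ℝ) (h : L2 (cell m R)) (u v : HTilde m R) :
    linSource k h u v = (k : ℂ) ^ 2 * perturbationL hm R h u v := by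
  rw [perturbationL_apply, linSource, ← integral_const_mul]
  exact integral_congr_ae (Eventually.of_forall fun x => by ring)

/-- The periodic index, extended by zero from the strip. -/
noncomputable def layerIndex (R : ℝ) (np : Pt m → ℂ) : Pt m → ℂ := (strip m R).indicator np

theorem strip_subset_halfSpace : strip m R ⊆ halfSpace m := fun _ hx => hx.1

/-- An essentially bounded function on `s`, extended by zero, is a bounded potential. -/
theorem exists_isPotential_indicator {s : Set (Pt m)} (hs : MeasurableSet s) {f : Pt m → ℂ}
    (h : MemLp f ⊤ (volume.restrict s)) : ∃ M ≥ 0, IsPotential M (s.indicator f) := by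
  refine ⟨(eLpNormEssSup f (volume.restrict s)).toReal, ENNReal.toReal_nonneg,
    (aestronglyMeasurable_indicator_iff hs).2 h.1, ?_⟩
  have h2 : eLpNormEssSup f (volume.restrict s) ≠ ⊤ := by
    have := h.2.ne
    rwa [eLpNorm_exponent_top] at this
  have h1 := ae_le_eLpNormEssSup (f := f) (μ := volume.restrict s)
  rw [ae_restrict_iff' hs] at h1
  filter_upwards [h1] with x hx
  by_cases hxs : x ∈ s
  · rw [Set.indicator_of_mem hxs]
    have := ENNReal.toReal_mono h2 (hx hxs)
    rwa [toReal_enorm] at this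
  · rw [Set.indicator_of_notMem hxs, norm_zero]
    exact ENNReal.toReal_nonneg

theorem exists_isPotential {R₀ : ℝ} {np : Pt m → ℂ} (hnp : IsPeriodicIndex m R₀ np) (R : ℝ) :
    ∃ M ≥ 0, IsPotential M (layerIndex R np) :=
  exists_isPotential_indicator measurableSet_strip
    (hnp.bounded.mono_measure (Measure.restrict_mono strip_subset_halfSpace le_rfl))

/-- The bounded operator with the sesquilinear form `form k np q`. -/
noncomputable def formL (hm : m = 1 ∨ m = 2) {k : ℝ} (hk : 0 < k) (hR : 0 ≤ R) {np : Pt m → ℂ}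
    {M : ℝ} (hM : 0 ≤ M) (hV : IsPotential M (layerIndex R np)) (q : L2 (cell m R)) :
    HTilde m R →L[ℂ] (HTilde m R →L⋆[ℂ] ℂ) :=
  dirichletL m R - (k : ℂ) ^ 2 • potentialL hM hV R - (k : ℂ) ^ 2 • perturbationL hm R q
    - dtnL hk hR

theorem form_eq (hm : m = 1 ∨ m = 2) {k : ℝ} (hk : 0 < k) (hR : 0 ≤ R) {np : Pt m → ℂ} {M : ℝ}
    (hM : 0 ≤ M) (hV : IsPotential M (layerIndex R np)) (q : L2 (cell m R)) (u v : HTilde m R) :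
    form k np q u v = formL hm hk hR hM hV q u v := by
  simp only [formL, sub_apply, smul_apply, dtnL_apply,
    perturbationL_apply, potentialL_apply, dirichletL_apply, smul_eq_mul, form]
  congr 1
  have i1 : ∀ i, Integrable (fun x => grad u i x * conj (grad v i x))
      (volume.restrict (strip m R)) := fun i =>
    (Lp.memLp (grad u i)).integrable_mul (Lp.memLp (grad v i)).star
  have i2 := integrable_potential_mul hV (val u) (val v)
  have e3 : ∫ x in cell m R, q x * val u x * conj (val v x)
      = ∫ x in strip m R, (cell m R).indicator (fun x => q x * val u x * conj (val v x)) x := by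
    rw [integral_indicator measurableSet_cell, Measure.restrict_restrict measurableSet_cell,
      Set.inter_eq_left.2 (cell_subset_strip m R)]
  have i3 : Integrable ((cell m R).indicator (fun x => q x * val u x * conj (val v x)))
      (volume.restrict (strip m R)) := by
    rw [integrable_indicator_iff measurableSet_cell, IntegrableOn,
      Measure.restrict_restrict measurableSet_cell, Set.inter_eq_left.2 (cell_subset_strip m R)]
    exact integrable_cell_mul hm q u v
  rw [e3, ← integral_finsetSum _ fun i _ => i1 i, ← integral_const_mul, ← integral_const_mul,
    ← integral_sub (integrable_finsetSum _ fun i _ => i1 i) (i2.const_mul _)]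
  refine Eq.trans ?_ (integral_sub
    ((integrable_finsetSum _ fun i _ => i1 i).sub (i2.const_mul _)) (i3.const_mul _))
  refine setIntegral_congr_fun measurableSet_strip fun x hx => ?_
  simp only [layerIndex, Set.indicator_of_mem hx]
  by_cases hc : x ∈ cell m R
  · simp only [Set.indicator_of_mem hc]; ring
  · simp only [Set.indicator_of_notMem hc]; ring

/-! ### Lattice translates -/

/-- The lattice vector `2πj`. -/
noncomputable def latticePt (j : Fin m → ℤ) : Pt m :=
  (WithLp.toLp 2 fun i => 2 * Real.pi * (j i : ℝ), 0)

theorem shift_eq (j : Fin m → ℤ) : shift j = fun x => x + latticePt j := by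
  funext x
  simp [shift, latticePt, Prod.add_def]

/-- The translate of `box m N R` by the lattice vector `2πj`. -/
def latticeBox (N R : ℝ) (j : Fin m → ℤ) : Set (Pt m) :=
  {x | (∀ i, |x.1 i - 2 * Real.pi * j i| < N) ∧ 0 < x.2 ∧ x.2 < R}

theorem shift_fst_apply (j : Fin m → ℤ) (x : Pt m) (i : Fin m) :
    (shift j x).1 i = x.1 i + 2 * Real.pi * j i := rfl

theorem shift_preimage_latticeBox (N R : ℝ) (j : Fin m → ℤ) :
    shift j ⁻¹' latticeBox N R j = box m N R := by
  ext x
  simp only [latticeBox, box, Set.mem_preimage, Set.mem_ofPred_eq, shift_fst_apply,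
    add_sub_cancel_right]
  rfl

theorem measurePreserving_shift (j : Fin m → ℤ) :
    MeasurePreserving (shift j) (volume : Measure (Pt m)) volume := by
  rw [shift_eq]
  exact measurePreserving_add_right volume _

theorem measurableEmbedding_shift (j : Fin m → ℤ) : MeasurableEmbedding (shift (m := m) j) := by
  rw [shift_eq]
  exact measurableEmbedding_addRight _

theorem setIntegral_box_shift (N R : ℝ) (j : Fin m → ℤ) (f : Pt m → ℝ) :
    ∫ x in box m N R, f (shift j x) = ∫ x in latticeBox N R j, f x := by
  rw [← shift_preimage_latticeBox N R j]
  exact (measurePreserving_shift j).setIntegral_preimage_emb (measurableEmbedding_shift j) f _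

theorem measurableSet_latticeBox (N R : ℝ) (j : Fin m → ℤ) :
    MeasurableSet (latticeBox N R j) := by
  have h : latticeBox N R j = (⋂ i : Fin m, {x : Pt m | |x.1 i - 2 * Real.pi * j i| < N})
      ∩ strip m R := by
    ext x; simp [latticeBox, strip]
  rw [h]
  refine (MeasurableSet.iInter fun i => ?_).inter measurableSet_strip
  have hc : Continuous fun x : Pt m => |x.1 i - 2 * Real.pi * j i| := by fun_prop
  exact (isOpen_lt hc continuous_const).measurableSet

theorem sum_setIntegral_latticeBox (N R : ℝ) {f : Pt m → ℝ} (hf : Integrable f volume)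
    (S : Finset (Fin m → ℤ)) :
    ∑ j ∈ S, ∫ x in latticeBox N R j, f x
      = ∫ x, ∑ j ∈ S, (latticeBox N R j).indicator f x := by
  rw [integral_finsetSum _ fun j _ => hf.indicator (measurableSet_latticeBox N R j)]
  exact Finset.sum_congr rfl fun j _ => (integral_indicator (measurableSet_latticeBox N R j)).symm

open Classical in
theorem sum_indicator_latticeBox (N R : ℝ) (f : Pt m → ℝ) (S : Finset (Fin m → ℤ)) (x : Pt m) :
    ∑ j ∈ S, (latticeBox N R j).indicator f x
      = ((S.filter fun j => x ∈ latticeBox N R j).card : ℝ) * f x := by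
  simp only [Set.indicator_apply]
  rw [← Finset.sum_filter, Finset.sum_const, nsmul_eq_mul]

open Classical in
theorem card_latticeBox_le (N R : ℝ) (S : Finset (Fin m → ℤ)) (x : Pt m) :
    (S.filter fun j => x ∈ latticeBox N R j).card ≤ (⌈N / Real.pi⌉ + 1).toNat ^ m := by
  have hpi := Real.pi_pos
  have hsub : (S.filter fun j => x ∈ latticeBox N R j) ⊆ Fintype.piFinset fun i : Fin m =>
      Finset.Icc ⌈(x.1 i - N) / (2 * Real.pi)⌉ (⌈(x.1 i - N) / (2 * Real.pi)⌉ + ⌈N / Real.pi⌉) := by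
    intro j hj
    rw [Fintype.mem_piFinset]
    intro i
    have h := abs_lt.1 ((Finset.mem_filter.1 hj).2.1 i)
    rw [Finset.mem_Icc, Int.ceil_le, div_le_iff₀ (by positivity)]
    refine ⟨by linarith, ?_⟩
    have h1 : (j i : ℝ) ≤ (x.1 i - N) / (2 * Real.pi) + N / Real.pi := by
      have e : (x.1 i - N) / (2 * Real.pi) + N / Real.pi = (x.1 i + N) / (2 * Real.pi) := by
        field_simp; ring
      rw [e, le_div_iff₀ (by positivity)]
      linarith
    have h2 := h1.trans (add_le_add (Int.le_ceil _) (Int.le_ceil _))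
    exact_mod_cast h2
  refine (Finset.card_le_card hsub).trans (le_of_eq ?_)
  rw [Fintype.card_piFinset]
  simp [add_assoc]

/-- The lattice translates of a box overlap only boundedly often. -/
theorem sum_setIntegral_latticeBox_le (N R : ℝ) {f : Pt m → ℝ} (hf : Integrable f volume)
    (hf0 : ∀ᵐ x, 0 ≤ f x) (S : Finset (Fin m → ℤ)) :
    ∑ j ∈ S, ∫ x in latticeBox N R j, f x
      ≤ ((⌈N / Real.pi⌉ + 1).toNat ^ m : ℕ) * ∫ x, f x := by
  classical
  rw [sum_setIntegral_latticeBox N R hf, ← integral_const_mul]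
  refine integral_mono_ae
    (integrable_finsetSum _ fun j _ => hf.indicator (measurableSet_latticeBox N R j))
    (hf.const_mul _) ?_
  filter_upwards [hf0] with x hx
  rw [sum_indicator_latticeBox]
  exact mul_le_mul_of_nonneg_right (by exact_mod_cast card_latticeBox_le N R S x) hx

/-- The lattice translates of a box that contains a period cell cover the strip. -/
theorem integral_le_of_sum_latticeBox_le {N : ℝ} (hN : Real.pi < N) {f : Pt m → ℝ}
    (hf : Integrable f volume) (hf0 : ∀ x, 0 ≤ f x) (hfs : ∀ x ∉ strip m R, f x = 0) {B : ℝ}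
    (hB : ∀ S : Finset (Fin m → ℤ), ∑ j ∈ S, ∫ x in latticeBox N R j, f x ≤ B) :
    ∫ x, f x ≤ B := by
  classical
  have hlim := tendsto_setIntegral_of_monotone (μ := volume) (f := f)
    (s := fun n : ℕ => box m ((n : ℝ) + 1) R) (fun n => measurableSet_box _)
    (fun a b hab => box_mono (by gcongr)) hf.integrableOn
  have hU : ⋃ n : ℕ, box m ((n : ℝ) + 1) R = strip m R := by
    refine Set.Subset.antisymm (Set.iUnion_subset fun n => box_subset_strip _) fun x hx => ?_
    obtain ⟨n, hn⟩ := exists_nat_ge (∑ i, |x.1 i|)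
    refine Set.mem_iUnion.2 ⟨n, fun i => ?_, hx⟩
    have := Finset.single_le_sum (f := fun i => |x.1 i|) (fun i _ => abs_nonneg _)
      (Finset.mem_univ i)
    dsimp only at this
    linarith
  rw [hU, setIntegral_eq_integral_of_forall_compl_eq_zero hfs] at hlim
  refine le_of_tendsto' hlim fun n => le_trans ?_
    (hB (Fintype.piFinset fun _ : Fin m => Finset.Icc (-(n + 1 : ℤ)) (n + 1)))
  rw [sum_setIntegral_latticeBox N R hf, ← integral_indicator (measurableSet_box _)]
  refine integral_mono (hf.indicator (measurableSet_box _))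
    (integrable_finsetSum _ fun j _ => hf.indicator (measurableSet_latticeBox N R j)) fun x => ?_
  dsimp only
  rw [sum_indicator_latticeBox]
  by_cases hx : x ∈ box m ((n : ℝ) + 1) R
  · rw [Set.indicator_of_mem hx]
    refine le_mul_of_one_le_left (hf0 x) ?_
    rw [Nat.one_le_cast, Nat.one_le_iff_ne_zero, Finset.card_ne_zero]
    -- the translate by the lattice point closest to `x`
    refine ⟨fun i => round (x.1 i / (2 * Real.pi)), Finset.mem_filter.2 ⟨?_, fun i => ?_, hx.2⟩⟩
    · rw [Fintype.mem_piFinset]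
      intro i
      have h1 := abs_le.1 (abs_sub_round (x.1 i / (2 * Real.pi)))
      have h2 : |x.1 i / (2 * Real.pi)| ≤ (n + 1) / 2 := by
        rw [abs_div, abs_of_pos Real.two_pi_pos, div_le_iff₀ Real.two_pi_pos]
        have h3 := (hx.1 i).le
        have h4 := Real.pi_gt_three
        nlinarith [abs_nonneg (x.1 i)]
      have h5 := abs_le.1 h2
      have hn : (0 : ℝ) ≤ n := Nat.cast_nonneg n
      rw [Finset.mem_Icc]
      constructor
      · have : (-(n + 1 : ℝ)) ≤ (round (x.1 i / (2 * Real.pi)) : ℝ) := by linarith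
        exact_mod_cast this
      · have : (round (x.1 i / (2 * Real.pi)) : ℝ) ≤ (n + 1 : ℝ) := by linarith
        exact_mod_cast this
    · have h1 := abs_sub_round (x.1 i / (2 * Real.pi))
      have e : x.1 i - 2 * Real.pi * (round (x.1 i / (2 * Real.pi)) : ℝ)
          = 2 * Real.pi * (x.1 i / (2 * Real.pi) - round (x.1 i / (2 * Real.pi))) := by
        have := Real.pi_ne_zero
        field_simp
      rw [e, abs_mul, abs_of_pos Real.two_pi_pos]
      have := Real.pi_pos
      nlinarith
  · rw [Set.indicator_of_notMem hx]
    exact mul_nonneg (Nat.cast_nonneg _) (hf0 x)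

/-! ### Translation of the data -/

theorem IsTest.comp_sub {φ : Pt m → ℂ} (hφ : IsTest φ) (c : Pt m) :
    IsTest (fun x => φ (x - c)) :=
  ⟨hφ.1.comp (contDiff_id.sub contDiff_const),
    hφ.2.comp_isClosedEmbedding (Homeomorph.subRight c).isClosedEmbedding⟩

theorem tsupport_comp_sub_subset (φ : Pt m → ℂ) (c : Pt m) :
    tsupport (fun x => φ (x - c)) ⊆ {x | x - c ∈ tsupport φ} :=
  closure_minimal (fun _ hx => subset_tsupport φ hx)
    ((isClosed_tsupport φ).preimage (by fun_prop))

theorem pd_comp_sub (i : Option (Fin m)) (φ : Pt m → ℂ) (c x : Pt m) :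
    pd i (fun x => φ (x - c)) x = pd i φ (x - c) := by
  rw [pd, fderiv_comp_sub]
  rfl

theorem integral_shift_mul (j : Fin m → ℤ) (f φ : Pt m → ℂ) :
    ∫ x, f (shift j x) * φ x = ∫ x, f x * φ (x - latticePt j) := by
  rw [← (measurePreserving_shift j).integral_comp (measurableEmbedding_shift j)
    (fun x => f x * φ (x - latticePt j))]
  simp [shift_eq]

theorem memLp_shift {f : Pt m → ℂ} (hf : MemLp f 2 volume) (j : Fin m → ℤ) :
    MemLp (fun x => f (shift j x)) 2 volume :=
  hf.comp_measurePreserving (measurePreserving_shift j)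

theorem IsLayer.shift {u : Pt m → ℂ} {g : Option (Fin m) → Pt m → ℂ} (h : IsLayer R u g)
    (j : Fin m → ℤ) : IsLayer R (fun x => u (shift j x)) (fun i x => g i (shift j x)) where
  isH1 :=
    { memLp := memLp_shift h.isH1.memLp j
      memLp_grad := fun i => memLp_shift (h.isH1.memLp_grad i) j
      weak := fun φ hφ hs i => by
        rw [integral_shift_mul, integral_shift_mul j u (pd i φ)]
        have := h.isH1.weak _ (hφ.comp_sub (latticePt j)) (fun x hx => by
          have h1 := hs (tsupport_comp_sub_subset φ _ hx)
          simpa [latticePt] using h1) i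
        simpa only [pd_comp_sub] using this }
  val_zero x hx := h.val_zero _ hx
  grad_zero i x hx := h.grad_zero i _ hx

/-- A function that is `2π`-periodic in the horizontal variables. -/
def IsPeriodic {α : Type*} (f : Pt m → α) : Prop := ∀ j : Fin m → ℤ, ∀ᵐ x, f (shift j x) = f x

/-- The translated data. -/
noncomputable def LayerData.shift (d : LayerData m) (j : Fin m → ℤ) : LayerData m where
  u x := d.u (LayerScattering.shift j x)
  du i x := d.du i (LayerScattering.shift j x)
  w x := d.w (LayerScattering.shift j x)
  dw i x := d.dw i (LayerScattering.shift j x)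
  p x := d.p (LayerScattering.shift j x)

/-- The equation holds in the whole strip. -/
structure GlobalEq (R : ℝ) (V : Pt m → ℂ) (d : LayerData m) : Prop where
  isLayer_u : IsLayer R d.u d.du
  isLayer_w : IsLayer R d.w d.dw
  memLp_p : MemLp d.p 2 volume
  eq : ∀ φ : Pt m → ℂ, IsTest φ → tsupport φ ⊆ strip m R →
    (∑ i, ∫ x, d.du i x * pd i φ x) - ∫ x, V x * d.u x * φ x
      = (∑ i, ∫ x, d.dw i x * pd i φ x) + ∫ x, (d.w x + d.p x) * φ x

theorem GlobalEq.localEq {V : Pt m → ℂ} {d : LayerData m} (h : GlobalEq R V d) (N : ℝ) :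
    LocalEq N R V d where
  isLayer_u := h.isLayer_u
  isLayer_w := h.isLayer_w
  memLp_p := h.memLp_p
  eq φ hφ hs := h.eq φ hφ (hs.trans (box_subset_strip _))

theorem GlobalEq.shift {V : Pt m → ℂ} (hV : IsPeriodic V) {d : LayerData m} (h : GlobalEq R V d)
    (j : Fin m → ℤ) : GlobalEq R V (d.shift j) where
  isLayer_u := h.isLayer_u.shift j
  isLayer_w := h.isLayer_w.shift j
  memLp_p := memLp_shift h.memLp_p j
  eq φ hφ hs := by
    have := h.eq _ (hφ.comp_sub (latticePt j)) (fun x hx => by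
      have h1 := hs (tsupport_comp_sub_subset φ _ hx)
      simpa [latticePt, strip] using h1)
    have eV : ∫ x, V x * d.u (LayerScattering.shift j x) * φ x
        = ∫ x, (fun y => V y * d.u y) (LayerScattering.shift j x) * φ x := by
      refine integral_congr_ae ?_
      filter_upwards [hV j] with x hx
      rw [hx]
    simp only [LayerData.shift]
    rw [eV, integral_shift_mul j (fun y => V y * d.u y) φ,
      integral_shift_mul j (fun y => d.w y + d.p y) φ]
    simp only [integral_shift_mul]
    simpa only [pd_comp_sub] using this

theorem LayerData.size_shift (d : LayerData m) (j : Fin m → ℤ) (N : ℝ) :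
    (d.shift j).size N R = ∫ x in latticeBox (N + 1) R j, energy d.u d.du x :=
  setIntegral_box_shift (N + 1) R j (energy d.u d.du)

theorem LayerData.defect_shift (d : LayerData m) (j : Fin m → ℤ) (N : ℝ) {σ : Pt m → ℝ}
    (hσ : IsPeriodic σ) : (d.shift j).defect N R σ
      = ∫ x in latticeBox (N + 1) R j, (energy d.w d.dw x + ‖d.p x‖ ^ 2 + σ x * ‖d.u x‖ ^ 2) := by
  rw [← setIntegral_box_shift (N + 1) R j
    (fun x => energy d.w d.dw x + ‖d.p x‖ ^ 2 + σ x * ‖d.u x‖ ^ 2)]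
  refine integral_congr_ae (ae_restrict_of_ae ?_)
  filter_upwards [hσ j] with x hx
  rw [hx]
  rfl

/-- The local estimate, summed over all lattice translates of the box. -/
theorem global_estimate (hm : m = 1 ∨ m = 2) {M : ℝ} (hM : 0 ≤ M) {V : Pt m → ℂ}
    (hV : IsPotential M V) (hVp : IsPeriodic V) {σ : Pt m → ℝ} (hσ : IsAbsorption σ)
    (hσp : IsPeriodic σ) {s : Set (Pt m)} (hso : IsOpen s) (hsn : s.Nonempty) {N : ℝ}
    (hN : Real.pi < N) (hs : s ⊆ box m N R) (hpos : ∀ᵐ x, x ∈ s → 0 < σ x) {η : ℝ} (hη : 0 < η) :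
    ∃ K ≥ 0, ∀ d : LayerData m, GlobalEq R V d →
      ∫ x, ‖d.u x‖ ^ 2 ≤ η * (∫ x, energy d.u d.du x)
        + K * ∫ x, (energy d.w d.dw x + ‖d.p x‖ ^ 2 + σ x * ‖d.u x‖ ^ 2) := by
  set c : ℝ := (((⌈(N + 1) / Real.pi⌉ + 1).toNat ^ m : ℕ) : ℝ) with hc
  have hc0 : 0 ≤ c := Nat.cast_nonneg _
  have hc1 : 0 < c + 1 := by linarith
  obtain ⟨K, hK, h⟩ := local_estimate hm (Real.pi_pos.trans hN) hM hV hσ hso hsn hs hpos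
    (η / (c + 1)) (by positivity)
  refine ⟨K * c, by positivity, fun d hd => ?_⟩
  have hu2 := integrable_norm_sq hd.isLayer_u.isH1.memLp
  have hE := hd.isLayer_u.isH1.integrable_energy
  have hD := (hd.localEq N).integrable_defect hσ
  have hD0 : ∀ᵐ x, 0 ≤ energy d.w d.dw x + ‖d.p x‖ ^ 2 + σ x * ‖d.u x‖ ^ 2 := by
    filter_upwards [hσ.nonneg] with x hx
    have := energy_nonneg d.w d.dw x
    positivity
  refine integral_le_of_sum_latticeBox_le hN hu2 (fun x => by positivity)
    (fun x hx => by rw [hd.isLayer_u.val_zero x hx]; simp) fun S => ?_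
  have h1 : ∀ j ∈ S, ∫ x in latticeBox N R j, ‖d.u x‖ ^ 2
      ≤ η / (c + 1) * (∫ x in latticeBox (N + 1) R j, energy d.u d.du x)
        + K * ∫ x in latticeBox (N + 1) R j,
          (energy d.w d.dw x + ‖d.p x‖ ^ 2 + σ x * ‖d.u x‖ ^ 2) := fun j _ => by
    have := h (d.shift j) ((hd.shift hVp j).localEq N)
    rw [d.size_shift, d.defect_shift j N hσp] at this
    rw [← setIntegral_box_shift N R j fun x => ‖d.u x‖ ^ 2]
    exact this
  refine (Finset.sum_le_sum h1).trans ?_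
  rw [Finset.sum_add_distrib, ← Finset.mul_sum, ← Finset.mul_sum]
  have h2 := sum_setIntegral_latticeBox_le (N + 1) R hE
    (Eventually.of_forall fun x => energy_nonneg _ _ x) S
  have h3 := sum_setIntegral_latticeBox_le (N + 1) R hD hD0 S
  rw [← hc] at h2 h3
  have hI : 0 ≤ ∫ x, energy d.u d.du x := integral_nonneg fun x => energy_nonneg _ _ x
  have h4 : η / (c + 1) * (c * ∫ x, energy d.u d.du x) ≤ η * ∫ x, energy d.u d.du x := by
    rw [div_mul_eq_mul_div, div_le_iff₀ hc1]
    nlinarith [mul_nonneg hη.le hI]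
  calc _ ≤ η / (c + 1) * (c * ∫ x, energy d.u d.du x) + K * (c * ∫ x,
        (energy d.w d.dw x + ‖d.p x‖ ^ 2 + σ x * ‖d.u x‖ ^ 2)) := by
        have := hη.le
        gcongr
    _ ≤ _ := by rw [mul_assoc]; gcongr

/-! ### The a priori estimate -/

theorem IsPotential.const_mul {M : ℝ} {V : Pt m → ℂ} (hV : IsPotential M V) (c : ℂ) :
    IsPotential (‖c‖ * M) fun x => c * V x :=
  ⟨hV.aesm.const_mul c, hV.bdd.mono fun x hx => by rw [norm_mul]; gcongr⟩

theorem IsPotential.conj {M : ℝ} {V : Pt m → ℂ} (hV : IsPotential M V) :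
    IsPotential M fun x => conj (V x) :=
  ⟨Complex.continuous_conj.comp_aestronglyMeasurable hV.aesm,
    hV.bdd.mono fun x hx => by rwa [RCLike.norm_conj]⟩

theorem IsPotential.add {M M' : ℝ} {V P : Pt m → ℂ} (hV : IsPotential M V)
    (hP : IsPotential M' P) : IsPotential (M + M') fun x => V x + P x :=
  ⟨hV.aesm.add hP.aesm, by
    filter_upwards [hV.bdd, hP.bdd] with x h1 h2
    exact (norm_add_le _ _).trans (add_le_add h1 h2)⟩

theorem size_ext_le (u w : HTilde m R) (p : Pt m → ℂ) (N : ℝ) :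
    (⟨extVal u, extGrad u, extVal w, extGrad w, p⟩ : LayerData m).size N R ≤ ‖u‖ ^ 2 := by
  rw [norm_sq_eq_integral_energy]
  exact setIntegral_le_integral (isH1_ext u).integrable_energy
    (Eventually.of_forall fun x => energy_nonneg _ _ x)

theorem integral_defect_ext {σ : Pt m → ℝ} (hσ : IsAbsorption σ) (u w : HTilde m R) {p : Pt m → ℂ}
    (hp : MemLp p 2 volume) :
    ∫ x, (energy (extVal w) (extGrad w) x + ‖p x‖ ^ 2 + σ x * ‖extVal u x‖ ^ 2)
      = ‖w‖ ^ 2 + (∫ x, ‖p x‖ ^ 2) + ∫ x, σ x * ‖extVal u x‖ ^ 2 := by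
  rw [norm_sq_eq_integral_energy, ← integral_add (isH1_ext w).integrable_energy
    (integrable_norm_sq hp)]
  exact integral_add ((isH1_ext w).integrable_energy.add (integrable_norm_sq hp))
    (hσ.integrable_mul (isH1_ext u).memLp)

/-- A term linear in `U` is absorbed by `U ^ 2`. -/
theorem le_mul_of_sq_le {U W L : ℝ} (hU : 0 ≤ U) (hW : 0 ≤ W) (hL : 0 ≤ L)
    (h : U ^ 2 ≤ 2 * L * (W ^ 2 + U * W)) : U ≤ (4 * L + 1) * W := by
  rcases le_total U W with h1 | h1
  · nlinarith [mul_nonneg hL hW]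
  · rcases hU.eq_or_lt with h0 | h0
    · rw [← h0]; positivity
    · have h2 : W ^ 2 ≤ U * W := by nlinarith
      have h3 : U * U ≤ U * (4 * L * W) := by nlinarith
      nlinarith [le_of_mul_le_mul_left h3 h0]

/-- The equation satisfied by `u` in the interior of the strip, with the right hand side given by
the Riesz representative `w`. -/
def InteriorEq (V : Pt m → ℂ) (u w : HTilde m R) : Prop :=
  ∀ φ : Pt m → ℂ, IsTest φ → tsupport φ ⊆ strip m R →
    (∑ i, ∫ x, extGrad u i x * pd i φ x) - ∫ x, V x * extVal u x * φ x
      = (∑ i, ∫ x, extGrad w i x * pd i φ x) + ∫ x, extVal w x * φ x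

/-- The local estimate in terms of the norms of `H̃¹`. -/
theorem exists_box_le (hm : m = 1 ∨ m = 2) {M : ℝ} (hM : 0 ≤ M) {V : Pt m → ℂ}
    (hV : IsPotential M V) {σ : Pt m → ℝ} (hσ : IsAbsorption σ) {s : Set (Pt m)} (hso : IsOpen s)
    (hsn : s.Nonempty) {N : ℝ} (hN : 0 < N) (hs : s ⊆ box m N R) (hpos : ∀ᵐ x, x ∈ s → 0 < σ x)
    {η : ℝ} (hη : 0 < η) :
    ∃ K ≥ 0, ∀ u w : HTilde m R, InteriorEq V u w → ∫ x, σ x * ‖extVal u x‖ ^ 2 ≤ ‖u‖ * ‖w‖ →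
      ∫ x in box m N R, ‖extVal u x‖ ^ 2 ≤ η * ‖u‖ ^ 2 + K * (‖w‖ ^ 2 + ‖u‖ * ‖w‖) := by
  obtain ⟨K, hK, hloc⟩ := local_estimate hm hN hM hV hσ hso hsn hs hpos η hη
  refine ⟨K, hK, fun u w heq h1 => ?_⟩
  have h0 : MemLp (fun _ : Pt m => (0 : ℂ)) 2 volume := MemLp.zero
  have d1 := hloc ⟨extVal u, extGrad u, extVal w, extGrad w, fun _ => 0⟩
    { isLayer_u := isLayer_ext u
      isLayer_w := isLayer_ext w
      memLp_p := h0
      eq := fun φ hφ hs => by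
        simp only [add_zero]
        exact heq φ hφ (hs.trans (box_subset_strip _)) }
  have e1 := integral_defect_ext hσ u w h0
  have d2 : (⟨extVal u, extGrad u, extVal w, extGrad w, fun _ => 0⟩ : LayerData m).defect N R σ
      ≤ ‖w‖ ^ 2 + ‖u‖ * ‖w‖ := by
    refine (setIntegral_le_integral ?_ ?_).trans ?_
    · exact ((isH1_ext w).integrable_energy.add (integrable_norm_sq h0)).add
        (hσ.integrable_mul (isH1_ext u).memLp)
    · filter_upwards [hσ.nonneg] with x hx
      have := energy_nonneg (extVal w) (extGrad w) x
      simp only [Pi.zero_apply]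
      positivity
    · rw [e1]
      simpa using h1
  exact d1.trans (add_le_add (mul_le_mul_of_nonneg_left (size_ext_le u w _ N) hη.le)
    (mul_le_mul_of_nonneg_left d2 hK))

/-- The global estimate, with the contribution `P` to the potential that is supported in the cell
treated as a right hand side. -/
theorem exists_strip_le (hm : m = 1 ∨ m = 2) {M M' : ℝ} (hM : 0 ≤ M) {V P : Pt m → ℂ}
    (hV : IsPotential M V) (hVp : IsPeriodic V) (hP : IsPotential M' P) {σ : Pt m → ℝ}
    (hσ : IsAbsorption σ) (hσp : IsPeriodic σ) {s : Set (Pt m)} (hso : IsOpen s)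
    (hsn : s.Nonempty) {N : ℝ} (hN : Real.pi < N) (hPs : ∀ x ∉ box m N R, P x = 0)
    (hs : s ⊆ box m N R) (hpos : ∀ᵐ x, x ∈ s → 0 < σ x) {η : ℝ} (hη : 0 < η) :
    ∃ K ≥ 0, ∀ u w : HTilde m R, InteriorEq (fun x => V x + P x) u w →
      ∫ x, σ x * ‖extVal u x‖ ^ 2 ≤ ‖u‖ * ‖w‖ →
      ∫ x, ‖extVal u x‖ ^ 2 ≤ η * ‖u‖ ^ 2 + K * (‖w‖ ^ 2 + ‖u‖ * ‖w‖
        + M' ^ 2 * ∫ x in box m N R, ‖extVal u x‖ ^ 2) := by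
  obtain ⟨K, hK, hglob⟩ := global_estimate hm hM hV hVp hσ hσp hso hsn hN hs hpos hη
  refine ⟨K, hK, fun u w heq h1 => ?_⟩
  have hPu : MemLp (fun x => P x * extVal u x) 2 volume := hP.memLp_mul (isH1_ext u).memLp
  have d3 := hglob ⟨extVal u, extGrad u, extVal w, extGrad w, fun x => P x * extVal u x⟩
    { isLayer_u := isLayer_ext u
      isLayer_w := isLayer_ext w
      memLp_p := hPu
      eq := fun φ hφ hs => by
        have := heq φ hφ hs
        have i1 := hφ.integrable_mul (hV.memLp_mul (isH1_ext u).memLp)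
        have i2 := hφ.integrable_mul hPu
        have i3 := hφ.integrable_mul (isH1_ext w).memLp
        simp only [add_mul] at this ⊢
        rw [integral_add i1 i2] at this
        rw [integral_add i3 i2]
        linear_combination this }
  dsimp only at d3
  rw [integral_defect_ext hσ u w hPu, ← norm_sq_eq_integral_energy] at d3
  have d4 : ∫ x, ‖P x * extVal u x‖ ^ 2 ≤ M' ^ 2 * ∫ x in box m N R, ‖extVal u x‖ ^ 2 := by
    rw [← integral_const_mul, ← integral_indicator (measurableSet_box N)]
    refine integral_mono_ae (integrable_norm_sq hPu)
      (((integrable_norm_sq (isH1_ext u).memLp).const_mul _).indicator (measurableSet_box N)) ?_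
    filter_upwards [hP.bdd] with x hx
    by_cases hc : x ∈ box m N R
    · rw [Set.indicator_of_mem hc, norm_mul, mul_pow]
      gcongr
    · rw [Set.indicator_of_notMem hc, hPs x hc]
      simp
  refine d3.trans (add_le_add le_rfl (mul_le_mul_of_nonneg_left ?_ hK))
  linarith

/-- Two estimates with small multiples of `U ^ 2` are combined: the small constants are such that each
of these multiples contributes at most `U ^ 2 / 4` to the right hand side of `hU`. -/
theorem sq_le_of_two_step {A K K' B U T S x y : ℝ} (hA : 0 < A) (hK : 0 ≤ K) (hB : 0 ≤ B)
    (hS : S ≤ T) (hx : x ≤ 1 / (4 * A) * U ^ 2 + K * (T + B * y))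
    (hy : y ≤ 1 / (4 * A * (K * B + 1)) * U ^ 2 + K' * T) (hU : U ^ 2 ≤ A * x + S) :
    U ^ 2 ≤ 2 * (A * K + A * K * B * K' + 1) * T := by
  have s1 : A * (K * (B * y)) ≤ 1 / 4 * U ^ 2 + A * K * B * K' * T := by
    have : A * (K * (B * y)) ≤ A * (K * (B *
        (1 / (4 * A * (K * B + 1)) * U ^ 2 + K' * T))) := by gcongr
    refine this.trans ?_
    have e : A * (K * (B * (1 / (4 * A * (K * B + 1)) * U ^ 2 + K' * T)))
        = (K * B) / (K * B + 1) * (1 / 4 * U ^ 2) + A * K * B * K' * T := by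
      have : K * B + 1 ≠ 0 := by positivity
      field_simp
    rw [e]
    have h3 : (K * B) / (K * B + 1) ≤ 1 := by
      rw [div_le_one (by positivity)]; linarith
    have h4 : 0 ≤ 1 / 4 * U ^ 2 := by positivity
    nlinarith
  have s2 : A * x ≤ 1 / 4 * U ^ 2 + A * K * T + A * (K * (B * y)) := by
    refine (mul_le_mul_of_nonneg_left hx hA.le).trans (le_of_eq ?_)
    field_simp
    ring
  linarith

/-- The a priori estimate. The local estimate for the potential `V + P` on one box that contains the
cell controls `u` there; the global estimate for the periodic potential `V`, with `P u` on the right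
hand side, then controls `u` everywhere. -/
theorem exists_norm_le (hm : m = 1 ∨ m = 2) {M M' : ℝ} (hM : 0 ≤ M) (hM' : 0 ≤ M')
    {V P : Pt m → ℂ} (hV : IsPotential M V) (hVp : IsPeriodic V) (hP : IsPotential M' P)
    (hPs : ∀ x ∉ cell m R, P x = 0) {σ : Pt m → ℝ} (hσ : IsAbsorption σ) (hσp : IsPeriodic σ)
    {s : Set (Pt m)} (hso : IsOpen s) (hsn : s.Nonempty) (hs : s ⊆ strip m R)
    (hpos : ∀ᵐ x, x ∈ s → 0 < σ x) {A : ℝ} (hA : 0 < A) :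
    ∃ C, ∀ u w : HTilde m R, InteriorEq (fun x => V x + P x) u w →
      ∫ x, σ x * ‖extVal u x‖ ^ 2 ≤ ‖u‖ * ‖w‖ →
      ‖u‖ ^ 2 ≤ A * (∫ x, ‖extVal u x‖ ^ 2) + ‖u‖ * ‖w‖ → ‖u‖ ≤ C * ‖w‖ := by
  obtain ⟨x₀, hx₀⟩ := hsn
  obtain ⟨N, hpiN, hxN⟩ : ∃ N, Real.pi < N ∧ ∀ i, |x₀.1 i| < N := by
    refine ⟨Real.pi + 1 + ∑ i, |x₀.1 i|, ?_, fun i => ?_⟩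
    · linarith [Finset.sum_nonneg fun i (_ : i ∈ Finset.univ) => abs_nonneg (x₀.1 i)]
    · have := Finset.single_le_sum (f := fun i => |x₀.1 i|) (fun i _ => abs_nonneg _)
        (Finset.mem_univ i)
      dsimp only at this
      linarith [Real.pi_pos]
  have hso' : IsOpen (s ∩ box m N R) := hso.inter (isOpen_box N)
  have hsn' : (s ∩ box m N R).Nonempty := ⟨x₀, hx₀, hxN, hs hx₀⟩
  have hpos' : ∀ᵐ x, x ∈ s ∩ box m N R → 0 < σ x := hpos.mono fun x h hx => h hx.1
  have hcell : ∀ x ∉ box m N R, P x = 0 := fun x hx => hPs x fun h =>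
    hx ⟨fun i => (abs_lt.2 (h.1 i)).trans hpiN, h.2⟩
  obtain ⟨K, hK, hglob⟩ := exists_strip_le hm hM hV hVp hP hσ hσp hso' hsn' hpiN hcell
    Set.inter_subset_right hpos' (η := 1 / (4 * A)) (by positivity)
  obtain ⟨K', hK', hloc⟩ := exists_box_le hm (add_nonneg hM hM') (hV.add hP) hσ hso' hsn'
    (Real.pi_pos.trans hpiN) Set.inter_subset_right hpos'
    (η := 1 / (4 * A * (K * M' ^ 2 + 1))) (by positivity)
  refine ⟨4 * (A * K + A * K * M' ^ 2 * K' + 1) + 1, fun u w heq h1 h2 =>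
    le_mul_of_sq_le (norm_nonneg u) (norm_nonneg w) (by positivity) ?_⟩
  exact sq_le_of_two_step hA hK (by positivity)
    (le_add_of_nonneg_left (by positivity)) (hglob u w heq h1) (hloc u w heq h1) h2

/-! ### Weak solutions for bounded potentials -/

theorem inner_eq_add (v w : HTilde m R) :
    innerSL ℂ v w = inner ℂ (val v) (val w) + ∑ i, inner ℂ (grad v i) (grad w i) := by
  change inner ℂ (v : GradPair m R) (w : GradPair m R) = _
  rw [WithLp.prod_inner_apply, PiLp.inner_apply]
  rfl

theorem norm_innerSL_le (u w : HTilde m R) : ‖innerSL ℂ u w‖ ≤ ‖u‖ * ‖w‖ := by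
  rw [innerSL_apply_apply]
  exact norm_inner_le_norm u w

theorem dirichletL_eq_inner (u v : HTilde m R) :
    dirichletL m R u v = ∑ i, inner ℂ (grad v i) (grad u i) := rfl

theorem conj_dirichletL (u v : HTilde m R) : conj (dirichletL m R v u) = dirichletL m R u v := by
  simp only [dirichletL_eq_inner, map_sum, inner_conj_symm]

theorem integral_mul_conj_eq (f : Pt m → ℂ) {v φ : Pt m → ℂ}
    (hv : (strip m R).indicator v =ᵐ[volume] (strip m R).indicator fun x => conj (φ x)) :
    ∫ x in strip m R, f x * conj (v x) = ∫ x, (strip m R).indicator f x * φ x := by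
  rw [integral_indicator_mul _ measurableSet_strip]
  refine integral_congr_ae ?_
  rw [Filter.EventuallyEq, ae_restrict_iff' measurableSet_strip]
  filter_upwards [hv] with x hx hs
  rw [Set.indicator_of_mem hs, Set.indicator_of_mem hs] at hx
  rw [hx, Complex.conj_conj]

/-- `u` satisfies `∫ ∇u·∇v̄ - V u v̄ - D(v) = ⟨v, w⟩` for all `v ∈ H̃¹`. -/
def IsWeak (V : Pt m → ℂ) (D : HTilde m R → ℂ) (u w : HTilde m R) : Prop :=
  ∀ v : HTilde m R, innerSL ℂ v w = dirichletL m R u v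
    - (∫ x in strip m R, V x * val u x * conj (val v x)) - D v

/-- The weak formulation is tested with conjugates of test functions; their trace vanishes, so that the
boundary term drops out. -/
theorem IsWeak.interiorEq (hR : 0 ≤ R) {V : Pt m → ℂ} {D : HTilde m R → ℂ} {u w : HTilde m R}
    (h : IsWeak V D u w) (hD : ∀ v, trace v = 0 → D v = 0) : InteriorEq V u w := by
  intro φ hφ hs
  have hsub : tsupport (fun x => conj (φ x)) ⊆ strip m R := by
    refine (closure_mono fun x hx => ?_).trans hs
    rw [Function.mem_support] at hx ⊢
    exact fun h0 => hx (by rw [h0, map_zero])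
  have hψ : IsUpperTest fun x => conj (φ x) := ⟨hφ.conj, hsub.trans fun x hx => hx.1⟩
  have e0 : extVal (ofTest R hψ) =ᵐ[volume] _ := extVal_ofTest hψ
  have e1 : ∀ i, extGrad (ofTest R hψ) i =ᵐ[volume]
      (strip m R).indicator fun x => conj (pd i φ x) := fun i => by
    refine (extGrad_ofTest hψ i).trans (Eventually.of_forall fun x => ?_)
    have : pd i (fun x => conj (φ x)) = fun x => conj (pd i φ x) :=
      funext fun x => pd_conj hφ.differentiable.differentiableAt i
    rw [this]
  have key := h (ofTest R hψ)
  rw [hD _ (trace_ofTest_eq_zero hψ hR (hsub.trans fun x hx => hx.2)), inner_eq_add,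
    dirichletL_apply, L2.inner_def] at key
  simp only [L2.inner_def, RCLike.inner_apply] at key
  rw [integral_mul_conj_eq _ e0, integral_mul_conj_eq (fun x => V x * val u x) e0] at key
  simp only [fun (f : Pt m → ℂ) i => integral_mul_conj_eq f (e1 i)] at key
  have eV : ∀ x, (strip m R).indicator (fun x => V x * val u x) x = V x * extVal u x := fun x => by
    rw [extVal, Set.indicator_mul_right]
  simp only [eV, sub_zero] at key
  simp only [extGrad]
  rw [← key, add_comm]
  rfl

theorem dirichletL_self (u : HTilde m R) :
    dirichletL m R u u = ((∑ i, ‖grad u i‖ ^ 2 : ℝ) : ℂ) := by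
  rw [dirichletL_eq_inner]
  push_cast
  exact Finset.sum_congr rfl fun i _ => inner_self_eq_norm_sq_to_K _

theorem im_integral_potential {M : ℝ} {V : Pt m → ℂ} (hV : IsPotential M V) (u : HTilde m R) :
    (∫ x in strip m R, V x * val u x * conj (val u x)).im = ∫ x, (V x).im * ‖extVal u x‖ ^ 2 := by
  have h := integral_im (𝕜 := ℂ) (integrable_potential_mul hV (val u) (val u))
  simp only [RCLike.im_to_complex] at h
  rw [← h, ← integral_indicator measurableSet_strip]
  refine integral_congr_ae (Eventually.of_forall fun x => ?_)
  by_cases hx : x ∈ strip m R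
  · simp only [extVal, Set.indicator_of_mem hx, mul_assoc, Complex.mul_conj, Complex.im_mul_ofReal,
      Complex.normSq_eq_norm_sq]
  · simp [extVal, hx]

theorem IsPotential.isAbsorption {M : ℝ} {V : Pt m → ℂ} (hV : IsPotential M V) {s : ℝ}
    (hs : |s| ≤ 1) (h0 : ∀ᵐ x, 0 ≤ s * (V x).im) : IsAbsorption fun x => s * (V x).im where
  aesm := (Complex.continuous_im.comp_aestronglyMeasurable hV.aesm).const_mul s
  nonneg := h0
  bdd := ⟨M, by
    filter_upwards [hV.bdd] with x hx
    have h1 := Complex.abs_im_le_norm (V x)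
    calc s * (V x).im ≤ |s| * |(V x).im| := by rw [← abs_mul]; exact le_abs_self _
      _ ≤ 1 * M := mul_le_mul hs (h1.trans hx) (abs_nonneg _) zero_le_one
      _ = M := one_mul M⟩

/-- The a priori estimate for weak solutions. The sign `s` distinguishes the problem from its
adjoint: the imaginary part of the form has a fixed sign and bounds the absorbed energy, and its
real part is coercive up to a multiple of the `L²` norm. -/
theorem exists_norm_le_of_isWeak (hm : m = 1 ∨ m = 2) (hR : 0 ≤ R) {M M' : ℝ} (hM : 0 ≤ M)
    (hM' : 0 ≤ M') {V P : Pt m → ℂ} (hV : IsPotential M V) (hVp : IsPeriodic V)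
    (hP : IsPotential M' P) (hPs : ∀ x ∉ cell m R, P x = 0) {s : ℝ} (hs : |s| ≤ 1)
    (hV0 : ∀ᵐ x, 0 ≤ s * (V x).im) (hP0 : ∀ᵐ x, 0 ≤ s * (P x).im) {U : Set (Pt m)}
    (hUo : IsOpen U) (hUn : U.Nonempty) (hU : U ⊆ strip m R)
    (hpos : ∀ᵐ x, x ∈ U → 0 < s * (V x).im) :
    ∃ C, ∀ (u w : HTilde m R) (D : HTilde m R → ℂ), (∀ v, trace v = 0 → D v = 0) →
      (D u).re ≤ 0 → 0 ≤ s * (D u).im → IsWeak (fun x => V x + P x) D u w → ‖u‖ ≤ C * ‖w‖ := by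
  obtain ⟨C, hC⟩ := exists_norm_le hm hM hM' hV hVp hP hPs (hV.isAbsorption hs hV0)
    (fun j => (hVp j).mono fun x hx => by rw [hx]) hUo hUn hU hpos
    (A := 1 + (M + M')) (by positivity)
  refine ⟨C, fun u w D hD hre him h => hC u w (h.interiorEq hR hD) ?_ ?_⟩
  · have hVP := hV.add hP
    have h1 := h u
    have h2 : (innerSL ℂ u w).im = -(∫ x, (V x + P x).im * ‖extVal u x‖ ^ 2) - (D u).im := by
      rw [h1, Complex.sub_im, Complex.sub_im, im_integral_potential hVP, dirichletL_self,
        Complex.ofReal_im, zero_sub]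
    have hu := (isH1_ext u).memLp
    have i1 : Integrable (fun x => s * ((V x + P x).im * ‖extVal u x‖ ^ 2)) volume := by
      have := ((hVP.isAbsorption hs (by
        filter_upwards [hV0, hP0] with x a b
        rw [Complex.add_im, mul_add]; positivity)).integrable_mul hu)
      exact this.congr (Eventually.of_forall fun x => by ring)
    have h3 : ∫ x, s * (V x).im * ‖extVal u x‖ ^ 2
        ≤ ∫ x, s * ((V x + P x).im * ‖extVal u x‖ ^ 2) := by
      refine integral_mono_ae ((hV.isAbsorption hs hV0).integrable_mul hu) i1 ?_
      filter_upwards [hP0] with x hx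
      rw [Complex.add_im]
      nlinarith [mul_nonneg hx (sq_nonneg ‖extVal u x‖)]
    rw [integral_const_mul] at h3
    have h4 : |(innerSL ℂ u w).im| ≤ ‖u‖ * ‖w‖ :=
      (Complex.abs_im_le_norm _).trans (norm_innerSL_le u w)
    have h5 : -(s * (innerSL ℂ u w).im) ≤ |(innerSL ℂ u w).im| := by
      calc -(s * (innerSL ℂ u w).im) ≤ |s * (innerSL ℂ u w).im| := neg_le_abs _
        _ = |s| * |(innerSL ℂ u w).im| := abs_mul _ _
        _ ≤ 1 * |(innerSL ℂ u w).im| := by gcongr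
        _ = _ := one_mul _
    rw [h2] at h5
    rw [h2] at h4
    nlinarith
  · have h1 := congrArg Complex.re (h u)
    rw [Complex.sub_re, Complex.sub_re, dirichletL_self, Complex.ofReal_re] at h1
    have h2 := (Complex.re_le_norm _).trans (norm_integral_potential_le (hV.add hP) (val u) (val u))
    have h3 : (innerSL ℂ u w).re ≤ ‖u‖ * ‖w‖ :=
      (Complex.re_le_norm _).trans (norm_innerSL_le u w)
    have h4 := norm_sq_eq_add u
    have h5 : ‖val u‖ ^ 2 = ∫ x, ‖extVal u x‖ ^ 2 := norm_sq_ext (val u)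
    rw [← h5]
    linarith [sq ‖val u‖, mul_assoc (M + M') ‖val u‖ ‖val u‖]

/-! ### The problem at a center -/

theorem isPeriodic_layerIndex {R₀ : ℝ} {np : Pt m → ℂ} (hnp : IsPeriodicIndex m R₀ np) (R : ℝ) :
    IsPeriodic (layerIndex R np) := by
  intro j
  have h := hnp.periodic j
  have hh : MeasurableSet (halfSpace m) := (isOpen_lt continuous_const continuous_snd).measurableSet
  rw [ae_restrict_iff' hh] at h
  filter_upwards [h] with x hx
  by_cases hs : x ∈ strip m R
  · have hs' : shift j x ∈ strip m R := hs
    rw [layerIndex, Set.indicator_of_mem hs, Set.indicator_of_mem hs', hx hs.1]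
  · have hs' : shift j x ∉ strip m R := hs
    rw [layerIndex, Set.indicator_of_notMem hs, Set.indicator_of_notMem hs']

theorem im_layerIndex_nonneg {R₀ : ℝ} {np : Pt m → ℂ} (hnp : IsPeriodicIndex m R₀ np) (R : ℝ) :
    ∀ᵐ x, 0 ≤ (layerIndex R np x).im := by
  have h := hnp.im_nonneg
  have hh : MeasurableSet (halfSpace m) := (isOpen_lt continuous_const continuous_snd).measurableSet
  rw [ae_restrict_iff' hh] at h
  filter_upwards [h] with x hx
  by_cases hs : x ∈ strip m R
  · rw [layerIndex, Set.indicator_of_mem hs]; exact hx hs.1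
  · rw [layerIndex, Set.indicator_of_notMem hs]; simp

/-- Since the medium does not absorb above height `R₀`, it absorbs somewhere in the strip. -/
theorem exists_absorbing {R₀ : ℝ} {np : Pt m → ℂ} (hnp : IsPeriodicIndex m R₀ np) (hR : R₀ < R) :
    ∃ U : Set (Pt m), IsOpen U ∧ U.Nonempty ∧ U ⊆ strip m R ∧
      ∀ᵐ x, x ∈ U → 0 < (layerIndex R np x).im := by
  obtain ⟨U, hUo, hUn, hUh, hU⟩ := hnp.absorbing
  rw [ae_restrict_iff' hUo.measurableSet] at hU
  refine ⟨U ∩ strip m R, hUo.inter isOpen_strip, ?_, Set.inter_subset_right, ?_⟩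
  · by_contra hne
    rw [Set.not_nonempty_iff_eq_empty] at hne
    have h1 := hnp.eq_one
    have hh : MeasurableSet (halfSpace m) :=
      (isOpen_lt continuous_const continuous_snd).measurableSet
    rw [ae_restrict_iff' hh] at h1
    have h2 : ∀ᵐ x, x ∉ U := by
      filter_upwards [hU, h1] with x hx hx1 hxU
      have hxR : R ≤ x.2 := by
        by_contra hlt
        have : x ∈ U ∩ strip m R := ⟨hxU, hUh hxU, not_le.1 hlt⟩
        rw [hne] at this
        exact this
      have := hx hxU
      rw [hx1 (hUh hxU) (hR.trans_le hxR)] at this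
      simp at this
    have h3 : volume U = 0 := by
      rw [ae_iff] at h2
      simpa using h2
    exact (hUo.measure_pos volume hUn).ne' h3
  · filter_upwards [hU] with x hx hxU
    rw [layerIndex, Set.indicator_of_mem hxU.2]
    exact hx hxU.1

theorem form_eq_of_isPotential (k : ℝ) {np : Pt m → ℂ} {M M' : ℝ}
    (hV : IsPotential M (layerIndex R np)) {q : L2 (cell m R)}
    (hq : IsPotential M' ((cell m R).indicator q)) (u v : HTilde m R) :
    form k np q u v = dirichletL m R u v
      - (∫ x in strip m R, ((k : ℂ) ^ 2 * layerIndex R np x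
        + (k : ℂ) ^ 2 * (cell m R).indicator q x) * val u x * conj (val v x))
      - dtnPairing k (trace u) (trace v) := by
  have i1 : ∀ i, Integrable (fun x => grad u i x * conj (grad v i x))
      (volume.restrict (strip m R)) := fun i =>
    (Lp.memLp (grad u i)).integrable_mul (Lp.memLp (grad v i)).star
  have i2 := integrable_potential_mul ((hV.const_mul ((k : ℂ) ^ 2)).add
    (hq.const_mul ((k : ℂ) ^ 2))) (val u) (val v)
  rw [form, dirichletL_apply, ← integral_finsetSum _ fun i _ => i1 i,
    ← integral_sub (integrable_finsetSum _ fun i _ => i1 i) i2]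
  congr 1
  refine setIntegral_congr_fun measurableSet_strip fun x hx => ?_
  simp only [layerIndex, Set.indicator_of_mem hx]
  ring

theorem trace_zero (hR : 0 ≤ R) : trace (0 : HTilde m R) = 0 := by
  have := trace_smul hR 0 (0 : HTilde m R)
  rwa [zero_smul, zero_smul] at this

theorem dtnPairing_zero_right {k : ℝ} (hk : 0 < k) (hR : 0 ≤ R) (u : HTilde m R) :
    dtnPairing k (trace u) 0 = 0 := by
  rw [← trace_zero (m := m) hR, ← dtnL_apply hk hR, map_zero]

theorem dtnPairing_zero_left {k : ℝ} (hk : 0 < k) (hR : 0 ≤ R) (u : HTilde m R) :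
    dtnPairing k 0 (trace u) = 0 := by
  rw [← trace_zero (m := m) hR, ← dtnL_apply hk hR, map_zero]
  rfl

/-- The form at a center is bounded below, and so is its adjoint. -/
theorem exists_norm_le_center (hm : m = 1 ∨ m = 2) {k R₀ : ℝ} (hk : 0 < k) (hR : 0 ≤ R)
    (hRR : R₀ < R) {np : Pt m → ℂ} (hnp : IsPeriodicIndex m R₀ np) {q : L2 (cell m R)}
    (hq : IsCenter q) :
    ∃ C, ∀ u w : HTilde m R, ((∀ v, innerSL ℂ v w = form k np q u v) ∨
      (∀ v, innerSL ℂ v w = conj (form k np q v u))) → ‖u‖ ≤ C * ‖w‖ := by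
  obtain ⟨M, hM, hV⟩ := exists_isPotential hnp R
  obtain ⟨M', hM', hP⟩ := exists_isPotential_indicator measurableSet_cell hq.1
  obtain ⟨U, hUo, hUn, hUs, hU⟩ := exists_absorbing hnp hRR
  have hk2 : ∀ z : ℂ, ((k : ℂ) ^ 2 * z).im = k ^ 2 * z.im := fun z => by
    rw [← Complex.ofReal_pow, Complex.im_ofReal_mul]
  have hVp := isPeriodic_layerIndex hnp R
  have hV' := hV.const_mul ((k : ℂ) ^ 2)
  have hP' := hP.const_mul ((k : ℂ) ^ 2)
  have hV0 : ∀ᵐ x, 0 ≤ ((k : ℂ) ^ 2 * layerIndex R np x).im := by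
    filter_upwards [im_layerIndex_nonneg hnp R] with x hx
    rw [hk2]; positivity
  have hP0 : ∀ᵐ x, 0 ≤ ((k : ℂ) ^ 2 * (cell m R).indicator q x).im := by
    have h := hq.2
    rw [ae_restrict_iff' measurableSet_cell] at h
    filter_upwards [h] with x hx
    rw [hk2]
    by_cases hc : x ∈ cell m R
    · rw [Set.indicator_of_mem hc]
      have := hx hc
      positivity
    · rw [Set.indicator_of_notMem hc]; simp
  have hU' : ∀ᵐ x, x ∈ U → 0 < ((k : ℂ) ^ 2 * layerIndex R np x).im := by
    filter_upwards [hU] with x hx hxU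
    have := hx hxU
    rw [hk2]; positivity
  have hPs : ∀ x ∉ cell m R, (k : ℂ) ^ 2 * (cell m R).indicator q x = 0 := fun x hx => by
    rw [Set.indicator_of_notMem hx, mul_zero]
  obtain ⟨C, hC⟩ := exists_norm_le_of_isWeak hm hR (by positivity) (by positivity) hV'
    (fun j => (hVp j).mono fun x hx => by rw [hx]) hP' hPs (s := 1) (by simp)
    (by simpa only [one_mul] using hV0) (by simpa only [one_mul] using hP0) hUo hUn hUs
    (by simpa only [one_mul] using hU')
  obtain ⟨C', hC'⟩ := exists_norm_le_of_isWeak hm hR (by positivity) (by positivity) hV'.conj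
    (fun j => (hVp j).mono fun x hx => by rw [hx]) hP'.conj
    (fun x hx => by rw [hPs x hx, map_zero]) (s := -1) (by simp)
    (by simpa only [Complex.conj_im, neg_mul_neg, one_mul] using hV0)
    (by simpa only [Complex.conj_im, neg_mul_neg, one_mul] using hP0) hUo hUn hUs
    (by simpa only [Complex.conj_im, neg_mul_neg, one_mul] using hU')
  refine ⟨max C C', fun u w h => ?_⟩
  rcases h with h | h
  · refine (hC u w (fun v => dtnPairing k (trace u) (trace v))
      (fun v hv => by rw [hv]; exact dtnPairing_zero_right hk hR u)
      (dtnPairing_self_re hk hR u) ?_ ?_).trans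
      (mul_le_mul_of_nonneg_right (le_max_left _ _) (norm_nonneg w))
    · rw [one_mul]; exact dtnPairing_self_im hk hR u
    · intro v
      rw [h v, form_eq_of_isPotential k hV hP]
  · refine (hC' u w (fun v => conj (dtnPairing k (trace v) (trace u)))
      (fun v hv => by rw [hv, dtnPairing_zero_left hk hR u, map_zero]) ?_ ?_ ?_).trans
      (mul_le_mul_of_nonneg_right (le_max_right _ _) (norm_nonneg w))
    · rw [Complex.conj_re]; exact dtnPairing_self_re hk hR u
    · rw [Complex.conj_im, neg_mul_neg, one_mul]; exact dtnPairing_self_im hk hR u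
    · intro v
      rw [h v, form_eq_of_isPotential k hV hP, map_sub, map_sub, conj_dirichletL, ← integral_conj]
      congr 2
      refine integral_congr_ae (Eventually.of_forall fun x => ?_)
      simp only [map_mul, map_add, Complex.conj_conj]
      ring

/-! ### Completeness and the Riesz isomorphism -/

theorem isClosed_HTilde : IsClosed (HTilde m R : Set (GradPair m R)) := by
  have h : (HTilde m R : Set (GradPair m R)) = ⋂ (φ : Pt m → ℂ) (_ : IsTest φ)
      (_ : ∀ x ∈ tsupport φ, x.2 < R) (i : Option (Fin m)),
      {U | ∫ x in strip m R, U.snd i x * φ x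
        = -∫ x in strip m R, U.fst x * fderiv ℝ φ x (dir m i)} := by
    ext U
    simp only [Set.mem_iInter]
    rfl
  rw [h]
  refine isClosed_iInter fun φ => isClosed_iInter fun hφ => isClosed_iInter fun _ =>
    isClosed_iInter fun i => ?_
  have m1 : MemLp φ 2 (volume.restrict (strip m R)) := (hφ.memLp 2).restrict _
  have m2 : MemLp (fun x => fderiv ℝ φ x (dir m i)) 2 (volume.restrict (strip m R)) :=
    ((hφ.pd i).memLp 2).restrict _
  simp only [← pairL_apply m1, ← pairL_apply m2]
  have c1 : Continuous fun U : GradPair m R => U.snd i := by fun_prop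
  have c2 : Continuous fun U : GradPair m R => U.fst := by fun_prop
  exact isClosed_eq ((pairL m1).continuous.comp c1) ((pairL m2).continuous.comp c2).neg

instance : CompleteSpace (HTilde m R) := isClosed_HTilde.completeSpace_coe

theorem bijective_innerSLFlip :
    Function.Bijective (innerSLFlip ℂ : HTilde m R →L[ℂ] (HTilde m R →L⋆[ℂ] ℂ)) := by
  constructor
  · refine (injective_iff_map_eq_zero _).2 fun x hx => ?_
    have h := DFunLike.congr_fun hx x
    rw [innerSLFlip_apply_apply] at h
    exact inner_self_eq_zero.1 h
  · intro ℓ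
    let g : HTilde m R →L[ℂ] ℂ := ((starL ℂ : ℂ ≃L⋆[ℂ] ℂ) : ℂ →L⋆[ℂ] ℂ).comp ℓ
    refine ⟨(InnerProductSpace.toDual ℂ (HTilde m R)).symm g, ?_⟩
    ext v
    rw [innerSLFlip_apply_apply, ← inner_conj_symm, InnerProductSpace.toDual_symm_apply]
    exact star_star (ℓ v)

/-- The Riesz isomorphism of `H̃¹` with its antidual. -/
noncomputable def rieszE : HTilde m R ≃L[ℂ] (HTilde m R →L⋆[ℂ] ℂ) :=
  ContinuousLinearEquiv.ofBijective (innerSLFlip ℂ)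
    (LinearMap.ker_eq_bot.2 bijective_innerSLFlip.1)
    (LinearMap.range_eq_top.2 bijective_innerSLFlip.2)

/-- The inverse of the Riesz isomorphism. -/
noncomputable def rieszInv (m : ℕ) (R : ℝ) : (HTilde m R →L⋆[ℂ] ℂ) →L[ℂ] HTilde m R :=
  ContinuousLinearEquiv.toContinuousLinearMap (rieszE (m := m) (R := R)).symm

theorem rieszE_apply_apply (y v : HTilde m R) : rieszE y v = innerSL ℂ v y := rfl

/-- An operator on a Hilbert space that is bounded below, and whose adjoint is bounded below, is
invertible. -/
theorem isUnit_of_bounded_below {E : Type*} [NormedAddCommGroup E] [InnerProductSpace ℂ E]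
    [CompleteSpace E] {T : E →L[ℂ] E} {C : ℝ} (h : ∀ u, ‖u‖ ≤ C * ‖T u‖)
    (h' : ∀ u, ‖u‖ ≤ C * ‖ContinuousLinearMap.adjoint T u‖) : IsUnit T := by
  rw [ContinuousLinearMap.isUnit_iff_bijective,
    ContinuousLinearMap.bijective_iff_dense_range_and_antilipschitz]
  constructor
  · rw [Submodule.topologicalClosure_eq_top_iff, ContinuousLinearMap.orthogonal_range,
      LinearMap.ker_eq_bot']
    intro u hu
    have := h' u
    rw [show ContinuousLinearMap.adjoint T u = 0 from hu, norm_zero, mul_zero] at this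
    exact norm_le_zero_iff.1 this
  · exact ⟨C.toNNReal, T.antilipschitz_of_bound fun u => (h u).trans (by
      gcongr
      exact Real.le_coe_toNNReal C)⟩

/-! ### The operators of the problem -/

section Operators

variable {k : ℝ} {np : Pt m → ℂ} {M : ℝ}

/-- The operator `A_q` on `H̃¹` with `⟨A_q u, v⟩ = a_q(u, v)`. -/
noncomputable def opA (hm : m = 1 ∨ m = 2) (hk : 0 < k) (hR : 0 ≤ R) (hM : 0 ≤ M)
    (hV : IsPotential M (layerIndex R np)) (q : L2 (cell m R)) : HTilde m R →L[ℂ] HTilde m R :=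
  (rieszInv m R).comp (formL hm hk hR hM hV q)

variable (hm : m = 1 ∨ m = 2) (hk : 0 < k) (hR : 0 ≤ R) (hM : 0 ≤ M)
  (hV : IsPotential M (layerIndex R np))

theorem rieszE_opA (q : L2 (cell m R)) (u : HTilde m R) :
    rieszE (opA hm hk hR hM hV q u) = formL hm hk hR hM hV q u :=
  rieszE.apply_symm_apply _

theorem innerSL_opA (q : L2 (cell m R)) (u v : HTilde m R) :
    innerSL ℂ v (opA hm hk hR hM hV q u) = form k np q u v := by
  rw [← rieszE_apply_apply, rieszE_opA, form_eq hm hk hR hM hV]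

theorem isSolution_iff (q : L2 (cell m R)) (ℓ : HTilde m R →L⋆[ℂ] ℂ) (u : HTilde m R) :
    IsSolution k np q ℓ u ↔ opA hm hk hR hM hV q u = rieszE.symm ℓ := by
  rw [← rieszE.injective.eq_iff, rieszE_opA, rieszE.apply_symm_apply]
  constructor
  · intro h
    ext v
    rw [← form_eq hm hk hR hM hV]
    exact h v
  · intro h v
    rw [form_eq hm hk hR hM hV, h]

theorem isUnit_opA_iff (q : L2 (cell m R)) :
    IsUnit (opA hm hk hR hM hV q) ↔ IsInvertible k np q := by
  rw [ContinuousLinearMap.isUnit_iff_bijective, Function.bijective_iff_existsUnique, IsInvertible]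
  simp only [isSolution_iff hm hk hR hM hV]
  exact (rieszE (m := m) (R := R)).symm.surjective.forall

theorem isTheSolution_inv {q : L2 (cell m R)} (x : (HTilde m R →L[ℂ] HTilde m R)ˣ)
    (hx : (x : HTilde m R →L[ℂ] HTilde m R) = opA hm hk hR hM hV q) (ℓ : HTilde m R →L⋆[ℂ] ℂ) :
    IsTheSolution k np q ℓ ((x⁻¹ : (HTilde m R →L[ℂ] HTilde m R)ˣ).1 (rieszE.symm ℓ)) := by
  constructor
  · rw [isSolution_iff hm hk hR hM hV, ← hx, ← mul_apply_eq_comp, Units.mul_inv]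
    rfl
  · intro u' h
    rw [isSolution_iff hm hk hR hM hV, ← hx] at h
    rw [← h, ← mul_apply_eq_comp, Units.inv_mul]
    rfl

theorem isUnit_opA_center {R₀ : ℝ} (hRR : R₀ < R) (hnp : IsPeriodicIndex m R₀ np)
    {q : L2 (cell m R)} (hq : IsCenter q) : IsUnit (opA hm hk hR hM hV q) := by
  obtain ⟨C, hC⟩ := exists_norm_le_center hm hk hR hRR hnp hq
  refine isUnit_of_bounded_below (C := C)
    (fun u => hC u _ (Or.inl fun v => innerSL_opA hm hk hR hM hV q u v))
    fun u => hC u _ (Or.inr fun v => ?_)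
  rw [innerSL_apply_apply, ContinuousLinearMap.adjoint_inner_right, ← inner_conj_symm,
    ← innerSL_opA hm hk hR hM hV q v u, innerSL_apply_apply]

/-- The derivative of `q ↦ B_q`. -/
noncomputable def derivB (hm : m = 1 ∨ m = 2) (k R : ℝ) :
    L2 (cell m R) →L[ℂ] (HTilde m R →L[ℂ] (HTilde m R →L⋆[ℂ] ℂ)) :=
  -((k : ℂ) ^ 2 • perturbationL hm R)

theorem derivB_apply (h : L2 (cell m R)) (u v : HTilde m R) :
    derivB hm k R h u v = -linSource k h u v := by
  rw [linSource_eq hm]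
  rfl

theorem hasFDerivAt_formL (q : L2 (cell m R)) :
    HasFDerivAt (formL hm hk hR hM hV) (derivB hm k R) q := by
  have e : formL hm hk hR hM hV = fun q => derivB hm k R q
      + (dirichletL m R - (k : ℂ) ^ 2 • potentialL hM hV R - dtnL hk hR) := by
    funext q
    rw [formL, derivB]
    simp only [neg_apply, smul_apply]
    abel
  rw [e]
  exact (derivB hm k R).hasFDerivAt.add_const _

/-- The derivative of `q ↦ A_q`. -/
noncomputable def derivA (hm : m = 1 ∨ m = 2) (k R : ℝ) :
    L2 (cell m R) →L[ℂ] (HTilde m R →L[ℂ] HTilde m R) :=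
  (ContinuousLinearMap.compL ℂ (HTilde m R) (HTilde m R →L⋆[ℂ] ℂ) (HTilde m R)
    (rieszInv m R)).comp (derivB hm k R)

theorem hasFDerivAt_opA (q : L2 (cell m R)) :
    HasFDerivAt (opA hm hk hR hM hV) (derivA hm k R) q :=
  (ContinuousLinearMap.compL ℂ (HTilde m R) (HTilde m R →L⋆[ℂ] ℂ) (HTilde m R)
    (rieszInv m R)).hasFDerivAt.comp q
    (hasFDerivAt_formL hm hk hR hM hV q)

theorem isOpen_isUnit_opA : IsOpen {q : L2 (cell m R) | IsUnit (opA hm hk hR hM hV q)} :=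
  Units.isOpen.preimage (continuous_iff_continuousAt.2 fun q =>
    (hasFDerivAt_opA hm hk hR hM hV q).continuousAt)

theorem diffOp_eq (q : L2 (cell m R)) : diffOp k np q = formL hm hk hR hM hV q := by
  have h : ∃ B : HTilde m R →L[ℂ] (HTilde m R →L⋆[ℂ] ℂ), ∀ u v, B u v = form k np q u v :=
    ⟨formL hm hk hR hM hV q, fun u v => (form_eq hm hk hR hM hV q u v).symm⟩
  rw [diffOp, dif_pos h]
  ext u v
  rw [h.choose_spec, form_eq hm hk hR hM hV]

end Operators

/-! ### Restriction, sources and the measurement operator -/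

/-- Restriction of `L²` functions to a subset. -/
noncomputable def restrictL {s t : Set (Pt m)} (h : s ⊆ t) : L2 t →L[ℂ] L2 s :=
  have hle : volume.restrict s ≤ volume.restrict t := Measure.restrict_mono h le_rfl
  LinearMap.mkContinuous
    { toFun := fun u => ((Lp.memLp u).mono_measure hle).toLp u
      map_add' := fun u v => by
        rw [← MemLp.toLp_add]
        exact MemLp.toLp_congr _ _ (ae_mono hle (Lp.coeFn_add u v))
      map_smul' := fun c u => by
        rw [RingHom.id_apply, ← MemLp.toLp_const_smul]
        exact MemLp.toLp_congr _ _ (ae_mono hle (Lp.coeFn_smul c u)) }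
    1 fun u => by
      change ‖((Lp.memLp u).mono_measure hle).toLp u‖ ≤ _
      rw [one_mul, Lp.norm_toLp, Lp.norm_def]
      exact ENNReal.toReal_mono (Lp.eLpNorm_ne_top u) (eLpNorm_mono_measure u hle)

theorem coeFn_restrictL {s t : Set (Pt m)} (h : s ⊆ t) (u : L2 t) :
    restrictL h u =ᵐ[volume.restrict s] u :=
  ((Lp.memLp u).mono_measure (Measure.restrict_mono h le_rfl)).coeFn_toLp

theorem cell_subset_strip_of_le {R₀ : ℝ} (h : R₀ ≤ R) : cell m R₀ ⊆ strip m R :=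
  fun _ hx => ⟨hx.2.1, hx.2.2.trans_le h⟩

/-- The functional `v ↦ ∫ f v̄`, as a bounded linear function of `f`. -/
noncomputable def sourceL {R₀ : ℝ} (h : R₀ ≤ R) : L2 (cell m R₀) →L[ℂ] (HTilde m R →L⋆[ℂ] ℂ) :=
  LinearMap.mkContinuous₂ (LinearMap.mk₂'ₛₗ (RingHom.id ℂ) (starRingEnd ℂ)
    (fun (f : L2 (cell m R₀)) (v : HTilde m R) =>
      inner ℂ (restrictL (cell_subset_strip_of_le h) (valL m R v)) f)
    (fun f g v => inner_add_right _ _ _)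
    (fun c f v => inner_smul_right _ _ _)
    (fun f v w => by rw [map_add, map_add, inner_add_left])
    (fun c f v => by rw [map_smul, map_smul, inner_smul_left]; rfl))
    ‖(restrictL (cell_subset_strip_of_le h)).comp (valL m R)‖ fun f v => by
      simp only [LinearMap.mk₂'ₛₗ_apply]
      refine (norm_inner_le_norm _ _).trans ?_
      have := ((restrictL (cell_subset_strip_of_le h)).comp (valL m R)).le_opNorm v
      rw [mul_right_comm]
      exact mul_le_mul_of_nonneg_right this (norm_nonneg f)

theorem sourceL_apply {R₀ : ℝ} (h : R₀ ≤ R) (f : L2 (cell m R₀)) (v : HTilde m R) :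
    sourceL h f v = source R f v := by
  change inner ℂ (restrictL (cell_subset_strip_of_le h) (valL m R v)) f = _
  rw [L2.inner_def, source]
  refine integral_congr_ae ?_
  filter_upwards [coeFn_restrictL (cell_subset_strip_of_le h) (valL m R v)] with x hx
  rw [hx, RCLike.inner_apply]
  rfl

theorem IsTheSolution.unique {k : ℝ} {np : Pt m → ℂ} {q : L2 (cell m R)} {ℓ : HTilde m R → ℂ}
    {u u' : HTilde m R} (h : IsTheSolution k np q ℓ u) (h' : IsTheSolution k np q ℓ u') :
    u = u' := h'.2 u h.1

theorem Lam_eq {R₀ k : ℝ} {np : Pt m → ℂ} {q : L2 (cell m R)}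
    {L : L2 (cell m R₀) →L[ℂ] L2 (cell m R)} (hL : IsMeasurement k np q L) :
    Lam R₀ k np q = L := by
  have h : ∃ L : L2 (cell m R₀) →L[ℂ] L2 (cell m R), IsMeasurement k np q L := ⟨L, hL⟩
  rw [Lam, dif_pos h]
  ext1 f
  obtain ⟨u, hu, e⟩ := hL f
  obtain ⟨u', hu', e'⟩ := h.choose_spec f
  rw [e, e', hu.unique hu']

/-- The measurement operator, as a linear function of the inverse of `A_q`. -/
noncomputable def measureL {R₀ : ℝ} (h : R₀ ≤ R) :
    (HTilde m R →L[ℂ] HTilde m R) →L[ℂ] (L2 (cell m R₀) →L[ℂ] L2 (cell m R)) :=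
  (ContinuousLinearMap.compL ℂ (L2 (cell m R₀)) (HTilde m R) (L2 (cell m R))
    ((restrictL (cell_subset_strip m R)).comp (valL m R))).comp
  ((ContinuousLinearMap.compL ℂ (L2 (cell m R₀)) (HTilde m R) (HTilde m R)).flip
    ((rieszInv m R).comp (sourceL h)))

theorem measureL_apply {R₀ : ℝ} (h : R₀ ≤ R) (T : HTilde m R →L[ℂ] HTilde m R)
    (f : L2 (cell m R₀)) :
    measureL h T f = restrictCell (val (T (rieszE.symm (sourceL h f)))) := rfl

section Derivative

variable {k : ℝ} {np : Pt m → ℂ} {M : ℝ} (hm : m = 1 ∨ m = 2) (hk : 0 < k) (hR : 0 ≤ R)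
  (hM : 0 ≤ M) (hV : IsPotential M (layerIndex R np))

theorem isMeasurement_measureL {R₀ : ℝ} (h : R₀ ≤ R) {q : L2 (cell m R)}
    (x : (HTilde m R →L[ℂ] HTilde m R)ˣ)
    (hx : (x : HTilde m R →L[ℂ] HTilde m R) = opA hm hk hR hM hV q) :
    IsMeasurement k np q (measureL h (x⁻¹ : (HTilde m R →L[ℂ] HTilde m R)ˣ).1 :
      L2 (cell m R₀) →L[ℂ] L2 (cell m R)) := by
  intro f
  refine ⟨_, ?_, measureL_apply h _ f⟩
  have := isTheSolution_inv hm hk hR hM hV x hx (sourceL h f)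
  rwa [show ⇑(sourceL h f) = source R f from funext fun v => sourceL_apply h f v] at this

theorem Lam_eventuallyEq {R₀ : ℝ} (h : R₀ ≤ R) {q : L2 (cell m R)}
    (hq : IsUnit (opA hm hk hR hM hV q)) :
    (Lam R₀ k np : L2 (cell m R) → _) =ᶠ[𝓝 q]
      fun p => measureL h (Ring.inverse (opA hm hk hR hM hV p)) := by
  filter_upwards [(isOpen_isUnit_opA hm hk hR hM hV).mem_nhds hq] with p hp
  obtain ⟨x, hx⟩ := hp
  rw [← hx, Ring.inverse_unit]
  exact Lam_eq (isMeasurement_measureL hm hk hR hM hV h x hx)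

/-- The derivative of the measurement operator, by the formula for the derivative of the inverse. -/
noncomputable def derivLam {R₀ : ℝ} (hm : m = 1 ∨ m = 2) (k : ℝ) (h : R₀ ≤ R)
    (x : (HTilde m R →L[ℂ] HTilde m R)ˣ) :
    L2 (cell m R) →L[ℂ] (L2 (cell m R₀) →L[ℂ] L2 (cell m R)) :=
  (measureL h).comp ((-ContinuousLinearMap.mulLeftRight ℂ (HTilde m R →L[ℂ] HTilde m R)
    (x⁻¹ : (HTilde m R →L[ℂ] HTilde m R)ˣ).1 (x⁻¹ : (HTilde m R →L[ℂ] HTilde m R)ˣ).1).comp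
      (derivA hm k R))

theorem hasFDerivAt_ringInverse_of_eq {A : Type*} [NormedRing A] [NormedAlgebra ℂ A]
    [HasSummableGeomSeries A] (x : Aˣ) {a : A} (hx : (x : A) = a) :
    HasFDerivAt Ring.inverse (-ContinuousLinearMap.mulLeftRight ℂ A (x⁻¹ : Aˣ).1 (x⁻¹ : Aˣ).1) a := by
  subst hx
  exact hasFDerivAt_ringInverse x

theorem hasFDerivAt_Lam {R₀ : ℝ} (h : R₀ ≤ R) {q : L2 (cell m R)}
    (x : (HTilde m R →L[ℂ] HTilde m R)ˣ)
    (hx : (x : HTilde m R →L[ℂ] HTilde m R) = opA hm hk hR hM hV q) :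
    HasFDerivAt (Lam (R := R) R₀ k np) (derivLam hm k h x) q := by
  refine HasFDerivAt.congr_of_eventuallyEq ?_
    (Lam_eventuallyEq hm hk hR hM hV h ⟨x, hx⟩)
  have h1 := hasFDerivAt_ringInverse_of_eq x hx
  have h2 := hasFDerivAt_opA hm hk hR hM hV q
  have h3 := h1.comp q h2
  exact (measureL (m := m) (R := R) h).hasFDerivAt.comp q h3

theorem derivLam_apply {R₀ : ℝ} (h : R₀ ≤ R) (x : (HTilde m R →L[ℂ] HTilde m R)ˣ)
    (g : L2 (cell m R)) (f : L2 (cell m R₀)) :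
    derivLam hm k h x g f = -restrictCell (val ((x⁻¹ : (HTilde m R →L[ℂ] HTilde m R)ˣ).1
      (rieszE.symm (derivB hm k R g ((x⁻¹ : (HTilde m R →L[ℂ] HTilde m R)ˣ).1
        (rieszE.symm (sourceL h f))))))) := by
  change (restrictL (cell_subset_strip m R)).comp (valL m R) (-_) = _
  rw [map_neg]
  rfl

end Derivative

theorem isOpen_domainQ (k : ℝ) (np : Pt m → ℂ) : IsOpen (domainQ k np : Set (L2 (cell m R))) := by
  rw [Metric.isOpen_iff]
  rintro q ⟨q₀, hq₀, δ, hδ, hball, hq⟩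
  obtain ⟨ε, hε, h⟩ := Metric.isOpen_iff.1 Metric.isOpen_ball q hq
  exact ⟨ε, hε, fun p hp => ⟨q₀, hq₀, δ, hδ, hball, h hp⟩⟩

/-- The operator `B_q`, as an isomorphism of `H̃¹` with its antidual. -/
noncomputable def opEquiv (x : (HTilde m R →L[ℂ] HTilde m R)ˣ) :
    HTilde m R ≃L[ℂ] (HTilde m R →L⋆[ℂ] ℂ) :=
  (ContinuousLinearEquiv.ofUnit x).trans rieszE

theorem rieszE_symm_neg (ℓ : HTilde m R →L⋆[ℂ] ℂ) :
    (rieszE (m := m) (R := R)).symm (-ℓ) = -(rieszE (m := m) (R := R)).symm ℓ :=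
  map_neg (rieszInv m R) ℓ

theorem restrictCell_val_neg (w : HTilde m R) :
    restrictCell (val (-w)) = -restrictCell (val w) :=
  map_neg ((restrictL (cell_subset_strip m R)).comp (valL m R)) w

section Operators

variable {k : ℝ} {np : Pt m → ℂ} {M : ℝ} (hm : m = 1 ∨ m = 2) (hk : 0 < k) (hR : 0 ≤ R)
  (hM : 0 ≤ M) (hV : IsPotential M (layerIndex R np))

theorem coe_opEquiv {q : L2 (cell m R)} (x : (HTilde m R →L[ℂ] HTilde m R)ˣ)
    (hx : (x : HTilde m R →L[ℂ] HTilde m R) = opA hm hk hR hM hV q) :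
    (opEquiv x : HTilde m R →L[ℂ] (HTilde m R →L⋆[ℂ] ℂ)) = formL hm hk hR hM hV q := by
  ext1 u
  rw [← rieszE_opA, ← hx]
  rfl

theorem isLinearization_derivLam {R₀ : ℝ} (hR₀ : R₀ ≤ R) {q : L2 (cell m R)}
    (x : (HTilde m R →L[ℂ] HTilde m R)ˣ)
    (hx : (x : HTilde m R →L[ℂ] HTilde m R) = opA hm hk hR hM hV q) (h : L2 (cell m R)) :
    IsLinearization k np q h (derivLam (R₀ := R₀) hm k hR₀ x h) := by
  intro f
  have h1 := isTheSolution_inv hm hk hR hM hV x hx (sourceL hR₀ f)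
  have e := derivLam_apply hm (k := k) hR₀ x h f
  rw [show ⇑(sourceL hR₀ f) = source R f from funext fun v => sourceL_apply hR₀ f v] at h1
  generalize (x⁻¹ : (HTilde m R →L[ℂ] HTilde m R)ˣ).1 (rieszE.symm (sourceL hR₀ f)) = u at h1 e
  have h2 := isTheSolution_inv hm hk hR hM hV x hx (-derivB hm k R h u)
  rw [show ⇑(-derivB hm k R h u) = linSource k h u from funext fun v => by
    rw [neg_apply, derivB_apply, neg_neg]] at h2
  refine ⟨u, _, h1, h2, ?_⟩
  rw [e, rieszE_symm_neg, map_neg (x⁻¹ : (HTilde m R →L[ℂ] HTilde m R)ˣ).1,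
    restrictCell_val_neg]

end Operators

end LayerScattering

theorem mainTheorem8 (m : ℕ) (hm : m = 1 ∨ m = 2) (k R₀ R : ℝ) (hk : 0 < k) (hR₀ : 0 < R₀)
    (hR : R₀ < R) (np : Pt m → ℂ) (hnp : IsPeriodicIndex m R₀ np) :
    -- the set of perturbations is open and contains all its centers
    IsOpen (domainQ k np : Set (L2 (cell m R))) ∧
    (∀ q₀ : L2 (cell m R), IsCenter q₀ → q₀ ∈ domainQ k np) ∧
    -- the differential operators represent the sesquilinear forms
    (∀ (q : L2 (cell m R)) (u v : HTilde m R), diffOp k np q u v = form k np q u v) ∧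
    ∀ q ∈ (domainQ k np : Set (L2 (cell m R))),
      -- the measurement operator is well defined
      IsMeasurement k np q (Lam R₀ k np q) ∧
      ∃ (Lam' : L2 (cell m R) →L[ℂ] (L2 (cell m R₀) →L[ℂ] L2 (cell m R)))
        (B' : L2 (cell m R) →L[ℂ] (HTilde m R →L[ℂ] (HTilde m R →L⋆[ℂ] ℂ)))
        (Bq : HTilde m R ≃L[ℂ] (HTilde m R →L⋆[ℂ] ℂ)),
        -- the derivative at `q` is `h ↦ W_h`
        HasFDerivAt (Lam (R := R) R₀ k np) Lam' q ∧
        (∀ h : L2 (cell m R), IsLinearization k np q h (Lam' h)) ∧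
        -- `B'_q h` is the operator with form `-k² ∫ h u v̄`
        HasFDerivAt (diffOp (R := R) k np) B' q ∧
        (∀ (h : L2 (cell m R)) (u v : HTilde m R), B' h u v = -linSource k h u v) ∧
        -- `Λ_q f` is `B_q⁻¹ F`, and `Λ'(q)[h] f` is `-B_q⁻¹ (B'_q h) B_q⁻¹ F`, restricted to the
        -- cell, where `F` is the functional given by `f`
        (Bq : HTilde m R →L[ℂ] (HTilde m R →L⋆[ℂ] ℂ)) = diffOp k np q ∧
        ∀ f : L2 (cell m R₀), ∃ F : HTilde m R →L⋆[ℂ] ℂ, (∀ v, F v = source R f v) ∧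
          Lam R₀ k np q f = restrictCell (val (Bq.symm F)) ∧
          ∀ h : L2 (cell m R),
            Lam' h f = -restrictCell (val (Bq.symm (B' h (Bq.symm F)))) := by
  have hR0 : 0 ≤ R := (hR₀.trans hR).le
  obtain ⟨M, hM, hV⟩ := exists_isPotential hnp R
  have hcenter : ∀ q₀ : L2 (cell m R), IsCenter q₀ → q₀ ∈ domainQ k np := fun q₀ hq₀ => by
    obtain ⟨δ, hδ, hball⟩ := Metric.isOpen_iff.1 (isOpen_isUnit_opA hm hk hR0 hM hV) q₀
      (isUnit_opA_center hm hk hR0 hM hV hR hnp hq₀)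
    exact ⟨q₀, hq₀, δ, hδ, fun p hp => (isUnit_opA_iff hm hk hR0 hM hV p).1 (hball hp),
      Metric.mem_ball_self hδ⟩
  refine ⟨isOpen_domainQ k np, hcenter, fun q u v => ?_, fun q hq => ?_⟩
  · rw [diffOp_eq hm hk hR0 hM hV, form_eq hm hk hR0 hM hV]
  obtain ⟨q₀, -, δ, -, hball, hqδ⟩ := hq
  obtain ⟨x, hx⟩ := (isUnit_opA_iff hm hk hR0 hM hV q).2 (hball q hqδ)
  have hmeas := isMeasurement_measureL (R₀ := R₀) hm hk hR0 hM hV hR.le x hx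
  have hLam := Lam_eq hmeas
  refine ⟨hLam ▸ hmeas, derivLam hm k hR.le x, derivB hm k R, opEquiv x,
    hasFDerivAt_Lam hm hk hR0 hM hV hR.le x hx,
    isLinearization_derivLam hm hk hR0 hM hV hR.le x hx, ?_, derivB_apply hm, ?_, fun f => ?_⟩
  · rw [show (diffOp k np : L2 (cell m R) → _) = formL hm hk hR0 hM hV from
      funext (diffOp_eq hm hk hR0 hM hV)]
    exact hasFDerivAt_formL hm hk hR0 hM hV q
  · rw [diffOp_eq hm hk hR0 hM hV]
    exact coe_opEquiv hm hk hR0 hM hV x hx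
  · refine ⟨sourceL hR.le f, sourceL_apply hR.le f, ?_, fun h => ?_⟩
    · exact (DFunLike.congr_fun hLam f).trans (measureL_apply hR.le _ f)
    · exact derivLam_apply hm hR.le x h f
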